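/- Let $\mathbb K$ be a field. All $\mathbb S$-modules are symmetric sequences of $\mathbb Z$-graded $\mathbb K$-vector spaces (arity $0$ allowed, homological grading, Koszul signs), $\circ$ is the composite product and $I$ its unit; $s$ and $s^{-1}$ denote suspension and desuspension. A dg operad $(\mathcal P,\gamma,1,d)$ is a monoid for $\circ$ with a derivation $d$ of degree $-1$ such that $d^2=0$. A curved conilpotent cooperad $(\mathcal C,\Delta,\epsilon,1,d,\theta)$ is a coaugmented comonoid for $\circ$ which is conilpotent (its coradical filtration is exhaustive), with a coderivation $d$ of degree $-1$, $d(1)=0$, and a map $\theta:\mathcal C(1)\to\mathbb K$ of degree $-2$ such that $$d^2=(\theta\otimes \mathrm{Id}-\mathrm{Id}\otimes\theta)\Delta_2,\qquad \theta d=0 .$$ Here $\overline{\mathcal C}=\ker\epsilon$, and $\Delta_2(x)=\sum x_{(1)}\otimes x_{(2)}$ is the part of $\Delta(x)$ on trees with exactly two vertices, both labelled by $\overline{\mathcal C}$. Morphisms of curved conilpotent cooperads are the morphisms of coaugmented cooperads that commute with $d$ and with $\theta$. * The cobar construction $\Omega_u\mathcal C$ is the free operad $\mathbb T(s^{-1}\overline{\mathcal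 C})$ with the derivation given by $$D(s^{-1}x)=\theta(x)1-s^{-1}dx-\sum(-1)^{|x_{(1)}|}s^{-1}x_{(1)}\otimes s^{-1}x_{(2)} .$$ * The curved bar construction $B_c\mathcal P$ is the cofree conilpotent cooperad $\mathbb T^c(s\mathcal P\oplus\mathbb K\cdot v)$, where $v$ has arity $1$ and degree $2$. Its coderivation $D$ is the one whose projection to $s\mathcal P\oplus\mathbb K\cdot v$ is $sx\mapsto -s\,dx$, $v\mapsto s1$, $sx\otimes sy\mapsto(-1)^{|x|}s\gamma(x\otimes y)$, and zero on all other trees. Its curvature is the projection to $\mathbb K\cdot v$ followed by $v\mapsto 1$. * $\mathrm{Tw}(\mathcal C,\mathcal P)$ is the set of maps of $\mathbb S$-modules $\alpha:\overline{\mathcal C}\to\mathcal P$ of degree $-1$ such that $\partial(\alpha)+\gamma(\alpha\otimes\alpha)\Delta_2=\Theta$, where $\partial(\alpha)=d\alpha+\alpha d$ and $\Theta(x)=\theta(x)1_{\mathcal P}$. **Proposition.** The constructions $\Omega_u$ and $B_c$ are well defined functors between curved conilpotent cooperads and dg operads, and there are bijections, natural in $\mathcal C$ and $\mathcal P$, $$\mathrm{Hom}_{\mathsf{Operad}}(\Omega_u\mathcal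 C,\mathcal P)\;\cong\;\mathrm{Tw}(\mathcal C,\mathcal P)\;\cong\;\mathrm{Hom}_{\mathsf{cCoop}}(\mathcal C,B_c\mathcal P).$$ The first sends $F$ to the map $x\mapsto F(s^{-1}x)$. The inverse of the second sends $f$ to the composite of $f$ with the projection $B_c\mathcal P\to s\mathcal P$ and $s^{-1}:s\mathcal P\to\mathcal P$. The composite bijection is that of an adjunction $\Omega_u\dashv B_c$, so $B_c$ is right adjoint to $\Omega_u$. -/

import Mathlib

open CategoryTheory
open scoped TensorProduct DirectSum

universe u

namespace OperadicBar

/-- A graded symmetric sequence (graded `S`-module) over `K`, written as a functor from the groupoid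
of finite sets and bijections to `ℤ`-graded `K`-vector spaces: `obj X d` is the part of arity `X`
and homological degree `d`. Evaluating at `Fin n` with the action of its permutations gives the
usual family of graded representations of the symmetric groups, and this is an equivalence. -/
structure SMod (K : Type u) [Field K] where
  obj : (X : Type) → [Finite X] → ℤ → Type u
  [grp : ∀ (X : Type) [Finite X] (d : ℤ), AddCommGroup (obj X d)]
  [mod : ∀ (X : Type) [Finite X] (d : ℤ), Module K (obj X d)]
  map : ∀ {X Y : Type} [Finite X] [Finite Y], (X ≃ Y) → ∀ d : ℤ, obj X d →ₗ[K] obj Y d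
  map_refl : ∀ (X : Type) [Finite X] (d : ℤ) (x : obj X d), map (Equiv.refl X) d x = x
  map_trans : ∀ {X Y Z : Type} [Finite X] [Finite Y] [Finite Z] (e : X ≃ Y) (e' : Y ≃ Z)
    (d : ℤ) (x : obj X d), map (e.trans e') d x = map e' d (map e d x)

attribute [instance] SMod.grp SMod.mod

variable {K : Type u} [Field K]

/-- Transport along an equality of degrees. -/
def SMod.cast (V : SMod K) (X : Type) [Finite X] {d d' : ℤ} (h : d = d') :
    V.obj X d →ₗ[K] V.obj X d' := by
  subst h; exact LinearMap.id

/-- The action of a bijection, combined with transport along an equality of degrees. -/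
def SMod.tr (V : SMod K) {X Y : Type} [Finite X] [Finite Y] (e : X ≃ Y) {d d' : ℤ}
    (h : d = d') : V.obj X d →ₗ[K] V.obj Y d' :=
  V.cast Y h ∘ₗ V.map e d

/-- Homogeneous equivariant maps of degree `k` between graded `S`-modules. -/
structure DegMap (V W : SMod K) (k : ℤ) where
  app : ∀ (X : Type) [Finite X] (d d' : ℤ), d + k = d' → (V.obj X d →ₗ[K] W.obj X d')
  natural : ∀ {X Y : Type} [Finite X] [Finite Y] (e : X ≃ Y) (d d' : ℤ) (h : d + k = d')
    (x : V.obj X d), app Y d d' h (V.map e d x) = W.map e d' (app X d d' h x)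

/-- The Koszul sign of the permutation `ψ` acting on a word of letters of degrees `q`: the product of
`(-1) ^ (q i * q j)` over the inversions of `ψ`. -/
def koszul {k k' : ℕ} (ψ : Fin k ≃ Fin k') (q : Fin k → ℤ) : ℤˣ :=
  (∑ i, ∑ j, if i < j ∧ ψ j < ψ i then q i * q j else 0).negOnePow

theorem negOnePow_congr {a b : ℤ} (h : (a : ZMod 2) = b) : a.negOnePow = b.negOnePow := by
  rw [Int.negOnePow_eq_iff, even_iff_two_dvd]
  exact_mod_cast (ZMod.intCast_eq_intCast_iff_dvd_sub b a 2).1 h.symm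

/-- The index of a summand of total degree `d` of the arity `X` part of a composite product: a
two-level tree with leaves `X` and `k` numbered upper vertices, the leaf `x` being attached to the
upper vertex `f x` (upper vertices without leaves are allowed), together with the degree `p` of the
lower vertex and the degrees `q i` of the upper vertices. -/
structure Shape (X : Type) (d : ℤ) where
  k : ℕ
  f : X → Fin k
  p : ℤ
  q : Fin k → ℤ
  hd : p + ∑ i, q i = d

noncomputable instance (X : Type) (d : ℤ) : DecidableEq (Shape X d) := Classical.decEq _

/-- Renumbering of the upper vertices. -/
abbrev Shape.reindex {X : Type} {d : ℤ} (s : Shape X d) {k' : ℕ} (ψ : Fin s.k ≃ Fin k') : Shape X d where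
  k := k'
  f x := ψ (s.f x)
  p := s.p
  q i := s.q (ψ.symm i)
  hd := by rw [Equiv.sum_comp ψ.symm s.q, s.hd]

/-- The decorations of the tree `s`: the lower vertex by `V`, the upper vertices by `W`. -/
abbrev Shape.Tens (V W : SMod K) {X : Type} [Finite X] {d : ℤ} (s : Shape X d) : Type u :=
  V.obj (Fin s.k) s.p ⊗[K] (⨂[K] i, W.obj {x // s.f x = i} (s.q i))

def fibEquiv {X I J : Type} {f : X → I} {f' : X → J} {i : I} {j : J}
    (h : ∀ x, f x = i ↔ f' x = j) : {x // f x = i} ≃ {x // f' x = j} :=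
  Equiv.subtypeEquivRight h

/-- The generator `(μ; ν₁, …, ν_k)`. -/
noncomputable def sym (V W : SMod K) {X : Type} [Finite X] {d : ℤ} (s : Shape X d)
    (μ : V.obj (Fin s.k) s.p) (ν : ∀ i, W.obj {x // s.f x = i} (s.q i)) :
    ⨁ s : Shape X d, s.Tens V W :=
  DirectSum.lof K _ (fun s : Shape X d => s.Tens V W) s (μ ⊗ₜ PiTensorProduct.tprod K ν)

/-- The relations that renumbering the upper vertices acts by the Koszul sign; the quotient by them is
the space of coinvariants under the symmetric groups. -/
def compRel (V W : SMod K) (X : Type) [Finite X] (d : ℤ) :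
    Submodule K (⨁ s : Shape X d, s.Tens V W) :=
  Submodule.span K {z | ∃ (s : Shape X d) (k' : ℕ) (ψ : Fin s.k ≃ Fin k')
    (μ : V.obj (Fin s.k) s.p) (ν : ∀ i, W.obj {x // s.f x = i} (s.q i)),
    z = sym V W (s.reindex ψ) (V.map ψ s.p μ)
          (fun i => W.map (fibEquiv (fun _ => Equiv.eq_symm_apply ψ)) _ (ν (ψ.symm i)))
        - koszul ψ s.q • sym V W s μ ν}

/-- The arity `X`, degree `d` part of the composite product `V ∘ W`. -/
abbrev compObj (V W : SMod K) (X : Type) [Finite X] (d : ℤ) : Type u :=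
  (⨁ s : Shape X d, s.Tens V W) ⧸ compRel V W X d

/-- The class of `(μ; ν₁, …, ν_k)` in `V ∘ W`. -/
noncomputable def cmk {V W : SMod K} {X : Type} [Finite X] {d : ℤ} (s : Shape X d)
    (μ : V.obj (Fin s.k) s.p) (ν : ∀ i, W.obj {x // s.f x = i} (s.q i)) : compObj V W X d :=
  (compRel V W X d).mkQ (sym V W s μ ν)

theorem mk_reindex {V W : SMod K} {X : Type} [Finite X] {d : ℤ} (s : Shape X d)
    {k' : ℕ} (ψ : Fin s.k ≃ Fin k')
    (μ : V.obj (Fin s.k) s.p) (ν : ∀ i, W.obj {x // s.f x = i} (s.q i)) :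
    cmk (V := V) (W := W) (s.reindex ψ) (V.map ψ s.p μ)
          (fun i => W.map (fibEquiv (fun _ => Equiv.eq_symm_apply ψ)) _ (ν (ψ.symm i)))
        = koszul ψ s.q • cmk s μ ν := by
  unfold cmk
  rw [← sub_eq_zero, ← LinearMap.map_smul_of_tower, ← map_sub]
  rw [Submodule.mkQ_apply, Submodule.Quotient.mk_eq_zero]
  exact Submodule.subset_span ⟨s, k', ψ, μ, ν, rfl⟩

/-- A linear map out of `V ∘ W` given by compatible linear maps on decorated trees. -/
noncomputable def compLift {V W : SMod K} {X : Type} [Finite X] {d : ℤ} {M : Type*} [AddCommGroup M]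
    [Module K M] (φ : ∀ s : Shape X d, s.Tens V W →ₗ[K] M)
    (h : ∀ (s : Shape X d) (k' : ℕ) (ψ : Fin s.k ≃ Fin k')
      (μ : V.obj (Fin s.k) s.p) (ν : ∀ i, W.obj {x // s.f x = i} (s.q i)),
      φ (s.reindex ψ) (V.map ψ s.p μ ⊗ₜ PiTensorProduct.tprod K
          (fun i => W.map (fibEquiv (fun _ => Equiv.eq_symm_apply ψ)) _ (ν (ψ.symm i))))
        = koszul ψ s.q • φ s (μ ⊗ₜ PiTensorProduct.tprod K ν)) :
    compObj V W X d →ₗ[K] M :=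
  (compRel V W X d).liftQ (DirectSum.toModule K _ M φ) (by
    rw [compRel, Submodule.span_le]
    rintro _ ⟨s, k', ψ, μ, ν, rfl⟩
    simp only [SetLike.mem_coe, LinearMap.mem_ker, map_sub, LinearMap.map_smul_of_tower, sym,
      DirectSum.toModule_lof]
    rw [h, sub_self])

@[simp] theorem compLift_mk {V W : SMod K} {X : Type} [Finite X] {d : ℤ} {M : Type*} [AddCommGroup M]
    [Module K M] (φ : ∀ s : Shape X d, s.Tens V W →ₗ[K] M) (h) (s : Shape X d)
    (μ : V.obj (Fin s.k) s.p) (ν : ∀ i, W.obj {x // s.f x = i} (s.q i)) :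
    compLift φ h (cmk s μ ν) = φ s (μ ⊗ₜ PiTensorProduct.tprod K ν) := by
  simp [compLift, cmk, sym, DirectSum.toModule_lof]

theorem comp_hom_ext {V W : SMod K} {X : Type} [Finite X] {d : ℤ} {M : Type*} [AddCommGroup M]
    [Module K M] {F G : compObj V W X d →ₗ[K] M}
    (h : ∀ (s : Shape X d) μ ν, F (cmk s μ ν) = G (cmk s μ ν)) : F = G := by
  apply Submodule.linearMap_qext
  apply DirectSum.linearMap_ext
  intro s
  apply TensorProduct.ext
  apply LinearMap.ext
  intro μ
  apply PiTensorProduct.ext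
  apply MultilinearMap.ext
  intro ν
  exact h s μ ν

theorem SMod.tr_rfl (V : SMod K) {X Y : Type} [Finite X] [Finite Y] (e : X ≃ Y) {d : ℤ}
    (x : V.obj X d) : V.tr e rfl x = V.map e d x := rfl

theorem SMod.tr_tr (V : SMod K) {X Y Z : Type} [Finite X] [Finite Y] [Finite Z] (e : X ≃ Y)
    (e' : Y ≃ Z) {d d' d'' : ℤ} (h : d = d') (h' : d' = d'') (x : V.obj X d) :
    V.tr e' h' (V.tr e h x) = V.tr (e.trans e') (h.trans h') x := by
  subst h h'; exact (V.map_trans e e' d x).symm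

theorem SMod.tr_id (V : SMod K) {X : Type} [Finite X] (e : X ≃ X) (he : ∀ x, e x = x) {d : ℤ}
    (h : d = d) (x : V.obj X d) : V.tr e h x = x := by
  obtain rfl : e = Equiv.refl X := Equiv.ext he
  exact V.map_refl X d x

theorem SMod.tr_congr (V : SMod K) {X Y : Type} [Finite X] [Finite Y] (e e' : X ≃ Y)
    {d d' : ℤ} (h : d = d') (he : ∀ x, e x = e' x) (x : V.obj X d) : V.tr e h x = V.tr e' h x := by
  obtain rfl : e = e' := Equiv.ext he
  rfl

theorem DegMap.app_tr {V W : SMod K} {k : ℤ} (f : DegMap V W k) {X Y : Type} [Finite X] [Finite Y]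
    (e : X ≃ Y) {d₁ d₂ : ℤ} (hd : d₁ = d₂) {d₁' d₂' : ℤ} (h₁ : d₁ + k = d₁') (h₂ : d₂ + k = d₂')
    (x : V.obj X d₁) :
    f.app Y d₂ d₂' h₂ (V.tr e hd x) = W.tr e (by omega) (f.app X d₁ d₁' h₁ x) := by
  subst hd; subst h₁; subst h₂; exact f.natural e _ _ rfl x

theorem fam {W : SMod K} {X I : Type} [Finite X] {f : X → I} {q : I → ℤ}
    (ν : ∀ i, W.obj {x // f x = i} (q i)) {i j : I} (h : i = j) :
    ν j = W.tr (fibEquiv fun x => by rw [h]) (by rw [h]) (ν i) := by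
  subst h; rw [SMod.tr_id _ _ (fun _ => rfl)]

noncomputable def mkL {V W : SMod K} {X : Type} [Finite X] {d : ℤ} (s : Shape X d) :
    s.Tens V W →ₗ[K] compObj V W X d :=
  (compRel V W X d).mkQ ∘ₗ DirectSum.lof K _ (fun s : Shape X d => s.Tens V W) s

theorem mkL_tmul {V W : SMod K} {X : Type} [Finite X] {d : ℤ} (s : Shape X d)
    (μ : V.obj (Fin s.k) s.p) (ν : ∀ i, W.obj {x // s.f x = i} (s.q i)) :
    mkL (V := V) (W := W) s (μ ⊗ₜ PiTensorProduct.tprod K ν) = cmk s μ ν := rfl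

theorem mk_eq {V W : SMod K} {X : Type} [Finite X] {d : ℤ} {s s' : Shape X d}
    (ψ : Fin s.k ≃ Fin s'.k) (hf : ∀ x, s'.f x = ψ (s.f x)) (hp : s.p = s'.p)
    (hq : ∀ i, s.q i = s'.q (ψ i))
    {μ : V.obj (Fin s.k) s.p} {ν : ∀ i, W.obj {x // s.f x = i} (s.q i)}
    {μ' : V.obj (Fin s'.k) s'.p} {ν' : ∀ i, W.obj {x // s'.f x = i} (s'.q i)}
    (hμ : μ' = V.tr ψ hp μ)
    (hν : ∀ i, ν' (ψ i) = W.tr (fibEquiv fun x => by rw [hf, ψ.apply_eq_iff_eq]) (hq i) (ν i)) :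
    cmk s' μ' ν' = koszul ψ s.q • cmk s μ ν := by
  rcases s with ⟨k, f, p, q, hd⟩
  rcases s' with ⟨k', f', p', q', hd'⟩
  dsimp only at ψ hf hp hq μ ν μ' ν' hμ hν ⊢
  obtain rfl : f' = fun x => ψ (f x) := funext hf
  subst hp
  obtain rfl : q' = fun i => q (ψ.symm i) := funext fun i => by rw [hq, ψ.apply_symm_apply]
  refine Eq.trans ?_ (mk_reindex ⟨k, f, p, q, hd⟩ ψ μ ν)
  rw [hμ]
  refine congrArg (cmk (V := V) (W := W) (d := d) ⟨k', fun x => ψ (f x), p, fun i => q (ψ.symm i), hd'⟩ (V.map ψ p μ)) ?_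
  funext i
  obtain ⟨i, rfl⟩ := ψ.surjective i
  rw [hν]
  have : ∀ j (hj : i = j) (h1) (h2), W.tr (d := q i) (d' := q (ψ.symm (ψ i))) (fibEquiv h1) h2 (ν i) =
      W.tr (d := q j) (d' := q (ψ.symm (ψ i))) (fibEquiv (f := f) (f' := fun x => ψ (f x)) (i := j) (j := ψ i) (by subst hj; exact h1))
        (by rw [← hj, ψ.symm_apply_apply]) (ν j) := by
    rintro j rfl h1 h2; rfl
  exact this _ (ψ.symm_apply_apply i).symm _ _

theorem mk_congr {V W : SMod K} {X : Type} [Finite X] {d : ℤ} {k : ℕ} {f f' : X → Fin k}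
    {p p' : ℤ} {q q' : Fin k → ℤ} {hd hd'} (hf : ∀ x, f x = f' x) (hp : p = p')
    (hq : ∀ i, q i = q' i)
    {μ : V.obj (Fin k) p} {ν : ∀ i, W.obj {x // f x = i} (q i)}
    {μ' : V.obj (Fin k) p'} {ν' : ∀ i, W.obj {x // f' x = i} (q' i)}
    (hμ : μ' = V.tr (Equiv.refl _) hp μ)
    (hν : ∀ i, ν' i = W.tr (fibEquiv fun x => by rw [hf]) (hq i) (ν i)) :
    cmk (V := V) (W := W) (d := d) ⟨k, f', p', q', hd'⟩ μ' ν' = cmk ⟨k, f, p, q, hd⟩ μ ν := by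
  obtain rfl : f = f' := funext hf
  subst hp
  obtain rfl : q = q' := funext hq
  rw [SMod.tr_id _ _ (fun _ => rfl)] at hμ
  subst hμ
  congr 1
  funext i
  rw [hν, SMod.tr_id _ _ (fun _ => rfl)]

abbrev Shape.relabel {X Y : Type} {d : ℤ} (s : Shape X d) (e : X ≃ Y) : Shape Y d where
  k := s.k
  f y := s.f (e.symm y)
  p := s.p
  q := s.q
  hd := s.hd

def fibRelabel {X Y I : Type} (f : X → I) (e : X ≃ Y) (i : I) :
    {x // f x = i} ≃ {y // f (e.symm y) = i} :=
  e.subtypeEquiv fun x => by simp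

noncomputable def symMap {V V' W W' : SMod K} {X Y : Type} [Finite X] [Finite Y] {d d' : ℤ}
    (s : Shape X d) (f : Y → Fin s.k) (p : ℤ) (q : Fin s.k → ℤ) (hd : p + ∑ i, q i = d')
    (A : V.obj (Fin s.k) s.p →ₗ[K] V'.obj (Fin s.k) p)
    (B : ∀ i, W.obj {x // s.f x = i} (s.q i) →ₗ[K] W'.obj {y // f y = i} (q i)) :
    s.Tens V W →ₗ[K] compObj V' W' Y d' :=
  mkL ⟨s.k, f, p, q, hd⟩ ∘ₗ TensorProduct.map A (PiTensorProduct.map B)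

theorem symMap_tmul {V V' W W' : SMod K} {X Y : Type} [Finite X] [Finite Y] {d d' : ℤ}
    (s : Shape X d) (f : Y → Fin s.k) (p : ℤ) (q : Fin s.k → ℤ) (hd : p + ∑ i, q i = d')
    (A : V.obj (Fin s.k) s.p →ₗ[K] V'.obj (Fin s.k) p)
    (B : ∀ i, W.obj {x // s.f x = i} (s.q i) →ₗ[K] W'.obj {y // f y = i} (q i))
    (μ : V.obj (Fin s.k) s.p) (ν : ∀ i, W.obj {x // s.f x = i} (s.q i)) :
    symMap s f p q hd A B (μ ⊗ₜ PiTensorProduct.tprod K ν) =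
      cmk ⟨s.k, f, p, q, hd⟩ (A μ) (fun i => B i (ν i)) := by
  simp only [symMap, LinearMap.comp_apply, TensorProduct.map_tmul, PiTensorProduct.map_tprod]
  rfl

noncomputable def compObjMap (V W : SMod K) {X Y : Type} [Finite X] [Finite Y] (e : X ≃ Y) (d : ℤ) :
    compObj V W X d →ₗ[K] compObj V W Y d :=
  compLift (fun s => symMap s (fun y => s.f (e.symm y)) s.p s.q s.hd LinearMap.id
      fun i => W.map (fibRelabel s.f e i) (s.q i)) (by
    intro s k' ψ μ ν
    rw [symMap_tmul, symMap_tmul]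
    refine mk_eq (s := s.relabel e) (s' := (s.reindex ψ).relabel e) ψ (fun _ => rfl) rfl
      (fun i => by simp) rfl fun i => ?_
    rw [fam ν (ψ.symm_apply_apply i).symm]
    simp only [← SMod.tr_rfl, SMod.tr_tr]
    exact SMod.tr_congr _ _ _ _ (fun _ => rfl) _)

theorem compObjMap_mk (V W : SMod K) {X Y : Type} [Finite X] [Finite Y] (e : X ≃ Y) {d : ℤ}
    (s : Shape X d) (μ : V.obj (Fin s.k) s.p) (ν : ∀ i, W.obj {x // s.f x = i} (s.q i)) :
    compObjMap V W e d (cmk s μ ν) =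
      cmk (s.relabel e) μ (fun i => W.map (fibRelabel s.f e i) (s.q i) (ν i)) := by
  rw [compObjMap, compLift_mk, symMap_tmul]
  rfl

/-- The composite product `V ∘ W` of graded `S`-modules. -/
noncomputable def comp (V W : SMod K) : SMod K where
  obj X _ d := compObj V W X d
  map e d := compObjMap V W e d
  map_refl X _ d x := by
    refine LinearMap.congr_fun (g := LinearMap.id) (comp_hom_ext fun s μ ν => ?_) x
    rw [compObjMap_mk]
    refine mk_congr (fun _ => rfl) rfl (fun _ => rfl) (SMod.tr_id V _ (fun _ => rfl) _ _).symm fun i => rfl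
  map_trans e e' d x := by
    refine LinearMap.congr_fun (g := (compObjMap V W e' d) ∘ₗ (compObjMap V W e d)) (comp_hom_ext fun s μ ν => ?_) x
    simp only [LinearMap.comp_apply, compObjMap_mk]
    refine mk_congr (fun _ => rfl) rfl (fun _ => rfl) (SMod.tr_id V _ (fun _ => rfl) _ _).symm fun i => ?_
    simp only [← SMod.tr_rfl, SMod.tr_tr]
    refine Eq.trans ?_ (SMod.tr_tr W _ _ _ _ _).symm
    exact SMod.tr_congr W _ _ _ (fun _ => rfl) _

theorem comp_map_mk (V W : SMod K) {X Y : Type} [Finite X] [Finite Y] (e : X ≃ Y) {d : ℤ}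
    (s : Shape X d) (μ : V.obj (Fin s.k) s.p) (ν : ∀ i, W.obj {x // s.f x = i} (s.q i)) :
    (comp V W).map e d (cmk s μ ν) =
      cmk (s.relabel e) μ (fun i => W.map (fibRelabel s.f e i) (s.q i) (ν i)) :=
  compObjMap_mk V W e s μ ν

abbrev Shape.shiftBot {X : Type} {d d' : ℤ} (s : Shape X d) (a : ℤ) (h : d + a = d') :
    Shape X d' where
  k := s.k
  f := s.f
  p := s.p + a
  q := s.q
  hd := by have := s.hd; omega

noncomputable def compMapApp {V V' W W' : SMod K} {a : ℤ} (f : DegMap V V' a) (g : DegMap W W' 0)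
    (X : Type) [Finite X] (d d' : ℤ) (h : d + a = d') : compObj V W X d →ₗ[K] compObj V' W' X d' :=
  compLift (fun s => symMap s s.f (s.p + a) s.q (s.shiftBot a h).hd
      (f.app (Fin s.k) s.p (s.p + a) rfl)
      (fun i => g.app {x // s.f x = i} (s.q i) (s.q i) (add_zero _))) (by
    intro s k' ψ μ ν
    rw [symMap_tmul, symMap_tmul]
    refine mk_eq (s := s.shiftBot a h) (s' := (s.reindex ψ).shiftBot a h) ψ (fun _ => rfl) rfl
      (fun i => by simp) (f.natural _ _ _ _ _) fun i => ?_
    rw [fam ν (ψ.symm_apply_apply i).symm]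
    simp only [← SMod.tr_rfl, SMod.tr_tr]
    exact g.app_tr _ _ _ _ _)

theorem compMapApp_mk {V V' W W' : SMod K} {a : ℤ} (f : DegMap V V' a) (g : DegMap W W' 0)
    {X : Type} [Finite X] {d d' : ℤ} (h : d + a = d') (s : Shape X d)
    (μ : V.obj (Fin s.k) s.p) (ν : ∀ i, W.obj {x // s.f x = i} (s.q i)) :
    compMapApp f g X d d' h (cmk s μ ν) =
      cmk (s.shiftBot a h) (f.app (Fin s.k) s.p (s.p + a) rfl μ)
        (fun i => g.app {x // s.f x = i} (s.q i) (s.q i) (add_zero _) (ν i)) := by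
  rw [compMapApp, compLift_mk, symMap_tmul]

/-- `f ∘ g` for `f` of any degree and `g` of degree `0`:
`(μ; ν₁, …, ν_k) ↦ (f μ; g ν₁, …, g ν_k)`. -/
noncomputable def compMap {V V' W W' : SMod K} {a : ℤ} (f : DegMap V V' a) (g : DegMap W W' 0) :
    DegMap (comp V W) (comp V' W') a where
  app X _ d d' h := compMapApp f g X d d' h
  natural {X Y} _ _ e d d' h x := by
    refine LinearMap.congr_fun (f := compMapApp f g Y d d' h ∘ₗ compObjMap V W e d)
      (g := compObjMap V' W' e d' ∘ₗ compMapApp f g X d d' h) (comp_hom_ext fun s μ ν => ?_) x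
    rw [LinearMap.comp_apply, LinearMap.comp_apply, compObjMap_mk, compMapApp_mk, compMapApp_mk,
      compObjMap_mk]
    refine mk_congr (fun _ => rfl) rfl (fun _ => rfl) (SMod.tr_id V' _ (fun _ => rfl) _ _).symm fun i => ?_
    dsimp only
    rw [SMod.tr_id _ _ (fun _ => rfl)]
    exact g.natural _ _ _ _ _


abbrev Shape.shiftAt {X : Type} {d d' : ℤ} (s : Shape X d) (a b : ℤ) (h : d + (a + b) = d')
    (i : Fin s.k) : Shape X d' where
  k := s.k
  f := s.f
  p := s.p + a
  q j := s.q j + if j = i then b else 0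
  hd := by
    have := s.hd
    simp only [Finset.sum_add_distrib, Finset.sum_ite_eq', Finset.mem_univ, if_true]
    omega

def infSign {k : ℕ} (b p : ℤ) (q : Fin k → ℤ) (i : Fin k) : ℤˣ :=
  (b * (p + ∑ j, if j < i then q j else 0)).negOnePow

theorem infSign_koszul {k k' : ℕ} (ψ : Fin k ≃ Fin k') (b p : ℤ) (q : Fin k → ℤ) (i : Fin k) :
    infSign b p (fun j => q (ψ.symm j)) (ψ i) * koszul ψ (fun j => q j + if j = i then b else 0) =
      koszul ψ q * infSign b p q i := by
  simp only [infSign, koszul, ← Int.negOnePow_add]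
  apply negOnePow_congr
  have e : ∑ j, (if j < ψ i then q (ψ.symm j) else 0) = ∑ j, if ψ j < ψ i then q j else 0 := by
    rw [← Equiv.sum_comp ψ]; simp
  rw [e]
  push_cast
  have e1 : ∀ x y, (if x < y ∧ ψ y < ψ x then ((q x : ZMod 2) + if x = i then (b : ZMod 2) else 0) *
      ((q y : ZMod 2) + if y = i then (b : ZMod 2) else 0) else 0) =
      (if x < y ∧ ψ y < ψ x then (q x : ZMod 2) * q y else 0) +
      (if y = i then b * (if x < i ∧ ψ i < ψ x then (q x : ZMod 2) else 0) else 0) +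
      (if x = i then b * (if i < y ∧ ψ y < ψ i then (q y : ZMod 2) else 0) else 0) := by
    intro x y
    by_cases hx : x = i <;> by_cases hy : y = i <;> simp [hx, hy] <;> split_ifs <;> ring
  simp only [e1, Finset.sum_add_distrib, Finset.sum_ite_eq', Finset.mem_univ, if_true]
  rw [Finset.sum_comm (f := fun x y => if x = i then _ else _)]
  simp only [Finset.sum_ite_eq', Finset.mem_univ, if_true, ← Finset.mul_sum]
  have e2 : ∑ j, (if ψ j < ψ i then (q j : ZMod 2) else 0) +
      ∑ j, (if j < i ∧ ψ i < ψ j then (q j : ZMod 2) else 0) +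
      ∑ j, (if i < j ∧ ψ j < ψ i then (q j : ZMod 2) else 0) = ∑ j, if j < i then (q j : ZMod 2) else 0 := by
    rw [← Finset.sum_add_distrib, ← Finset.sum_add_distrib]
    refine Finset.sum_congr rfl fun j _ => ?_
    have h2 : (2 : ZMod 2) = 0 := rfl
    rcases lt_trichotomy j i with h | h | h
    · rcases lt_trichotomy (ψ j) (ψ i) with h' | h' | h'
      · simp [h, h', h.not_gt, h'.not_gt]
      · exact absurd (ψ.injective h') h.ne
      · simp [h, h', h.not_gt, h'.not_gt]
    · subst h; simp
    · rcases lt_trichotomy (ψ j) (ψ i) with h' | h' | h'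
      · simp [h, h', h.not_gt, h'.not_gt, CharTwo.add_self_eq_zero]
      · exact absurd (ψ.injective h') h.ne'
      · simp [h, h', h.not_gt, h'.not_gt]
  rw [← e2]
  ring

def infMap {W W' : SMod K} {b : ℤ} (g : DegMap W W' 0) (h : DegMap W W' b) {X : Type} [Finite X]
    {k : ℕ} (f : X → Fin k) (q : Fin k → ℤ) (i j : Fin k) :
    W.obj {x // f x = j} (q j) →ₗ[K] W'.obj {x // f x = j} (q j + if j = i then b else 0) :=
  if hj : j = i then h.app _ _ _ (by rw [if_pos hj]) else g.app _ _ _ (by rw [if_neg hj])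

noncomputable def compInfApp {V V' W W' : SMod K} {a b : ℤ} (f : DegMap V V' a) (g : DegMap W W' 0)
    (h : DegMap W W' b) (X : Type) [Finite X] (d d' : ℤ) (hd : d + (a + b) = d') :
    compObj V W X d →ₗ[K] compObj V' W' X d' :=
  compLift (fun s => ∑ i : Fin s.k, infSign b s.p s.q i •
      symMap s s.f (s.p + a) (fun j => s.q j + if j = i then b else 0) (s.shiftAt a b hd i).hd
        (f.app (Fin s.k) s.p (s.p + a) rfl) (infMap g h s.f s.q i)) (by
    intro s k' ψ μ ν
    rw [LinearMap.sum_apply, LinearMap.sum_apply, ← Equiv.sum_comp ψ, Finset.smul_sum]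
    refine Finset.sum_congr rfl fun i _ => ?_
    rw [LinearMap.smul_apply, LinearMap.smul_apply, symMap_tmul, symMap_tmul]
    rw [smul_smul, ← infSign_koszul, ← smul_smul]
    congr 1
    refine mk_eq (s := s.shiftAt a b hd i) (s' := (s.reindex ψ).shiftAt a b hd (ψ i)) ψ (fun _ => rfl) rfl
      (fun j => by simp) (f.natural _ _ _ _ _) fun j => ?_
    rw [fam ν (ψ.symm_apply_apply j).symm]
    simp only [← SMod.tr_rfl, SMod.tr_tr]
    by_cases hj : j = i
    · rw [infMap, infMap, dif_pos hj, dif_pos (by rw [hj])]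
      exact h.app_tr _ _ _ _ _
    · rw [infMap, infMap, dif_neg hj, dif_neg (by rwa [ψ.apply_eq_iff_eq])]
      exact g.app_tr _ _ _ _ _)

theorem compInfApp_mk {V V' W W' : SMod K} {a b : ℤ} (f : DegMap V V' a) (g : DegMap W W' 0)
    (h : DegMap W W' b) {X : Type} [Finite X] {d d' : ℤ} (hd : d + (a + b) = d') (s : Shape X d)
    (μ : V.obj (Fin s.k) s.p) (ν : ∀ i, W.obj {x // s.f x = i} (s.q i)) :
    compInfApp f g h X d d' hd (cmk s μ ν) = ∑ i : Fin s.k, infSign b s.p s.q i •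
      cmk (s.shiftAt a b hd i) (f.app (Fin s.k) s.p (s.p + a) rfl μ)
        (fun j => infMap g h s.f s.q i j (ν j)) := by
  rw [compInfApp, compLift_mk, LinearMap.sum_apply]
  refine Finset.sum_congr rfl fun i _ => ?_
  rw [LinearMap.smul_apply, symMap_tmul]

/-- The infinitesimal composite `f ∘ (g; h)` with `g` of degree `0`: the sum over `i` of
`± (f μ; g ν₁, …, h ν_i, …, g ν_k)`, with the Koszul sign of moving `h` past `μ, ν₁, …, ν_{i-1}`. -/
noncomputable def compInf {V V' W W' : SMod K} {a b : ℤ} (f : DegMap V V' a) (g : DegMap W W' 0)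
    (h : DegMap W W' b) : DegMap (comp V W) (comp V' W') (a + b) where
  app X _ d d' hd := compInfApp f g h X d d' hd
  natural {X Y} _ _ e d d' hd x := by
    refine LinearMap.congr_fun (f := compInfApp f g h Y d d' hd ∘ₗ compObjMap V W e d)
      (g := compObjMap V' W' e d' ∘ₗ compInfApp f g h X d d' hd) (comp_hom_ext fun s μ ν => ?_) x
    rw [LinearMap.comp_apply, LinearMap.comp_apply, compObjMap_mk, compInfApp_mk, compInfApp_mk,
      map_sum]
    refine Finset.sum_congr rfl fun i _ => ?_
    rw [LinearMap.map_smul_of_tower, compObjMap_mk]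
    congr 1
    refine mk_congr (fun _ => rfl) rfl (fun _ => rfl) (SMod.tr_id V' _ (fun _ => rfl) _ _).symm fun j => ?_
    dsimp only
    rw [SMod.tr_id _ _ (fun _ => rfl)]
    by_cases hj : j = i
    · rw [infMap, infMap, dif_pos hj, dif_pos hj]
      exact h.natural _ _ _ _ _
    · rw [infMap, infMap, dif_neg hj, dif_neg hj]
      exact g.natural _ _ _ _ _

/-- The unit `I` of the composite product: `K` in arity one and degree zero. -/
def unit (K : Type u) [Field K] : SMod K where
  obj X _ d := {_e : X ≃ Unit // d = 0} → K
  map e _ := LinearMap.funLeft K K fun e' => ⟨e.trans e'.1, e'.2⟩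
  map_refl _ _ _ _ := rfl
  map_trans _ _ _ _ := rfl

def unit.one (K : Type u) [Field K] (X : Type) [Finite X] : (unit K).obj X 0 := fun _ => 1


def fibCard {m k : ℕ} (f : Fin m → Fin k) (i : Fin k) : ℕ := Fintype.card {j // f j = i}

/-- The increasing enumeration of a fibre. -/
def fibEnum {m k : ℕ} (f : Fin m → Fin k) (i : Fin k) :
    Fin (fibCard f i) ≃o {j // f j = i} :=
  monoEquivOfFin _ rfl

abbrev blockShape {X : Type} {m k : ℕ} (g : X → Fin m) (s : Fin m → ℤ) (f : Fin m → Fin k)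
    (q : Fin k → ℤ) (i : Fin k) :
    Shape {x // f (g x) = i} (q i + ∑ j : {j // f j = i}, s j) where
  k := fibCard f i
  f x := (fibEnum f i).symm ⟨g x, x.2⟩
  p := q i
  q l := s (fibEnum f i l)
  hd := congrArg (q i + ·) (Equiv.sum_comp (fibEnum f i).toEquiv fun j => s j)

def blockFib {X : Type} {m k : ℕ} (g : X → Fin m) (f : Fin m → Fin k) (i : Fin k)
    (l : Fin (fibCard f i)) :
    {x // g x = fibEnum f i l} ≃
      {y : {x // f (g x) = i} // (fibEnum f i).symm ⟨g y, y.2⟩ = l} where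
  toFun x := ⟨⟨x.1, by rw [x.2]; exact (fibEnum f i l).2⟩, by
    rw [OrderIso.symm_apply_eq]; exact Subtype.ext x.2⟩
  invFun y := ⟨y.1.1, by
    have := y.2; rw [OrderIso.symm_apply_eq] at this; exact congrArg Subtype.val this⟩
  left_inv _ := rfl
  right_inv _ := rfl

/-- The `i`-th block `(w; ρ_j with f j = i)` of the reassociated composite, the `ρ_j` being written in
increasing order of `j`. -/
noncomputable def blockMap (W U : SMod K) {X : Type} [Finite X] {m k : ℕ} (g : X → Fin m)
    (s : Fin m → ℤ) (f : Fin m → Fin k) (q : Fin k → ℤ)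
    (ρ : ∀ j, U.obj {x // g x = j} (s j)) (i : Fin k) :
    W.obj {j // f j = i} (q i) →ₗ[K] (comp W U).obj {x // f (g x) = i}
      (q i + ∑ j : {j // f j = i}, s j) :=
  mkL (V := W) (W := U) (blockShape g s f q i) ∘ₗ
    (TensorProduct.mk K _ _).flip (PiTensorProduct.tprod K fun l =>
      U.map (blockFib g f i l) _ (ρ (fibEnum f i l))) ∘ₗ
    W.map (fibEnum f i).symm.toEquiv (q i)

theorem blockMap_apply {W U : SMod K} {X : Type} [Finite X] {m k : ℕ} (g : X → Fin m)
    (s : Fin m → ℤ) (f : Fin m → Fin k) (q : Fin k → ℤ)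
    (ρ : ∀ j, U.obj {x // g x = j} (s j)) (i : Fin k) (w : W.obj {j // f j = i} (q i)) :
    blockMap W U g s f q ρ i w = cmk (blockShape g s f q i) (W.map (fibEnum f i).symm.toEquiv (q i) w)
      fun l => U.map (blockFib g f i l) _ (ρ (fibEnum f i l)) := rfl

/-- The Koszul sign of rewriting `w₁ ⋯ w_k ρ₁ ⋯ ρ_m` (degrees `q` and `s`) as the product over `i` of
the blocks consisting of `w_i` followed by the `ρ_j` with `f j = i`. -/
def assocSign {m k : ℕ} (s : Fin m → ℤ) (f : Fin m → Fin k) (q : Fin k → ℤ) : ℤˣ :=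
  ((∑ j, ∑ i, if f j < i then s j * q i else 0) +
    ∑ j, ∑ j', if j < j' ∧ f j' < f j then s j * s j' else 0).negOnePow

abbrev assocShape {X : Type} {d : ℤ} (S : Shape X d) (s : Shape (Fin S.k) S.p) : Shape X d where
  k := s.k
  f x := s.f (S.f x)
  p := s.p
  q i := s.q i + ∑ j : {j // s.f j = i}, S.q j
  hd := by
    rw [Finset.sum_add_distrib, ← add_assoc, s.hd, Fintype.sum_fiberwise s.f S.q, S.hd]

theorem sum_fib {m k : ℕ} {M : Type*} [AddCommMonoid M] (f : Fin m → Fin k) (i : Fin k)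
    (F : Fin m → M) : ∑ j : {j // f j = i}, F j = ∑ j, if f j = i then F j else 0 := by
  rw [← Finset.sum_filter]
  exact (Finset.sum_subtype _ (by simp) F).symm

theorem blockDeg_congr {m m' k k' : ℕ} {s : Fin m → ℤ} {s' : Fin m' → ℤ} {f : Fin m → Fin k}
    {f' : Fin m' → Fin k'} {i : Fin k} {i' : Fin k'} (τ : {j // f j = i} ≃ {j // f' j = i'})
    (hs : ∀ j : {j // f j = i}, s j = s' (τ j)) {a b : ℤ} (h : a = b) :
    a + ∑ j : {j // f j = i}, s j = b + ∑ j : {j // f' j = i'}, s' j := by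
  rw [h, ← Equiv.sum_comp τ]
  simp only [hs]

theorem comp_tr_mk {V W : SMod K} {X Y : Type} [Finite X] [Finite Y] (e : X ≃ Y) {d d' : ℤ}
    (h : d = d') (s : Shape X d) (μ : V.obj (Fin s.k) s.p)
    (ν : ∀ i, W.obj {x // s.f x = i} (s.q i)) :
    (comp V W).tr e h (cmk s μ ν) =
      cmk (d := d') ⟨s.k, fun y => s.f (e.symm y), s.p, s.q, s.hd.trans h⟩ μ
        (fun i => W.map (fibRelabel s.f e i) (s.q i) (ν i)) := by
  subst h
  exact compObjMap_mk V W e s μ ν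

def fibConj {m m' k k' : ℕ} {f : Fin m → Fin k} {f' : Fin m' → Fin k'} {i : Fin k} {i' : Fin k'}
    (τ : {j // f j = i} ≃ {j // f' j = i'}) :
    Fin (fibCard f i) ≃ Fin (fibCard f' i') :=
  ((fibEnum f i).toEquiv.trans τ).trans (fibEnum f' i').symm.toEquiv

theorem fibEnum_fibConj {m m' k k' : ℕ} {f : Fin m → Fin k} {f' : Fin m' → Fin k'} {i : Fin k}
    {i' : Fin k'} (τ : {j // f j = i} ≃ {j // f' j = i'}) (l) :
    fibEnum f' i' (fibConj τ l) = τ (fibEnum f i l) := by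
  simp [fibConj]

theorem koszul_fibConj {m m' k k' : ℕ} {f : Fin m → Fin k} {f' : Fin m' → Fin k'} {i : Fin k}
    {i' : Fin k'} (τ : {j // f j = i} ≃ {j // f' j = i'}) (s : Fin m → ℤ) :
    koszul (fibConj τ) (fun l => s (fibEnum f i l)) =
      (∑ j : {j // f j = i}, ∑ j' : {j // f j = i},
        if j < j' ∧ τ j' < τ j then s j * s j' else 0).negOnePow := by
  rw [koszul]
  congr 1
  rw [← Equiv.sum_comp (fibEnum f i).toEquiv]
  refine Finset.sum_congr rfl fun l _ => ?_
  rw [← Equiv.sum_comp (fibEnum f i).toEquiv]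
  refine Finset.sum_congr rfl fun l' _ => ?_
  simp [fibConj]

theorem koszul_mono {k k' : ℕ} (ψ : Fin k ≃ Fin k') (q : Fin k → ℤ) (h : ∀ i j, i < j → ψ i < ψ j) :
    koszul ψ q = 1 := by
  rw [koszul, Finset.sum_eq_zero, Int.negOnePow_zero]
  intro i _
  refine Finset.sum_eq_zero fun j _ => if_neg ?_
  rintro ⟨h1, h2⟩
  exact (h _ _ h1).not_gt h2

theorem blockMap_rel {W U : SMod K} {X : Type} [Finite X] {m m' k k' : ℕ} {g : X → Fin m}
    {g' : X → Fin m'} {s : Fin m → ℤ} {s' : Fin m' → ℤ} {f : Fin m → Fin k}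
    {f' : Fin m' → Fin k'} {q : Fin k → ℤ} {q' : Fin k' → ℤ} {i : Fin k} {i' : Fin k'}
    {ρ : ∀ j, U.obj {x // g x = j} (s j)} {ρ' : ∀ j, U.obj {x // g' x = j} (s' j)}
    (τ : {j // f j = i} ≃ {j // f' j = i'})
    (hX : ∀ x, f (g x) = i ↔ f' (g' x) = i')
    (hg : ∀ (j : {j // f j = i}) (x : X), g x = j ↔ g' x = τ j)
    (hs : ∀ j : {j // f j = i}, s j = s' (τ j)) (hq : q i = q' i')
    (hρ : ∀ j : {j // f j = i}, ρ' (τ j) = U.tr (fibEquiv (hg j)) (hs j) (ρ j))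
    (w : W.obj {j // f j = i} (q i)) :
    blockMap W U g' s' f' q' ρ' i' (W.tr τ hq w) =
      koszul (fibConj τ) (fun l => s (fibEnum f i l)) •
        (comp W U).tr (fibEquiv hX) (blockDeg_congr τ hs hq) (blockMap W U g s f q ρ i w) := by
  rw [blockMap_apply, blockMap_apply, comp_tr_mk]
  refine mk_eq (s := ⟨fibCard f i, fun x => (fibEnum f i).symm ⟨g ((fibEquiv hX).symm x), ((fibEquiv hX).symm x).2⟩,
      q i, fun l => s (fibEnum f i l), (blockShape g s f q i).hd.trans (blockDeg_congr τ hs hq)⟩)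
    (s' := blockShape g' s' f' q' i') (fibConj τ) ?_ hq ?_ ?_ ?_
  · intro x
    dsimp only
    rw [OrderIso.symm_apply_eq, fibEnum_fibConj, OrderIso.apply_symm_apply]
    refine Subtype.ext ?_
    exact (hg ⟨g x, (hX x).2 x.2⟩ x).1 rfl
  · intro l
    dsimp only
    rw [fibEnum_fibConj, hs]
  · rw [← SMod.tr_rfl, ← SMod.tr_rfl, SMod.tr_tr, SMod.tr_tr]
    refine SMod.tr_congr W _ _ _ (fun x => ?_) _
    simp [fibConj]
  · intro l
    rw [fam ρ' (congrArg Subtype.val (fibEnum_fibConj τ l).symm), hρ]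
    simp only [← SMod.tr_rfl, SMod.tr_tr]
    exact SMod.tr_congr U _ _ _ (fun _ => rfl) _

theorem sum_symm {n : ℕ} (F : Fin n → Fin n → ZMod 2) (h : ∀ j, F j j = 0) :
    ∑ j, ∑ j', F j j' = ∑ j, ∑ j', if j < j' then F j j' + F j' j else 0 := by
  have e : ∀ j j', F j j' = (if j < j' then F j j' else 0) + if j' < j then F j j' else 0 := by
    intro j j'
    rcases lt_trichotomy j j' with h' | h' | h'
    · simp [h', h'.not_gt]
    · subst h'; simp [h]
    · simp [h', h'.not_gt]
  have e' : ∀ j j', (if j < j' then F j j' + F j' j else 0) =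
      (if j < j' then F j j' else 0) + if j < j' then F j' j else 0 := by
    intro j j'; split_ifs <;> simp
  rw [Finset.sum_congr rfl fun j _ => Finset.sum_congr rfl fun j' _ => e j j']
  simp only [e', Finset.sum_add_distrib]
  congr 1
  exact Finset.sum_comm

theorem two_add (c : ZMod 2) : c + c = 0 := CharTwo.add_self_eq_zero c

theorem assocSign_reindex {m k k' : ℕ} (s : Fin m → ℤ) (f : Fin m → Fin k) (q : Fin k → ℤ)
    (ψ : Fin k ≃ Fin k') :
    assocSign s (fun j => ψ (f j)) (fun i => q (ψ.symm i)) *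
      koszul ψ (fun i => q i + ∑ j : {j // f j = i}, s j) = koszul ψ q * assocSign s f q := by
  simp only [assocSign, koszul, ← Int.negOnePow_add]
  apply negOnePow_congr
  have e : ∀ j, ∑ i, (if ψ (f j) < i then s j * q (ψ.symm i) else 0) =
      ∑ i, if ψ (f j) < ψ i then s j * q i else 0 := by
    intro j; rw [← Equiv.sum_comp ψ]; simp
  simp only [e, sum_fib]
  push_cast
  have e1 : ∀ x y, (if x < y ∧ ψ y < ψ x then
        ((q x : ZMod 2) + ∑ j, if f j = x then (s j : ZMod 2) else 0) *
        ((q y : ZMod 2) + ∑ j, if f j = y then (s j : ZMod 2) else 0) else 0) =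
      (if x < y ∧ ψ y < ψ x then (q x : ZMod 2) * q y else 0) +
      (∑ j, if f j = y then (if x < f j ∧ ψ (f j) < ψ x then (s j : ZMod 2) * q x else 0) else 0) +
      (∑ j, if f j = x then (if f j < y ∧ ψ y < ψ (f j) then (s j : ZMod 2) * q y else 0) else 0) +
      ∑ j, if f j = x then ∑ j', (if f j' = y then
        (if f j < f j' ∧ ψ (f j') < ψ (f j) then (s j : ZMod 2) * s j' else 0) else 0) else 0 := by
    intro x y
    have h1 : (∑ j, if f j = y then (if x < f j ∧ ψ (f j) < ψ x then (s j : ZMod 2) * q x else 0) else 0) =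
        if x < y ∧ ψ y < ψ x then q x * ∑ j, (if f j = y then (s j : ZMod 2) else 0) else 0 := by
      rw [Finset.mul_sum]
      by_cases h : x < y ∧ ψ y < ψ x
      · rw [if_pos h]
        refine Finset.sum_congr rfl fun j _ => ?_
        by_cases hj : f j = y
        · subst hj; simp [h, mul_comm]
        · simp [hj]
      · rw [if_neg h]
        refine Finset.sum_eq_zero fun j _ => ?_
        by_cases hj : f j = y
        · subst hj; rw [if_pos rfl, if_neg h]
        · simp [hj]
    have h2 : (∑ j, if f j = x then (if f j < y ∧ ψ y < ψ (f j) then (s j : ZMod 2) * q y else 0) else 0) =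
        if x < y ∧ ψ y < ψ x then (∑ j, if f j = x then (s j : ZMod 2) else 0) * q y else 0 := by
      rw [Finset.sum_mul]
      by_cases h : x < y ∧ ψ y < ψ x
      · rw [if_pos h]
        refine Finset.sum_congr rfl fun j _ => ?_
        by_cases hj : f j = x
        · subst hj; simp [h]
        · simp [hj]
      · rw [if_neg h]
        refine Finset.sum_eq_zero fun j _ => ?_
        by_cases hj : f j = x
        · subst hj; rw [if_pos rfl, if_neg h]
        · simp [hj]
    have h3 : (∑ j, if f j = x then ∑ j', (if f j' = y then
        (if f j < f j' ∧ ψ (f j') < ψ (f j) then (s j : ZMod 2) * s j' else 0) else 0) else 0) =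
        if x < y ∧ ψ y < ψ x then (∑ j, if f j = x then (s j : ZMod 2) else 0) *
          ∑ j, (if f j = y then (s j : ZMod 2) else 0) else 0 := by
      rw [Finset.sum_mul]
      by_cases h : x < y ∧ ψ y < ψ x
      · rw [if_pos h]
        refine Finset.sum_congr rfl fun j _ => ?_
        by_cases hj : f j = x
        · subst hj
          rw [if_pos rfl, if_pos rfl, Finset.mul_sum]
          refine Finset.sum_congr rfl fun j' _ => ?_
          by_cases hj' : f j' = y
          · subst hj'; simp [h]
          · simp [hj']
        · simp [hj]
      · rw [if_neg h]
        refine Finset.sum_eq_zero fun j _ => ?_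
        by_cases hj : f j = x
        · subst hj
          rw [if_pos rfl]
          refine Finset.sum_eq_zero fun j' _ => ?_
          by_cases hj' : f j' = y
          · subst hj'; rw [if_pos rfl, if_neg h]
          · simp [hj']
        · simp [hj]
    rw [h1, h2, h3]
    split_ifs <;> ring
  simp only [e1, Finset.sum_add_distrib]
  have t2 : ∑ x, ∑ y, ∑ j, (if f j = y then (if x < f j ∧ ψ (f j) < ψ x then (s j : ZMod 2) * q x else 0) else 0) =
      ∑ j, ∑ x, if x < f j ∧ ψ (f j) < ψ x then (s j : ZMod 2) * q x else 0 := by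
    rw [Finset.sum_comm (s := (Finset.univ : Finset (Fin m)))]
    refine Finset.sum_congr rfl fun x _ => ?_
    rw [Finset.sum_comm]
    simp
  have t3 : ∑ x, ∑ y, ∑ j, (if f j = x then (if f j < y ∧ ψ y < ψ (f j) then (s j : ZMod 2) * q y else 0) else 0) =
      ∑ j, ∑ y, if f j < y ∧ ψ y < ψ (f j) then (s j : ZMod 2) * q y else 0 := by
    rw [Finset.sum_comm, Finset.sum_comm (s := (Finset.univ : Finset (Fin m)))]
    refine Finset.sum_congr rfl fun x _ => ?_
    rw [Finset.sum_comm]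
    simp
  have t4 : ∑ x, ∑ y, ∑ j, (if f j = x then ∑ j', (if f j' = y then
        (if f j < f j' ∧ ψ (f j') < ψ (f j) then (s j : ZMod 2) * s j' else 0) else 0) else 0) =
      ∑ j, ∑ j', if j < j' then (if f j < f j' ∧ ψ (f j') < ψ (f j) then (s j : ZMod 2) * s j' else 0) +
        (if f j' < f j ∧ ψ (f j) < ψ (f j') then (s j' : ZMod 2) * s j else 0) else 0 := by
    rw [← sum_symm (fun j j' => if f j < f j' ∧ ψ (f j') < ψ (f j) then (s j : ZMod 2) * s j' else 0)
      (by simp)]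
    rw [Finset.sum_congr rfl fun x _ => Finset.sum_comm, Finset.sum_comm]
    refine Finset.sum_congr rfl fun j _ => ?_
    rw [Finset.sum_comm]
    simp only [Finset.sum_ite_eq, Finset.mem_univ, if_true]
    rw [Finset.sum_comm]
    simp only [Finset.sum_ite_eq, Finset.mem_univ, if_true]
  rw [t2, t3, t4]
  have a : (∑ j, ∑ i, if ψ (f j) < ψ i then (s j : ZMod 2) * q i else 0) +
      (∑ j, ∑ x, if x < f j ∧ ψ (f j) < ψ x then (s j : ZMod 2) * q x else 0) +
      (∑ j, ∑ y, if f j < y ∧ ψ y < ψ (f j) then (s j : ZMod 2) * q y else 0) =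
      ∑ j, ∑ i, if f j < i then (s j : ZMod 2) * q i else 0 := by
    simp only [← Finset.sum_add_distrib]
    refine Finset.sum_congr rfl fun j _ => Finset.sum_congr rfl fun i _ => ?_
    rcases lt_trichotomy (f j) i with h | h | h
    · rcases lt_trichotomy (ψ (f j)) (ψ i) with h' | h' | h'
      · simp [h, h', h.not_gt, h'.not_gt]
      · exact absurd (ψ.injective h') h.ne
      · simp [h, h', h.not_gt, h'.not_gt]
    · subst h; simp
    · rcases lt_trichotomy (ψ (f j)) (ψ i) with h' | h' | h'
      · simp [h, h', h.not_gt, h'.not_gt, two_add]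
      · exact absurd (ψ.injective h') h.ne'
      · simp [h, h', h.not_gt, h'.not_gt]
  have b : (∑ j, ∑ j', if j < j' ∧ ψ (f j') < ψ (f j) then (s j : ZMod 2) * s j' else 0) +
      (∑ j, ∑ j', if j < j' then (if f j < f j' ∧ ψ (f j') < ψ (f j) then (s j : ZMod 2) * s j' else 0) +
        (if f j' < f j ∧ ψ (f j) < ψ (f j') then (s j' : ZMod 2) * s j else 0) else 0) =
      ∑ j, ∑ j', if j < j' ∧ f j' < f j then (s j : ZMod 2) * s j' else 0 := by
    simp only [← Finset.sum_add_distrib]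
    refine Finset.sum_congr rfl fun j _ => Finset.sum_congr rfl fun j' _ => ?_
    by_cases hj : j < j'
    · rcases lt_trichotomy (f j) (f j') with h | h | h
      · rcases lt_trichotomy (ψ (f j)) (ψ (f j')) with h' | h' | h'
        · simp [hj, h, h', h.not_gt, h'.not_gt]
        · exact absurd (ψ.injective h') h.ne
        · simp [hj, h, h', h.not_gt, h'.not_gt, two_add]
      · simp [h]
      · rcases lt_trichotomy (ψ (f j)) (ψ (f j')) with h' | h' | h'
        · simp [hj, h, h', h.not_gt, h'.not_gt, mul_comm]
        · exact absurd (ψ.injective h') h.ne'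
        · simp [hj, h, h', h.not_gt, h'.not_gt]
    · simp [hj]
  rw [← a, ← b]
  ring

theorem assocSign_perm {m m' k : ℕ} (s : Fin m → ℤ) (f : Fin m → Fin k) (q : Fin k → ℤ)
    (ψ : Fin m ≃ Fin m') :
    assocSign (fun j => s (ψ.symm j)) (fun j => f (ψ.symm j)) q *
      ∏ i, koszul (fibConj (fibRelabel f ψ i)) (fun l => s (fibEnum f i l)) =
        koszul ψ s * assocSign s f q := by
  have hp : ∀ F : Fin k → ℤ, ∏ i, (F i).negOnePow = (∑ i, F i).negOnePow := by
    intro F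
    induction (Finset.univ : Finset (Fin k)) using Finset.induction_on with
    | empty => simp
    | insert a t ha ih => rw [Finset.prod_insert ha, Finset.sum_insert ha, ih, Int.negOnePow_add]
  simp only [koszul_fibConj, hp]
  simp only [assocSign, koszul, ← Int.negOnePow_add]
  apply negOnePow_congr
  have e : ∑ j', ∑ i, (if f (ψ.symm j') < i then s (ψ.symm j') * q i else 0) =
      ∑ j, ∑ i, if f j < i then s j * q i else 0 := by
    rw [← Equiv.sum_comp ψ]; simp
  have e' : ∑ j, ∑ j', (if j < j' ∧ f (ψ.symm j') < f (ψ.symm j) then s (ψ.symm j) * s (ψ.symm j') else 0) =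
      ∑ j, ∑ j', if ψ j < ψ j' ∧ f j' < f j then s j * s j' else 0 := by
    rw [← Equiv.sum_comp ψ]
    refine Finset.sum_congr rfl fun j _ => ?_
    rw [← Equiv.sum_comp ψ]
    simp
  have e'' : ∑ i, ∑ j : {j // f j = i}, ∑ j' : {j // f j = i},
      (if j < j' ∧ fibRelabel f ψ i j' < fibRelabel f ψ i j then s j * s j' else 0) =
      ∑ j, ∑ j', if f j' = f j then (if j < j' ∧ ψ j' < ψ j then s j * s j' else 0) else 0 := by
    have : ∀ i, ∑ j : {j // f j = i}, ∑ j' : {j // f j = i},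
      (if j < j' ∧ fibRelabel f ψ i j' < fibRelabel f ψ i j then s j * s j' else 0) =
      ∑ j, if f j = i then ∑ j', (if f j' = i then (if j < j' ∧ ψ j' < ψ j then s j * s j' else 0) else 0) else 0 := by
      intro i
      rw [← sum_fib f i (fun j => ∑ j', (if f j' = i then (if j < j' ∧ ψ j' < ψ j then s j * s j' else 0) else 0))]
      refine Finset.sum_congr rfl fun j _ => ?_
      rw [← sum_fib f i (fun j' => if (j : Fin m) < j' ∧ ψ j' < ψ j then s j * s j' else 0)]
      rfl
    simp only [this]
    rw [Finset.sum_comm]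
    refine Finset.sum_congr rfl fun j _ => ?_
    simp
  rw [e, e', e'']
  push_cast
  rw [sum_symm (fun j j' => if ψ j < ψ j' ∧ f j' < f j then (s j : ZMod 2) * s j' else 0) (by simp)]
  have b : (∑ j, ∑ j', if j < j' then (if ψ j < ψ j' ∧ f j' < f j then (s j : ZMod 2) * s j' else 0) +
        (if ψ j' < ψ j ∧ f j < f j' then (s j' : ZMod 2) * s j else 0) else 0) +
      (∑ j, ∑ j', if f j' = f j then (if j < j' ∧ ψ j' < ψ j then (s j : ZMod 2) * s j' else 0) else 0) =
      (∑ j, ∑ j', if j < j' ∧ ψ j' < ψ j then (s j : ZMod 2) * s j' else 0) +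
      ∑ j, ∑ j', if j < j' ∧ f j' < f j then (s j : ZMod 2) * s j' else 0 := by
    simp only [← Finset.sum_add_distrib]
    refine Finset.sum_congr rfl fun j _ => Finset.sum_congr rfl fun j' _ => ?_
    by_cases hj : j < j'
    · rcases lt_trichotomy (f j) (f j') with h | h | h
      · rcases lt_trichotomy (ψ j) (ψ j') with h' | h' | h'
        · simp [hj, h, h', h.not_gt, h'.not_gt]
        · exact absurd (ψ.injective h') hj.ne
        · simp [hj, h, h', h.not_gt, h'.not_gt, h.ne', mul_comm]
      · simp [h, hj]
      · rcases lt_trichotomy (ψ j) (ψ j') with h' | h' | h'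
        · simp [hj, h, h', h.not_gt, h'.not_gt]
        · exact absurd (ψ.injective h') hj.ne
        · simp [hj, h, h', h.not_gt, h'.not_gt, h.ne, two_add]
    · simp [hj]
  linear_combination b

noncomputable def assocInner {V W U : SMod K} {X : Type} [Finite X] {d : ℤ} (S : Shape X d)
    (ρ : ∀ j, U.obj {x // S.f x = j} (S.q j)) :
    compObj V W (Fin S.k) S.p →ₗ[K] compObj V (comp W U) X d :=
  compLift (fun s => assocSign S.q s.f s.q •
    symMap (W' := comp W U) s (fun x => s.f (S.f x)) s.p _ (assocShape S s).hd LinearMap.id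
      (blockMap W U S.f S.q s.f s.q ρ)) (by
    intro s k' ψ μ ν
    rw [LinearMap.smul_apply, LinearMap.smul_apply, symMap_tmul, symMap_tmul, smul_smul,
      ← assocSign_reindex, ← smul_smul]
    congr 1
    refine mk_eq (W := comp W U) (s := assocShape S s) (s' := assocShape S (s.reindex ψ)) ψ (fun _ => rfl) rfl
      (fun j => blockDeg_congr (fibEquiv fun _ => ψ.apply_eq_iff_eq.symm) (fun _ => rfl) (by simp))
      rfl fun j => ?_
    rw [fam ν (ψ.symm_apply_apply j).symm]
    rw [← SMod.tr_rfl, SMod.tr_tr]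
    refine (blockMap_rel (W := W) (U := U) (fibEquiv fun _ => ψ.apply_eq_iff_eq.symm) (fun _ => ψ.apply_eq_iff_eq.symm) (fun _ _ => Iff.rfl)
      (ρ := ρ) (fun _ => rfl) (by simp) (fun _ => ?_) _).trans ?_
    · exact (SMod.tr_id _ _ (fun _ => rfl) _ _).symm
    · rw [koszul_mono, one_smul]
      intro a b hab
      have h := (fibEnum s.f j).lt_iff_lt.2 hab
      rw [← (fibEnum _ _).lt_iff_lt, fibEnum_fibConj, fibEnum_fibConj]
      exact h)

theorem assocInner_mk {V W U : SMod K} {X : Type} [Finite X] {d : ℤ} (S : Shape X d)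
    (ρ : ∀ j, U.obj {x // S.f x = j} (S.q j)) (s : Shape (Fin S.k) S.p)
    (μ : V.obj (Fin s.k) s.p) (ν : ∀ i, W.obj {x // s.f x = i} (s.q i)) :
    assocInner S ρ (cmk s μ ν) = assocSign S.q s.f s.q •
      cmk (V := V) (W := comp W U) (assocShape S s) μ
        (fun i => blockMap W U S.f S.q s.f s.q ρ i (ν i)) := by
  rw [assocInner, compLift_mk, LinearMap.smul_apply, symMap_tmul]
  rfl

noncomputable def mkM {V W : SMod K} {X : Type} [Finite X] {d : ℤ} (s : Shape X d)
    (μ : V.obj (Fin s.k) s.p) :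
    MultilinearMap K (fun i => W.obj {x // s.f x = i} (s.q i)) (compObj V W X d) :=
  (mkL s ∘ₗ TensorProduct.mk K _ _ μ).compMultilinearMap (PiTensorProduct.tprod K)

theorem blockMap_update {W U : SMod K} {X : Type} [Finite X] {m k : ℕ} (g : X → Fin m)
    (s : Fin m → ℤ) (f : Fin m → Fin k) (q : Fin k → ℤ)
    (ρ : ∀ j, U.obj {x // g x = j} (s j)) (j : Fin m) (c : U.obj {x // g x = j} (s j))
    (w : ∀ i, W.obj {j // f j = i} (q i)) :
    (fun i => blockMap W U g s f q (Function.update ρ j c) i (w i)) =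
      Function.update (fun i => blockMap W U g s f q ρ i (w i)) (f j)
        (blockMap W U g s f q (Function.update ρ j c) (f j) (w (f j))) := by
  funext i
  by_cases hi : i = f j
  · subst hi; simp
  · rw [Function.update_of_ne hi, blockMap_apply, blockMap_apply]
    congr 1
    funext l
    rw [Function.update_of_ne]
    intro h
    exact hi (by rw [← h]; exact (fibEnum f i l).2.symm)

theorem blockMap_update_self {W U : SMod K} {X : Type} [Finite X] {m k : ℕ} (g : X → Fin m)
    (s : Fin m → ℤ) (f : Fin m → Fin k) (q : Fin k → ℤ)
    (ρ : ∀ j, U.obj {x // g x = j} (s j)) (i : Fin k) (j : {j // f j = i})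
    (w : W.obj {j // f j = i} (q i)) : ∃ L : U.obj {x // g x = j} (s j) →ₗ[K] (comp W U).obj {x // f (g x) = i}
      (q i + ∑ j : {j // f j = i}, s j), ∀ c, blockMap W U g s f q (Function.update ρ j c) i w = L c := by
  obtain ⟨l, rfl⟩ := (fibEnum f i).surjective j
  refine ⟨(mkM (blockShape g s f q i) (W.map (fibEnum f i).symm.toEquiv (q i) w)).toLinearMap
    (fun l => U.map (blockFib g f i l) _ (ρ (fibEnum f i l))) l ∘ₗ U.map (blockFib g f i l) _, fun c => ?_⟩
  rw [blockMap_apply]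
  change cmk _ _ _ = cmk _ _ _
  congr 1
  funext l'
  by_cases h : l' = l
  · subst h; simp
  · rw [Function.update_of_ne h, Function.update_of_ne]
    exact fun h' => h ((fibEnum f i).injective (Subtype.ext h'))

theorem assocInner_update {V W U : SMod K} {X : Type} [Finite X] {d : ℤ} (S : Shape X d)
    (ρ : ∀ j, U.obj {x // S.f x = j} (S.q j)) (j : Fin S.k) (s : Shape (Fin S.k) S.p)
    (μ : V.obj (Fin s.k) s.p) (ν : ∀ i, W.obj {x // s.f x = i} (s.q i)) :
    ∃ L : U.obj {x // S.f x = j} (S.q j) →ₗ[K] compObj V (comp W U) X d,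
      ∀ c, assocInner S (Function.update ρ j c) (cmk s μ ν) = L c := by
  obtain ⟨L, hL⟩ := blockMap_update_self S.f S.q s.f s.q ρ (s.f j) ⟨j, rfl⟩ (ν (s.f j))
  refine ⟨assocSign S.q s.f s.q • (mkM (V := V) (W := comp W U) (assocShape S s) μ).toLinearMap
    (fun i => blockMap W U S.f S.q s.f s.q ρ i (ν i)) (s.f j) ∘ₗ L, fun c => ?_⟩
  rw [assocInner_mk, blockMap_update, hL]
  rfl

noncomputable def assocM {V W U : SMod K} {X : Type} [Finite X] {d : ℤ} (S : Shape X d) :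
    MultilinearMap K (fun j => U.obj {x // S.f x = j} (S.q j))
      ((comp V W).obj (Fin S.k) S.p →ₗ[K] compObj V (comp W U) X d) where
  toFun ρ := assocInner S ρ
  map_update_add' {inst} ρ j x y := by
    obtain rfl : inst = instDecidableEqFin S.k := Subsingleton.elim _ _
    refine comp_hom_ext fun s μ ν => ?_
    obtain ⟨L, hL⟩ := assocInner_update S ρ j s μ ν
    refine (hL _).trans ?_
    rw [map_add, ← hL, ← hL]
    rfl
  map_update_smul' {inst} ρ j c x := by
    obtain rfl : inst = instDecidableEqFin S.k := Subsingleton.elim _ _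
    refine comp_hom_ext fun s μ ν => ?_
    obtain ⟨L, hL⟩ := assocInner_update S ρ j s μ ν
    refine (hL _).trans ?_
    rw [map_smul, ← hL]
    rfl

theorem mkM_smul {V W : SMod K} {X : Type} [Finite X] {d : ℤ} (s : Shape X d)
    (μ : V.obj (Fin s.k) s.p) (c : Fin s.k → ℤˣ) (ν : ∀ i, W.obj {x // s.f x = i} (s.q i)) :
    cmk s μ (fun i => c i • ν i) = (∏ i, c i) • cmk s μ ν := by
  have h := (mkM (V := V) (W := W) s μ).map_smul_univ (fun i => ((c i : ℤ) : K)) ν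
  have e : ∀ (M : Type u) [AddCommGroup M] [Module K M] (z : ℤˣ) (x : M), z • x = ((z : ℤ) : K) • x := by
    intro M _ _ z x
    rw [Units.smul_def, Int.cast_smul_eq_zsmul]
  simp only [e]
  refine Eq.trans h ?_
  rw [← Int.cast_prod, ← Units.coe_prod]
  rfl

theorem assocInner_reindex {V W U : SMod K} {X : Type} [Finite X] {d : ℤ} (S : Shape X d)
    (ρ : ∀ j, U.obj {x // S.f x = j} (S.q j)) {m' : ℕ} (ψ : Fin S.k ≃ Fin m')
    (lam : compObj V W (Fin S.k) S.p) :
    assocInner (S.reindex ψ)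
      (fun j => U.map (fibEquiv (fun _ => Equiv.eq_symm_apply ψ)) _ (ρ (ψ.symm j)))
      (compObjMap V W ψ S.p lam) = koszul ψ S.q • assocInner S ρ lam := by
  refine LinearMap.congr_fun (f := assocInner (S.reindex ψ)
      (fun j => U.map (fibEquiv (fun _ => Equiv.eq_symm_apply ψ)) _ (ρ (ψ.symm j))) ∘ₗ (compObjMap V W ψ S.p))
    (g := koszul ψ S.q • assocInner S ρ) (comp_hom_ext fun s μ ν => ?_) lam
  rw [LinearMap.comp_apply, LinearMap.smul_apply, compObjMap_mk, assocInner_mk, assocInner_mk, smul_smul,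
    ← assocSign_perm, ← smul_smul]
  congr 1
  refine Eq.trans ?_ (mkM_smul (V := V) (W := comp W U) (assocShape S s) μ _ _)
  refine mk_congr (W := comp W U) (fun _ => by simp) rfl
    (fun i => blockDeg_congr (fibRelabel s.f ψ i) (fun j => by simp [fibRelabel]) rfl)
    (SMod.tr_id V _ (fun _ => rfl) _ _).symm fun i => ?_
  refine (blockMap_rel (W := W) (U := U) (g := S.f) (s := S.q) (f := s.f) (q := s.q) (ρ := ρ)
    (fibRelabel s.f ψ i) (fun x => by simp) (fun j x => by simp [fibRelabel])
    (fun j => by simp [fibRelabel]) rfl (fun j => ?_) (ν i)).trans ?_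
  · change U.map _ _ (ρ (ψ.symm (ψ j))) = _
    rw [fam ρ (ψ.symm_apply_apply j).symm]
    refine (SMod.tr_tr U _ (fibEquiv _) _ rfl _).trans ?_
    exact SMod.tr_congr U _ _ _ (fun _ => rfl) _
  · rw [LinearMap.map_smul_of_tower]

noncomputable def assocApp (V W U : SMod K) (X : Type) [Finite X] (d : ℤ) :
    compObj (comp V W) U X d →ₗ[K] compObj V (comp W U) X d :=
  compLift (fun S => TensorProduct.lift (PiTensorProduct.lift (assocM S)).flip) (by
    intro S m' ψ lam ρ
    rw [TensorProduct.lift.tmul, TensorProduct.lift.tmul, LinearMap.flip_apply, LinearMap.flip_apply,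
      PiTensorProduct.lift.tprod, PiTensorProduct.lift.tprod]
    exact assocInner_reindex S ρ ψ lam)

theorem assocApp_mk {V W U : SMod K} {X : Type} [Finite X] {d : ℤ} (S : Shape X d)
    (lam : (comp V W).obj (Fin S.k) S.p) (ρ : ∀ j, U.obj {x // S.f x = j} (S.q j)) :
    assocApp V W U X d (cmk S lam ρ) = assocInner S ρ lam := by
  rw [assocApp, compLift_mk, TensorProduct.lift.tmul, LinearMap.flip_apply, PiTensorProduct.lift.tprod]
  rfl

/-- The associativity isomorphism `(V ∘ W) ∘ U → V ∘ (W ∘ U)`: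
`((μ; w₁, …, w_k); ρ₁, …, ρ_m) ↦ ± (μ; (w₁; ρ over 1), …, (w_k; ρ over k))`. -/
noncomputable def assoc (V W U : SMod K) :
    DegMap (comp (comp V W) U) (comp V (comp W U)) 0 where
  app X _ d d' h := (comp V (comp W U)).cast X (by omega) ∘ₗ assocApp V W U X d
  natural {X Y} _ _ e d d' h x := by
    obtain rfl : d = d' := by omega
    change assocApp V W U Y d (compObjMap _ _ e d x) = compObjMap _ _ e d (assocApp V W U X d x)
    refine LinearMap.congr_fun (f := assocApp V W U Y d ∘ₗ compObjMap (comp V W) U e d)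
      (g := compObjMap V (comp W U) e d ∘ₗ assocApp V W U X d) (comp_hom_ext fun S lam ρ => ?_) x
    rw [LinearMap.comp_apply, LinearMap.comp_apply, compObjMap_mk, assocApp_mk, assocApp_mk]
    refine LinearMap.congr_fun (f := assocInner (S.relabel e)
      (fun i => U.map (fibRelabel S.f e i) (S.q i) (ρ i)))
      (g := compObjMap V (comp W U) e d ∘ₗ assocInner S ρ) (comp_hom_ext fun s μ ν => ?_) lam
    rw [LinearMap.comp_apply, assocInner_mk, assocInner_mk, LinearMap.map_smul_of_tower, compObjMap_mk]
    congr 1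
    refine mk_congr (W := comp W U) (fun _ => rfl) rfl (fun i => rfl)
      (SMod.tr_id V _ (fun _ => rfl) _ _).symm fun i => ?_
    refine Eq.trans ?_ (SMod.tr_tr (comp W U) (fibRelabel (fun x => s.f (S.f x)) e i) _ rfl _ _).symm
    rw [blockMap_apply, blockMap_apply, comp_tr_mk]
    refine mk_congr (W := U) (fun _ => rfl) rfl (fun i => rfl)
      (SMod.tr_id W _ (fun _ => rfl) _ _).symm fun l => ?_
    simp only [← SMod.tr_rfl, SMod.tr_tr]
    refine Eq.trans ?_ (SMod.tr_tr U _ (fibEquiv _) rfl _ _).symm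
    exact SMod.tr_congr U _ _ _ (fun _ => rfl) _

def unitFib {X : Type} {d : ℤ} (s : Shape X d) (e : {_e : Fin s.k ≃ Unit // s.p = 0}) :
    {x // s.f x = e.1.symm ()} ≃ X :=
  Equiv.subtypeUnivEquiv fun _ => e.1.injective (Subsingleton.elim _ _)

theorem unitDeg {X : Type} {d : ℤ} (s : Shape X d) (e : {_e : Fin s.k ≃ Unit // s.p = 0}) :
    s.q (e.1.symm ()) = d := by
  have h := s.hd
  rw [e.2, zero_add, ← Equiv.sum_comp e.1.symm] at h
  simpa using h

def leftUnitM (V : SMod K) {X : Type} [Finite X] {d : ℤ} (s : Shape X d)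
    (e : {_e : Fin s.k ≃ Unit // s.p = 0}) :
    MultilinearMap K (fun i => V.obj {x // s.f x = i} (s.q i)) (V.obj X d) where
  toFun ν := V.tr (unitFib s e) (unitDeg s e) (ν (e.1.symm ()))
  map_update_add' ν i x y := by
    obtain rfl : i = e.1.symm () := e.1.injective (Subsingleton.elim _ _)
    simp
  map_update_smul' ν i c x := by
    obtain rfl : i = e.1.symm () := e.1.injective (Subsingleton.elim _ _)
    simp

/-- The coordinate of an element of `I`. -/
def unit.ev (K : Type u) [Field K] {X : Type} [Finite X] {d : ℤ} (e : {_e : X ≃ Unit // d = 0}) :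
    (unit K).obj X d →ₗ[K] K :=
  LinearMap.proj (R := K) (φ := fun _ => K) e

noncomputable def leftUnitE (V : SMod K) {X : Type} [Finite X] {d : ℤ} (s : Shape X d)
    (e : {_e : Fin s.k ≃ Unit // s.p = 0}) : s.Tens (unit K) V →ₗ[K] V.obj X d :=
  TensorProduct.lift ((LinearMap.lsmul K (V.obj X d)).compl₁₂ (unit.ev K e)
    (PiTensorProduct.lift (leftUnitM V s e)))

theorem leftUnitE_tmul (V : SMod K) {X : Type} [Finite X] {d : ℤ} (s : Shape X d)
    (e : {_e : Fin s.k ≃ Unit // s.p = 0}) (c : (unit K).obj (Fin s.k) s.p)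
    (ν : ∀ i, V.obj {x // s.f x = i} (s.q i)) :
    leftUnitE V s e (c ⊗ₜ PiTensorProduct.tprod K ν) =
      unit.ev K e c • V.tr (unitFib s e) (unitDeg s e) (ν (e.1.symm ())) := by
  rw [leftUnitE, TensorProduct.lift.tmul, LinearMap.compl₁₂_apply, PiTensorProduct.lift.tprod]
  rfl

noncomputable def leftUnitApp (V : SMod K) (X : Type) [Finite X] (d : ℤ) :
    compObj (unit K) V X d →ₗ[K] V.obj X d :=
  compLift (fun s => ∑ e, leftUnitE V s e) (by
    intro s k' ψ c ν
    rw [LinearMap.sum_apply, LinearMap.sum_apply, Finset.smul_sum]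
    refine (Fintype.sum_equiv ((Equiv.equivCongr ψ (Equiv.refl Unit)).subtypeEquiv fun _ => Iff.rfl) _ _ fun e => ?_).symm
    rw [koszul_mono ψ _ (fun i j h => absurd (e.1.injective (Subsingleton.elim _ _)) h.ne), one_smul,
      leftUnitE_tmul, leftUnitE_tmul]
    congr 1
    · change c e = c _
      congr 1
      exact Subtype.ext (Equiv.ext fun _ => rfl)
    · rw [← SMod.tr_rfl, SMod.tr_tr]
      change _ = V.tr _ _ (ν (ψ.symm (ψ (e.1.symm ()))))
      rw [fam ν (ψ.symm_apply_apply (e.1.symm ())).symm]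
      refine Eq.trans ?_ (SMod.tr_tr V _ _ _ _ _).symm
      exact SMod.tr_congr V _ _ _ (fun _ => rfl) _)

theorem leftUnitApp_mk (V : SMod K) {X : Type} [Finite X] {d : ℤ} (s : Shape X d)
    (c : (unit K).obj (Fin s.k) s.p) (ν : ∀ i, V.obj {x // s.f x = i} (s.q i)) :
    leftUnitApp V X d (cmk s c ν) =
      ∑ e, unit.ev K e c • V.tr (unitFib s e) (unitDeg s e) (ν (e.1.symm ())) := by
  rw [leftUnitApp, compLift_mk, LinearMap.sum_apply]
  exact Finset.sum_congr rfl fun e _ => leftUnitE_tmul V s e c ν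

/-- The isomorphism `I ∘ V → V`, `(c; ν) ↦ c ν`. -/
noncomputable def leftUnit (V : SMod K) : DegMap (comp (unit K) V) V 0 where
  app X _ d d' h := V.cast X (by omega) ∘ₗ leftUnitApp V X d
  natural {X Y} _ _ e d d' h x := by
    obtain rfl : d = d' := by omega
    change leftUnitApp V Y d (compObjMap _ _ e d x) = V.map e d (leftUnitApp V X d x)
    refine LinearMap.congr_fun (f := leftUnitApp V Y d ∘ₗ compObjMap (unit K) V e d)
      (g := V.map e d ∘ₗ leftUnitApp V X d) (comp_hom_ext fun s c ν => ?_) x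
    rw [LinearMap.comp_apply, LinearMap.comp_apply, compObjMap_mk, leftUnitApp_mk, leftUnitApp_mk, map_sum]
    refine Finset.sum_congr rfl fun e' _ => ?_
    refine Eq.trans ?_ (LinearMap.map_smul (V.map e d) _ _).symm
    congr 1
    simp only [← SMod.tr_rfl, SMod.tr_tr]
    exact SMod.tr_congr V _ _ _ (fun _ => rfl) _

noncomputable def bijFib {X I : Type} {f : X → I} (h : Function.Bijective f) (i : I) :
    {x // f x = i} ≃ Unit where
  toFun _ := ()
  invFun _ := ⟨(Equiv.ofBijective f h).symm i, Equiv.ofBijective_apply_symm_apply f h i⟩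
  left_inv x := Subsingleton.elim (h := ⟨fun a b => Subtype.ext (h.1 (a.2.trans b.2.symm))⟩) _ _
  right_inv _ := rfl

theorem unit.ev_tr {X Y : Type} [Finite X] [Finite Y] (e : X ≃ Y) {d d' : ℤ} (h : d = d')
    (a : {_e : X ≃ Unit // d = 0}) (a' : {_e : Y ≃ Unit // d' = 0}) (c : (unit K).obj X d) :
    unit.ev K a' ((unit K).tr e h c) = unit.ev K a c := by
  subst h
  exact congrArg c (Subtype.ext (Equiv.ext fun _ => rfl))

theorem ofBij_symm {X I : Type} {f : X → I} (h : Function.Bijective f) (x : X) :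
    (Equiv.ofBijective f h).symm (f x) = x :=
  (Equiv.symm_apply_eq _).2 rfl

theorem bijDeg {X : Type} {d : ℤ} {s : Shape X d} (h : ∀ i, s.q i = 0) : s.p = d := by
  have := s.hd
  simpa [h] using this

noncomputable def rightUnitE (V : SMod K) {X : Type} [Finite X] {d : ℤ} (s : Shape X d)
    (h : Function.Bijective s.f) (h' : ∀ i, s.q i = 0) : s.Tens V (unit K) →ₗ[K] V.obj X d :=
  TensorProduct.lift (((LinearMap.lsmul K (V.obj X d)).compl₁₂
    (PiTensorProduct.lift ((MultilinearMap.mkPiAlgebra K (Fin s.k) K).compLinearMap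
      fun i => unit.ev K ⟨bijFib h i, h' i⟩))
    (V.tr (Equiv.ofBijective s.f h).symm (bijDeg h'))).flip)

theorem rightUnitE_tmul (V : SMod K) {X : Type} [Finite X] {d : ℤ} (s : Shape X d)
    (h : Function.Bijective s.f) (h' : ∀ i, s.q i = 0) (μ : V.obj (Fin s.k) s.p)
    (c : ∀ i, (unit K).obj {x // s.f x = i} (s.q i)) :
    rightUnitE V s h h' (μ ⊗ₜ PiTensorProduct.tprod K c) =
      (∏ i, unit.ev K ⟨bijFib h i, h' i⟩ (c i)) •
        V.tr (Equiv.ofBijective s.f h).symm (bijDeg h') μ := by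
  rw [rightUnitE, TensorProduct.lift.tmul, LinearMap.flip_apply, LinearMap.compl₁₂_apply,
    PiTensorProduct.lift.tprod]
  rfl

theorem koszul_zero {k k' : ℕ} (ψ : Fin k ≃ Fin k') (q : Fin k → ℤ) (h : ∀ i, q i = 0) :
    koszul ψ q = 1 := by
  simp [koszul, h]

open Classical in
noncomputable def rightUnitApp (V : SMod K) (X : Type) [Finite X] (d : ℤ) :
    compObj V (unit K) X d →ₗ[K] V.obj X d :=
  compLift (fun s => if h : Function.Bijective s.f ∧ ∀ i, s.q i = 0 then
      rightUnitE V s h.1 h.2 else 0) (by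
    intro s k' ψ μ c
    by_cases h : Function.Bijective s.f ∧ ∀ i, s.q i = 0
    · have h1 : Function.Bijective (s.reindex ψ).f ∧ ∀ i, (s.reindex ψ).q i = 0 :=
        ⟨ψ.bijective.comp h.1, fun i => h.2 _⟩
      rw [dif_pos h, dif_pos h1, koszul_zero ψ _ h.2, one_smul, rightUnitE_tmul, rightUnitE_tmul]
      congr 1
      · refine (Fintype.prod_equiv ψ _ _ fun i => ?_).symm
        rw [fam c (ψ.symm_apply_apply i).symm, ← SMod.tr_rfl, SMod.tr_tr]
        exact (unit.ev_tr _ _ _ _ _).symm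
      · rw [← SMod.tr_rfl, SMod.tr_tr]
        refine SMod.tr_congr V _ _ _ (fun i => ?_) _
        obtain ⟨x, rfl⟩ := h.1.2 i
        exact (ofBij_symm h1.1 x).trans (ofBij_symm h.1 x).symm
    · have h1 : ¬ (Function.Bijective (s.reindex ψ).f ∧ ∀ i, (s.reindex ψ).q i = 0) := by
        rintro ⟨h1, h2⟩
        refine h ⟨?_, fun i => ?_⟩
        · exact (Function.Bijective.of_comp_iff' ψ.bijective s.f).1 h1
        · simpa using h2 (ψ i)
      rw [dif_neg h, dif_neg h1]
      simp)

open Classical in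
theorem rightUnitApp_mk (V : SMod K) {X : Type} [Finite X] {d : ℤ} (s : Shape X d)
    (μ : V.obj (Fin s.k) s.p) (c : ∀ i, (unit K).obj {x // s.f x = i} (s.q i)) :
    rightUnitApp V X d (cmk s μ c) = if h : Function.Bijective s.f ∧ ∀ i, s.q i = 0 then
      (∏ i, unit.ev K ⟨bijFib h.1 i, h.2 i⟩ (c i)) •
        V.tr (Equiv.ofBijective s.f h.1).symm (bijDeg h.2) μ else 0 := by
  rw [rightUnitApp, compLift_mk]
  by_cases h : Function.Bijective s.f ∧ ∀ i, s.q i = 0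
  · rw [dif_pos h, dif_pos h, rightUnitE_tmul]
  · rw [dif_neg h, dif_neg h]
    rfl

/-- The isomorphism `V ∘ I → V`, `(μ; c₁, …, c_k) ↦ c₁ ⋯ c_k μ`. -/
noncomputable def rightUnit (V : SMod K) : DegMap (comp V (unit K)) V 0 where
  app X _ d d' h := V.cast X (by omega) ∘ₗ rightUnitApp V X d
  natural {X Y} _ _ e d d' h x := by
    obtain rfl : d = d' := by omega
    change rightUnitApp V Y d (compObjMap _ _ e d x) = V.map e d (rightUnitApp V X d x)
    refine LinearMap.congr_fun (f := rightUnitApp V Y d ∘ₗ compObjMap V (unit K) e d)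
      (g := V.map e d ∘ₗ rightUnitApp V X d) (comp_hom_ext fun s μ c => ?_) x
    rw [LinearMap.comp_apply, LinearMap.comp_apply, compObjMap_mk, rightUnitApp_mk, rightUnitApp_mk]
    by_cases h : Function.Bijective s.f ∧ ∀ i, s.q i = 0
    · have h1 : Function.Bijective (s.relabel e).f ∧ ∀ i, (s.relabel e).q i = 0 :=
        ⟨h.1.comp e.symm.bijective, h.2⟩
      rw [dif_pos h, dif_pos h1, map_smul]
      congr 1
      · exact Finset.prod_congr rfl fun i _ => unit.ev_tr _ rfl _ _ _
      · rw [← SMod.tr_rfl, SMod.tr_tr]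
        refine SMod.tr_congr V _ _ _ (fun i => ?_) _
        obtain ⟨x, rfl⟩ := h.1.2 i
        change _ = e ((Equiv.ofBijective s.f h.1).symm (s.f x))
        rw [ofBij_symm h.1 x, Equiv.symm_apply_eq]
        exact congrArg s.f (e.symm_apply_apply x).symm
    · have h1 : ¬ (Function.Bijective (s.relabel e).f ∧ ∀ i, (s.relabel e).q i = 0) := by
        rintro ⟨h1, h2⟩
        exact h ⟨(Function.Bijective.of_comp_iff _ e.symm.bijective).1 h1, h2⟩
      rw [dif_neg h, dif_neg h1, map_zero]

@[ext] theorem DegMap.ext {V W : SMod K} {k : ℤ} {f g : DegMap V W k}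
    (h : ∀ (X : Type) [Finite X] (d d' : ℤ) (hd : d + k = d') (x : V.obj X d),
      f.app X d d' hd x = g.app X d d' hd x) : f = g := by
  cases f
  cases g
  congr 1
  funext X _ d d' hd
  exact LinearMap.ext (h X d d' hd)

def DegMap.id (V : SMod K) : DegMap V V 0 where
  app X _ _ _ h := V.cast X (by omega)
  natural e d d' h x := by
    obtain rfl : d = d' := by omega
    rfl

/-- Composition; the degrees add. -/
def DegMap.comp {U V W : SMod K} {a b c : ℤ} (g : DegMap V W b) (f : DegMap U V a)
    (h : a + b = c := by norm_num) : DegMap U W c where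
  app X _ d d' hd := g.app X (d + a) d' (by omega) ∘ₗ f.app X d (d + a) rfl
  natural e d d' hd x := by
    rw [LinearMap.comp_apply, LinearMap.comp_apply, f.natural, g.natural]

def DegMap.recast {V W : SMod K} {a b : ℤ} (f : DegMap V W a) (h : a = b := by norm_num) :
    DegMap V W b where
  app X _ d d' hd := f.app X d d' (by omega)
  natural e d d' _ x := f.natural e d d' _ x

instance (V W : SMod K) (k : ℤ) : Zero (DegMap V W k) :=
  ⟨{ app := fun _ _ _ _ _ => 0, natural := fun e _ d' _ _ => (map_zero (W.map e d')).symm }⟩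

instance (V W : SMod K) (k : ℤ) : Add (DegMap V W k) :=
  ⟨fun f g =>
    { app := fun X _ d d' h => f.app X d d' h + g.app X d d' h
      natural := fun e d d' h x => by
        rw [LinearMap.add_apply, LinearMap.add_apply, f.natural, g.natural, map_add] }⟩

instance (V W : SMod K) (k : ℤ) : Neg (DegMap V W k) :=
  ⟨fun f =>
    { app := fun X _ d d' h => -f.app X d d' h
      natural := fun e d d' h x => by
        rw [LinearMap.neg_apply, LinearMap.neg_apply, f.natural, map_neg] }⟩

instance (V W : SMod K) (k : ℤ) : Sub (DegMap V W k) :=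
  ⟨fun f g => f + -g⟩

theorem DegMap.comp_app {U V W : SMod K} {a b c : ℤ} (g : DegMap V W b) (f : DegMap U V a)
    (h : a + b = c) {X : Type} [Finite X] {d d' d'' : ℤ} (h₁ : d + a = d') (h₂ : d' + b = d'')
    (h₃ : d + c = d'') (x : U.obj X d) :
    (g.comp f h).app X d d'' h₃ x = g.app X d' d'' h₂ (f.app X d d' h₁ x) := by
  subst h₁
  rfl

theorem DegMap.comp_assoc {U V W Z : SMod K} {a b c ab bc abc : ℤ} (h : DegMap W Z c)
    (g : DegMap V W b) (f : DegMap U V a) (e₁ : a + b = ab) (e₂ : b + c = bc)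
    (e₃ : a + bc = abc) (e₄ : ab + c = abc) :
    (h.comp g e₂).comp f e₃ = h.comp (g.comp f e₁) e₄ := by
  ext X _ d d' hd x
  rw [comp_app (h.comp g e₂) f e₃ rfl (by omega), comp_app (d' := d + a + b) h g e₂ rfl (by omega),
    comp_app (d' := d + a + b) h (g.comp f e₁) e₄ (by omega) (by omega),
    comp_app (d' := d + a) g f e₁ rfl rfl]

theorem DegMap.id_app (V : SMod K) {X : Type} [Finite X] {d : ℤ} (x : V.obj X d) :
    (DegMap.id V).app X d d (add_zero d) x = x := rfl

theorem DegMap.id_comp {U V : SMod K} {a : ℤ} (f : DegMap U V a) (h : a + 0 = a) :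
    (DegMap.id V).comp f h = f := by
  ext X _ d d' hd x
  rw [comp_app _ f h hd (add_zero _)]
  rfl

theorem DegMap.comp_id {U V : SMod K} {a : ℤ} (f : DegMap U V a) (h : 0 + a = a) :
    f.comp (DegMap.id U) h = f := by
  ext X _ d d' hd x
  rw [comp_app f _ h (add_zero _) hd]
  rfl

theorem compMap_id (V W : SMod K) :
    compMap (DegMap.id V) (DegMap.id W) = DegMap.id (comp V W) := by
  ext X _ d d' h x
  obtain rfl : d = d' := by omega
  refine LinearMap.congr_fun (f := compMapApp (DegMap.id V) (DegMap.id W) X d d h)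
    (g := LinearMap.id) (comp_hom_ext fun s μ ν => ?_) x
  rw [compMapApp_mk]
  refine mk_congr (fun _ => rfl) (add_zero _).symm (fun _ => rfl) ?_ fun i => ?_
  · change V.cast _ _ _ = V.cast _ _ (V.map _ _ μ)
    rw [V.map_refl]
  · exact (SMod.tr_id W _ (fun _ => rfl) _ _).symm

theorem compMap_comp {U U' V V' W W' : SMod K} (f' : DegMap V W 0) (f : DegMap U V 0)
    (g' : DegMap V' W' 0) (g : DegMap U' V' 0) :
    (compMap f' g').comp (compMap f g) (add_zero 0) =
      compMap (f'.comp f (add_zero 0)) (g'.comp g (add_zero 0)) := by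
  ext X _ d d' h x
  obtain rfl : d = d' := by omega
  rw [DegMap.comp_app (compMap f' g') (compMap f g) _ h h]
  refine LinearMap.congr_fun (f := compMapApp f' g' X d d h ∘ₗ compMapApp f g X d d h)
    (g := compMapApp _ _ X d d h) (comp_hom_ext fun s μ ν => ?_) x
  rw [LinearMap.comp_apply, compMapApp_mk, compMapApp_mk, compMapApp_mk]
  refine mk_congr (fun _ => rfl) (add_zero _).symm (fun _ => rfl) ?_ fun i => ?_
  · dsimp only
    rw [DegMap.comp_app f' f _ rfl (add_zero _)]
    have h2 := f'.app_tr (Equiv.refl (Fin s.k)) (rfl : s.p + 0 = s.p + 0) (add_zero _) rfl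
      (f.app (Fin s.k) s.p (s.p + 0) rfl μ)
    rw [SMod.tr_id _ _ (fun _ => rfl)] at h2
    exact h2
  · dsimp only
    rw [DegMap.comp_app g' g _ (add_zero _) (add_zero _)]
    exact (SMod.tr_id W' _ (fun _ => rfl) _ _).symm

/-- The map `d ∘ Id + Id ∘ (Id; d)` induced on `V ∘ V` by a homogeneous map `d`. -/
noncomputable def compDer {V : SMod K} {k : ℤ} (d : DegMap V V k) :
    DegMap (comp V V) (comp V V) k :=
  compMap d (DegMap.id V) + (compInf (DegMap.id V) (DegMap.id V) d).recast (zero_add k)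

/-- A graded (symmetric) operad: a monoid for the composite product. -/
structure GradedOperad (K : Type u) [Field K] where
  S : SMod K
  γ : DegMap (comp S S) S 0
  η : DegMap (unit K) S 0
  γ_assoc : γ.comp (c := 0) (compMap γ (DegMap.id S)) =
    γ.comp ((compMap (DegMap.id S) γ).comp (c := 0) (assoc S S S))
  unit_left : γ.comp (compMap η (DegMap.id S)) = leftUnit S
  unit_right : γ.comp (compMap (DegMap.id S) η) = rightUnit S

/-- Morphisms of graded operads. -/
structure GradedOperad.Hom (P Q : GradedOperad K) where
  f : DegMap P.S Q.S 0
  map_γ : f.comp (c := 0) P.γ = Q.γ.comp (compMap f f)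
  map_η : f.comp P.η = Q.η

/-- A dg operad: a graded operad with a derivation of degree `-1` and square zero. -/
structure DGOperad (K : Type u) [Field K] extends GradedOperad K where
  d : DegMap S S (-1)
  d_sq : d.comp d = (0 : DegMap S S (-2))
  d_γ : d.comp (c := -1) γ = γ.comp (compDer d)
  d_η : d.comp η = (0 : DegMap (unit K) S (-1))

/-- Morphisms of dg operads. -/
@[ext] structure DGOperad.Hom (P Q : DGOperad K) extends
    GradedOperad.Hom P.toGradedOperad Q.toGradedOperad where
  map_d : f.comp (c := -1) P.d = Q.d.comp f

instance : Category (DGOperad K) where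
  Hom := DGOperad.Hom
  id P :=
    { f := DegMap.id P.S
      map_γ := by rw [compMap_id, DegMap.comp_id, DegMap.id_comp]
      map_η := DegMap.id_comp _ _
      map_d := by rw [DegMap.comp_id, DegMap.id_comp] }
  comp {P Q R} F G :=
    { f := G.f.comp F.f
      map_γ := by
        rw [DegMap.comp_assoc (ab := 0) (e₄ := rfl) (e₁ := rfl), F.map_γ, ← DegMap.comp_assoc (bc := 0) (e₂ := rfl) (e₃ := rfl), G.map_γ,
          DegMap.comp_assoc (ab := 0) (e₄ := rfl) (e₁ := rfl), compMap_comp]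
      map_η := by
        rw [DegMap.comp_assoc (ab := 0) (e₄ := rfl) (e₁ := rfl), F.map_η, G.map_η]
      map_d := by
        rw [DegMap.comp_assoc (ab := -1) (e₄ := rfl) (e₁ := rfl), F.map_d, ← DegMap.comp_assoc (bc := -1) (e₂ := rfl) (e₃ := rfl), G.map_d,
          DegMap.comp_assoc (ab := 0) (e₄ := rfl) (e₁ := rfl)] }
  id_comp F := DGOperad.Hom.ext (DegMap.comp_id F.f rfl)
  comp_id F := DGOperad.Hom.ext (DegMap.id_comp F.f rfl)
  assoc F G H := DGOperad.Hom.ext (DegMap.comp_assoc H.f G.f F.f rfl rfl rfl rfl).symm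

/-- A coaugmented graded cooperad: a comonoid for the composite product, with a morphism of cooperads
`η` from `I`. In `Δ_η` the decomposition of `I` is the inverse of the isomorphism
`I ∘ I → I`, moved to the other side. -/
structure GradedCooperad (K : Type u) [Field K] where
  S : SMod K
  Δ : DegMap S (comp S S) 0
  ε : DegMap S (unit K) 0
  η : DegMap (unit K) S 0
  Δ_coassoc : (assoc S S S).comp ((compMap Δ (DegMap.id S)).comp (c := 0) Δ) =
    (compMap (DegMap.id S) Δ).comp (c := 0) Δ
  counit_left : (leftUnit S).comp ((compMap ε (DegMap.id S)).comp (c := 0) Δ) = DegMap.id S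
  counit_right : (rightUnit S).comp ((compMap (DegMap.id S) ε).comp (c := 0) Δ) = DegMap.id S
  ε_η : ε.comp η = DegMap.id (unit K)
  Δ_η : Δ.comp (c := 0) (η.comp (c := 0) (leftUnit (unit K))) = compMap η η

/-- Morphisms of coaugmented graded cooperads. -/
structure GradedCooperad.Hom (C D : GradedCooperad K) where
  f : DegMap C.S D.S 0
  map_Δ : D.Δ.comp (c := 0) f = (compMap f f).comp C.Δ
  map_ε : D.ε.comp f = C.ε
  map_η : f.comp C.η = D.η

namespace GradedCooperad

variable (C : GradedCooperad K)

/-- The projection `x ↦ x - ε(x) 1` onto the coaugmentation coideal. -/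
noncomputable def proj : DegMap C.S C.S 0 := DegMap.id C.S - C.η.comp C.ε

/-- The infinitesimal decomposition `Δ₂(x) = ∑ x₁ ⊗ x₂`: the part `(x₁; 1, …, 1, x₂, 1, …, 1)` of
`Δ(x)` lying on trees with exactly two vertices, with `x₁` and `x₂` in the coaugmentation coideal. -/
noncomputable def Δ₂ : DegMap C.S (comp C.S C.S) 0 :=
  (compInf C.proj (C.η.comp (c := 0) C.ε) C.proj).comp C.Δ

/-- The coradical filtration: level `0` is the span of `1`, and `x` is of level `n + 1` if the part of
`Δ(x)` with nontrivial lower vertex is a sum of terms with all upper vertices of level `n`. -/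
noncomputable def level : ℕ → ∀ (X : Type) [Finite X] (d : ℤ), Submodule K (C.S.obj X d)
  | 0, X, _, d => LinearMap.range (C.η.app X d d (add_zero d))
  | n + 1, X, _, d =>
    (Submodule.span K {z : compObj C.S C.S X d | ∃ (s : Shape X d) (μ : C.S.obj (Fin s.k) s.p)
      (ν : ∀ i, C.S.obj {x // s.f x = i} (s.q i)),
      (∀ i, ν i ∈ level n {x // s.f x = i} (s.q i)) ∧ z = cmk s μ ν}).comap
    (((compMap C.proj (DegMap.id C.S)).comp (c := 0) C.Δ).app X d d (add_zero d))

/-- A coaugmented cooperad is conilpotent if its coradical filtration is exhaustive. -/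
def IsConilpotent : Prop :=
  ∀ (X : Type) [Finite X] (d : ℤ) (x : C.S.obj X d), ∃ n, x ∈ C.level n X d

/-- The coaugmentation coideal, that is the kernel of the counit. -/
noncomputable def coideal : SMod K where
  obj X _ d := LinearMap.ker (C.ε.app X d d (add_zero d))
  map {X Y} _ _ e d := (C.S.map e d).restrict fun x hx => by
    rw [LinearMap.mem_ker] at hx ⊢
    rw [C.ε.natural, hx, map_zero]
  map_refl X _ d x := Subtype.ext (C.S.map_refl X d x)
  map_trans e e' d x := Subtype.ext (C.S.map_trans e e' d x)

theorem ε_proj_app {X : Type} [Finite X] {d d' : ℤ} (h : d + 0 = d') (x : C.S.obj X d) :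
    C.ε.app X d' d' (add_zero d') (C.proj.app X d d' h x) = 0 := by
  obtain rfl : d = d' := by omega
  have h1 : (C.ε.comp C.η).app X d d h (C.ε.app X d d h x) =
      (DegMap.id (unit K)).app X d d h (C.ε.app X d d h x) := by rw [C.ε_η]
  rw [DegMap.comp_app _ _ _ h h] at h1
  change C.ε.app X d d h (x + -(C.η.comp C.ε).app X d d h x) = 0
  rw [← sub_eq_add_neg, map_sub, DegMap.comp_app _ _ _ h h, h1]
  exact sub_self _

/-- The projection `x ↦ x - ε(x) 1`, as a map to the coaugmentation coideal. -/
noncomputable def projCoideal : DegMap C.S C.coideal 0 where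
  app X _ d d' h := (C.proj.app X d d' h).codRestrict _ (C.ε_proj_app h)
  natural e d d' h x := Subtype.ext (C.proj.natural e d d' h x)

end GradedCooperad

/-- A curved conilpotent cooperad: a conilpotent graded cooperad with a coderivation `d` of degree
`-1` killing `1` and a curvature `θ` of degree `-2` such that
`d² = (θ ⊗ Id - Id ⊗ θ) Δ₂` and `θ d = 0`. -/
structure CurvedCooperad (K : Type u) [Field K] extends GradedCooperad K where
  conilpotent : toGradedCooperad.IsConilpotent
  d : DegMap S S (-1)
  θ : DegMap S (unit K) (-2)
  d_Δ : Δ.comp (c := -1) d = (compDer d).comp Δ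
  d_η : d.comp η = (0 : DegMap (unit K) S (-1))
  d_sq : d.comp (c := -2) d =
    (leftUnit S).comp ((compMap θ (DegMap.id S)).comp (c := -2) toGradedCooperad.Δ₂) -
    (rightUnit S).comp ((compInf (DegMap.id S) ε θ).comp (c := -2) toGradedCooperad.Δ₂)
  θ_d : θ.comp d = (0 : DegMap S (unit K) (-3))

/-- Morphisms of curved conilpotent cooperads: they commute with `d` and `θ`. -/
@[ext] structure CurvedCooperad.Hom (C D : CurvedCooperad K) extends
    GradedCooperad.Hom C.toGradedCooperad D.toGradedCooperad where
  map_d : D.d.comp (c := -1) f = f.comp C.d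
  map_θ : D.θ.comp f = C.θ

instance : Category (CurvedCooperad K) where
  Hom := CurvedCooperad.Hom
  id C :=
    { f := DegMap.id C.S
      map_Δ := by rw [compMap_id, DegMap.comp_id, DegMap.id_comp]
      map_ε := DegMap.comp_id _ _
      map_η := DegMap.id_comp _ _
      map_d := by rw [DegMap.comp_id, DegMap.id_comp]
      map_θ := DegMap.comp_id _ _ }
  comp {C D E} F G :=
    { f := G.f.comp F.f
      map_Δ := by
        rw [← DegMap.comp_assoc (bc := 0) (e₂ := rfl) (e₃ := rfl), G.map_Δ,
          DegMap.comp_assoc (ab := 0) (e₄ := rfl) (e₁ := rfl), F.map_Δ,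
          ← DegMap.comp_assoc (bc := 0) (e₂ := rfl) (e₃ := rfl), compMap_comp]
      map_ε := by
        rw [← DegMap.comp_assoc (bc := 0) (e₂ := rfl) (e₃ := rfl), G.map_ε, F.map_ε]
      map_η := by
        rw [DegMap.comp_assoc (ab := 0) (e₄ := rfl) (e₁ := rfl), F.map_η, G.map_η]
      map_d := by
        rw [← DegMap.comp_assoc (bc := -1) (e₂ := rfl) (e₃ := rfl), G.map_d,
          DegMap.comp_assoc (ab := -1) (e₄ := rfl) (e₁ := rfl), F.map_d,
          ← DegMap.comp_assoc (bc := 0) (e₂ := rfl) (e₃ := rfl)]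
      map_θ := by
        rw [← DegMap.comp_assoc (bc := -2) (e₂ := rfl) (e₃ := rfl), G.map_θ, F.map_θ] }
  id_comp F := CurvedCooperad.Hom.ext (DegMap.comp_id F.f rfl)
  comp_id F := CurvedCooperad.Hom.ext (DegMap.id_comp F.f rfl)
  assoc F G H := CurvedCooperad.Hom.ext (DegMap.comp_assoc H.f G.f F.f rfl rfl rfl rfl).symm

/-- The shift `sⁿ V`, with `(sⁿ V)_d = V_{d - n}`. -/
def shift (V : SMod K) (n : ℤ) : SMod K where
  obj X _ d := V.obj X (d - n)
  map e d := V.map e (d - n)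
  map_refl X _ d x := V.map_refl X (d - n) x
  map_trans e e' d x := V.map_trans e e' (d - n) x

/-- The map `sⁿ : V → sⁿ V` of degree `n`. -/
def susp (V : SMod K) (n : ℤ) : DegMap V (shift V n) n where
  app X _ d d' h := V.cast X (show d = d' - n by omega)
  natural e d d' h x := by
    obtain rfl : d = d' - n := by omega
    rfl

/-- The inverse map `sⁿ V → V` of degree `-n`. -/
def desusp (V : SMod K) (n : ℤ) (m : ℤ) (hm : n + m = 0 := by norm_num) :
    DegMap (shift V n) V m where
  app X _ d d' h := V.cast X (show d - n = d' by omega)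
  natural e d d' h x := by
    obtain rfl : d' = d - n := by omega
    rfl

/-- The direct sum of graded `S`-modules. -/
def sum (V W : SMod K) : SMod K where
  obj X _ d := V.obj X d × W.obj X d
  map e d := (V.map e d).prodMap (W.map e d)
  map_refl X _ d x := Prod.ext (V.map_refl X d x.1) (W.map_refl X d x.2)
  map_trans e e' d x := Prod.ext (V.map_trans e e' d x.1) (W.map_trans e e' d x.2)

def sumFst (V W : SMod K) : DegMap (sum V W) V 0 where
  app X _ _ _ h := V.cast X (by omega) ∘ₗ LinearMap.fst K _ _
  natural e d d' h x := by
    obtain rfl : d = d' := by omega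
    rfl

def sumSnd (V W : SMod K) : DegMap (sum V W) W 0 where
  app X _ _ _ h := W.cast X (by omega) ∘ₗ LinearMap.snd K _ _
  natural e d d' h x := by
    obtain rfl : d = d' := by omega
    rfl

/-- `O` is the free graded operad `T(V)` on `V`, with inclusion of generators `ι`. -/
def IsFreeOperad {V : SMod K} (O : GradedOperad K) (ι : DegMap V O.S 0) : Prop :=
  ∀ (Q : GradedOperad K) (g : DegMap V Q.S 0), ∃! F : GradedOperad.Hom O Q, F.f.comp ι = g

/-- `B` is the cofree conilpotent graded cooperad `T^c(V)` on `V`, with projection `π`. -/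
def IsCofreeCooperad {V : SMod K} (B : GradedCooperad K) (π : DegMap B.S V 0) : Prop :=
  B.IsConilpotent ∧ π.comp B.η = (0 : DegMap (unit K) V 0) ∧
  ∀ C : GradedCooperad K, C.IsConilpotent → ∀ g : DegMap C.S V 0,
    g.comp C.η = (0 : DegMap (unit K) V 0) → ∃! F : GradedCooperad.Hom C B, π.comp F.f = g

/-- The convolution square `γ (α ⊗ α) Δ₂`: on `(x₁; 1, …, x₂, …, 1)` it is
`± γ(α x₁; 1, …, α x₂, …, 1)`. -/
noncomputable def star (C : GradedCooperad K) (P : GradedOperad K) (α : DegMap C.S P.S (-1)) :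
    DegMap C.S P.S (-2) :=
  P.γ.comp ((compInf α (P.η.comp (c := 0) C.ε) α).comp (c := -2) C.Δ₂)

/-- Twisting morphisms from a curved conilpotent cooperad to a dg operad: maps of degree `-1` on the
coaugmentation coideal (written as maps that kill `1`) with
`∂α + γ (α ⊗ α) Δ₂ = Θ`, where `∂α = d α + α d` and `Θ(x) = θ(x) 1`. -/
@[ext] structure Tw (C : CurvedCooperad K) (P : DGOperad K) where
  α : DegMap C.S P.S (-1)
  α_η : α.comp C.η = (0 : DegMap (unit K) P.S (-1))
  eqn : P.d.comp α + α.comp C.d + star C.toGradedCooperad P.toGradedOperad α =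
    P.η.comp (c := -2) C.θ

/-- The map `C → O`, `x ↦ ι(s⁻¹ x)`, of degree `-1`, defined to vanish on `1`. -/
noncomputable def cobarGen {C : CurvedCooperad K} {O : DGOperad K}
    (ι : DegMap (shift C.coideal (-1)) O.S 0) : DegMap C.S O.S (-1) :=
  ι.comp ((susp C.coideal (-1)).comp (c := -1) C.projCoideal)

/-- `O` is the cobar construction of `C`: the free operad on `s⁻¹` of the coaugmentation coideal, with
`D(s⁻¹ x) = θ(x) 1 - s⁻¹ d x - ∑ (-1)^{|x₁|} s⁻¹ x₁ ⊗ s⁻¹ x₂`. -/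
structure IsCobar (C : CurvedCooperad K) (O : DGOperad K)
    (ι : DegMap (shift C.coideal (-1)) O.S 0) : Prop where
  free : IsFreeOperad O.toGradedOperad ι
  d_gen : O.d.comp (c := -2) (cobarGen ι) =
    O.η.comp C.θ - (cobarGen ι).comp C.d -
      star C.toGradedCooperad O.toGradedOperad (cobarGen ι)

/-- The cogenerators `s P ⊕ K v` of the bar construction, with `v` of arity one and degree two. -/
abbrev barCogen (P : DGOperad K) : SMod K := sum (shift P.S 1) (shift (unit K) 2)

/-- The `s P` component of the projection of the bar construction, followed by `s⁻¹`. -/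
noncomputable def barPr {P : DGOperad K} {B : CurvedCooperad K} (π : DegMap B.S (barCogen P) 0) :
    DegMap B.S P.S (-1) :=
  (desusp P.S 1 (-1)).comp ((sumFst _ _).comp (c := 0) π)

/-- The coefficient of `v` in the projection of the bar construction. -/
noncomputable def barV {P : DGOperad K} {B : CurvedCooperad K} (π : DegMap B.S (barCogen P) 0) :
    DegMap B.S (unit K) (-2) :=
  (desusp (unit K) 2 (-2)).comp ((sumSnd _ _).comp (c := 0) π)

/-- `B` is the curved bar construction of `P`: the cofree conilpotent cooperad on `s P ⊕ K v`, with
curvature the coefficient of `v`, and whose coderivation, projected to the cogenerators, is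
`s x ↦ - s d x`, `s x ⊗ s y ↦ (-1)^{|x|} s γ(x ⊗ y) = - s γ (s⁻¹ ⊗ s⁻¹)(s x ⊗ s y)`, `v ↦ s 1`,
and zero on all other trees. -/
structure IsBar (P : DGOperad K) (B : CurvedCooperad K) (π : DegMap B.S (barCogen P) 0) :
    Prop where
  cofree : IsCofreeCooperad B.toGradedCooperad π
  fst_d : (sumFst _ _).comp (c := -1) (π.comp (c := -1) B.d) = (susp P.S 1).comp
    (P.η.comp (c := -2) (barV π) - P.d.comp (barPr π) -
      star B.toGradedCooperad P.toGradedOperad (barPr π))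
  snd_d : (sumSnd _ _).comp (c := -1) (π.comp (c := -1) B.d) =
    (0 : DegMap B.S (shift (unit K) 2) (-1))
  θ_eq : B.θ = barV π

/-- The cobar construction as a functor on curved conilpotent cooperads: on a morphism `g` it is the
morphism of operads with `s⁻¹ x ↦ s⁻¹ g(x)`. -/
structure CobarConstruction (K : Type u) [Field K] where
  F : CurvedCooperad K ⥤ DGOperad K
  ι : ∀ C, DegMap (shift C.coideal (-1)) (F.obj C).S 0
  isCobar : ∀ C, IsCobar C (F.obj C) (ι C)
  map_gen : ∀ {C C' : CurvedCooperad K} (g : C ⟶ C'),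
    (F.map g).f.comp (c := -1) (cobarGen (ι C)) = (cobarGen (ι C')).comp g.f

/-- The curved bar construction as a functor on dg operads: on a morphism `g` it is the morphism of
cooperads induced by `s x ↦ s g(x)`, `v ↦ v` (the condition on `v` being part of the compatibility
with curvatures). -/
structure BarConstruction (K : Type u) [Field K] where
  F : DGOperad K ⥤ CurvedCooperad K
  π : ∀ P, DegMap (F.obj P).S (barCogen P) 0
  isBar : ∀ P, IsBar P (F.obj P) (π P)
  map_pr : ∀ {P P' : DGOperad K} (g : P ⟶ P'),
    (barPr (π P')).comp (c := -1) (F.map g).f = g.f.comp (barPr (π P))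

end OperadicBar

open OperadicBar

/-!
Everything is computed on the generators `gmk f p q hd μ ν` of a composite product, the trees with a
lower vertex `μ` and upper vertices `ν i` indexed by an arbitrary finite linear order. Renumbering the
upper vertices costs a Koszul sign (`gmk_eq`), and the associator has the closed formula `assoc_gmk`.
With these two facts the composite product becomes a monoidal structure on graded `S`-modules; the
part that needs work is that the associator is bijective (`bijective_assoc`) and the sign identity of
the pentagon (`asgn_pentagon`). Maps of nonzero degree are handled in the category `Tot K`, where
`tot` forgets the degrees.

The free operad and the cofree conilpotent cooperad on `V` have the same underlying module
`Tree V = I ⊕ V ∘ Tree V`. As `∘` is not additive in its right factor, this fixed point is built as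
the union of the modules of trees of bounded height, each of which is a retract of the next; maps out
of it are defined and compared by recursion on the height. Recursion on trees gives freeness
(`treeOperad_isFree`), and recursion along the coradical filtration gives cofreeness
(`treeCooperad_isCofree`).

Derivations of degree `n` along a morphism of operads are the lifts of this morphism to a square-zero
extension of the target by its own suspension (`OperadExt`); coderivations are dual (`CooperadExt`).
So the universal properties for morphisms yield existence and uniqueness of derivations with given
values on generators and of coderivations with given projection to cogenerators. Square-zero
extensions of operads also give the key identity `conv_assoc`: the product
`α ⋆ β = γ (α ⊗ β) Δ` is only pre-Lie, but `(α ⋆ α) ⋆ α = α ⋆ (α ⋆ α)` if `α` has odd degree, in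
every characteristic.

Let `E` be the derivation with `E α = θ 1 - α d - α ⋆ α` for the universal `α` on a cobar
construction. Then `E (E α) = 0`: the terms with `α ⋆ α` cancel by `conv_assoc`, and `α d²` cancels
against the terms with `θ` by the curvature equation (`derivation_sq_eq_zero`); uniqueness of
derivations gives `E² = 0`. On the bar construction the same computation shows that `E²` and
`(θ ⊗ id - id ⊗ θ) Δ` have the same projection to the cogenerators (`coderivation_sq`), and the
latter operator is a coderivation (`isCoderivation_act`), so the two agree.

Finally, a morphism of graded operads out of the free operad commutes with the differentials if it
does so on generators, that is, if its restriction is a twisting morphism; dually for the bar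
construction. This gives the two bijections (`IsCobar.homEquiv`, `IsBar.homEquiv`), and their
naturality makes the constructions functors and gives the adjunction.
-/

open CategoryTheory
open scoped TensorProduct DirectSum

namespace OperadicBar
variable {K : Type u} [Field K]

/-! ### Decorated trees indexed by arbitrary finite linear orders -/

/-- The increasing enumeration of a finite linear order. -/
def finEnum (I : Type) [Fintype I] [LinearOrder I] : Fin (Fintype.card I) ≃o I :=
  monoEquivOfFin I rfl

/-- The Koszul sign of a bijection between finite linear orders. -/
def ksign {I J : Type} [Fintype I] [LinearOrder I] [LinearOrder J] (ψ : I ≃ J) (q : I → ℤ) : ℤˣ :=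
  (∑ i, ∑ j, if i < j ∧ ψ j < ψ i then q i * q j else 0).negOnePow

theorem ksign_mono {I J : Type} [Fintype I] [LinearOrder I] [LinearOrder J] (ψ : I ≃ J)
    (q : I → ℤ) (h : ∀ i j, i < j → ψ i < ψ j) : ksign ψ q = 1 := by
  rw [ksign, Finset.sum_eq_zero, Int.negOnePow_zero]
  intro i _
  refine Finset.sum_eq_zero fun j _ => if_neg ?_
  rintro ⟨h1, h2⟩
  exact (h _ _ h1).not_gt h2

section gmk

variable {V W : SMod K} {X : Type} [Finite X] {I J : Type} [Fintype I] [LinearOrder I]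
  [Fintype J] [LinearOrder J] {d : ℤ}

/-- A bijection of finite linear orders, in terms of the positions of the elements. -/
def enumConj (ψ : I ≃ J) : Fin (Fintype.card I) ≃ Fin (Fintype.card J) :=
  (finEnum I).toEquiv.trans (ψ.trans (finEnum J).symm.toEquiv)

theorem finEnum_enumConj (ψ : I ≃ J) (l) : finEnum J (enumConj ψ l) = ψ (finEnum I l) := by
  simp [enumConj]

/-- The shape with upper vertices indexed by a finite linear order. -/
abbrev gshape (f : X → I) (p : ℤ) (q : I → ℤ) (hd : p + ∑ i, q i = d) : Shape X d where
  k := Fintype.card I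
  f x := (finEnum I).symm (f x)
  p := p
  q l := q (finEnum I l)
  hd := (congrArg (p + ·) (Equiv.sum_comp (finEnum I).toEquiv q)).trans hd

/-- The generator `(μ; ν_i, i ∈ I)` of `V ∘ W`, for upper vertices indexed by a finite linear
order `I`. -/
noncomputable def gmk (f : X → I) (p : ℤ) (q : I → ℤ) (hd : p + ∑ i, q i = d)
    (μ : V.obj I p) (ν : ∀ i, W.obj {x // f x = i} (q i)) : (comp V W).obj X d :=
  cmk (gshape f p q hd) (V.map (finEnum I).symm.toEquiv p μ)
    (fun l => W.map (fibEquiv fun _ => (OrderIso.symm_apply_eq _).symm) _ (ν (finEnum I l)))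

theorem tr_map (V : SMod K) {X Y Z : Type} [Finite X] [Finite Y] [Finite Z] (e : X ≃ Y)
    (e' : Y ≃ Z) {d d' : ℤ} (h : d = d') (x : V.obj X d) :
    V.tr e' h (V.map e d x) = V.tr (e.trans e') h x :=
  V.tr_tr e e' rfl h x

theorem map_tr (V : SMod K) {X Y Z : Type} [Finite X] [Finite Y] [Finite Z] (e : X ≃ Y)
    (e' : Y ≃ Z) {d d' : ℤ} (h : d = d') (x : V.obj X d) :
    V.map e' d' (V.tr e h x) = V.tr (e.trans e') h x :=
  V.tr_tr e e' h rfl x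

/-- Renumbering the upper vertices of a generator multiplies it by the Koszul sign of the renumbering. -/
theorem gmk_eq (ψ : I ≃ J) {f : X → I} {f' : X → J} {p p' : ℤ} {q : I → ℤ} {q' : J → ℤ} {hd hd'}
    (hf : ∀ x, f' x = ψ (f x)) (hp : p = p') (hq : ∀ i, q i = q' (ψ i))
    {μ : V.obj I p} {ν : ∀ i, W.obj {x // f x = i} (q i)}
    {μ' : V.obj J p'} {ν' : ∀ i, W.obj {x // f' x = i} (q' i)}
    (hμ : μ' = V.tr ψ hp μ)
    (hν : ∀ i, ν' (ψ i) = W.tr (fibEquiv fun x => by rw [hf, ψ.apply_eq_iff_eq]) (hq i) (ν i)) :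
    gmk (V := V) (W := W) (d := d) f' p' q' hd' μ' ν' = ksign ψ q • gmk f p q hd μ ν := by
  have hs : koszul (enumConj ψ) (fun l => q (finEnum I l)) = ksign ψ q := by
    rw [koszul, ksign]
    congr 1
    rw [← Equiv.sum_comp (finEnum I).toEquiv]
    refine Finset.sum_congr rfl fun l _ => ?_
    rw [← Equiv.sum_comp (finEnum I).toEquiv]
    refine Finset.sum_congr rfl fun l' _ => ?_
    have e : enumConj ψ l' < enumConj ψ l ↔ ψ (finEnum I l') < ψ (finEnum I l) := by
      rw [← (finEnum J).lt_iff_lt, finEnum_enumConj, finEnum_enumConj]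
    simp [e]
  have hm : V.map (finEnum J).symm.toEquiv p' (V.tr ψ hp μ) =
      V.tr (enumConj ψ) hp (V.map (finEnum I).symm.toEquiv p μ) := by
    rw [map_tr, tr_map]
    refine SMod.tr_congr V _ _ _ (fun i => ?_) _
    simp [enumConj]
  rw [← hs]
  refine mk_eq (s := gshape f p q hd) (s' := gshape f' p' q' hd') (enumConj ψ) ?_ hp ?_ ?_ ?_
  · intro x
    change (finEnum J).symm _ = _
    rw [OrderIso.symm_apply_eq, finEnum_enumConj, OrderIso.apply_symm_apply, hf]
  · intro l
    exact (hq _).trans (congrArg q' (finEnum_enumConj ψ l).symm)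
  · rw [hμ]
    exact hm
  · intro l
    dsimp only
    rw [fam ν' (finEnum_enumConj ψ l).symm, hν]
    simp only [← SMod.tr_rfl, SMod.tr_tr]
    exact SMod.tr_congr W _ _ _ (fun _ => rfl) _

theorem gmk_eq_mono (ψ : I ≃ J) (hψ : ∀ i j, i < j → ψ i < ψ j) {f : X → I} {f' : X → J}
    {p p' : ℤ} {q : I → ℤ} {q' : J → ℤ} {hd hd'}
    (hf : ∀ x, f' x = ψ (f x)) (hp : p = p') (hq : ∀ i, q i = q' (ψ i))
    {μ : V.obj I p} {ν : ∀ i, W.obj {x // f x = i} (q i)}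
    {μ' : V.obj J p'} {ν' : ∀ i, W.obj {x // f' x = i} (q' i)}
    (hμ : μ' = V.tr ψ hp μ)
    (hν : ∀ i, ν' (ψ i) = W.tr (fibEquiv fun x => by rw [hf, ψ.apply_eq_iff_eq]) (hq i) (ν i)) :
    gmk (d := d) f' p' q' hd' μ' ν' = gmk f p q hd μ ν := by
  rw [gmk_eq (hd := hd) ψ hf hp hq hμ hν, ksign_mono ψ q hψ, one_smul]

theorem gmk_congr {f f' : X → I} {p p' : ℤ} {q q' : I → ℤ} {hd hd'}
    (hf : ∀ x, f' x = f x) (hp : p = p') (hq : ∀ i, q i = q' i)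
    {μ : V.obj I p} {ν : ∀ i, W.obj {x // f x = i} (q i)}
    {μ' : V.obj I p'} {ν' : ∀ i, W.obj {x // f' x = i} (q' i)}
    (hμ : μ' = V.tr (Equiv.refl _) hp μ)
    (hν : ∀ i, ν' i = W.tr (fibEquiv fun x => by rw [hf]) (hq i) (ν i)) :
    gmk (d := d) f' p' q' hd' μ' ν' = gmk f p q hd μ ν :=
  gmk_eq_mono (Equiv.refl I) (fun _ _ h => h) hf hp hq hμ hν

theorem cmk_eq_gmk (s : Shape X d) (μ : V.obj (Fin s.k) s.p)
    (ν : ∀ i, W.obj {x // s.f x = i} (s.q i)) :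
    (cmk s μ ν : (comp V W).obj X d) = gmk s.f s.p s.q s.hd μ ν := by
  have h := mk_eq (s := s) (s' := gshape s.f s.p s.q s.hd) (finEnum (Fin s.k)).symm.toEquiv
    (fun _ => rfl) rfl (fun l => congrArg s.q (OrderIso.apply_symm_apply _ _).symm) (μ := μ) (ν := ν)
    (μ' := V.map (finEnum (Fin s.k)).symm.toEquiv s.p μ) (ν' := fun l =>
      W.map (fibEquiv fun _ => (OrderIso.symm_apply_eq _).symm) _ (ν (finEnum (Fin s.k) l))) rfl
    (fun l => by
      dsimp only
      rw [fam ν (show l = finEnum (Fin s.k) ((finEnum (Fin s.k)).symm.toEquiv l) from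
        (OrderIso.apply_symm_apply (finEnum (Fin s.k)) l).symm)]
      simp only [← SMod.tr_rfl, SMod.tr_tr]
      exact SMod.tr_congr W _ _ _ (fun _ => rfl) _)
  rw [koszul_mono _ _ (fun i j h => (finEnum (Fin s.k)).symm.lt_iff_lt.2 h), one_smul] at h
  exact h.symm

theorem comp_tr_gmk {Y : Type} [Finite Y] (e : X ≃ Y) {d' : ℤ} (h : d = d') (f : X → I) (p : ℤ)
    (q : I → ℤ) (hd : p + ∑ i, q i = d) (μ : V.obj I p)
    (ν : ∀ i, W.obj {x // f x = i} (q i)) :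
    (comp V W).tr e h (gmk f p q hd μ ν) =
      gmk (d := d') (fun y => f (e.symm y)) p q (hd.trans h) μ
        (fun i => W.map (fibRelabel f e i) (q i) (ν i)) := by
  rw [gmk, comp_tr_mk, gmk]
  congr 1
  funext l
  simp only [← SMod.tr_rfl, SMod.tr_tr]
  exact SMod.tr_congr W _ _ _ (fun _ => rfl) _

theorem gmk_zero (f : X → I) (p : ℤ) (q : I → ℤ) (hd : p + ∑ i, q i = d)
    (μ : V.obj I p) (ν : ∀ i, W.obj {x // f x = i} (q i)) (i : I) (hi : ν i = 0) :
    gmk f p q hd μ ν = 0 := by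
  refine (mkM (V := V) (W := W) (gshape f p q hd)
      (V.map (finEnum I).symm.toEquiv p μ)).map_coord_zero ((finEnum I).symm i) ?_
  dsimp only
  rw [fam ν (show i = finEnum I ((finEnum I).symm i) by simp), hi, map_zero, map_zero]

theorem gmk_zero_left (f : X → I) (p : ℤ) (q : I → ℤ) (hd : p + ∑ i, q i = d)
    (ν : ∀ i, W.obj {x // f x = i} (q i)) :
    gmk (V := V) f p q hd 0 ν = 0 := by
  change mkL (gshape f p q hd) _ = 0
  rw [map_zero, TensorProduct.zero_tmul, map_zero]

theorem gmk_ext {M : Type*} [AddCommGroup M] [Module K M] {F G : (comp V W).obj X d →ₗ[K] M}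
    (h : ∀ (k : ℕ) (f : X → Fin k) (p : ℤ) (q : Fin k → ℤ) (hd : p + ∑ i, q i = d)
      (μ : V.obj (Fin k) p) (ν : ∀ i, W.obj {x // f x = i} (q i)),
      F (gmk f p q hd μ ν) = G (gmk f p q hd μ ν)) : F = G := by
  refine comp_hom_ext fun s μ ν => ?_
  have := h s.k s.f s.p s.q s.hd μ ν
  rwa [← cmk_eq_gmk] at this

/-- The map `μ ↦ (μ; ν)`. -/
noncomputable def gmkL (f : X → I) (p : ℤ) (q : I → ℤ) (hd : p + ∑ i, q i = d)
    (ν : ∀ i, W.obj {x // f x = i} (q i)) : V.obj I p →ₗ[K] (comp V W).obj X d where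
  toFun μ := gmk f p q hd μ ν
  map_add' μ μ' := by
    change mkL (gshape f p q hd) _ = mkL (gshape f p q hd) _ + mkL (gshape f p q hd) _
    rw [map_add, TensorProduct.add_tmul, map_add]
    rfl
  map_smul' c μ := by
    change mkL (gshape f p q hd) _ = c • mkL (gshape f p q hd) _
    rw [map_smul, ← TensorProduct.smul_tmul', map_smul]
    rfl

/-- Two maps out of `(V ∘ W) ∘ U` agreeing on iterated generators are equal. -/
theorem gmk_ext₂ {U : SMod K} {M : Type*} [AddCommGroup M] [Module K M]
    {F G : (comp (comp V W) U).obj X d →ₗ[K] M}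
    (h : ∀ (m : ℕ) (φ : X → Fin m) (P : ℤ) (s : Fin m → ℤ) (hd : P + ∑ j, s j = d)
      (k : ℕ) (f : Fin m → Fin k) (p : ℤ) (q : Fin k → ℤ) (hP : p + ∑ i, q i = P)
      (μ : V.obj (Fin k) p) (w : ∀ i, W.obj {j // f j = i} (q i))
      (ρ : ∀ j, U.obj {x // φ x = j} (s j)),
      F (gmk (V := comp V W) φ P s hd (gmk f p q hP μ w) ρ) =
        G (gmk (V := comp V W) φ P s hd (gmk f p q hP μ w) ρ)) : F = G := by
  refine gmk_ext fun m φ P s hd lam ρ => ?_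
  refine LinearMap.congr_fun (f := F ∘ₗ gmkL (V := comp V W) (I := Fin m) φ P s hd ρ)
    (g := G ∘ₗ gmkL (V := comp V W) (I := Fin m) φ P s hd ρ) (gmk_ext fun k f p q hP μ w => ?_) lam
  exact h _ _ _ _ _ _ _ _ _ _ _ _ _

end gmk

/-- The Koszul sign of rewriting `w₁ ⋯ w_k ρ₁ ⋯ ρ_m` as the product of the blocks consisting of `w_i`
followed by the `ρ_j` with `f j = i`. -/
def asgn {I J : Type} [Fintype I] [LinearOrder I] [Fintype J] [LinearOrder J] (s : J → ℤ)
    (f : J → I) (q : I → ℤ) : ℤˣ :=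
  ((∑ j, ∑ i, if f j < i then s j * q i else 0) +
    ∑ j, ∑ j', if j < j' ∧ f j' < f j then s j * s j' else 0).negOnePow

/-- The part over the fibre of `φ ∘ f` of the fibres of `φ`. -/
def fibFib {X I J : Type} (φ : X → J) (f : J → I) (i : I) (j : {j // f j = i}) :
    {x // φ x = j} ≃ {y : {x // f (φ x) = i} // (⟨φ y, y.2⟩ : {j // f j = i}) = j} where
  toFun x := ⟨⟨x.1, by rw [x.2]; exact j.2⟩, Subtype.ext x.2⟩
  invFun y := ⟨y.1.1, congrArg Subtype.val y.2⟩
  left_inv _ := rfl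
  right_inv _ := rfl

theorem fibSum {I J : Type} [Fintype I] [LinearOrder I] [Fintype J] (s : J → ℤ) (f : J → I)
    (q : I → ℤ) {P p d : ℤ} (hd : P + ∑ j, s j = d) (hP : p + ∑ i, q i = P) :
    p + ∑ i, (q i + ∑ j : {j // f j = i}, s j) = d := by
  rw [Finset.sum_add_distrib, ← add_assoc, hP, Fintype.sum_fiberwise f s, hd]

theorem blockMap_gmk {W U : SMod K} {X : Type} [Finite X] {m k : ℕ} (g : X → Fin m)
    (s : Fin m → ℤ) (f : Fin m → Fin k) (q : Fin k → ℤ)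
    (ρ : ∀ j, U.obj {x // g x = j} (s j)) (i : Fin k) (w : W.obj {j // f j = i} (q i)) :
    blockMap W U g s f q ρ i w = gmk (X := {x // f (g x) = i}) (I := {j // f j = i})
      (fun x => ⟨g x, x.2⟩) (q i)
      (fun j => s j) rfl w (fun j => U.map (fibFib g f i j) _ (ρ j)) := by
  rw [blockMap_apply]
  refine congrArg (cmk (blockShape g s f q i) _) (funext fun l => ?_)
  simp only [← SMod.tr_rfl, SMod.tr_tr]
  exact SMod.tr_congr U _ _ _ (fun _ => rfl) _

/-- The associator on iterated generators: the upper vertices are grouped into blocks, at the cost of the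
Koszul sign `asgn`. -/
theorem assoc_gmk {V W U : SMod K} {X : Type} [Finite X] {I J : Type} [Fintype I] [LinearOrder I]
    [Fintype J] [LinearOrder J] {d P p : ℤ} (φ : X → J) (s : J → ℤ) (hd : P + ∑ j, s j = d)
    (f : J → I) (q : I → ℤ) (hP : p + ∑ i, q i = P) (μ : V.obj I p)
    (w : ∀ i, W.obj {j // f j = i} (q i)) (ρ : ∀ j, U.obj {x // φ x = j} (s j)) :
    (assoc V W U).app X d d (add_zero d) (gmk (V := comp V W) φ P s hd (gmk f p q hP μ w) ρ) =
      asgn s f q • gmk (W := comp W U) (fun x => f (φ x)) p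
        (fun i => q i + ∑ j : {j // f j = i}, s j) (fibSum s f q hd hP) μ
        (fun i => gmk (I := {j // f j = i}) (fun x => ⟨φ x, x.2⟩) (q i) (fun j => s j) rfl (w i)
          (fun j => U.map (fibFib φ f i j) _ (ρ j))) := by
  have h1 : (comp V W).map (finEnum J).symm.toEquiv P (gmk f p q hP μ w) =
      gmk (fun y => f (finEnum J y)) p q hP μ
        (fun i => W.map (fibRelabel f (finEnum J).symm.toEquiv i) (q i) (w i)) :=
    comp_tr_gmk _ rfl _ _ _ _ _ _
  have h2 : asgn s f q = assocSign (fun l => s (finEnum J l))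
      (fun l => (finEnum I).symm (f (finEnum J l))) (fun l => q (finEnum I l)) := by
    rw [asgn, assocSign]
    congr 1
    congr 1
    · rw [← Equiv.sum_comp (finEnum J).toEquiv]
      refine Finset.sum_congr rfl fun l _ => ?_
      rw [← Equiv.sum_comp (finEnum I).toEquiv]
      refine Finset.sum_congr rfl fun l' _ => ?_
      simp [OrderIso.symm_apply_lt]
    · rw [← Equiv.sum_comp (finEnum J).toEquiv]
      refine Finset.sum_congr rfl fun l _ => ?_
      rw [← Equiv.sum_comp (finEnum J).toEquiv]
      refine Finset.sum_congr rfl fun l' _ => ?_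
      simp
  have hτ : ∀ l, ∀ j : Fin (Fintype.card J), (finEnum I).symm (f (finEnum J j)) = l ↔
      f (finEnum J j) = finEnum I l := fun l j => OrderIso.symm_apply_eq _
  rw [gmk, h1]
  refine (assocApp_mk _ _ _).trans ((assocInner_mk _ _ _ _ _).trans ?_)
  rw [h2]
  congr 1
  refine mk_congr (W := comp W U) ?_ rfl ?_ ?_ ?_
  · intro x; simp
  · intro i
    refine congrArg _ ?_
    refine (Fintype.sum_equiv ((finEnum J).toEquiv.subtypeEquiv (hτ i)) _ _ fun j => ?_).symm
    rfl
  · exact (SMod.tr_id V _ (fun _ => rfl) _ _).symm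
  · intro i
    dsimp only
    rw [blockMap_gmk, tr_map, comp_tr_gmk]
    refine gmk_eq_mono ((finEnum J).symm.toEquiv.subtypeEquiv fun j => ?_) ?_ ?_ rfl ?_ ?_ ?_
    · simp [OrderIso.symm_apply_eq]
    · intro j j' h
      exact (finEnum J).symm.lt_iff_lt.2 h
    · intro x; rfl
    · intro j; simp
    · refine (W.map_trans _ _ _ _).symm.trans ?_
      exact SMod.tr_congr W _ _ rfl (fun j => rfl) _
    · intro j
      have : (j : J) = finEnum J (((finEnum J).symm.toEquiv.subtypeEquiv (q := fun l => (finEnum I).symm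
          (f (finEnum J l)) = i) (by simp [OrderIso.symm_apply_eq])) j) :=
        (OrderIso.apply_symm_apply (finEnum J) (j : J)).symm
      rw [fam ρ this]
      simp only [← SMod.tr_rfl, SMod.tr_tr]
      exact SMod.tr_congr U _ _ _ (fun j => rfl) _

end OperadicBar

namespace OperadicBar
variable {K : Type u} [Field K]

/-! ### The additive structure on homogeneous maps -/

section additive

variable {U V W : SMod K} {k : ℤ}

theorem DegMap.add_app (f g : DegMap V W k) {X : Type} [Finite X] {d d' : ℤ} (h : d + k = d')
    (x : V.obj X d) : (f + g).app X d d' h x = f.app X d d' h x + g.app X d d' h x := rfl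

noncomputable instance : AddCommGroup (DegMap V W k) where
  add_assoc f g h := DegMap.ext fun X _ d d' hd x => add_assoc _ _ _
  zero_add f := DegMap.ext fun X _ d d' hd x => zero_add _
  add_zero f := DegMap.ext fun X _ d d' hd x => add_zero _
  add_comm f g := DegMap.ext fun X _ d d' hd x => add_comm _ _
  neg_add_cancel f := DegMap.ext fun X _ d d' hd x => neg_add_cancel _
  nsmul := nsmulRec
  zsmul := zsmulRec

/-- Evaluation of homogeneous maps at an element. -/
def DegMap.evalHom {X : Type} [Finite X] {d d' : ℤ} (h : d + k = d') (x : V.obj X d) :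
    DegMap V W k →+ W.obj X d' where
  toFun f := f.app X d d' h x
  map_zero' := rfl
  map_add' _ _ := rfl

theorem units_smul_eq {M : Type*} [AddCommGroup M] (z : ℤˣ) (x : M) : z • x = (z : ℤ) • x := rfl

theorem DegMap.smul_app (z : ℤˣ) (f : DegMap V W k) {X : Type} [Finite X] {d d' : ℤ}
    (h : d + k = d') (x : V.obj X d) : (z • f).app X d d' h x = z • f.app X d d' h x := by
  rw [units_smul_eq, units_smul_eq]
  exact map_zsmul (DegMap.evalHom h x) (z : ℤ) f

variable {a b c : ℤ}

theorem DegMap.add_comp (g g' : DegMap V W b) (f : DegMap U V a) (h : a + b = c) :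
    (g + g').comp f h = g.comp f h + g'.comp f h := rfl

theorem DegMap.comp_add (g : DegMap V W b) (f f' : DegMap U V a) (h : a + b = c) :
    g.comp (f + f') h = g.comp f h + g.comp f' h :=
  DegMap.ext fun _ _ _ _ _ _ => map_add (g.app _ _ _ _) _ _

/-- Equality of homogeneous maps up to an equality of their degrees. -/
def DegMap.Same {a b : ℤ} (f : DegMap V W a) (g : DegMap V W b) : Prop :=
  ∃ h : a = b, f.recast h = g

theorem DegMap.Same.refl (f : DegMap V W a) : f.Same f := ⟨rfl, rfl⟩

theorem DegMap.Same.symm {f : DegMap V W a} {g : DegMap V W b} (h : f.Same g) : g.Same f := by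
  obtain ⟨rfl, rfl⟩ := h; exact ⟨rfl, rfl⟩

theorem DegMap.Same.trans {f : DegMap V W a} {g : DegMap V W b} {h : DegMap V W c}
    (h₁ : f.Same g) (h₂ : g.Same h) : f.Same h := by
  obtain ⟨rfl, rfl⟩ := h₁; exact h₂

theorem DegMap.same_recast (f : DegMap V W a) (h : a = b) : (f.recast h).Same f := by
  subst h; exact ⟨rfl, rfl⟩

theorem DegMap.Same.comp {a' b' c' : ℤ} {f : DegMap U V a} {f' : DegMap U V a'}
    {g : DegMap V W b} {g' : DegMap V W b'} (hg : g.Same g') (hf : f.Same f') (h : a + b = c)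
    (h' : a' + b' = c') : (g.comp f h).Same (g'.comp f' h') := by
  obtain ⟨rfl, rfl⟩ := hg; obtain ⟨rfl, rfl⟩ := hf
  subst h; subst h'; exact ⟨rfl, rfl⟩

theorem DegMap.Same.app_eq {f : DegMap V W a} {g : DegMap V W b} (h : f.Same g) {X : Type}
    [Finite X] {d d' : ℤ} (h₁ : d + a = d') (h₂ : d + b = d') (x : V.obj X d) :
    f.app X d d' h₁ x = g.app X d d' h₂ x := by
  obtain ⟨rfl, rfl⟩ := h; rfl

theorem DegMap.Same.eq {f g : DegMap V W a} (h : f.Same g) : f = g := by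
  obtain ⟨_, rfl⟩ := h; rfl

theorem DegMap.tr_app (f : DegMap V W k) {X : Type} [Finite X] (e : X ≃ X) (he : ∀ x, e x = x)
    {d d₁ d₂ : ℤ} (h₁ : d + k = d₁) (h₂ : d + k = d₂) (h : d₁ = d₂) (x : V.obj X d) :
    W.tr e h (f.app X d d₁ h₁ x) = f.app X d d₂ h₂ x := by
  subst h; exact W.tr_id e he rfl _

theorem DegMap.app_map_tr (f : DegMap V W k) {X Y : Type} [Finite X] [Finite Y] (e e' : X ≃ Y)
    (he : ∀ x, e x = e' x) {d d₁ d₂ : ℤ} (h₁ : d + k = d₁) (h₂ : d + k = d₂) (h : d₂ = d₁)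
    (x : V.obj X d) :
    f.app Y d d₁ h₁ (V.map e d x) = W.tr e' h (f.app X d d₂ h₂ x) := by
  subst h
  rw [f.natural]
  exact W.tr_congr _ _ _ he _

end additive

/-! ### Homogeneous maps on generators of composite products -/

/-- The map `h` if the condition `c` holds and `g` otherwise. -/
def infD {W W' : SMod K} {b : ℤ} (g : DegMap W W' 0) (h : DegMap W W' b) (c : Prop) [Decidable c] :
    DegMap W W' (if c then b else 0) :=
  if hc : c then h.recast (by rw [if_pos hc]) else g.recast (by rw [if_neg hc])

theorem infD_pos {W W' : SMod K} {b : ℤ} (g : DegMap W W' 0) (h : DegMap W W' b) {c : Prop}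
    [Decidable c] (hc : c) : (infD g h c).Same h := by
  rw [infD, dif_pos hc]; exact DegMap.same_recast _ _

theorem infD_neg {W W' : SMod K} {b : ℤ} (g : DegMap W W' 0) (h : DegMap W W' b) {c : Prop}
    [Decidable c] (hc : ¬ c) : (infD g h c).Same g := by
  rw [infD, dif_neg hc]; exact DegMap.same_recast _ _

theorem infD_congr {W W' : SMod K} {b : ℤ} (g : DegMap W W' 0) (h : DegMap W W' b) {c c' : Prop}
    [Decidable c] [Decidable c'] (hc : c ↔ c') : (infD g h c).Same (infD g h c') := by
  by_cases h' : c
  · exact (infD_pos g h h').trans (infD_pos g h (hc.1 h')).symm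
  · exact (infD_neg g h h').trans (infD_neg g h fun h'' => h' (hc.2 h'')).symm

theorem infMap_eq {W W' : SMod K} {b : ℤ} (g : DegMap W W' 0) (h : DegMap W W' b) {X : Type}
    [Finite X] {k : ℕ} (f : X → Fin k) (q : Fin k → ℤ) (i j : Fin k)
    (x : W.obj {x // f x = j} (q j)) :
    infMap g h f q i j x = (infD g h (j = i)).app _ (q j) (q j + if j = i then b else 0) rfl x := by
  by_cases hj : j = i
  · rw [(infD_pos g h hj).app_eq _ (by rw [if_pos hj]), infMap, dif_pos hj]
  · rw [(infD_neg g h hj).app_eq _ (by rw [if_neg hj]), infMap, dif_neg hj]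

/-- The Koszul sign of moving a map of degree `b` to the position `i` of `μ ν₁ ⋯ ν_k`. -/
def infs {I : Type} [Fintype I] [LinearOrder I] (b p : ℤ) (q : I → ℤ) (i : I) : ℤˣ :=
  (b * (p + ∑ j, if j < i then q j else 0)).negOnePow

section gapp

variable {V V' V'' W W' W'' : SMod K} {X : Type} [Finite X] {I : Type} [Fintype I] [LinearOrder I]
  {a a' b : ℤ} {B B' : I → ℤ} {d d' : ℤ}

/-- The generator `(f μ; F_i ν_i)`, without a Koszul sign. -/
noncomputable def gapp (f : DegMap V V' a) (F : ∀ j, DegMap W W' (B j)) (φ : X → I) (p : ℤ)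
    (q : I → ℤ) (hd : (p + a) + ∑ j, (q j + B j) = d) (μ : V.obj I p)
    (ν : ∀ i, W.obj {x // φ x = i} (q i)) : (comp V' W').obj X d :=
  gmk φ (p + a) (fun j => q j + B j) hd (f.app I p (p + a) rfl μ)
    (fun j => (F j).app _ (q j) (q j + B j) rfl (ν j))

theorem gapp_congr {f : DegMap V V' a} {F : ∀ j, DegMap W W' (B j)} {f' : DegMap V V' a'}
    {F' : ∀ j, DegMap W W' (B' j)} {φ : X → I} {p : ℤ}
    {q : I → ℤ} {hd : (p + a) + ∑ j, (q j + B j) = d} {hd' : (p + a') + ∑ j, (q j + B' j) = d}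
    {μ : V.obj I p} {ν : ∀ i, W.obj {x // φ x = i} (q i)} (h : f.Same f')
    (h' : ∀ j, (F j).Same (F' j)) :
    gapp f F φ p q hd μ ν = gapp f' F' φ p q hd' μ ν := by
  obtain rfl : B = B' := funext fun j => (h' j).1
  obtain rfl : F = F' := funext fun j => (h' j).eq
  obtain ⟨rfl, rfl⟩ := h
  rfl

theorem gapp_zero {f : DegMap V V' a} {F : ∀ j, DegMap W W' (B j)} {φ : X → I} {p : ℤ}
    {q : I → ℤ} {hd : (p + a) + ∑ j, (q j + B j) = d} {μ : V.obj I p}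
    {ν : ∀ i, W.obj {x // φ x = i} (q i)} (i : I) {b : ℤ} (h : (F i).Same (0 : DegMap W W' b)) :
    gapp f F φ p q hd μ ν = 0 := by
  refine gmk_zero _ _ _ _ _ _ i ?_
  obtain ⟨h, h'⟩ := h.symm
  rw [← h']
  rfl

theorem gapp_gapp {f : DegMap V V' a} {F : ∀ j, DegMap W W' (B j)} {f' : DegMap V' V'' a'}
    {F' : ∀ j, DegMap W' W'' (B' j)} {φ : X → I} {p : ℤ}
    {q : I → ℤ} {hd' : (p + a + a') + ∑ j, (q j + B j + B' j) = d'}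
    {hd'' : (p + (a + a')) + ∑ j, (q j + (B j + B' j)) = d'} {μ : V.obj I p}
    {ν : ∀ i, W.obj {x // φ x = i} (q i)} :
    gapp f' F' φ (p + a) (fun j => q j + B j) hd' (f.app I p (p + a) rfl μ)
      (fun j => (F j).app _ (q j) (q j + B j) rfl (ν j)) =
    gapp (f'.comp f rfl) (fun j => (F' j).comp (F j) rfl) φ p q hd'' μ ν := by
  refine gmk_congr (fun _ => rfl) (add_assoc _ _ _).symm (fun j => (add_assoc _ _ _).symm) ?_ ?_
  · rw [DegMap.comp_app _ _ rfl rfl (by omega), DegMap.tr_app]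
    exact fun _ => rfl
  · intro j
    rw [DegMap.comp_app _ _ rfl rfl (by dsimp only; omega), DegMap.tr_app]
    exact fun _ => rfl

theorem compMap_gmk (f : DegMap V V' a) (g : DegMap W W' 0) (h : d + a = d') (φ : X → I) (p : ℤ)
    (q : I → ℤ) (hd : p + ∑ i, q i = d) (μ : V.obj I p) (ν : ∀ i, W.obj {x // φ x = i} (q i)) :
    (compMap f g).app X d d' h (gmk φ p q hd μ ν) =
      gapp f (fun _ => g) φ p q (by simp only [add_zero]; omega) μ ν := by
  refine (compMapApp_mk f g h _ _ _).trans ?_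
  refine mk_congr (fun _ => rfl) rfl (fun _ => add_zero _) ?_ fun i => ?_
  · rw [SMod.tr_id _ _ fun _ => rfl]
    exact f.natural (finEnum I).symm.toEquiv _ _ _ _
  · rw [tr_map]
    exact g.app_map_tr _ _ (fun _ => rfl) _ _ _ _

theorem shiftSum {p : ℤ} {q : I → ℤ} (hd : p + ∑ i, q i = d) (h : d + (a + b) = d') (i : I) :
    (p + a) + ∑ j, (q j + if j = i then b else 0) = d' := by
  simp only [Finset.sum_add_distrib, Finset.sum_ite_eq', Finset.mem_univ, if_true]
  omega

theorem compInf_gmk (f : DegMap V V' a) (g : DegMap W W' 0) (h : DegMap W W' b)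
    (hh : d + (a + b) = d') (φ : X → I) (p : ℤ)
    (q : I → ℤ) (hd : p + ∑ i, q i = d) (μ : V.obj I p) (ν : ∀ i, W.obj {x // φ x = i} (q i)) :
    (compInf f g h).app X d d' hh (gmk φ p q hd μ ν) =
      ∑ i, infs b p q i • gapp f (fun j => infD g h (j = i)) φ p q (shiftSum hd hh i) μ ν := by
  refine (compInfApp_mk f g h hh _ _ _).trans ?_
  rw [← Equiv.sum_comp (finEnum I).toEquiv]
  refine Finset.sum_congr rfl fun i _ => ?_
  have h1 : infs b p q ((finEnum I).toEquiv i) = infSign b p (fun l => q (finEnum I l)) i := by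
    rw [infs, infSign, ← Equiv.sum_comp (finEnum I).toEquiv]
    simp
  rw [h1]
  congr 1
  refine mk_congr (fun _ => rfl) rfl (fun j => ?_) ?_ fun j => ?_
  · simp
  · rw [SMod.tr_id _ _ fun _ => rfl]
    exact f.natural (finEnum I).symm.toEquiv _ _ _ _
  · have hc : j = i ↔ finEnum I j = (finEnum I).toEquiv i := (finEnum I).injective.eq_iff.symm
    have hd : (if finEnum I j = (finEnum I).toEquiv i then b else 0) = if j = i then b else 0 := by
      simp only [hc]
    rw [tr_map, infMap_eq, (infD_congr g h hc).app_eq _ (by rw [hd])]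
    exact DegMap.app_map_tr _ _ _ (fun _ => rfl) _ _ _ _

end gapp

end OperadicBar

namespace OperadicBar
open Finset (sum_congr sum_add_distrib sum_comm sum_eq_zero)
variable {K : Type u} [Field K]

/-! ### Composition rules for composites of homogeneous maps -/

section rules

variable {V V' V'' W W' W'' U U' : SMod K} {a a' b b' c c' k : ℤ}

theorem degMap_ext_gmk {Z : SMod K} {F G : DegMap (comp V W) Z k}
    (H : ∀ (X : Type) [Finite X] (d d' : ℤ) (h : d + k = d') (n : ℕ) (φ : X → Fin n) (p : ℤ)
      (q : Fin n → ℤ) (hd : p + ∑ i, q i = d) (μ : V.obj (Fin n) p)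
      (ν : ∀ i, W.obj {x // φ x = i} (q i)),
      F.app X d d' h (gmk φ p q hd μ ν) = G.app X d d' h (gmk φ p q hd μ ν)) : F = G :=
  DegMap.ext fun X _ d d' h x => LinearMap.congr_fun (gmk_ext fun _ _ _ _ _ _ _ => H X d d' h _ _ _ _ _ _ _) x

theorem degMap_ext_gmk₂ {Z : SMod K} {F G : DegMap (comp (comp V W) U) Z k}
    (H : ∀ (X : Type) [Finite X] (d d' : ℤ) (h : d + k = d') (m : ℕ) (φ : X → Fin m) (P : ℤ)
      (s : Fin m → ℤ) (hd : P + ∑ j, s j = d) (n : ℕ) (f : Fin m → Fin n) (p : ℤ)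
      (q : Fin n → ℤ) (hP : p + ∑ i, q i = P) (μ : V.obj (Fin n) p)
      (w : ∀ i, W.obj {j // f j = i} (q i)) (ρ : ∀ j, U.obj {x // φ x = j} (s j)),
      F.app X d d' h (gmk (V := comp V W) φ P s hd (gmk f p q hP μ w) ρ) =
        G.app X d d' h (gmk (V := comp V W) φ P s hd (gmk f p q hP μ w) ρ)) : F = G :=
  DegMap.ext fun X _ d d' h x => LinearMap.congr_fun (gmk_ext₂ fun _ _ _ _ _ _ _ _ _ _ _ _ _ =>
    H X d d' h _ _ _ _ _ _ _ _ _ _ _ _ _) x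

/-- The infinitesimal composite, of a prescribed degree. -/
noncomputable def cinf (f : DegMap V V' a) (g : DegMap W W' 0) (h : DegMap W W' b)
    (hc : a + b = c := by norm_num) : DegMap (comp V W) (comp V' W') c :=
  (compInf f g h).recast hc

theorem cinf_gmk {X I : Type} [Finite X] [Fintype I] [LinearOrder I] {d d' : ℤ}
    (f : DegMap V V' a) (g : DegMap W W' 0) (h : DegMap W W' b) (hc : a + b = c)
    (hh : d + c = d') (φ : X → I) (p : ℤ)
    (q : I → ℤ) (hd : p + ∑ i, q i = d) (μ : V.obj I p) (ν : ∀ i, W.obj {x // φ x = i} (q i)) :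
    (cinf f g h hc).app X d d' hh (gmk φ p q hd μ ν) =
      ∑ i, infs b p q i • gapp f (fun j => infD g h (j = i)) φ p q
        (shiftSum hd (by omega) i) μ ν :=
  compInf_gmk f g h (by omega) φ p q hd μ ν

theorem compMap_comp_compMap (f : DegMap V' V'' a') (f' : DegMap V V' a) (g : DegMap W' W'' 0)
    (g' : DegMap W W' 0) (hc : a + a' = c) :
    (compMap f g).comp (compMap f' g') hc = compMap (f.comp f' hc) (g.comp g' (add_zero 0)) := by
  subst hc
  refine degMap_ext_gmk fun X _ d d' h n φ p q hd μ ν => ?_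
  rw [DegMap.comp_app _ _ _ rfl (by omega), compMap_gmk, gapp, compMap_gmk, gapp_gapp, compMap_gmk]

theorem compMap_comp_cinf (f : DegMap V' V'' a') (f' : DegMap V V' a) (g : DegMap W' W'' 0)
    (g' : DegMap W W' 0) (h' : DegMap W W' b) (h₁ : a + b = c) (h₂ : c + a' = c') {a'' : ℤ}
    (h₃ : a + a' = a'') (h₄ : b + 0 = b) (h₅ : a'' + b = c') :
    (compMap f g).comp (cinf f' g' h' h₁) h₂ =
      cinf (f.comp f' h₃) (g.comp g' (add_zero 0)) (g.comp h' h₄) h₅ := by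
  subst h₃
  refine degMap_ext_gmk fun X _ d d' h n φ p q hd μ ν => ?_
  rw [DegMap.comp_app _ _ _ rfl (by omega), cinf_gmk, cinf_gmk, map_sum]
  refine sum_congr rfl fun i _ => ?_
  rw [LinearMap.map_smul_of_tower, gapp, compMap_gmk, gapp_gapp]
  · refine congrArg (infs b p q i • ·) (gapp_congr (.refl _) fun j => ?_)
    by_cases hj : j = i
    · exact (DegMap.Same.comp (.refl _) (infD_pos _ _ hj) _ _).trans (infD_pos _ _ hj).symm
    · exact (DegMap.Same.comp (.refl _) (infD_neg _ _ hj) _ _).trans (infD_neg _ _ hj).symm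
  · have := shiftSum (a := a + a') (b := b) (d' := d') hd (by omega) i
    simp only [add_zero]; exact this

theorem infs_shift {I : Type} [Fintype I] [LinearOrder I] (b p a : ℤ) (q : I → ℤ) (i : I) :
    infs b (p + a) q i = (b * a).negOnePow * infs b p q i := by
  rw [infs, infs, ← Int.negOnePow_add]
  congr 1
  ring

theorem cinf_comp_compMap (f : DegMap V' V'' a') (f' : DegMap V V' a) (g : DegMap W' W'' 0)
    (g' : DegMap W W' 0) (h : DegMap W' W'' b) (h₁ : a' + b = c) (h₂ : a + c = c') {a'' : ℤ}
    (h₃ : a + a' = a'') (h₄ : 0 + b = b) (h₅ : a'' + b = c') :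
    (cinf f g h h₁).comp (compMap f' g') h₂ = (b * a).negOnePow •
      cinf (f.comp f' h₃) (g.comp g' (add_zero 0)) (h.comp g' h₄) h₅ := by
  subst h₃
  refine degMap_ext_gmk fun X _ d d' hh n φ p q hd μ ν => ?_
  rw [DegMap.comp_app _ _ _ rfl (by omega), DegMap.smul_app, compMap_gmk, gapp, cinf_gmk, cinf_gmk,
    Finset.smul_sum]
  refine sum_congr rfl fun i _ => ?_
  rw [infs_shift, gapp_gapp, smul_smul]
  · have hq : infs b p (fun j => q j + 0) i = infs b p q i := by simp only [add_zero]
    rw [hq]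
    refine congrArg (((b * a).negOnePow * infs b p q i) • ·) (gapp_congr (.refl _) fun j => ?_)
    by_cases hj : j = i
    · exact (DegMap.Same.comp (infD_pos _ _ hj) (.refl _) _ h₄).trans (infD_pos _ _ hj).symm
    · exact (DegMap.Same.comp (infD_neg _ _ hj) (.refl _) _ (add_zero 0)).trans
        (infD_neg _ _ hj).symm
  · have := shiftSum (a := a + a') (b := b) (d' := d') hd (by omega) i
    simp only [zero_add]; exact this

theorem two_shiftSum {I : Type} [Fintype I] [LinearOrder I] {d d' p : ℤ} {q : I → ℤ}
    (hd : p + ∑ i, q i = d) (h : d + (a + b + b') = d') (i i' : I) :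
    (p + a) + ∑ j, (q j + ((if j = i' then b' else 0) + if j = i then b else 0)) = d' := by
  simp only [sum_add_distrib, Finset.sum_ite_eq', Finset.mem_univ, if_true]
  omega

/-- The composite of two infinitesimal composites is again one if its off-diagonal terms vanish, or
cancel in pairs because the same map of odd degree occurs twice. -/
theorem cinf_comp_cinf (f : DegMap V' V'' a') (f' : DegMap V V' a) (g : DegMap W' W'' 0)
    (g' : DegMap W W' 0) (h : DegMap W' W'' b) (h' : DegMap W W' b') (h₁ : a' + b = c)
    {e : ℤ} (h₁' : a + b' = c') (h₂ : c' + c = e) {a'' b'' : ℤ} (h₃ : a + a' = a'')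
    (h₄ : b' + b = b'') (h₅ : a'' + b'' = e)
    (H : h.comp g' (zero_add b) = 0 ∨ g.comp h' (add_zero b') = 0 ∨
      Odd b ∧ (h.comp g' (zero_add b)).Same (g.comp h' (add_zero b'))) :
    (cinf f g h h₁).comp (cinf f' g' h' h₁') h₂ = (b * a).negOnePow •
      cinf (f.comp f' h₃) (g.comp g' (add_zero 0)) (h.comp h' h₄) h₅ := by
  subst h₃
  subst h₄
  refine degMap_ext_gmk fun X _ d d' hh n φ p q hd μ ν => ?_
  rw [DegMap.comp_app _ _ _ rfl (by omega), DegMap.smul_app, cinf_gmk, cinf_gmk, map_sum,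
    Finset.smul_sum]
  set E : Fin n → Fin n → (comp V'' W'').obj X d' := fun i i' =>
    gapp (f.comp f' rfl) (fun j => (infD g h (j = i)).comp (infD g' h' (j = i')) rfl) φ p q
      (two_shiftSum hd (by omega) i i') μ ν with hE
  have e1 : ∀ i', (cinf f g h h₁).app X (d + c') d' (by omega)
      (infs b' p q i' • gapp f' (fun j => infD g' h' (j = i')) φ p q
        (shiftSum hd (by omega) i') μ ν) =
      ∑ i, (infs b' p q i' * infs b (p + a) (fun j => q j + if j = i' then b' else 0) i) •
        E i i' := by
    intro i'
    rw [LinearMap.map_smul_of_tower, gapp, cinf_gmk, Finset.smul_sum]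
    refine sum_congr rfl fun i _ => ?_
    rw [gapp_gapp, smul_smul]
  rw [sum_congr rfl fun i' _ => e1 i']
  have e2 : ∀ i, infs b' p q i * infs b (p + a) (fun j => q j + if j = i then b' else 0) i =
      (b * a).negOnePow * infs (b' + b) p q i := by
    intro i
    rw [infs_shift]
    have : infs b p (fun j => q j + if j = i then b' else 0) i = infs b p q i := by
      rw [infs, infs]
      congr 3
      refine sum_congr rfl fun j _ => ?_
      split_ifs with h1 h2
      · exact absurd h2 h1.ne
      · rw [add_zero]
      · rfl
    rw [this, mul_left_comm, infs, infs, infs, ← Int.negOnePow_add (b' * _)]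
    congr 2
    ring
  have e3 : ∀ i, E i i = gapp (f.comp f' rfl) (fun j => infD (g.comp g' (add_zero 0)) (h.comp h' rfl)
      (j = i)) φ p q (shiftSum hd (by omega) i) μ ν := by
    intro i
    refine gapp_congr (.refl _) fun j => ?_
    by_cases hj : j = i
    · exact (DegMap.Same.comp (infD_pos _ _ hj) (infD_pos _ _ hj) _ rfl).trans
        (infD_pos _ _ hj).symm
    · exact (DegMap.Same.comp (infD_neg _ _ hj) (infD_neg _ _ hj) _ (add_zero 0)).trans
        (infD_neg _ _ hj).symm
  have e4 : ∑ i', ∑ i, (if i = i' then 0 else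
      (infs b' p q i' * infs b (p + a) (fun j => q j + if j = i' then b' else 0) i) •
        E i i') = 0 := by
    rcases H with H | H | ⟨ho, hs⟩
    · refine sum_eq_zero fun i' _ => sum_eq_zero fun i _ => ?_
      split_ifs with hi
      · rfl
      · rw [hE]
        dsimp only
        rw [gapp_zero (b := b) i, smul_zero]
        rw [← H]
        exact DegMap.Same.comp (infD_pos _ _ rfl) (infD_neg _ _ hi) _ _
    · refine sum_eq_zero fun i' _ => sum_eq_zero fun i _ => ?_
      split_ifs with hi
      · rfl
      · rw [hE]
        dsimp only
        rw [gapp_zero (b := b') i', smul_zero]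
        rw [← H]
        exact DegMap.Same.comp (infD_neg _ _ (Ne.symm hi)) (infD_pos _ _ rfl) _ _
    · obtain rfl : b = b' := hs.1
      rw [← Finset.sum_product']
      refine Finset.sum_involution (fun x _ => (x.2, x.1)) ?_ ?_ (fun _ _ => Finset.mem_univ _)
        (fun _ _ => rfl)
      · rintro ⟨i', i⟩ _
        dsimp only
        by_cases hi : i = i'
        · rw [if_pos hi, if_pos hi.symm, add_zero]
        · rw [if_neg hi, if_neg (Ne.symm hi)]
          have hEE : E i i' = E i' i := by
            refine gapp_congr (.refl _) fun j => ?_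
            by_cases hj : j = i
            · subst hj
              exact (DegMap.Same.comp (infD_pos _ _ rfl) (infD_neg _ _ hi) _ _).trans
                (hs.trans (DegMap.Same.comp (infD_neg _ _ hi) (infD_pos _ _ rfl) _ _).symm)
            · by_cases hj' : j = i'
              · subst hj'
                exact (DegMap.Same.comp (infD_neg _ _ (Ne.symm hi)) (infD_pos _ _ rfl) _ _).trans
                  (hs.symm.trans (DegMap.Same.comp (infD_pos _ _ rfl) (infD_neg _ _ hj) _ _).symm)
              · exact (DegMap.Same.comp (infD_neg _ _ hj) (infD_neg _ _ hj') _ (add_zero 0)).trans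
                  (DegMap.Same.comp (infD_neg _ _ hj') (infD_neg _ _ hj) _ (add_zero 0)).symm
          have hsg : ∀ i i' : Fin n, infs b p q i' *
              infs b (p + a) (fun j => q j + if j = i' then b else 0) i =
              ((b * a).negOnePow * (infs b p q i * infs b p q i')) *
                (if i' < i then -1 else 1) := by
            intro i i'
            rw [infs_shift]
            have : infs b p (fun j => q j + if j = i' then b else 0) i =
                infs b p q i * (if i' < i then -1 else 1) := by
              have h1 : (if i' < i then (-1 : ℤˣ) else 1) =
                  (b * if i' < i then b else 0).negOnePow := by
                split_ifs
                · rw [Int.negOnePow_odd _ (ho.mul ho)]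
                · rw [mul_zero, Int.negOnePow_zero]
              rw [h1, infs, infs, ← Int.negOnePow_add]
              congr 1
              have h2 : ∑ j, (if j < i then q j + (if j = i' then b else 0) else 0) =
                  ∑ j, (if j < i then q j else 0) + if i' < i then b else 0 := by
                have : (if i' < i then b else 0) = ∑ j, if j = i' then (if j < i then b else 0) else 0 := by
                  simp
                rw [this, ← sum_add_distrib]
                refine sum_congr rfl fun j _ => ?_
                split_ifs <;> simp
              rw [h2]
              ring
            rw [this]
            ac_rfl
          rw [hEE, hsg i i', hsg i' i, mul_comm (infs b p q i')]
          rcases lt_or_gt_of_ne hi with hlt | hlt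
          · rw [if_neg hlt.not_gt, if_pos hlt, mul_one, mul_neg_one, Units.neg_smul, add_neg_cancel]
          · rw [if_pos hlt, if_neg hlt.not_gt, mul_one, mul_neg_one, Units.neg_smul, neg_add_cancel]
      · rintro ⟨i', i⟩ _ h0 h1
        dsimp only at h0
        rw [if_pos (by simpa using congrArg Prod.fst h1)] at h0
        exact h0 rfl
  have e5 : ∀ (F : Fin n → (comp V'' W'').obj X d') (i' : Fin n),
      ∑ i, F i = ∑ i, (if i = i' then 0 else F i) + F i' := by
    intro F i'
    have : ∀ i, F i = (if i = i' then 0 else F i) + if i = i' then F i else 0 := by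
      intro i; split_ifs <;> simp
    rw [sum_congr rfl fun i _ => this i, sum_add_distrib]
    simp
  rw [sum_congr rfl fun i' _ => e5 _ i', sum_add_distrib, e4, zero_add]
  refine sum_congr rfl fun i _ => ?_
  rw [e2, e3, smul_smul]

end rules

end OperadicBar

namespace OperadicBar
open Finset (sum_congr sum_add_distrib sum_comm sum_eq_zero)
variable {K : Type u} [Field K]

/-! ### Linearity of composites in each factor -/

section linearity

variable {V V' V'' W W' W'' U U' : SMod K} {a a' b b' c c' k : ℤ}

theorem gmk_add_left {X I : Type} [Finite X] [Fintype I] [LinearOrder I] {d : ℤ} (f : X → I)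
    (p : ℤ) (q : I → ℤ) (hd : p + ∑ i, q i = d) (μ μ' : V.obj I p)
    (ν : ∀ i, W.obj {x // f x = i} (q i)) :
    gmk f p q hd (μ + μ') ν = gmk f p q hd μ ν + gmk f p q hd μ' ν :=
  map_add (gmkL f p q hd ν) μ μ'

/-- A generator depends linearly on each of its upper entries. -/
theorem gmk_entry {X I : Type} [Finite X] [Fintype I] [LinearOrder I] {d : ℤ} (f : X → I)
    (p : ℤ) (q : I → ℤ) (hd : p + ∑ i, q i = d) (μ : V.obj I p)
    (ν : ∀ i, W.obj {x // f x = i} (q i)) (i : I) :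
    ∃ L : W.obj {x // f x = i} (q i) →ₗ[K] (comp V W).obj X d,
      ∀ ν' : (∀ i, W.obj {x // f x = i} (q i)), (∀ j, j ≠ i → ν' j = ν j) →
        gmk f p q hd μ ν' = L (ν' i) := by
  obtain ⟨l, rfl⟩ := (finEnum I).surjective i
  refine ⟨(mkM (gshape f p q hd) (V.map (finEnum I).symm.toEquiv p μ)).toLinearMap
    (fun l => W.map (fibEquiv fun _ => (OrderIso.symm_apply_eq _).symm) _ (ν (finEnum I l))) l ∘ₗ
      W.map (fibEquiv fun _ => (OrderIso.symm_apply_eq _).symm) _, fun ν' h => ?_⟩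
  refine congrArg (mkM (gshape f p q hd) (V.map (finEnum I).symm.toEquiv p μ)) (funext fun l' => ?_)
  by_cases hl : l' = l
  · subst hl
    rw [Function.update_self]
  · rw [Function.update_of_ne hl, h]
    exact fun h' => hl ((finEnum I).injective h')

theorem gapp_add_left (f f' : DegMap V V' a) {X I : Type} [Finite X] [Fintype I] [LinearOrder I]
    {d : ℤ} {B : I → ℤ} (F : ∀ j, DegMap W W' (B j)) (φ : X → I) (p : ℤ)
    (q : I → ℤ) (hd : (p + a) + ∑ j, (q j + B j) = d) (μ : V.obj I p)
    (ν : ∀ i, W.obj {x // φ x = i} (q i)) :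
    gapp (f + f') F φ p q hd μ ν = gapp f F φ p q hd μ ν + gapp f' F φ p q hd μ ν :=
  gmk_add_left _ _ _ _ _ _ _

theorem compMap_add_left (f f' : DegMap V V' a) (g : DegMap W W' 0) :
    compMap (f + f') g = compMap f g + compMap f' g := by
  refine degMap_ext_gmk fun X _ d d' h n φ p q hd μ ν => ?_
  rw [DegMap.add_app, compMap_gmk, compMap_gmk, compMap_gmk, gapp_add_left]

theorem cinf_add_left (f f' : DegMap V V' a) (g : DegMap W W' 0) (h : DegMap W W' b)
    (hc : a + b = c) : cinf (f + f') g h hc = cinf f g h hc + cinf f' g h hc := by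
  refine degMap_ext_gmk fun X _ d d' hh n φ p q hd μ ν => ?_
  rw [DegMap.add_app, cinf_gmk, cinf_gmk, cinf_gmk, ← sum_add_distrib]
  refine sum_congr rfl fun i _ => ?_
  rw [gapp_add_left, smul_add]

theorem cinf_add_right (f : DegMap V V' a) (g : DegMap W W' 0) (h h' : DegMap W W' b)
    (hc : a + b = c) : cinf f g (h + h') hc = cinf f g h hc + cinf f g h' hc := by
  refine degMap_ext_gmk fun X _ d d' hh n φ p q hd μ ν => ?_
  rw [DegMap.add_app, cinf_gmk, cinf_gmk, cinf_gmk, ← sum_add_distrib]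
  refine sum_congr rfl fun i _ => ?_
  rw [← smul_add]
  refine congrArg (infs b p q i • ·) ?_
  obtain ⟨L, hL⟩ := gmk_entry φ (p + a) (fun j => q j + if j = i then b else 0)
    (shiftSum (d' := d') (b := b) hd (by omega) i) (f.app _ p _ rfl μ)
    (fun j => (infD g h (j = i)).app _ (q j) _ rfl (ν j)) i
  have e : ∀ (h₁ : DegMap W W' b) j, j ≠ i → (infD g h₁ (j = i)).app _ (q j) _ rfl (ν j) =
      (infD g h (j = i)).app _ (q j) _ rfl (ν j) := fun h₁ j hj => by
    rw [(infD_neg g h₁ hj).app_eq _ (by rw [if_neg hj]), (infD_neg g h hj).app_eq]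
  have hi : ∀ h₁ : DegMap W W' b, (infD g h₁ (i = i)).app _ (q i) _ rfl (ν i) =
      h₁.app _ (q i) _ (by rw [if_pos rfl]) (ν i) := fun h₁ =>
    (infD_pos g h₁ rfl).app_eq _ _ _
  rw [gapp, gapp, gapp, hL _ (e _), hL _ (e _), hL _ (e _), hi, hi, hi, ← map_add]
  rfl

/-- `compMap f g` as a homomorphism in `f`. -/
noncomputable def compMapHom (g : DegMap W W' 0) :
    DegMap V V' a →+ DegMap (comp V W) (comp V' W') a :=
  AddMonoidHom.mk' (fun f => compMap f g) fun f f' => compMap_add_left f f' g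

/-- `cinf f g h` as a homomorphism in `h`. -/
noncomputable def cinfHom (f : DegMap V V' a) (g : DegMap W W' 0) (hc : a + b = c) :
    DegMap W W' b →+ DegMap (comp V W) (comp V' W') c :=
  AddMonoidHom.mk' (fun h => cinf f g h hc) fun h h' => cinf_add_right f g h h' hc

/-- `cinf f g h` as a homomorphism in `f`. -/
noncomputable def cinfHomLeft (g : DegMap W W' 0) (h : DegMap W W' b) (hc : a + b = c) :
    DegMap V V' a →+ DegMap (comp V W) (comp V' W') c :=
  AddMonoidHom.mk' (fun f => cinf f g h hc) fun f f' => cinf_add_left f f' g h hc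

theorem compMap_zero_left (g : DegMap W W' 0) : compMap (0 : DegMap V V' a) g = 0 :=
  map_zero (compMapHom g)

theorem compMap_sub_left (f f' : DegMap V V' a) (g : DegMap W W' 0) :
    compMap (f - f') g = compMap f g - compMap f' g :=
  map_sub (compMapHom g) f f'

theorem cinf_zero_right (f : DegMap V V' a) (g : DegMap W W' 0) (hc : a + b = c) :
    cinf f g (0 : DegMap W W' b) hc = 0 :=
  map_zero (cinfHom f g hc)

theorem cinf_sub_right (f : DegMap V V' a) (g : DegMap W W' 0) (h h' : DegMap W W' b)
    (hc : a + b = c) : cinf f g (h - h') hc = cinf f g h hc - cinf f g h' hc :=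
  map_sub (cinfHom f g hc) h h'

theorem cinf_zero_left (g : DegMap W W' 0) (h : DegMap W W' b) (hc : a + b = c) :
    cinf (0 : DegMap V V' a) g h hc = 0 :=
  map_zero (cinfHomLeft g h hc)

theorem cinf_neg_left (f : DegMap V V' a) (g : DegMap W W' 0) (h : DegMap W W' b)
    (hc : a + b = c) : cinf (-f) g h hc = -cinf f g h hc :=
  map_neg (cinfHomLeft g h hc) f

theorem cinf_sub_left (f f' : DegMap V V' a) (g : DegMap W W' 0) (h : DegMap W W' b)
    (hc : a + b = c) : cinf (f - f') g h hc = cinf f g h hc - cinf f' g h hc :=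
  map_sub (cinfHomLeft g h hc) f f'

end linearity

/-! ### Naturality of the associator -/

section assocNat

variable {V V' W W' U U' : SMod K} {X I J : Type} [Finite X] [Fintype I] [LinearOrder I]
  [Fintype J] [LinearOrder J] {a : ℤ} {b : I → ℤ} {c : J → ℤ}

theorem assoc_gapp (f : DegMap V V' a) (G : ∀ i, DegMap W W' (b i))
    (H : ∀ j, DegMap U U' (c j)) (φ : X → J) {P p d : ℤ} (s : J → ℤ) (fn : J → I) (q : I → ℤ)
    (hP : (p + a) + ∑ i, (q i + b i) = P) (hd : P + ∑ j, (s j + c j) = d) (D : I → ℤ)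
    (hD : (p + a) + ∑ i, D i = d)
    (hDi : ∀ i, (q i + b i) + ∑ j : {j // fn j = i}, (s j + c j) = D i)
    (μ : V.obj I p) (w : ∀ i, W.obj {j // fn j = i} (q i)) (ρ : ∀ j, U.obj {x // φ x = j} (s j)) :
    (assoc V' W' U').app X d d (add_zero d)
      (gmk (V := comp V' W') φ P (fun j => s j + c j) hd (gapp f G fn p q hP μ w)
        (fun j => (H j).app _ (s j) _ rfl (ρ j))) =
      asgn (fun j => s j + c j) fn (fun i => q i + b i) •
        gmk (W := comp W' U') (fun x => fn (φ x)) (p + a) D hD (f.app _ p _ rfl μ)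
          (fun i => gapp (G i) (fun j : {j // fn j = i} => H j) (X := {x // fn (φ x) = i})
            (fun x => ⟨φ x, x.2⟩) (q i) (fun j => s j) (hDi i) (w i)
            (fun j => U.map (fibFib φ fn i j) _ (ρ j))) := by
  obtain rfl : (fun i => (q i + b i) + ∑ j : {j // fn j = i}, (s j + c j)) = D := funext hDi
  rw [gapp, assoc_gmk]
  refine congrArg (asgn (fun j => s j + c j) fn (fun i => q i + b i) • ·) ?_
  refine congrArg (gmk (W := comp W' U') (fun x => fn (φ x)) (p + a) _ hD (f.app _ p _ rfl μ))
    (funext fun i => ?_)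
  refine congrArg (gmk _ _ _ _ _) (funext fun j => ?_)
  exact ((H j).natural _ _ _ _ _).symm

theorem sum_fibre {M : Type*} [AddCommMonoid M] (f : J → I) (i : I)
    (F : J → M) : ∑ j : {j // f j = i}, F j = ∑ j, if f j = i then F j else 0 := by
  rw [← Finset.sum_filter]
  exact (Finset.sum_subtype _ (by simp) F).symm

/-- The signs when a map of degree `b` is applied to a vertex in the middle level. -/
theorem asgn_infs_mid (b p : ℤ) (s : J → ℤ) (f : J → I) (q : I → ℤ) (i₀ : I) :
    infs b p q i₀ * asgn s f (fun i => q i + if i = i₀ then b else 0) =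
      asgn s f q * infs b p (fun i => q i + ∑ j : {j // f j = i}, s j) i₀ := by
  simp only [infs, asgn, ← Int.negOnePow_add, sum_fibre]
  congr 1
  have e1 : ∑ j, ∑ i, (if f j < i then s j * (q i + if i = i₀ then b else 0) else 0) =
      ∑ j, ∑ i, (if f j < i then s j * q i else 0) + b * ∑ j, if f j < i₀ then s j else 0 := by
    rw [Finset.mul_sum, ← sum_add_distrib]
    refine sum_congr rfl fun j _ => ?_
    have : b * (if f j < i₀ then s j else 0) =
        ∑ i, if i = i₀ then (if f j < i then b * s j else 0) else 0 := by simp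
    rw [this, ← sum_add_distrib]
    refine sum_congr rfl fun i _ => ?_
    split_ifs <;> ring
  have e2 : ∑ i, (if i < i₀ then q i + ∑ j, (if f j = i then s j else 0) else 0) =
      ∑ i, (if i < i₀ then q i else 0) + ∑ j, if f j < i₀ then s j else 0 := by
    have : ∀ i, (if i < i₀ then q i + ∑ j, (if f j = i then s j else 0) else 0) =
        (if i < i₀ then q i else 0) + ∑ j, if f j = i then (if f j < i₀ then s j else 0) else 0 := by
      intro i
      split_ifs with h
      · congr 1
        refine sum_congr rfl fun j _ => ?_
        split_ifs with h1 h2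
        · rfl
        · exact absurd (h1 ▸ h) h2
        · rfl
      · rw [zero_add, sum_eq_zero]
        intro j _
        split_ifs with h1 h2
        · exact absurd (h1 ▸ h2) h
        · rfl
        · rfl
    rw [sum_congr rfl fun i _ => this i, sum_add_distrib]
    congr 1
    rw [sum_comm]
    simp
  rw [e1, e2]
  ring

/-- The signs when a map of degree `b` is applied to a vertex in the top level. -/
theorem asgn_infs_top (b p : ℤ) {P : ℤ} (s : J → ℤ) (f : J → I) (q : I → ℤ)
    (hP : p + ∑ i, q i = P) (j₀ : J) :
    infs b P s j₀ * asgn (fun j => s j + if j = j₀ then b else 0) f q =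
      asgn s f q * (infs b p (fun i => q i + ∑ j : {j // f j = i}, s j) (f j₀) *
        infs b (q (f j₀)) (fun j : {j // f j = f j₀} => s j) ⟨j₀, rfl⟩) := by
  have h0 : ∑ j : {j // f j = f j₀}, (if j < ⟨j₀, rfl⟩ then s j else 0) =
      ∑ j, if f j = f j₀ then (if j < j₀ then s j else 0) else 0 := by
    rw [← sum_fibre f (f j₀) fun j => if j < j₀ then s j else 0]
    rfl
  simp only [infs, asgn, ← Int.negOnePow_add, h0, sum_fibre]
  subst hP
  apply negOnePow_congr
  push_cast
  have e1 : ∑ j, ∑ i, (if f j < i then ((s j : ZMod 2) + if j = j₀ then (b : ZMod 2) else 0) * q i else 0) =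
      ∑ j, ∑ i, (if f j < i then (s j : ZMod 2) * q i else 0) +
        b * ∑ i, if f j₀ < i then (q i : ZMod 2) else 0 := by
    have : (b : ZMod 2) * ∑ i, (if f j₀ < i then (q i : ZMod 2) else 0) =
        ∑ j, if j = j₀ then ∑ i, (if f j < i then (b : ZMod 2) * q i else 0) else 0 := by
      simp [Finset.mul_sum]
    rw [this, ← sum_add_distrib]
    refine sum_congr rfl fun j _ => ?_
    split_ifs with h
    · rw [← sum_add_distrib]
      refine sum_congr rfl fun i _ => ?_
      split_ifs <;> ring
    · simp
  have e2 : ∑ j, ∑ j', (if j < j' ∧ f j' < f j then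
        ((s j : ZMod 2) + if j = j₀ then (b : ZMod 2) else 0) *
          ((s j' : ZMod 2) + if j' = j₀ then (b : ZMod 2) else 0) else 0) =
      ∑ j, ∑ j', (if j < j' ∧ f j' < f j then (s j : ZMod 2) * s j' else 0) +
        b * (∑ j, (if j₀ < j ∧ f j < f j₀ then (s j : ZMod 2) else 0)) +
        b * (∑ j, (if j < j₀ ∧ f j₀ < f j then (s j : ZMod 2) else 0)) := by
    have h1 : (b : ZMod 2) * (∑ j, (if j₀ < j ∧ f j < f j₀ then (s j : ZMod 2) else 0)) =
        ∑ j, ∑ j', if j = j₀ then (if j < j' ∧ f j' < f j then (b : ZMod 2) * s j' else 0) else 0 := by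
      rw [sum_comm]; simp [Finset.mul_sum]
    have h2 : (b : ZMod 2) * (∑ j, (if j < j₀ ∧ f j₀ < f j then (s j : ZMod 2) else 0)) =
        ∑ j, ∑ j', if j' = j₀ then (if j < j' ∧ f j' < f j then (b : ZMod 2) * s j else 0) else 0 := by
      simp [Finset.mul_sum]
    rw [h1, h2, ← sum_add_distrib, ← sum_add_distrib]
    refine sum_congr rfl fun j _ => ?_
    rw [← sum_add_distrib, ← sum_add_distrib]
    refine sum_congr rfl fun j' _ => ?_
    by_cases h : j < j' ∧ f j' < f j
    · by_cases hj : j = j₀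
      · have : j' ≠ j₀ := fun h' => (hj ▸ h' ▸ h.1).ne rfl
        rw [if_pos h, if_pos h, if_pos hj, if_neg this, if_pos hj, if_pos h, if_neg this]; ring
      · by_cases hj' : j' = j₀
        · rw [if_pos h, if_pos h, if_neg hj, if_pos hj', if_neg hj, if_pos hj', if_pos h]; ring
        · rw [if_pos h, if_pos h, if_neg hj, if_neg hj', if_neg hj, if_neg hj']; ring
    · simp [h]
  have e3 : ∑ i, (if i < f j₀ then (q i : ZMod 2) + ∑ j, (if f j = i then (s j : ZMod 2) else 0) else 0) =
      ∑ i, (if i < f j₀ then (q i : ZMod 2) else 0) + ∑ j, if f j < f j₀ then (s j : ZMod 2) else 0 := by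
    have : ∀ i, (if i < f j₀ then (q i : ZMod 2) + ∑ j, (if f j = i then (s j : ZMod 2) else 0) else 0) =
        (if i < f j₀ then (q i : ZMod 2) else 0) +
          ∑ j, if f j = i then (if f j < f j₀ then (s j : ZMod 2) else 0) else 0 := by
      intro i
      split_ifs with h
      · congr 1
        refine sum_congr rfl fun j _ => ?_
        split_ifs with h1 h2
        · rfl
        · exact absurd (h1 ▸ h) h2
        · rfl
      · rw [zero_add, sum_eq_zero]
        intro j _
        split_ifs with h1 h2
        · exact absurd (h1 ▸ h2) h
        · rfl
        · rfl
    rw [sum_congr rfl fun i _ => this i, sum_add_distrib]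
    congr 1
    rw [sum_comm]
    simp
  have e4 : ∑ i, (q i : ZMod 2) = ∑ i, (if i < f j₀ then (q i : ZMod 2) else 0) + q (f j₀) +
      ∑ i, (if f j₀ < i then (q i : ZMod 2) else 0) := by
    have : (q (f j₀) : ZMod 2) = ∑ i, if i = f j₀ then (q i : ZMod 2) else 0 := by simp
    rw [this, ← sum_add_distrib, ← sum_add_distrib]
    refine sum_congr rfl fun i _ => ?_
    rcases lt_trichotomy i (f j₀) with h | h | h
    · simp [h, h.ne, h.not_gt]
    · simp [h]
    · simp [h, h.ne', h.not_gt]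
  have e5 : ∑ j, (if j < j₀ then (s j : ZMod 2) else 0) +
        ∑ j, (if j₀ < j ∧ f j < f j₀ then (s j : ZMod 2) else 0) +
        ∑ j, (if j < j₀ ∧ f j₀ < f j then (s j : ZMod 2) else 0) =
      ∑ j, (if f j < f j₀ then (s j : ZMod 2) else 0) +
        ∑ j, if f j = f j₀ then (if j < j₀ then (s j : ZMod 2) else 0) else 0 := by
    simp only [← sum_add_distrib]
    refine sum_congr rfl fun j _ => ?_
    rcases lt_trichotomy j j₀ with h | h | h
    · rcases lt_trichotomy (f j) (f j₀) with h' | h' | h'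
      · simp [h, h', h'.ne, h'.not_gt, h.not_gt]
      · simp [h, h']
      · simp [h, h', h'.ne', h'.not_gt, h.not_gt, two_add]
    · simp [h]
    · rcases lt_trichotomy (f j) (f j₀) with h' | h' | h'
      · simp [h, h', h'.ne, h.not_gt]
      · simp [h', h.not_gt]
      · simp [h', h'.ne', h'.not_gt, h.not_gt]
  rw [e1, e2, e3, e4]
  have h2 : (2 : ZMod 2) = 0 := rfl
  linear_combination (b : ZMod 2) * e5 + (b : ZMod 2) * (∑ i, if f j₀ < i then (q i : ZMod 2) else 0) * h2

end assocNat

end OperadicBar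

namespace OperadicBar
variable {K : Type u} [Field K]

/-! ### Compatibility of the associator with homogeneous maps -/

section assocRules

variable {V V' W W' U U' : SMod K} {a b c : ℤ}

theorem assoc_comp_compMap (f : DegMap V V' a) (g : DegMap W W' 0) (h : DegMap U U' 0)
    (h₁ : a + 0 = a) (h₂ : 0 + a = a) :
    (assoc V' W' U').comp (compMap (compMap f g) h) h₁ =
      (compMap f (compMap g h)).comp (assoc V W U) h₂ := by
  refine degMap_ext_gmk₂ fun X _ d d' hh m φ P s hd n fn p q hP μ w ρ => ?_
  have hD : (p + a) + ∑ i, (q i + ∑ j : {j // fn j = i}, s j + 0) = d' := by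
    have := fibSum s fn q hd hP
    simp only [add_zero]; omega
  have hPa : P + a = P + a := rfl
  rw [DegMap.comp_app _ _ _ hh (by omega), DegMap.comp_app _ _ _ (add_zero d) hh, assoc_gmk,
    LinearMap.map_smul_of_tower, compMap_gmk, compMap_gmk, gapp, compMap_gmk,
    assoc_gapp f (fun _ => g) (fun _ => h) φ s fn q _ _ _ hD
      (fun i => by simp only [add_zero])]
  have e : asgn (fun j => s j + 0) fn (fun i => q i + 0) = asgn s fn q := by
    simp only [add_zero]
  rw [e]
  refine congrArg (asgn s fn q • ·) ?_
  refine congrArg (gmk (W := comp W' U') (fun x => fn (φ x)) (p + a) _ hD (f.app _ p _ rfl μ))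
    (funext fun i => ?_)
  exact (compMap_gmk _ _ _ _ _ _ _ _ _).symm

/-- Naturality of the associator when the marked vertex lies in the middle level. -/
theorem assoc_comp_cinf_mid (f : DegMap V V' a) (g : DegMap W W' 0) (g' : DegMap W W' b)
    (h : DegMap U U' 0) (h₀ : a + b = c) (h₁ : c + 0 = c) (h₂ : 0 + c = c) :
    (assoc V' W' U').comp (compMap (cinf f g g' h₀) h) h₁ =
      (cinf f (compMap g h) (compMap g' h) h₀).comp (assoc V W U) h₂ := by
  refine degMap_ext_gmk₂ fun X _ d d' hh m φ P s hd n fn p q hP μ w ρ => ?_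
  rw [DegMap.comp_app _ _ _ hh (by omega), DegMap.comp_app _ _ _ (add_zero d) hh, assoc_gmk,
    LinearMap.map_smul_of_tower, compMap_gmk, cinf_gmk, gapp, cinf_gmk, Finset.smul_sum]
  have key : ∀ i, (assoc V' W' U').app X d' d' (add_zero d')
      (gmk (V := comp V' W') φ (P + c) (fun j => s j + 0) (by simp only [add_zero]; omega)
        (infs b p q i • gapp f (fun j => infD g g' (j = i)) fn p q
          (shiftSum (d' := P + c) hP (by omega) i) μ w) (fun j => h.app _ (s j) _ rfl (ρ j))) =
      asgn s fn q • infs b p (fun i => q i + ∑ j : {j // fn j = i}, s j) i •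
        gapp f (fun j => infD (compMap g h) (compMap g' h) (j = i)) (fun x => fn (φ x)) p
        (fun i => q i + ∑ j : {j // fn j = i}, s j)
        (shiftSum (d' := d') (fibSum s fn q hd hP) (by omega) i) μ
        (fun i => gmk (I := {j // fn j = i}) (fun x => ⟨φ x, x.2⟩) (q i) (fun j => s j) rfl (w i)
          (fun j => U.map (fibFib φ fn i j) _ (ρ j))) := by
    intro i
    have e1 := assoc_gapp f (fun j => infD g g' (j = i)) (fun _ => h) φ s fn q
        (shiftSum (d' := P + c) hP (by omega) i) (d := d') (by simp only [add_zero]; omega)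
        (fun j => q j + ∑ j' : {j' // fn j' = j}, s j' + if j = i then b else 0)
        (shiftSum (d' := d') (fibSum s fn q hd hP) (by omega) i)
        (fun j => by simp only [add_zero]; ring) μ w ρ
    have e2 := LinearMap.map_smul_of_tower (gmkL (V := comp V' W') (d := d') φ (P + c) (fun j => s j + 0) (by simp only [add_zero]; omega) (fun j => h.app _ (s j) _ rfl (ρ j))) (infs b p q i)
      (gapp f (fun j => infD g g' (j = i)) fn p q
          (shiftSum (d' := P + c) hP (by omega) i) μ w)
    refine (congrArg ((assoc V' W' U').app X d' d' (add_zero d')) e2).trans ?_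
    rw [LinearMap.map_smul_of_tower]
    refine (congrArg (infs b p q i • ·) e1).trans ?_
    have e3 : asgn (fun j => s j + 0) fn (fun j => q j + if j = i then b else 0) =
      asgn s fn (fun j => q j + if j = i then b else 0) := by simp only [add_zero]
    rw [e3]
    rw [smul_smul, smul_smul, asgn_infs_mid]
    refine congrArg ((_ : ℤˣ) • ·) ?_
    refine congrArg (gmk (W := comp W' U') (fun x => fn (φ x)) (p + a) _ _ (f.app _ p _ rfl μ))
      (funext fun j => ?_)
    by_cases hj : j = i
    · rw [(infD_pos (compMap g h) (compMap g' h) hj).app_eq _ (by dsimp only; rw [if_pos hj]), compMap_gmk]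
      exact gapp_congr (infD_pos _ _ hj) fun _ => .refl _
    · rw [(infD_neg (compMap g h) (compMap g' h) hj).app_eq _ (by dsimp only; rw [if_neg hj]), compMap_gmk]
      exact gapp_congr (infD_neg _ _ hj) fun _ => .refl _
  have e4 := map_sum (gmkL (V := comp V' W') (d := d') φ (P + c) (fun j => s j + 0) (by simp only [add_zero]; omega) (fun j => h.app _ (s j) _ rfl (ρ j))) (fun i => infs b p q i • gapp f (fun j => infD g g' (j = i)) fn p q
          (shiftSum (d' := P + c) hP (by omega) i) μ w) Finset.univ
  refine (congrArg ((assoc V' W' U').app X d' d' (add_zero d')) e4).trans ?_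
  rw [map_sum]
  exact Finset.sum_congr rfl fun i _ => key i

/-- Naturality of the associator when the marked vertex lies in the top level: it is then a marked vertex
of a marked block. -/
theorem assoc_comp_cinf_top (f : DegMap V V' a) (g : DegMap W W' 0) (h : DegMap U U' 0)
    (h' : DegMap U U' b) (h₀ : a + b = c) (h₁ : c + 0 = c) (h₂ : 0 + c = c) (h₃ : 0 + b = b) :
    (assoc V' W' U').comp (cinf (compMap f g) h h' h₀) h₁ =
      (cinf f (compMap g h) (cinf g h h' h₃) h₀).comp (assoc V W U) h₂ := by
  refine degMap_ext_gmk₂ fun X _ d d' hh m φ P s hd n fn p q hP μ w ρ => ?_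
  rw [DegMap.comp_app _ _ _ hh (by omega), DegMap.comp_app _ _ _ (add_zero d) hh, assoc_gmk,
    LinearMap.map_smul_of_tower, cinf_gmk, cinf_gmk, map_sum, Finset.smul_sum,
    ← Finset.sum_fiberwise Finset.univ fn]
  refine Finset.sum_congr rfl fun i _ => ?_
  set S : Fin n → ℤ := fun i => q i + ∑ j : {j // fn j = i}, s j with hS
  have hSd : p + ∑ i, S i = d := fibSum s fn q hd hP
  set N : ∀ i, (comp W U).obj {x // fn (φ x) = i} (S i) := fun i =>
    gmk (I := {j // fn j = i}) (fun x => ⟨φ x, x.2⟩) (q i) (fun j => s j) rfl (w i)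
          (fun j => U.map (fibFib φ fn i j) _ (ρ j)) with hN
  obtain ⟨L, hL⟩ := gmk_entry (W := comp W' U') (d := d') (fun x => fn (φ x)) (p + a)
    (fun j => S j + if j = i then b else 0)
    (shiftSum (d' := d') (b := b) hSd (by omega) i) (f.app _ p _ rfl μ)
    (fun j => (infD (compMap g h) (cinf g h h' h₃) (j = i)).app _ (S j) _ rfl (N j)) i
  have hii : S i + b = S i + if i = i then b else 0 := by rw [if_pos rfl]
  have e0 := ((infD_pos (compMap g h) (cinf g h h' h₃) rfl).app_eq rfl hii (N i)).trans
    (cinf_gmk g h h' h₃ hii (X := {x // fn (φ x) = i}) (I := {j // fn j = i})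
      (fun x => ⟨φ x, x.2⟩) (q i) (fun j => s j) rfl (w i)
      (fun j => U.map (fibFib φ fn i j) _ (ρ j)))
  refine Eq.trans ?_ (congrArg (fun z => asgn s fn q • infs b p S i • z)
    (((hL _ fun _ _ => rfl).trans (congrArg L e0)).trans (map_sum L _ _))).symm
  rw [Finset.smul_sum, Finset.smul_sum]
  have hfil : ∀ F : Fin m → (comp V' (comp W' U')).obj X d',
      ∑ j with fn j = i, F j = ∑ j : {j // fn j = i}, F j := fun F =>
    Finset.sum_subtype _ (by simp) F
  rw [hfil]
  refine Finset.sum_congr rfl fun j₀ _ => ?_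
  obtain ⟨j₀, rfl⟩ := j₀
  rw [LinearMap.map_smul_of_tower, LinearMap.map_smul_of_tower, gapp, compMap_gmk]
  have hDi : ∀ i, (q i + 0) + ∑ j : {j // fn j = i}, (s j + if (j : Fin m) = j₀ then b else 0) =
      S i + if i = fn j₀ then b else 0 := fun i => by
    simp only [hS, add_zero, Finset.sum_add_distrib]
    rw [sum_fibre fn i fun j => if j = j₀ then b else 0]
    simp only [← ite_and, and_comm]
    simp only [ite_and, Finset.sum_ite_eq', Finset.mem_univ, if_true, @eq_comm _ (fn j₀), add_assoc]
  have e1 := assoc_gapp f (fun _ => g) (fun j => infD h h' (j = j₀)) φ s fn q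
    (hP := by simp only [add_zero]; omega) (d := d')
    (shiftSum (a := a) (b := b) (d' := d') hd (by omega) j₀)
    (fun j => S j + if j = fn j₀ then b else 0)
    (shiftSum (a := a) (d' := d') (b := b) hSd (by omega) (fn j₀)) hDi μ w ρ
  refine (congrArg (infs b P s j₀ • ·) e1).trans ?_
  have e3 : asgn (fun j => s j + if j = j₀ then b else 0) fn (fun j => q j + 0) =
    asgn (fun j => s j + if j = j₀ then b else 0) fn q := by simp only [add_zero]
  rw [e3, smul_smul, asgn_infs_top b p s fn q hP, smul_smul, smul_smul]
  rw [mul_assoc]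
  refine congrArg ((_ : ℤˣ) • ·) ?_
  have e5 : ∀ i, i ≠ fn j₀ → gapp g (fun j : {j // fn j = i} => infD h h' ((j : Fin m) = j₀))
      (X := {x // fn (φ x) = i}) (I := {j // fn j = i}) (fun x => ⟨φ x, x.2⟩) (q i)
      (fun j => s j) (hDi i) (w i) (fun j => U.map (fibFib φ fn i j) _ (ρ j)) =
      (infD (compMap g h) (cinf g h h' h₃) (i = fn j₀)).app _ (S i) _ rfl (N i) := by
    intro i hi
    rw [(infD_neg (compMap g h) (cinf g h h' h₃) hi).app_eq _ (by rw [if_neg hi]), hN]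
    refine Eq.trans ?_ (compMap_gmk _ _ _ _ _ _ _ _ _).symm
    exact gapp_congr (.refl _) fun j => infD_neg _ _ fun hj => hi (j.2 ▸ congrArg fn hj)
  rw [hL _ e5]
  refine congrArg L (gapp_congr (.refl _) fun j => infD_congr _ _ ?_)
  exact ⟨fun h => Subtype.ext h, fun h => congrArg Subtype.val h⟩

end assocRules

end OperadicBar

namespace OperadicBar
variable {K : Type u} [Field K]

/-! ### The unit isomorphisms -/

section units

variable {V V' W W' : SMod K} {X Y I : Type} [Finite X] [Finite Y] [Fintype I] [LinearOrder I] {a b d d' p : ℤ}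

/-- The element of `I` with all coordinates `1`; it vanishes unless the arity is one and `d = 0`. -/
def unitOne (K : Type u) [Field K] (X : Type) [Finite X] (d : ℤ) : (unit K).obj X d := fun _ => 1

theorem tr_unitOne (e : X ≃ Y) (h : d = d') : (unit K).tr e h (unitOne K X d) = unitOne K Y d' := by
  subst h; rfl

theorem unit_eq_smul (e : {_e : X ≃ Unit // d = 0}) (c : (unit K).obj X d) :
    c = unit.ev K e c • unitOne K X d := by
  funext e'
  obtain rfl : e' = e := Subtype.ext (Equiv.ext fun _ => rfl)
  exact (mul_one _).symm

theorem unit_eq_zero (h : IsEmpty {_e : X ≃ Unit // d = 0}) (c : (unit K).obj X d) : c = 0 :=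
  funext fun e => h.elim e

/-- Everything is in the fibre of the map to a point. -/
def topFib {X : Type} (i : Unit) : X ≃ {x : X // (fun _ : X => ()) x = i} :=
  (Equiv.subtypeUnivEquiv fun _ => rfl).symm

theorem gmk_smul_univ (f : X → I) (p : ℤ) (q : I → ℤ) (hd : p + ∑ i, q i = d) (μ : V.obj I p)
    (ν : ∀ i, W.obj {x // f x = i} (q i)) (c : I → K) :
    gmk f p q hd μ (fun i => c i • ν i) = (∏ i, c i) • gmk f p q hd μ ν := by
  have h := (mkM (V := V) (W := W) (gshape f p q hd) (V.map (finEnum I).symm.toEquiv p μ)).map_smul_univ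
    (fun l => c (finEnum I l)) (fun l => W.map (fibEquiv fun _ => (OrderIso.symm_apply_eq _).symm) _
      (ν (finEnum I l)))
  rw [← Equiv.prod_comp (finEnum I).toEquiv]
  refine Eq.trans ?_ h
  refine congrArg (mkM (gshape f p q hd) (V.map (finEnum I).symm.toEquiv p μ)) (funext fun l => ?_)
  exact map_smul _ _ _

/-- The generator `(1; x)` of `I ∘ V`. -/
noncomputable def lgen (V : SMod K) (X : Type) [Finite X] (d : ℤ) :
    V.obj X d →ₗ[K] (comp (unit K) V).obj X d :=
  (gmk_entry (V := unit K) (W := V) (d := d) (fun _ : X => ()) 0 (fun _ => d) (by simp)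
    (unitOne K Unit 0) (fun i => V.map (topFib i) d 0) ()).choose ∘ₗ V.map (topFib ()) d

theorem lgen_apply (x : V.obj X d) : lgen V X d x = gmk (V := unit K) (W := V) (d := d)
    (fun _ : X => ()) 0 (fun _ => d) (by simp) (unitOne K Unit 0) (fun i => V.map (topFib i) d x) :=
  ((gmk_entry (V := unit K) (W := V) (d := d) (fun _ : X => ()) 0 (fun _ => d) (by simp)
    (unitOne K Unit 0) (fun i => V.map (topFib i) d 0) ()).choose_spec
    (fun i => V.map (topFib i) d x) fun j hj => (hj rfl).elim).symm

theorem gmk_eq_lgen (φ : X → I) (e : I ≃ Unit) (q : I → ℤ) (hd : p + ∑ i, q i = d)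
    (hp : p = 0) (hq : ∀ i, q i = d) (ν : ∀ i, V.obj {x // φ x = i} (q i)) (i : I)
    (he : ∀ x, φ x = i) :
    gmk (V := unit K) φ p q hd (unitOne K I p) ν =
      lgen V X d (V.tr (Equiv.subtypeUnivEquiv he) (hq i) (ν i)) := by
  rw [lgen_apply]
  refine (gmk_eq_mono e (fun i j h => absurd (e.injective rfl : i = j) h.ne) (fun _ => rfl) hp (fun i => hq i)
    (tr_unitOne _ _).symm fun j => ?_).symm
  obtain rfl : j = i := e.injective rfl
  rw [map_tr]
  exact V.tr_congr _ _ _ (fun _ => rfl) _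

theorem leftUnit_gmk (φ : X → I) (e : I ≃ Unit) (q : I → ℤ) (hd : p + ∑ i, q i = d)
    (hp : p = 0) (hq : ∀ i, q i = d) (ν : ∀ i, V.obj {x // φ x = i} (q i)) (i : I)
    (he : ∀ x, φ x = i) (c : (unit K).obj I p) :
    (leftUnit V).app X d d (add_zero d) (gmk (V := unit K) φ p q hd c ν) =
      unit.ev K ⟨e, hp⟩ c • V.tr (Equiv.subtypeUnivEquiv he) (hq i) (ν i) := by
  change leftUnitApp V X d (cmk (gshape φ p q hd) _ _) = _
  rw [leftUnitApp_mk]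
  have : Unique {_e : Fin (Fintype.card I) ≃ Unit // p = 0} :=
    ⟨⟨⟨(finEnum I).toEquiv.trans e, hp⟩⟩, fun _ => Subtype.ext (Equiv.ext fun _ => rfl)⟩
  rw [Fintype.sum_unique]
  refine congrArg₂ (fun (x : K) y => x • y) (unit.ev_tr (K := K) (finEnum I).symm.toEquiv rfl _ _ c) ?_
  rw [← SMod.tr_rfl, SMod.tr_tr]
  dsimp only
  rw [fam ν (show i = finEnum I _ from e.injective rfl), SMod.tr_tr]
  exact V.tr_congr _ _ _ (fun _ => rfl) _

theorem leftUnit_lgen (x : V.obj X d) :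
    (leftUnit V).app X d d (add_zero d) (lgen V X d x) = x := by
  rw [lgen_apply, leftUnit_gmk _ (Equiv.refl Unit) _ _ rfl (fun _ => rfl) _ () (fun _ => rfl)]
  refine (one_smul K _).trans ?_
  rw [tr_map]
  exact V.tr_id _ (fun _ => rfl) _ _

theorem lgen_leftUnit (z : (comp (unit K) V).obj X d) :
    lgen V X d ((leftUnit V).app X d d (add_zero d) z) = z := by
  refine LinearMap.congr_fun (f := lgen V X d ∘ₗ (leftUnit V).app X d d (add_zero d))
    (g := LinearMap.id) (gmk_ext fun k φ p q hd c ν => ?_) z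
  rw [LinearMap.comp_apply, LinearMap.id_apply]
  by_cases h : IsEmpty {_e : Fin k ≃ Unit // p = 0}
  · rw [unit_eq_zero h c, gmk_zero_left, map_zero, map_zero]
  · obtain ⟨e, hp⟩ := not_isEmpty_iff.1 h
    have hq : ∀ i, q i = d := fun i => by
      rw [hp, zero_add, ← Equiv.sum_comp e.symm, Fintype.sum_unique] at hd
      rw [← hd]
      exact congrArg q (e.injective rfl)
    have he : ∀ x, φ x = e.symm () := fun x => e.injective rfl
    rw [leftUnit_gmk φ e q hd hp hq ν _ he, map_smul, ← gmk_eq_lgen φ e q hd hp hq ν _ he]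
    have := map_smul (gmkL φ p q hd ν) (unit.ev K ⟨e, hp⟩ c) (unitOne K (Fin k) p)
    refine this.symm.trans (congrArg (gmkL φ p q hd ν) (unit_eq_smul _ _).symm)

/-- The generator `(μ; 1, …, 1)` of `V ∘ I`. -/
noncomputable def rgen (V : SMod K) (X : Type) [Finite X] (d : ℤ) :
    V.obj X d →ₗ[K] (comp V (unit K)).obj X d :=
  gmkL (W := unit K) (Finite.equivFin X) d (fun _ => 0) (by simp) (fun _ => unitOne K _ 0) ∘ₗ
    V.map (Finite.equivFin X) d

theorem rgen_apply (x : V.obj X d) : rgen V X d x = gmk (W := unit K) (Finite.equivFin X) d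
    (fun _ => 0) (by simp) (V.map (Finite.equivFin X) d x) (fun _ => unitOne K _ 0) := rfl

theorem gmk_eq_rgen (φ : X ≃ I) (q : I → ℤ) (hd : p + ∑ i, q i = d)
    (hp : p = d) (hq : ∀ i, q i = 0) (μ : V.obj I p) :
    gmk (W := unit K) φ p q hd μ (fun i => unitOne K _ _) =
      rgen V X d (V.tr φ.symm hp μ) := by
  have h := gmk_eq (V := V) (W := unit K) (φ.symm.trans (Finite.equivFin X)) (f := φ) (f' := Finite.equivFin X)
    (d := d) (hd := hd) (hd' := by simp) (q' := fun _ => 0) (p' := d)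
    (fun x => by simp) hp hq (μ := μ) (ν := fun i => unitOne K _ _) rfl
    (ν' := fun i => unitOne K _ _) fun i => (tr_unitOne _ _).symm
  have h1 : ksign (φ.symm.trans (Finite.equivFin X)) q = 1 := by simp [ksign, hq]
  rw [h1, one_smul] at h
  rw [← h]
  refine congrArg (gmkL (W := unit K) (Finite.equivFin X) d (fun _ => 0) (by simp) (fun _ => unitOne K _ 0)) ?_
  exact (map_tr V _ _ _ _).symm

theorem rightUnit_gmk (φ : X ≃ I) (q : I → ℤ) (hd : p + ∑ i, q i = d)
    (hp : p = d) (hq : ∀ i, q i = 0) (μ : V.obj I p) :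
    (rightUnit V).app X d d (add_zero d) (gmk (W := unit K) φ p q hd μ (fun i => unitOne K _ _)) =
      V.tr φ.symm hp μ := by
  change rightUnitApp V X d (cmk (gshape φ p q hd) _ _) = _
  rw [rightUnitApp_mk]
  have hb : Function.Bijective (gshape φ p q hd).f := (finEnum I).symm.bijective.comp φ.bijective
  rw [dif_pos ⟨hb, fun i => hq _⟩]
  have : ∏ i, unit.ev K ⟨bijFib hb i, hq (finEnum I i)⟩ ((unit K).map (fibEquiv fun _ => (OrderIso.symm_apply_eq _).symm) _
    (unitOne K {x // φ x = finEnum I i} (q (finEnum I i)))) = 1 := Finset.prod_eq_one fun i _ => rfl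
  refine (congrArg (· • _) this).trans ?_
  rw [one_smul, tr_map]
  refine V.tr_congr _ _ _ (fun i => ?_) _
  obtain ⟨x, rfl⟩ := φ.surjective i
  exact (ofBij_symm hb x).trans (φ.symm_apply_apply x).symm

theorem rightUnit_rgen (x : V.obj X d) :
    (rightUnit V).app X d d (add_zero d) (rgen V X d x) = x := by
  refine (rightUnit_gmk (Finite.equivFin X) _ _ rfl (fun _ => rfl) _).trans ?_
  rw [tr_map]
  exact V.tr_id _ (fun _ => by simp) _ _

theorem rgen_rightUnit (z : (comp V (unit K)).obj X d) :
    rgen V X d ((rightUnit V).app X d d (add_zero d) z) = z := by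
  refine LinearMap.congr_fun (f := rgen V X d ∘ₗ (rightUnit V).app X d d (add_zero d))
    (g := LinearMap.id) (gmk_ext fun k φ p q hd μ c => ?_) z
  rw [LinearMap.comp_apply, LinearMap.id_apply]
  by_cases h : ∀ i, Nonempty {_e : {x // φ x = i} ≃ Unit // q i = 0}
  · have hb : Function.Bijective φ := by
      refine ⟨fun x y hxy => ?_, fun i => ?_⟩
      · obtain ⟨e, -⟩ := h (φ y)
        exact congrArg Subtype.val (e.injective (a₁ := ⟨x, hxy⟩) (a₂ := ⟨y, rfl⟩) rfl)
      · obtain ⟨e, -⟩ := h i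
        exact ⟨_, (e.symm ()).2⟩
    obtain ⟨φ, rfl⟩ : ∃ φ' : X ≃ Fin k, φ = φ' := ⟨Equiv.ofBijective φ hb, rfl⟩
    have hq : ∀ i, q i = 0 := fun i => (h i).some.2
    have hp : p = d := by simpa [hq] using hd
    have : c = fun i => unit.ev K (h i).some (c i) • unitOne K _ _ := funext fun i => unit_eq_smul _ _
    rw [this, gmk_smul_univ, map_smul, map_smul, rightUnit_gmk φ q hd hp hq, gmk_eq_rgen φ q hd hp hq]
  · push Not at h
    obtain ⟨i, hi⟩ := h
    rw [gmk_zero _ _ _ _ _ _ i (unit_eq_zero hi _), map_zero, map_zero]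

/-- The inverse of `leftUnit`. -/
noncomputable def leftUnitInv (V : SMod K) : DegMap V (comp (unit K) V) 0 where
  app X _ d d' h := lgen V X d' ∘ₗ V.cast X (by omega)
  natural {X Y} _ _ e d d' h x := by
    obtain rfl : d = d' := by omega
    have : Function.Injective ((leftUnit V).app Y d d (add_zero d)) :=
      Function.LeftInverse.injective lgen_leftUnit
    apply this
    rw [(leftUnit V).natural]
    exact (leftUnit_lgen _).trans (congrArg (V.map e d) (leftUnit_lgen _).symm)

/-- The inverse of `rightUnit`. -/
noncomputable def rightUnitInv (V : SMod K) : DegMap V (comp V (unit K)) 0 where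
  app X _ d d' h := rgen V X d' ∘ₗ V.cast X (by omega)
  natural {X Y} _ _ e d d' h x := by
    obtain rfl : d = d' := by omega
    have : Function.Injective ((rightUnit V).app Y d d (add_zero d)) :=
      Function.LeftInverse.injective rgen_rightUnit
    apply this
    rw [(rightUnit V).natural]
    exact (rightUnit_rgen _).trans (congrArg (V.map e d) (rightUnit_rgen _).symm)

theorem degMap_ext_zero {V W : SMod K} {f g : DegMap V W 0}
    (h : ∀ (X : Type) [Finite X] (d : ℤ) (x : V.obj X d),
      f.app X d d (add_zero d) x = g.app X d d (add_zero d) x) : f = g :=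
  DegMap.ext fun X _ d d' hd x => by
    obtain rfl : d = d' := by omega
    exact h X d x

theorem leftUnit_comp_inv (V : SMod K) : (leftUnit V).comp (leftUnitInv V) = DegMap.id V :=
  degMap_ext_zero fun X _ d x => by
    rw [DegMap.comp_app _ _ _ (add_zero d) (add_zero d), DegMap.id_app]
    exact leftUnit_lgen x

theorem leftUnitInv_comp (V : SMod K) : (leftUnitInv V).comp (leftUnit V) = DegMap.id _ :=
  degMap_ext_zero fun X _ d x => by
    rw [DegMap.comp_app _ _ _ (add_zero d) (add_zero d), DegMap.id_app]
    exact lgen_leftUnit x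

theorem rightUnit_comp_inv (V : SMod K) : (rightUnit V).comp (rightUnitInv V) = DegMap.id V :=
  degMap_ext_zero fun X _ d x => by
    rw [DegMap.comp_app _ _ _ (add_zero d) (add_zero d), DegMap.id_app]
    exact rightUnit_rgen x

theorem rightUnitInv_comp (V : SMod K) : (rightUnitInv V).comp (rightUnit V) = DegMap.id _ :=
  degMap_ext_zero fun X _ d x => by
    rw [DegMap.comp_app _ _ _ (add_zero d) (add_zero d), DegMap.id_app]
    exact rgen_rightUnit x

theorem leftUnit_comp_cinf (g : DegMap V V' 0) (h : DegMap V V' b) (h₀ : 0 + b = b) (h₁ : b + 0 = b)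
    (h₂ : 0 + b = b) :
    (leftUnit V').comp (cinf (DegMap.id (unit K)) g h h₀) h₁ = h.comp (leftUnit V) h₂ := by
  refine DegMap.ext fun X _ d d' hh x => ?_
  rw [← lgen_leftUnit x]
  generalize (leftUnit V).app X d d (add_zero d) x = x
  rw [DegMap.comp_app _ _ _ hh (add_zero d'), DegMap.comp_app _ _ _ (add_zero d) hh, leftUnit_lgen,
    lgen_apply, cinf_gmk, Fintype.sum_unique]
  have e1 : infs b 0 (fun _ : Unit => d) default = 1 := by simp [infs]
  rw [e1, one_smul]
  refine (congrArg ((leftUnit V').app X d' d' (add_zero d')) (gapp_congr (f' := DegMap.id (unit K))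
    (B' := fun _ => b) (F' := fun _ => h) (.refl _) (hd' := by simpa using hh) fun j =>
      infD_pos g h (Subsingleton.elim j default))).trans ?_
  rw [gapp, leftUnit_gmk _ (Equiv.refl Unit) _ _ (add_zero (0 : ℤ)) (fun _ => hh) _ () (fun _ => rfl)]
  refine (one_smul K _).trans ?_
  rw [DegMap.app_map_tr (h₂ := rfl) (h := rfl) (e' := topFib ()) (he := fun _ => rfl), SMod.tr_tr,
    h.tr_app]
  exact fun _ => rfl

theorem leftUnit_comp_compMap (h : DegMap V V' 0) :
    (leftUnit V').comp (c := 0) (compMap (DegMap.id (unit K)) h) = h.comp (leftUnit V) := by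
  refine degMap_ext_zero fun X _ d x => ?_
  rw [← lgen_leftUnit x]
  generalize (leftUnit V).app X d d (add_zero d) x = x
  rw [DegMap.comp_app _ _ _ (add_zero d) (add_zero d), DegMap.comp_app _ _ _ (add_zero d) (add_zero d), leftUnit_lgen,
    lgen_apply, compMap_gmk, gapp,
    leftUnit_gmk _ (Equiv.refl Unit) _ _ (add_zero (0 : ℤ)) (fun _ => add_zero d) _ () (fun _ => rfl)]
  refine (one_smul K _).trans ?_
  rw [DegMap.app_map_tr (h₂ := rfl) (h := rfl) (e' := topFib ()) (he := fun _ => rfl), SMod.tr_tr,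
    h.tr_app]
  exact fun _ => rfl

theorem rightUnit_comp_compMap (f : DegMap V V' a) (h₁ : a + 0 = a) (h₂ : 0 + a = a) :
    (rightUnit V').comp (compMap f (DegMap.id (unit K))) h₁ = f.comp (rightUnit V) h₂ := by
  refine DegMap.ext fun X _ d d' hh x => ?_
  rw [← rgen_rightUnit x]
  generalize (rightUnit V).app X d d (add_zero d) x = x
  rw [DegMap.comp_app _ _ _ hh (add_zero d'), DegMap.comp_app _ _ _ (add_zero d) hh, rightUnit_rgen,
    rgen_apply, compMap_gmk, gapp]
  refine (rightUnit_gmk (Finite.equivFin X) _ _ hh (fun _ => rfl) _).trans ?_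
  rw [DegMap.app_map_tr (h₂ := rfl) (h := rfl) (e' := Finite.equivFin X) (he := fun _ => rfl), SMod.tr_tr,
    f.tr_app]
  exact fun _ => by simp

end units

end OperadicBar

namespace OperadicBar
open Finset (sum_congr sum_add_distrib sum_comm sum_eq_zero)
variable {K : Type u} [Field K]

/-! ### Bijectivity of the associator -/

section signs

variable {I I' J J' : Type} [Fintype I] [LinearOrder I] [Fintype I'] [LinearOrder I'] [Fintype J]
  [LinearOrder J] [Fintype J'] [LinearOrder J']

theorem sum_pairs (F : J → J → ZMod 2) (h : ∀ j, F j j = 0) :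
    ∑ j, ∑ j', F j j' = ∑ j, ∑ j', if j < j' then F j j' + F j' j else 0 := by
  have e : ∀ j j', F j j' = (if j < j' then F j j' else 0) + if j' < j then F j j' else 0 := by
    intro j j'
    rcases lt_trichotomy j j' with h' | h' | h'
    · simp [h', h'.not_gt]
    · subst h'; simp [h]
    · simp [h', h'.not_gt]
  have e' : ∀ j j', (if j < j' then F j j' + F j' j else 0) =
      (if j < j' then F j j' else 0) + if j < j' then F j' j else 0 := by
    intro j j'; split_ifs <;> simp
  rw [sum_congr rfl fun j _ => sum_congr rfl fun j' _ => e j j']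
  simp only [e', sum_add_distrib]
  congr 1
  exact sum_comm

theorem ksign_eq_koszul (ψ : I ≃ I') (q : I → ℤ) :
    ksign ψ q = koszul (enumConj ψ) (fun l => q (finEnum I l)) := by
  rw [koszul, ksign]
  congr 1
  rw [← Equiv.sum_comp (finEnum I).toEquiv]
  refine sum_congr rfl fun l _ => ?_
  rw [← Equiv.sum_comp (finEnum I).toEquiv]
  refine sum_congr rfl fun l' _ => ?_
  have e : enumConj ψ l' < enumConj ψ l ↔ ψ (finEnum I l') < ψ (finEnum I l) := by
    rw [← (finEnum I').lt_iff_lt, finEnum_enumConj, finEnum_enumConj]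
  simp [e]

theorem asgn_eq_assocSign (s : J → ℤ) (f : J → I) (q : I → ℤ) :
    asgn s f q = assocSign (fun l => s (finEnum J l))
      (fun l => (finEnum I).symm (f (finEnum J l))) (fun l => q (finEnum I l)) := by
  rw [asgn, assocSign]
  congr 1
  congr 1
  · rw [← Equiv.sum_comp (finEnum J).toEquiv]
    refine sum_congr rfl fun l _ => ?_
    rw [← Equiv.sum_comp (finEnum I).toEquiv]
    refine sum_congr rfl fun l' _ => ?_
    simp [OrderIso.symm_apply_lt]
  · rw [← Equiv.sum_comp (finEnum J).toEquiv]
    refine sum_congr rfl fun l _ => ?_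
    rw [← Equiv.sum_comp (finEnum J).toEquiv]
    refine sum_congr rfl fun l' _ => ?_
    simp

theorem asgn_top (s : J → ℤ) (f : J → I) (q : I → ℤ) (ψ : I ≃ I') :
    asgn s (fun j => ψ (f j)) (fun i => q (ψ.symm i)) *
      ksign ψ (fun i => q i + ∑ j : {j // f j = i}, s j) = ksign ψ q * asgn s f q := by
  rw [asgn_eq_assocSign s f q, ksign_eq_koszul ψ q, ← assocSign_reindex, asgn_eq_assocSign,
    ksign_eq_koszul]
  congr 2
  · funext l
    simp [enumConj]
  · funext l
    simp [enumConj]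
  · funext l
    congr 1
    refine (Fintype.sum_equiv ((finEnum J).toEquiv.subtypeEquiv fun j => ?_) _ _ fun j => ?_).symm
    · exact OrderIso.symm_apply_eq _
    · rfl

/-- The Koszul sign of the permutations induced by `χ` on the fibres of `f`. -/
def fsgn (s : J → ℤ) (f : J → I) (χ : J ≃ J') : ℤˣ :=
  (∑ j, ∑ j', if f j' = f j ∧ j < j' ∧ χ j' < χ j then s j * s j' else 0).negOnePow

theorem asgn_perm (s : J → ℤ) (f : J → I) (q : I → ℤ) (χ : J ≃ J') :
    asgn (fun j => s (χ.symm j)) (fun j => f (χ.symm j)) q * fsgn s f χ =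
      ksign χ s * asgn s f q := by
  simp only [asgn, ksign, fsgn, ← Int.negOnePow_add]
  apply negOnePow_congr
  have e : ∑ j', ∑ i, (if f (χ.symm j') < i then s (χ.symm j') * q i else 0) =
      ∑ j, ∑ i, if f j < i then s j * q i else 0 := by
    rw [← Equiv.sum_comp χ]; simp
  have e' : ∑ j, ∑ j', (if j < j' ∧ f (χ.symm j') < f (χ.symm j) then s (χ.symm j) * s (χ.symm j') else 0) =
      ∑ j, ∑ j', if χ j < χ j' ∧ f j' < f j then s j * s j' else 0 := by
    rw [← Equiv.sum_comp χ]
    refine sum_congr rfl fun j _ => ?_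
    rw [← Equiv.sum_comp χ]
    simp
  rw [e, e']
  push_cast
  rw [sum_pairs (fun j j' => if χ j < χ j' ∧ f j' < f j then (s j : ZMod 2) * s j' else 0) (by simp)]
  have b : (∑ j, ∑ j', if j < j' then (if χ j < χ j' ∧ f j' < f j then (s j : ZMod 2) * s j' else 0) +
        (if χ j' < χ j ∧ f j < f j' then (s j' : ZMod 2) * s j else 0) else 0) +
      (∑ j, ∑ j', if f j' = f j ∧ j < j' ∧ χ j' < χ j then (s j : ZMod 2) * s j' else 0) =
      (∑ j, ∑ j', if j < j' ∧ χ j' < χ j then (s j : ZMod 2) * s j' else 0) +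
      ∑ j, ∑ j', if j < j' ∧ f j' < f j then (s j : ZMod 2) * s j' else 0 := by
    simp only [← sum_add_distrib]
    refine sum_congr rfl fun j _ => sum_congr rfl fun j' _ => ?_
    by_cases hj : j < j'
    · rcases lt_trichotomy (f j) (f j') with h | h | h
      · rcases lt_trichotomy (χ j) (χ j') with h' | h' | h'
        · simp [hj, h, h', h.not_gt, h'.not_gt]
        · exact absurd (χ.injective h') hj.ne
        · simp [hj, h, h', h.not_gt, h'.not_gt, h.ne', mul_comm]
      · simp [h, hj]
      · rcases lt_trichotomy (χ j) (χ j') with h' | h' | h'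
        · simp [hj, h, h', h.not_gt, h'.not_gt]
        · exact absurd (χ.injective h') hj.ne
        · simp [hj, h, h', h.not_gt, h'.not_gt, h.ne, two_add]
    · simp [hj]
  linear_combination b

/-- The cocycle property of the associator signs under renumbering of the vertices of both levels. -/
theorem asgn_reindex {s : J → ℤ} {f : J → I} {q : I → ℤ} {s' : J' → ℤ} {f' : J' → I'} {q' : I' → ℤ}
    (ψ : I ≃ I') (χ : J ≃ J') (hs : ∀ j, s j = s' (χ j)) (hq : ∀ i, q i = q' (ψ i))
    (hf : ∀ j, f' (χ j) = ψ (f j)) :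
    asgn s' f' q' * (ksign χ s * ksign ψ q) =
      (ksign ψ (fun i => q i + ∑ j : {j // f j = i}, s j) * fsgn s f χ) * asgn s f q := by
  obtain rfl : s' = fun j => s (χ.symm j) := funext fun j => by rw [hs, χ.apply_symm_apply]
  obtain rfl : q' = fun j => q (ψ.symm j) := funext fun j => by rw [hq, ψ.apply_symm_apply]
  obtain rfl : f' = fun j => ψ (f (χ.symm j)) := funext fun j => by rw [← hf, χ.apply_symm_apply]
  have h1 := asgn_top s f q ψ
  have h2 := asgn_perm s (fun j => ψ (f j)) (fun i => q (ψ.symm i)) χ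
  have h3 : fsgn s (fun j => ψ (f j)) χ = fsgn s f χ := by
    simp only [fsgn, ψ.apply_eq_iff_eq]
  rw [h3] at h2
  have sq : ∀ z : ℤˣ, z * z = 1 := fun z => Int.units_mul_self z
  generalize ksign ψ (fun i => q i + ∑ j : {j // f j = i}, s j) = A at *
  generalize asgn s (fun j => ψ (f j)) (fun i => q (ψ.symm i)) = B at *
  generalize asgn (fun j => s (χ.symm j)) (fun j => ψ (f (χ.symm j))) (fun i => q (ψ.symm i)) = C at *
  generalize fsgn s f χ = D at *
  generalize ksign χ s = E at *
  generalize ksign ψ q = F at *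
  generalize asgn s f q = G at *
  have h1' : G = F * (B * A) := by rw [h1, ← mul_assoc, sq, one_mul]
  have h2' : C = E * B * D := by rw [← h2, mul_assoc, sq, mul_one]
  rw [h1', h2']
  calc E * B * D * (E * F) = (E * E) * (B * D * F) := by ac_rfl
    _ = (A * A) * (B * D * F) := by rw [sq, sq]
    _ = _ := by ac_rfl

end signs

section flat

variable {V W U : SMod K} {X : Type} [Finite X] {I I' J J' : Type} [Fintype I] [LinearOrder I]
  [Fintype I'] [LinearOrder I'] [Fintype J] [LinearOrder J] [Fintype J'] [LinearOrder J']
  {d p p' P P' : ℤ}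

/-- The generator of `(V ∘ W) ∘ U` which the associator sends to `(μ; (w_i; ρ_j, f j = i))`. -/
noncomputable def flat (φ : X → J) (s : J → ℤ) (hd : P + ∑ j, s j = d)
    (f : J → I) (q : I → ℤ) (hP : p + ∑ i, q i = P) (μ : V.obj I p)
    (w : ∀ i, W.obj {j // f j = i} (q i)) (ρ : ∀ j, U.obj {x // φ x = j} (s j)) :
    (comp (comp V W) U).obj X d :=
  asgn s f q • gmk (V := comp V W) φ P s hd (gmk f p q hP μ w) ρ

theorem assoc_flat (φ : X → J) (s : J → ℤ) (hd : P + ∑ j, s j = d)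
    (f : J → I) (q : I → ℤ) (hP : p + ∑ i, q i = P) (μ : V.obj I p)
    (w : ∀ i, W.obj {j // f j = i} (q i)) (ρ : ∀ j, U.obj {x // φ x = j} (s j)) :
    (assoc V W U).app X d d (add_zero d) (flat φ s hd f q hP μ w ρ) =
      gmk (W := comp W U) (fun x => f (φ x)) p
        (fun i => q i + ∑ j : {j // f j = i}, s j) (fibSum s f q hd hP) μ
        (fun i => gmk (I := {j // f j = i}) (fun x => ⟨φ x, x.2⟩) (q i) (fun j => s j) rfl (w i)
          (fun j => U.map (fibFib φ f i j) _ (ρ j))) := by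
  rw [flat, LinearMap.map_smul_of_tower, assoc_gmk, smul_smul, Int.units_mul_self, one_smul]

/-- `flat` depends on the numbering of the vertices only through the signs that occur in `V ∘ (W ∘ U)`. -/
theorem flat_reindex (ψ : I ≃ I') (χ : J ≃ J') {φ : X → J} {s : J → ℤ} {hd : P + ∑ j, s j = d}
    {f : J → I} {q : I → ℤ} {hP : p + ∑ i, q i = P} {μ : V.obj I p}
    {w : ∀ i, W.obj {j // f j = i} (q i)} {ρ : ∀ j, U.obj {x // φ x = j} (s j)}
    {φ' : X → J'} {s' : J' → ℤ} {hd' : P' + ∑ j, s' j = d}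
    {f' : J' → I'} {q' : I' → ℤ} {hP' : p' + ∑ i, q' i = P'} {μ' : V.obj I' p'}
    {w' : ∀ i, W.obj {j // f' j = i} (q' i)} {ρ' : ∀ j, U.obj {x // φ' x = j} (s' j)}
    (hφ : ∀ x, φ' x = χ (φ x)) (hs : ∀ j, s j = s' (χ j)) (hf : ∀ j, f' (χ j) = ψ (f j))
    (hq : ∀ i, q i = q' (ψ i)) (hp : p = p') (hμ : μ' = V.tr ψ hp μ)
    (hw : ∀ i, w' (ψ i) = W.tr (χ.subtypeEquiv fun j => by rw [hf, ψ.apply_eq_iff_eq]) (hq i) (w i))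
    (hρ : ∀ j, ρ' (χ j) = U.tr (fibEquiv fun x => by rw [hφ, χ.apply_eq_iff_eq]) (hs j) (ρ j)) :
    flat φ' s' hd' f' q' hP' μ' w' ρ' =
      (ksign ψ (fun i => q i + ∑ j : {j // f j = i}, s j) * fsgn s f χ) •
        flat φ s hd f q hP μ w ρ := by
  have hPP : P = P' := by
    rw [← hP, ← hP', hp, ← Equiv.sum_comp ψ]
    exact congrArg (p' + ·) (sum_congr rfl fun i _ => hq i)
  have h1 : gmk f' p' q' hP' μ' w' = ksign ψ q • (comp V W).tr χ hPP (gmk f p q hP μ w) := by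
    rw [comp_tr_gmk]
    refine gmk_eq ψ (fun j => ?_) hp hq hμ fun i => ?_
    · rw [← hf, χ.apply_symm_apply]
    · rw [hw, tr_map]
      exact W.tr_congr _ _ _ (fun _ => rfl) _
  have h2 : gmk (V := comp V W) φ' P' s' hd' ((comp V W).tr χ hPP (gmk f p q hP μ w)) ρ' =
      ksign χ s • gmk (V := comp V W) φ P s hd (gmk f p q hP μ w) ρ :=
    gmk_eq χ hφ hPP hs rfl hρ
  have h3 := LinearMap.map_smul_of_tower (gmkL (V := comp V W) φ' P' s' hd' ρ') (ksign ψ q)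
    ((comp V W).tr χ hPP (gmk f p q hP μ w))
  have h4 : gmk (V := comp V W) φ' P' s' hd' (gmk f' p' q' hP' μ' w') ρ' =
      (ksign χ s * ksign ψ q) • gmk (V := comp V W) φ P s hd (gmk f p q hP μ w) ρ := by
    rw [h1]
    refine h3.trans ((congrArg (ksign ψ q • ·) h2).trans ?_)
    rw [smul_smul, mul_comm]
  rw [flat, h4, smul_smul, asgn_reindex ψ χ hs hq hf, flat, smul_smul]

end flat

/-- A function on tuples of generators which is linear in each of its entries separately comes from a
multilinear map. -/
theorem exists_multilinear {n : ℕ} {M : Fin n → Type u} [∀ i, AddCommGroup (M i)]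
    [∀ i, Module K (M i)] {N : Type u} [AddCommGroup N] [Module K N] {G : Fin n → Type*}
    (g : ∀ i, G i → M i) (hg : ∀ i, Submodule.span K (Set.range (g i)) = ⊤) (Φ : (∀ i, G i) → N)
    (H : ∀ c i, ∃ L : M i →ₗ[K] N, ∀ x, L (g i x) = Φ (Function.update c i x)) :
    ∃ F : MultilinearMap K M N, ∀ c, F (fun i => g i (c i)) = Φ c := by
  induction n generalizing N with
  | zero =>
    refine ⟨MultilinearMap.constOfIsEmpty K M (Φ isEmptyElim), fun c => ?_⟩
    exact congrArg Φ (Subsingleton.elim _ _)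
  | succ n ih =>
    by_cases hG : IsEmpty (G (Fin.last n))
    · exact ⟨0, fun c => hG.elim (c (Fin.last n))⟩
    obtain ⟨y₀⟩ := not_isEmpty_iff.1 hG
    have h1 : ∀ c : ∀ i : Fin n, G i.castSucc, ∃ L : M (Fin.last n) →ₗ[K] N,
        ∀ y, L (g _ y) = Φ (Fin.snoc (α := G) c y) := by
      intro c
      obtain ⟨L, hL⟩ := H (Fin.snoc (α := G) c y₀) (Fin.last n)
      exact ⟨L, fun y => by rw [hL, Fin.update_snoc_last]⟩
    choose L hL using h1
    have h2 : ∀ (c : ∀ i : Fin n, G i.castSucc) (i : Fin n) (m : M (Fin.last n)),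
        ∃ B : M i.castSucc →ₗ[K] N, ∀ x, B (g _ x) = L (Function.update c i x) m := by
      intro c i m
      have hm : m ∈ Submodule.span K (Set.range (g (Fin.last n))) := by rw [hg]; trivial
      induction hm using Submodule.span_induction with
      | mem m hm =>
        obtain ⟨y, rfl⟩ := hm
        obtain ⟨B, hB⟩ := H (Fin.snoc (α := G) c y) i.castSucc
        exact ⟨B, fun x => by rw [hB, hL, Fin.snoc_update]⟩
      | zero => exact ⟨0, fun x => by rw [map_zero, LinearMap.zero_apply]⟩
      | add m m' _ _ h h' =>
        obtain ⟨B, hB⟩ := h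
        obtain ⟨B', hB'⟩ := h'
        exact ⟨B + B', fun x => by rw [map_add, LinearMap.add_apply, hB, hB']⟩
      | smul a m _ h =>
        obtain ⟨B, hB⟩ := h
        exact ⟨a • B, fun x => by rw [map_smul, LinearMap.smul_apply, hB]⟩
    have h3 : ∀ (c : ∀ i : Fin n, G i.castSucc) (i : Fin n),
        ∃ B : M i.castSucc →ₗ[K] (M (Fin.last n) →ₗ[K] N), ∀ x, B (g _ x) =
          L (Function.update c i x) := by
      intro c i
      choose B hB using h2 c i
      let B' : M (Fin.last n) →ₗ[K] M i.castSucc →ₗ[K] N :=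
        { toFun := B
          map_add' := fun m m' => LinearMap.ext_on_range (hg _) fun x => by
            rw [LinearMap.add_apply, hB, hB, hB, map_add]
          map_smul' := fun a m => LinearMap.ext_on_range (hg _) fun x => by
            rw [LinearMap.smul_apply, hB, hB, map_smul, RingHom.id_apply] }
      exact ⟨B'.flip, fun x => LinearMap.ext fun m => hB m x⟩
    obtain ⟨F, hF⟩ := ih (fun i => g i.castSucc) (fun i => hg _) L h3
    refine ⟨F.uncurryRight, fun c => ?_⟩
    have := hF (fun i => c i.castSucc)
    rw [MultilinearMap.uncurryRight_apply]
    refine (LinearMap.congr_fun this _).trans ((hL _ _).trans (congrArg Φ ?_))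
    exact Fin.snoc_init_self c

/-- Two multilinear maps agreeing on tuples of generators are equal. -/
theorem multilinear_ext_span {n : ℕ} {M : Fin n → Type u} [∀ i, AddCommGroup (M i)]
    [∀ i, Module K (M i)] {N : Type u} [AddCommGroup N] [Module K N] {G : Fin n → Type*}
    (g : ∀ i, G i → M i) (hg : ∀ i, Submodule.span K (Set.range (g i)) = ⊤)
    {F F' : MultilinearMap K M N} (h : ∀ c : ∀ i, G i, F (fun i => g i (c i)) = F' fun i => g i (c i)) :
    F = F' := by
  have key : ∀ (S : Finset (Fin n)) (m : ∀ i, M i), (∀ i, i ∉ S → m i ∈ Set.range (g i)) →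
      F m = F' m := by
    intro S
    induction S using Finset.induction_on with
    | empty =>
      intro m hm
      choose c hc using fun i => hm i (Finset.notMem_empty i)
      obtain rfl : (fun i => g i (c i)) = m := funext hc
      exact h c
    | insert a S ha ih =>
      intro m hm
      have := LinearMap.ext_on_range (f := F.toLinearMap m a) (g := F'.toLinearMap m a) (hg a)
        fun x => ih _ fun i hi => by
          by_cases hia : i = a
          · subst hia; rw [Function.update_self]; exact ⟨x, rfl⟩
          · rw [Function.update_of_ne hia]
            exact hm i fun h' => (Finset.mem_insert.1 h').elim hia hi
      have h' := LinearMap.congr_fun this (m a)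
      simpa using h'
  exact MultilinearMap.ext fun m => key Finset.univ m fun i hi => (hi (Finset.mem_univ i)).elim

end OperadicBar

namespace OperadicBar
variable {K : Type u} [Field K]

/-! ### Flattening trees with two upper levels -/

section inverse

variable {V W U : SMod K} {X Y : Type} [Finite X] [Finite Y] {d d' : ℤ}

/-- The data defining a generator of `W ∘ U`. -/
structure Gen (W U : SMod K) (X : Type) [Finite X] (d : ℤ) where
  s : Shape X d
  μ : W.obj (Fin s.k) s.p
  ν : ∀ i, U.obj {x // s.f x = i} (s.q i)

/-- The generator itself. -/
noncomputable def Gen.val (c : Gen W U X d) : (comp W U).obj X d :=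
  gmk c.s.f c.s.p c.s.q c.s.hd c.μ c.ν

theorem span_gen : Submodule.span K (Set.range (Gen.val (W := W) (U := U) (X := X) (d := d))) = ⊤ := by
  rw [← Submodule.ker_mkQ (Submodule.span K (Set.range Gen.val)), LinearMap.ker_eq_top]
  refine gmk_ext fun k f p q hd μ ν => ?_
  refine (Submodule.Quotient.mk_eq_zero _).2 ?_
  exact Submodule.subset_span ⟨⟨⟨k, f, p, q, hd⟩, μ, ν⟩, rfl⟩

/-- The relation that `g'` is obtained from `g` by relabelling the leaves along `e` and renumbering the
vertices, `z` being the exponent of the Koszul sign of the renumbering. -/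
structure Gen.Rel (e : X ≃ Y) (hd : d = d') (g : Gen W U X d) (g' : Gen W U Y d') (z : ℤ) where
  τ : Fin g.s.k ≃ Fin g'.s.k
  hf : ∀ x, g'.s.f (e x) = τ (g.s.f x)
  hp : g.s.p = g'.s.p
  hq : ∀ l, g.s.q l = g'.s.q (τ l)
  hμ : g'.μ = W.tr τ hp g.μ
  hν : ∀ l, g'.ν (τ l) = U.tr (e.subtypeEquiv fun x => by rw [hf, τ.apply_eq_iff_eq]) (hq l) (g.ν l)
  hz : (∑ l, ∑ l', if l < l' ∧ τ l' < τ l then g.s.q l * g.s.q l' else 0) = z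

variable {n n' : ℕ} {f : X → Fin n} {q : Fin n → ℤ} {p : ℤ} {f' : X → Fin n'} {q' : Fin n' → ℤ} {p' : ℤ}

/-- The index set of the upper vertices of `(μ; (w_i; ρ_{il}))`, ordered lexicographically. -/
structure FlatIdx {n : ℕ} (k : Fin n → ℕ) where
  fst : Fin n
  snd : Fin (k fst)

/-- The index set as a sigma type. -/
def FlatIdx.equiv (k : Fin n → ℕ) : FlatIdx k ≃ Σ i, Fin (k i) where
  toFun j := ⟨j.1, j.2⟩
  invFun j := ⟨j.1, j.2⟩
  left_inv _ := rfl
  right_inv _ := rfl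

noncomputable instance (k : Fin n → ℕ) : Fintype (FlatIdx k) :=
  Fintype.ofEquiv _ (FlatIdx.equiv k).symm

noncomputable instance (k : Fin n → ℕ) : LinearOrder (FlatIdx k) :=
  LinearOrder.lift' (fun j => (toLex (FlatIdx.equiv k j) : Σₗ i, Fin (k i)))
    (toLex.injective.comp (FlatIdx.equiv k).injective)

theorem FlatIdx.mk_lt_mk {k : Fin n → ℕ} {i : Fin n}
    {l l' : Fin (k i)} : (⟨i, l⟩ : FlatIdx k) < ⟨i, l'⟩ ↔ l < l' := by
  refine Sigma.Lex.lt_def.trans ⟨?_, fun h => .inr ⟨rfl, h⟩⟩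
  rintro (h | ⟨_, h⟩)
  · exact (lt_irrefl _ h).elim
  · exact h

theorem sum_flat {M : Type*} [AddCommMonoid M] {k : Fin n → ℕ}
    (F : FlatIdx k → M) : ∑ j, F j = ∑ i, ∑ l, F ⟨i, l⟩ :=
  ((FlatIdx.equiv k).symm.sum_comp F).symm.trans (Fintype.sum_sigma _)

/-- The upper vertices of the block `i`. -/
def flatFib (k : Fin n → ℕ) (i : Fin n) :
    Fin (k i) ≃ {j : FlatIdx k // j.1 = i} where
  toFun l := ⟨⟨i, l⟩, rfl⟩
  invFun j := j.2 ▸ j.1.2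
  left_inv l := rfl
  right_inv := by rintro ⟨⟨i, l⟩, rfl⟩; rfl

theorem sum_flatFib {M : Type*} [AddCommMonoid M] {k : Fin n → ℕ}
    (i : Fin n) (F : FlatIdx k → M) : ∑ j : {j : FlatIdx k // j.1 = i}, F j = ∑ l, F ⟨i, l⟩ :=
  (Fintype.sum_equiv (flatFib k i) _ _ fun _ => rfl).symm

/-- The vertex carrying the leaf `x`. -/
def flatMap (c : ∀ i, Gen W U {x // f x = i} (q i)) (x : X) : FlatIdx fun i => (c i).s.k :=
  ⟨f x, (c (f x)).s.f ⟨x, rfl⟩⟩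

/-- The leaves of an upper vertex, before and after flattening. -/
def flatLeaf (c : ∀ i, Gen W U {x // f x = i} (q i)) (j : FlatIdx fun i => (c i).s.k) :
    {x // (c j.1).s.f x = j.2} ≃ {x : X // flatMap c x = j} where
  toFun x := ⟨x.1, by
    obtain ⟨⟨x, hx⟩, hl⟩ := x
    obtain ⟨i, l⟩ := j
    dsimp only at hx l
    subst hx
    exact congrArg (FlatIdx.mk (f x)) hl⟩
  invFun x := ⟨⟨x.1, by obtain ⟨x, rfl⟩ := x; rfl⟩, by obtain ⟨x, rfl⟩ := x; rfl⟩
  left_inv l := rfl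
  right_inv l := rfl

theorem flatDeg (hd : p + ∑ i, q i = d) (c : ∀ i, Gen W U {x // f x = i} (q i)) :
    (p + ∑ i, (c i).s.p) + ∑ j : FlatIdx (fun i => (c i).s.k), (c j.1).s.q j.2 = d := by
  rw [sum_flat, add_assoc, ← Finset.sum_add_distrib, ← hd]
  exact congrArg (p + ·) (Finset.sum_congr rfl fun i _ => (c i).s.hd)

/-- The element of `(V ∘ W) ∘ U` corresponding to `(μ; c)`. -/
noncomputable def flatGen (hd : p + ∑ i, q i = d) (μ : V.obj (Fin n) p)
    (c : ∀ i, Gen W U {x // f x = i} (q i)) : (comp (comp V W) U).obj X d :=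
  flat (J := FlatIdx fun i => (c i).s.k) (P := p + ∑ i, (c i).s.p) (flatMap c)
    (fun j => (c j.1).s.q j.2) (flatDeg hd c) (fun j => j.1) (fun i => (c i).s.p) rfl μ
    (fun i => W.map (flatFib (fun i => (c i).s.k) i) _ (c i).μ) (fun j => U.map (flatLeaf c j) _ ((c j.1).ν j.2))

theorem flatMap_eq (c : ∀ i, Gen W U {x // f x = i} (q i)) (x : X) {i : Fin n} (h : f x = i) :
    flatMap c x = ⟨i, (c i).s.f ⟨x, h⟩⟩ := by
  subst h; rfl

/-- `flatGen` respects the relations between generators of the blocks, hence is defined on their classes. -/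
theorem flatGen_rel (ψ : Fin n ≃ Fin n') (hf : ∀ x, f' x = ψ (f x)) (hp : p = p')
    (hq : ∀ i, q i = q' (ψ i)) {hd : p + ∑ i, q i = d} {hd' : p' + ∑ i, q' i = d}
    {μ : V.obj (Fin n) p} {μ' : V.obj (Fin n') p'}
    (hμ : μ' = V.tr ψ hp μ)
    {c : ∀ i, Gen W U {x // f x = i} (q i)} {c' : ∀ i, Gen W U {x // f' x = i} (q' i)} {z : Fin n → ℤ}
    (H : ∀ i, Nonempty (Gen.Rel (fibEquiv fun x => by rw [hf, ψ.apply_eq_iff_eq]) (hq i) (c i) (c' (ψ i)) (z i))) :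
    flatGen hd' μ' c' = (ksign ψ q * (∑ i, z i).negOnePow) • flatGen hd μ c := by
  have R := fun i => Classical.choice (H i)
  let χ : (FlatIdx fun i => (c i).s.k) ≃ (FlatIdx fun i => (c' i).s.k) := (FlatIdx.equiv fun i => (c i).s.k).trans ((Equiv.sigmaCongr
    (β₁ := fun i => Fin (c i).s.k) (β₂ := fun i => Fin (c' i).s.k) ψ fun i => (R i).τ).trans
      (FlatIdx.equiv fun i => (c' i).s.k).symm)
  have h := flat_reindex ψ χ (φ := flatMap c) (φ' := flatMap c') (s := fun j => (c j.1).s.q j.2)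
    (s' := fun j => (c' j.1).s.q j.2) (hd := flatDeg hd c) (hd' := flatDeg hd' c')
    (f := fun j => j.1) (f' := fun j => j.1) (q := fun i => (c i).s.p) (q' := fun i => (c' i).s.p)
    (hP := rfl) (hP' := rfl) (μ := μ) (μ' := μ')
    (w := (fun i => W.map (flatFib (fun i => (c i).s.k) i) _ (c i).μ)) (ρ := (fun j => U.map (flatLeaf c j) _ ((c j.1).ν j.2)))
    (w' := (fun i => W.map (flatFib (fun i => (c' i).s.k) i) _ (c' i).μ)) (ρ' := (fun j => U.map (flatLeaf c' j) _ ((c' j.1).ν j.2)))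
    ?_ (fun j => (R j.1).hq j.2) (fun j => rfl) (fun i => (R i).hp) hp hμ ?_ ?_
  · refine h.trans (congrArg (· • flatGen hd μ c) (congrArg₂ (· * ·) ?_ ?_))
    · congr 1
      funext i
      rw [sum_flatFib i fun j : FlatIdx fun i => (c i).s.k => (c j.1).s.q j.2]
      exact (c i).s.hd
    · rw [fsgn, sum_flat]
      congr 1
      refine Finset.sum_congr rfl fun i _ => ?_
      rw [← (R i).hz]
      refine Finset.sum_congr rfl fun l _ => ?_
      rw [sum_flat, Finset.sum_eq_single i]
      · refine Finset.sum_congr rfl fun l' _ => ?_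
        have h1 : ((⟨i, l⟩ : FlatIdx fun i => (c i).s.k) < ⟨i, l'⟩) ↔ l < l' := FlatIdx.mk_lt_mk
        have h2 : χ ⟨i, l'⟩ < χ ⟨i, l⟩ ↔ (R i).τ l' < (R i).τ l := FlatIdx.mk_lt_mk
        simp only [h1, h2, true_and]
      · intro i' _ hi'
        exact Finset.sum_eq_zero fun l' _ => if_neg fun h => hi' h.1
      · intro h; exact (h (Finset.mem_univ _)).elim
  · intro x
    refine (flatMap_eq c' x (hf x)).trans ?_
    exact congrArg (FlatIdx.mk (ψ (f x))) ((R (f x)).hf ⟨x, rfl⟩)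
  · intro i
    refine (congrArg (W.map (flatFib (fun i => (c' i).s.k) (ψ i)) _) (R i).hμ).trans ?_
    refine (map_tr W _ _ _ _).trans (Eq.trans ?_ (tr_map W _ _ _ _).symm)
    refine W.tr_congr _ _ _ (fun l => ?_) _
    rfl
  · rintro ⟨i, l⟩
    refine (congrArg (U.map (flatLeaf c' ⟨ψ i, (R i).τ l⟩) _) ((R i).hν l)).trans ?_
    refine (map_tr U _ _ _ _).trans (Eq.trans ?_ (tr_map U _ _ _ _).symm)
    exact U.tr_congr _ _ _ (fun _ => rfl) _

theorem flatGen_left (hd : p + ∑ i, q i = d) (c : ∀ i, Gen W U {x // f x = i} (q i)) :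
    ∃ L : V.obj (Fin n) p →ₗ[K] (comp (comp V W) U).obj X d, ∀ μ, L μ = flatGen hd μ c :=
  ⟨asgn (fun j : FlatIdx fun i => (c i).s.k => (c j.1).s.q j.2) (fun j => j.1)
    (fun i => (c i).s.p) • (gmkL (V := comp V W) (flatMap c) (p + ∑ i, (c i).s.p)
      (fun j : FlatIdx fun i => (c i).s.k => (c j.1).s.q j.2) (flatDeg hd c)
      (fun j => U.map (flatLeaf c j) _ ((c j.1).ν j.2)) ∘ₗ
        gmkL (fun j : FlatIdx fun i => (c i).s.k => j.1) p (fun i => (c i).s.p) rfl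
          (fun i => W.map (flatFib _ i) _ (c i).μ)), fun μ => rfl⟩

/-- The generator data with prescribed shapes and decorations. -/
abbrev mkGen {n : ℕ} {f : X → Fin n} {q : Fin n → ℤ} (S : ∀ i, Shape {x // f x = i} (q i)) (w : ∀ i, W.obj (Fin (S i).k) (S i).p)
    (r : ∀ i l, U.obj {x // (S i).f x = l} ((S i).q l)) (i : Fin n) : Gen W U {x // f x = i} (q i) :=
  ⟨S i, w i, r i⟩

theorem flatGen_mid (hd : p + ∑ i, q i = d) (μ : V.obj (Fin n) p)
    (S : ∀ i, Shape {x // f x = i} (q i)) (w : ∀ i, W.obj (Fin (S i).k) (S i).p)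
    (r : ∀ i l, U.obj {x // (S i).f x = l} ((S i).q l)) (i : Fin n) :
    ∃ L : W.obj (Fin (S i).k) (S i).p →ₗ[K] (comp (comp V W) U).obj X d,
      ∀ x, L x = flatGen hd μ (mkGen S (Function.update w i x) r) := by
  obtain ⟨L, hL⟩ := gmk_entry (fun j : FlatIdx fun i => (S i).k => j.1) p (fun i => (S i).p) rfl μ
    (fun i => W.map (flatFib (fun i => (S i).k) i) _ (w i)) i
  refine ⟨asgn (fun j : FlatIdx fun i => (S i).k => (S j.1).q j.2) (fun j => j.1)
    (fun i => (S i).p) • (gmkL (V := comp V W) (flatMap (mkGen S w r)) (p + ∑ i, (S i).p)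
      (fun j : FlatIdx fun i => (S i).k => (S j.1).q j.2) (flatDeg hd (mkGen S w r))
      (fun j => U.map (flatLeaf (mkGen S w r) j) _ (r j.1 j.2)) ∘ₗ L ∘ₗ
        W.map (flatFib (fun i => (S i).k) i) _), fun x => ?_⟩
  have h := hL (fun i' => W.map (flatFib (fun i => (S i).k) i') _ (Function.update w i x i'))
    fun j hj => by rw [Function.update_of_ne hj]
  rw [Function.update_self] at h
  refine Eq.trans ?_ (congrArg (fun z => asgn (fun j : FlatIdx fun i => (S i).k => (S j.1).q j.2) (fun j => j.1)
    (fun i => (S i).p) • gmkL (V := comp V W) (flatMap (mkGen S w r)) (p + ∑ i, (S i).p)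
      (fun j : FlatIdx fun i => (S i).k => (S j.1).q j.2) (flatDeg hd (mkGen S w r))
      (fun j => U.map (flatLeaf (mkGen S w r) j) _ (r j.1 j.2)) z) h.symm)
  rfl

theorem flatGen_top (hd : p + ∑ i, q i = d) (μ : V.obj (Fin n) p)
    (S : ∀ i, Shape {x // f x = i} (q i)) (w : ∀ i, W.obj (Fin (S i).k) (S i).p)
    (r : ∀ i l, U.obj {x // (S i).f x = l} ((S i).q l)) (i : Fin n) (l : Fin (S i).k)
    (ν : ∀ l, U.obj {x // (S i).f x = l} ((S i).q l)) :
    ∃ L : U.obj {x // (S i).f x = l} ((S i).q l) →ₗ[K] (comp (comp V W) U).obj X d,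
      ∀ x, L x = flatGen hd μ (mkGen S w (Function.update r i (Function.update ν l x))) := by
  set r' := Function.update r i ν with hr'
  obtain ⟨L, hL⟩ := gmk_entry (V := comp V W) (flatMap (mkGen S w r)) (p + ∑ i, (S i).p)
      (fun j : FlatIdx fun i => (S i).k => (S j.1).q j.2) (flatDeg hd (mkGen S w r))
      (gmk (fun j : FlatIdx fun i => (S i).k => j.1) p (fun i => (S i).p) rfl μ
        (fun i => W.map (flatFib (fun i => (S i).k) i) _ (w i)))
      (fun j => U.map (flatLeaf (mkGen S w r) j) _ (r' j.1 j.2)) ⟨i, l⟩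
  refine ⟨asgn (fun j : FlatIdx fun i => (S i).k => (S j.1).q j.2) (fun j => j.1)
    (fun i => (S i).p) • (L ∘ₗ U.map (flatLeaf (mkGen S w r) ⟨i, l⟩) _), fun x => ?_⟩
  have h := hL (fun j => U.map (flatLeaf (mkGen S w r) j) _
    (Function.update r i (Function.update ν l x) j.1 j.2)) fun j hj => by
      congr 1
      by_cases hi : j.1 = i
      · obtain ⟨i', l'⟩ := j
        dsimp only at hi l' ⊢
        subst hi
        rw [hr', Function.update_self, Function.update_self, Function.update_of_ne]
        intro h
        exact hj (congrArg _ h)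
      · rw [hr', Function.update_of_ne hi, Function.update_of_ne hi]
  dsimp only at h
  rw [Function.update_self, Function.update_self] at h
  exact congrArg (asgn (fun j : FlatIdx fun i => (S i).k => (S j.1).q j.2) (fun j => j.1)
    (fun i => (S i).p) • ·) h.symm

end inverse

end OperadicBar

namespace OperadicBar
variable {K : Type u} [Field K]

/-! ### The inverse of the associator -/

section inverse

variable {V W U : SMod K} {X Y : Type} [Finite X] [Finite Y] {d d' : ℤ}
variable {n n' : ℕ} {f : X → Fin n} {q : Fin n → ℤ} {p : ℤ} {f' : X → Fin n'} {q' : Fin n' → ℤ} {p' : ℤ}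

theorem flatGen_tens (hd : p + ∑ i, q i = d) (μ : V.obj (Fin n) p)
    (S : ∀ i, Shape {x // f x = i} (q i)) (w : ∀ i, W.obj (Fin (S i).k) (S i).p)
    (r : ∀ i l, U.obj {x // (S i).f x = l} ((S i).q l)) (i : Fin n) :
    ∃ T : (S i).Tens W U →ₗ[K] (comp (comp V W) U).obj X d,
      ∀ x ν, T (x ⊗ₜ PiTensorProduct.tprod K ν) =
        flatGen hd μ (mkGen S (Function.update w i x) (Function.update r i ν)) := by
  have h1 : ∀ x, ∃ F : MultilinearMap K (fun l => U.obj {x // (S i).f x = l} ((S i).q l))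
      ((comp (comp V W) U).obj X d), ∀ ν, F ν = flatGen hd μ (mkGen S (Function.update w i x) (Function.update r i ν)) :=
    fun x => exists_multilinear (fun _ => id) (fun _ => by rw [Set.range_id, Submodule.span_univ])
      (fun ν => flatGen hd μ (mkGen S (Function.update w i x) (Function.update r i ν)))
      fun ν l => flatGen_top hd μ S _ r i l ν
  choose F hF using h1
  have h2 : ∀ ν, ∃ L : W.obj (Fin (S i).k) (S i).p →ₗ[K] (comp (comp V W) U).obj X d,
      ∀ x, L x = F x ν := fun ν => by
    obtain ⟨L, hL⟩ := flatGen_mid hd μ S w (Function.update r i ν) i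
    exact ⟨L, fun x => by rw [hL, hF]⟩
  refine ⟨TensorProduct.lift
    { toFun := fun x => PiTensorProduct.lift (F x)
      map_add' := fun x y => PiTensorProduct.ext (MultilinearMap.ext fun ν => ?_)
      map_smul' := fun a x => PiTensorProduct.ext (MultilinearMap.ext fun ν => ?_) }, fun x ν => ?_⟩
  · obtain ⟨L, hL⟩ := h2 ν
    simp [← hL]
  · obtain ⟨L, hL⟩ := h2 ν
    simp [← hL]
  · rw [← hF]
    simp

theorem flatGen_update (hd : p + ∑ i, q i = d) (μ : V.obj (Fin n) p)
    (c : ∀ i, Gen W U {x // f x = i} (q i)) (i : Fin n) (s : Shape {x // f x = i} (q i)) :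
    ∃ T : s.Tens W U →ₗ[K] (comp (comp V W) U).obj X d,
      ∀ x ν, T (x ⊗ₜ PiTensorProduct.tprod K ν) =
        flatGen hd μ (Function.update c i ⟨s, x, ν⟩) := by
  have key : ∀ c : ∀ i, Gen W U {x // f x = i} (q i),
      ∃ T : (c i).s.Tens W U →ₗ[K] (comp (comp V W) U).obj X d,
      ∀ x ν, T (x ⊗ₜ PiTensorProduct.tprod K ν) =
        flatGen hd μ (Function.update c i ⟨(c i).s, x, ν⟩) := by
    intro c
    obtain ⟨T, hT⟩ := flatGen_tens hd μ (fun i => (c i).s) (fun i => (c i).μ) (fun i => (c i).ν) i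
    refine ⟨T, fun x ν => (hT x ν).trans (congrArg _ (funext fun j => ?_))⟩
    by_cases h : j = i
    · subst h
      simp only [mkGen, Function.update_self]
    · simp only [mkGen, Function.update_of_ne h]
  have key' : ∀ g : Gen W U {x // f x = i} (q i), ∃ T : g.s.Tens W U →ₗ[K] (comp (comp V W) U).obj X d,
      ∀ x ν, T (x ⊗ₜ PiTensorProduct.tprod K ν) =
        flatGen hd μ (Function.update c i ⟨g.s, x, ν⟩) := by
    intro g
    have := key (Function.update c i g)
    simp only [Function.update_idem] at this
    rwa [Function.update_self] at this
  exact key' ⟨s, 0, 0⟩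

/-- Relabelling of the leaves of a generator. -/
def Gen.tr (e : X ≃ Y) (hd : d = d') (g : Gen W U X d) : Gen W U Y d' :=
  ⟨⟨g.s.k, fun y => g.s.f (e.symm y), g.s.p, g.s.q, g.s.hd.trans hd⟩, g.μ,
    fun l => U.map (fibRelabel g.s.f e l) _ (g.ν l)⟩

theorem Gen.val_tr (e : X ≃ Y) (hd : d = d') (g : Gen W U X d) :
    (g.tr e hd).val = (comp W U).tr e hd g.val :=
  (comp_tr_gmk e hd _ _ _ _ _ _).symm

theorem Gen.rel_tr (e : X ≃ Y) (hd : d = d') (g : Gen W U X d) :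
    Nonempty (Gen.Rel e hd g (g.tr e hd) 0) :=
  ⟨{  τ := Equiv.refl _
      hf := fun x => congrArg g.s.f (e.symm_apply_apply x)
      hp := rfl
      hq := fun _ => rfl
      hμ := (W.tr_id _ (fun _ => rfl) _ _).symm
      hν := fun l => U.tr_congr _ _ _ (fun _ => rfl) _
      hz := by
        refine Finset.sum_eq_zero fun l _ => Finset.sum_eq_zero fun l' _ => if_neg fun h => ?_
        exact (h.1.trans h.2).false }⟩

theorem Gen.Rel.refl (e : X ≃ X) (he : ∀ x, e x = x) (hd : d = d) (g : Gen W U X d) :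
    Nonempty (Gen.Rel e hd g g 0) := by
  obtain rfl : e = Equiv.refl X := Equiv.ext he
  exact ⟨{
    τ := Equiv.refl _
    hf := fun x => rfl
    hp := rfl
    hq := fun _ => rfl
    hμ := (W.tr_id _ (fun _ => rfl) _ _).symm
    hν := fun l => (U.tr_id _ (fun _ => rfl) _ _).symm
    hz := by
      refine Finset.sum_eq_zero fun l _ => Finset.sum_eq_zero fun l' _ => if_neg fun h => ?_
      exact (h.1.trans h.2).false }⟩

theorem flatGen_rel_refl {hd : p + ∑ i, q i = d} {μ : V.obj (Fin n) p}
    {c c' : ∀ i, Gen W U {x // f x = i} (q i)} {z : Fin n → ℤ}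
    (H : ∀ i, Nonempty (Gen.Rel (Equiv.refl _) rfl (c i) (c' i) (z i))) :
    flatGen hd μ c' = (∑ i, z i).negOnePow • flatGen hd μ c := by
  have h := flatGen_rel (Equiv.refl (Fin n)) (fun _ => rfl) rfl (fun _ => rfl) (hd := hd) (hd' := hd)
    (V.tr_id (Equiv.refl _) (fun _ => rfl) rfl μ).symm (c := c) (c' := c') (z := z) (fun i => H i)
  rwa [ksign_mono _ _ (fun _ _ h => h), one_mul] at h

/-- For a fixed lower vertex, `flatGen` extends to a multilinear map on the blocks. -/
theorem exists_flat (hd : p + ∑ i, q i = d) (μ : V.obj (Fin n) p) :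
    ∃ F : MultilinearMap K (fun i => (comp W U).obj {x // f x = i} (q i))
      ((comp (comp V W) U).obj X d), ∀ c, F (fun i => (c i).val) = flatGen hd μ c := by
  refine exists_multilinear (fun _ => Gen.val) (fun _ => span_gen) _ fun c i => ?_
  choose T hT using flatGen_update hd μ c i
  refine ⟨compLift (fun s => T s) fun s k' ψ x ν => ?_, fun g => ?_⟩
  · rw [hT, hT]
    have h := flatGen_rel_refl (hd := hd) (μ := μ)
      (c := Function.update c i ⟨s, x, ν⟩) (c' := Function.update c i ⟨s.reindex ψ, W.map ψ s.p x,
        fun i => U.map (fibEquiv (fun _ => Equiv.eq_symm_apply ψ)) _ (ν (ψ.symm i))⟩)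
      (z := Function.update (0 : Fin n → ℤ) i
        (∑ l, ∑ l', if l < l' ∧ ψ l' < ψ l then s.q l * s.q l' else 0)) fun j => ?_
    · have e (Z : ℤ) : ∑ j, Function.update (0 : Fin n → ℤ) i Z j = Z := by
        rw [Finset.sum_update_of_mem (Finset.mem_univ _)]
        simp
      rw [e] at h
      exact h
    · by_cases hj : j = i
      · subst hj
        rw [Function.update_self, Function.update_self, Function.update_self]
        refine ⟨{ τ := ψ
                  hf := fun x => rfl
                  hp := rfl
                  hq := fun l => ?_
                  hμ := rfl
                  hν := fun l => ?_
                  hz := rfl }⟩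
        · simp
        · dsimp only
          rw [fam ν (ψ.symm_apply_apply l).symm, map_tr]
          exact U.tr_congr _ _ _ (fun _ => rfl) _
      · rw [Function.update_of_ne hj, Function.update_of_ne hj, Function.update_of_ne hj]
        exact Gen.Rel.refl _ (fun _ => rfl) _ _
  · refine Eq.trans ?_ (hT g.s g.μ g.ν)
    refine Eq.trans (congrArg _ (cmk_eq_gmk g.s g.μ g.ν).symm) ?_
    exact compLift_mk _ _ _ _ _

/-- The inverse of the associator, characterised by its values on generators: the blocks are linear combinations
of classes of trees, so that flattening has to be extended multilinearly. -/
theorem exists_assocInv (V W U : SMod K) (X : Type) [Finite X] (d : ℤ) :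
    ∃ R : (comp V (comp W U)).obj X d →ₗ[K] (comp (comp V W) U).obj X d,
      ∀ (n : ℕ) (f : X → Fin n) (p : ℤ) (q : Fin n → ℤ) (hd : p + ∑ i, q i = d) (μ : V.obj (Fin n) p)
        (c : ∀ i, Gen W U {x // f x = i} (q i)),
        R (gmk (W := comp W U) f p q hd μ fun i => (c i).val) = flatGen hd μ c := by
  choose F hF using fun s : Shape X d => exists_flat (V := V) (W := W) (U := U) (f := s.f) s.hd
  have hext : ∀ (s : Shape X d) {G G' : MultilinearMap K (fun i => (comp W U).obj {x // s.f x = i} (s.q i))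
      ((comp (comp V W) U).obj X d)}, (∀ c : ∀ i, Gen W U {x // s.f x = i} (s.q i),
        G (fun i => (c i).val) = G' fun i => (c i).val) → G = G' := fun s _ _ h =>
    multilinear_ext_span (fun _ => Gen.val) (fun _ => span_gen) h
  let T : ∀ s : Shape X d, s.Tens V (comp W U) →ₗ[K] (comp (comp V W) U).obj X d := fun s =>
    TensorProduct.lift
    { toFun := fun μ => PiTensorProduct.lift (F s μ)
      map_add' := fun μ μ' => by
        rw [← map_add]
        refine congrArg _ (hext s fun c => ?_)
        obtain ⟨L, hL⟩ := flatGen_left s.hd c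
        rw [MultilinearMap.add_apply, hF, hF, hF, ← hL, ← hL, ← hL, map_add]
      map_smul' := fun a μ => by
        rw [← map_smul]
        refine congrArg _ (hext s fun c => ?_)
        obtain ⟨L, hL⟩ := flatGen_left s.hd c
        rw [MultilinearMap.smul_apply, hF, hF, ← hL, ← hL, map_smul, RingHom.id_apply] }
  have hT : ∀ s μ ν, T s (μ ⊗ₜ PiTensorProduct.tprod K ν) = F s μ ν := fun s μ ν => by
    simp [T]
  refine ⟨compLift T fun s k' ψ μ ν => ?_, fun n f p q hd μ c => ?_⟩
  · rw [hT, hT]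
    refine DFunLike.congr_fun (f := (MultilinearMap.domDomCongrLinearEquiv' K K _ _ ψ).symm
      ((F (s.reindex ψ) (V.map ψ s.p μ)).compLinearMap fun i => (comp W U).map (fibEquiv
        (fun _ => Equiv.eq_symm_apply ψ)) _)) (g := koszul ψ s.q • F s μ) (hext s fun c => ?_) ν
    rw [MultilinearMap.smul_apply, hF]
    refine Eq.trans (congrArg (F (s.reindex ψ) (V.map ψ s.p μ)) (funext fun i =>
      (Gen.val_tr (fibEquiv fun _ => Equiv.eq_symm_apply ψ) rfl (c (ψ.symm i))).symm)) ?_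
    rw [hF]
    have h := flatGen_rel ψ (fun _ => rfl) rfl (fun i => congrArg s.q (ψ.symm_apply_apply i).symm) (hd := s.hd)
      (hd' := (s.reindex ψ).hd) (μ := μ) (μ' := V.map ψ s.p μ) rfl (c := c)
      (c' := fun i => (c (ψ.symm i)).tr (fibEquiv fun _ => Equiv.eq_symm_apply ψ) rfl) (z := fun _ => 0) fun i => ?_
    · rw [Finset.sum_const_zero, Int.negOnePow_zero, mul_one] at h
      exact h
    · have key : ∀ j, ∀ hj : j = i, ∀ (h1 : ∀ x, s.f x = i ↔ ψ (s.f x) = ψ i) (h2 : ∀ x, s.f x = j ↔ ψ (s.f x) = ψ i)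
          (h3 : s.q i = s.q (ψ.symm (ψ i))) (h4 : s.q j = s.q (ψ.symm (ψ i))),
          Nonempty (Gen.Rel (fibEquiv h1) h3 (c i) ((c j).tr (fibEquiv h2) h4) 0) := by
        rintro j rfl h1 h2 h3 h4
        exact Gen.rel_tr _ _ _
      exact key _ (ψ.symm_apply_apply i) _ _ _ _
  · rw [← hF ⟨n, f, p, q, hd⟩, ← hT]
    refine Eq.trans (congrArg _ (cmk_eq_gmk (W := comp W U) ⟨n, f, p, q, hd⟩ μ fun i => (c i).val).symm) ?_
    exact compLift_mk _ _ _ _ _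

theorem assoc_flatGen (hd : p + ∑ i, q i = d) (μ : V.obj (Fin n) p)
    (c : ∀ i, Gen W U {x // f x = i} (q i)) :
    (assoc V W U).app X d d (add_zero d) (flatGen hd μ c) =
      gmk (W := comp W U) f p q hd μ fun i => (c i).val := by
  rw [flatGen, assoc_flat]
  have hs : ∀ i, (c i).s.p + ∑ j : {j : FlatIdx (fun i => (c i).s.k) // j.1 = i}, (c j.1.1).s.q j.1.2 = q i :=
    fun i => by
      rw [sum_flatFib i fun j : FlatIdx (fun i => (c i).s.k) => (c j.1).s.q j.2]
      exact (c i).s.hd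
  refine (gmk_congr (fun _ => rfl) rfl hs (V.tr_id _ (fun _ => rfl) _ _).symm fun i => ?_).symm
  rw [comp_tr_gmk]
  refine Eq.symm ?_
  rw [Gen.val]
  refine gmk_eq_mono (V := W) (W := U) (I := Fin (c i).s.k) (J := {j : FlatIdx (fun i => (c i).s.k) // j.1 = i})
    (flatFib (fun i => (c i).s.k) i) (fun l l' h => FlatIdx.mk_lt_mk.2 h)
    (f := (c i).s.f) (p := (c i).s.p) (q := (c i).s.q) (hd := (c i).s.hd) (μ := (c i).μ) (ν := (c i).ν) ?_ rfl
    (fun l => rfl) rfl fun l => ?_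
  · rintro ⟨x, rfl⟩
    rfl
  · refine (U.map_trans (fibFib _ _ _ _) (fibRelabel _ _ _) _ _).symm.trans ?_
    refine (U.map_trans (flatLeaf c ⟨i, l⟩) _ _ _).symm.trans ?_
    refine U.tr_congr _ _ rfl (fun x => ?_) _
    rfl

/-- The positions of the elements of `J` in the fibres of `f`. -/
noncomputable def fibIdx {m n : ℕ} (f : Fin m → Fin n) : Fin m ≃ FlatIdx fun i => Fintype.card {j // f j = i} where
  toFun j := ⟨f j, (finEnum {j' // f j' = f j}).symm ⟨j, rfl⟩⟩
  invFun j := (finEnum {j' // f j' = j.1} j.2).1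
  left_inv j := by simp
  right_inv := by
    rintro ⟨i, l⟩
    obtain ⟨⟨j, rfl⟩, hj⟩ : ∃ j, j = finEnum {j' // f j' = i} l := ⟨_, rfl⟩
    dsimp only
    rw [← hj]
    exact congrArg (FlatIdx.mk (f j)) ((OrderIso.symm_apply_eq _).2 hj)

/-- The generator data of the blocks of an element of `(V ∘ W) ∘ U`. -/
noncomputable def blockGen {m : ℕ} (φ : X → Fin m) (s : Fin m → ℤ) (fn : Fin m → Fin n) (q : Fin n → ℤ)
    (w : ∀ i, W.obj {j // fn j = i} (q i)) (ρ : ∀ j, U.obj {x // φ x = j} (s j)) (i : Fin n) :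
    Gen W U {x // fn (φ x) = i} (q i + ∑ j : {j // fn j = i}, s j) :=
  ⟨gshape (X := {x // fn (φ x) = i}) (I := {j // fn j = i}) (fun x => ⟨φ x, x.2⟩) (q i) (fun j => s j) rfl,
    W.map (finEnum _).symm.toEquiv _ (w i), fun l => U.map (fibEquiv fun _ => (OrderIso.symm_apply_eq _).symm) _
          (U.map (fibFib φ fn i (finEnum _ l)) _ (ρ (finEnum {j // fn j = i} l)))⟩

/-- Cutting an iterated generator into blocks and flattening these gives back the generator. -/
theorem flatGen_block {m : ℕ} {P : ℤ} (φ : X → Fin m) (s : Fin m → ℤ) (hd : P + ∑ j, s j = d)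
    (fn : Fin m → Fin n) (q : Fin n → ℤ) (hP : p + ∑ i, q i = P) (μ : V.obj (Fin n) p)
    (w : ∀ i, W.obj {j // fn j = i} (q i)) (ρ : ∀ j, U.obj {x // φ x = j} (s j)) :
    flatGen (fibSum s fn q hd hP) μ (blockGen φ s fn q w ρ) = flat φ s hd fn q hP μ w ρ := by
  set c := blockGen φ s fn q w ρ with hc
  have h := flat_reindex (Equiv.refl (Fin n)) (fibIdx fn) (φ := φ) (s := s) (hd := hd) (f := fn) (q := q)
    (hP := hP) (μ := μ) (w := w) (ρ := ρ) (φ' := flatMap c) (s' := fun j => (c j.1).s.q j.2)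
    (hd' := flatDeg (fibSum s fn q hd hP) c) (f' := fun j => j.1) (q' := q)
    (hP' := rfl) (μ' := μ)
    (w' := (fun i => W.map (flatFib (fun i => (c i).s.k) i) _ (c i).μ))
    (ρ' := (fun j => U.map (flatLeaf c j) _ ((c j.1).ν j.2)))
    (fun x => rfl) ?_ (fun j => rfl) (fun i => rfl) rfl
    (V.tr_id _ (fun _ => rfl) _ _).symm ?_ ?_
  · refine h.trans ?_
    have h1 : fsgn s fn (fibIdx fn) = 1 := by
      rw [fsgn, Finset.sum_eq_zero, Int.negOnePow_zero]
      intro j _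
      refine Finset.sum_eq_zero fun j' _ => if_neg ?_
      rintro ⟨h1, h2, h3⟩
      have : ∀ (i : Fin n) (h : fn j' = i), fibIdx fn j' = ⟨i, (finEnum {j // fn j = i}).symm ⟨j', h⟩⟩ := by
        rintro i rfl; rfl
      rw [this _ h1] at h3
      exact absurd ((finEnum _).symm.lt_iff_lt.1 (FlatIdx.mk_lt_mk.1 h3)) h2.not_gt
    rw [ksign_mono _ _ (fun _ _ h => h), h1, one_mul, one_smul]
  · intro j
    exact congrArg (fun j : {j' // fn j' = fn j} => s j) (OrderIso.apply_symm_apply (finEnum {j' // fn j' = fn j}) ⟨j, rfl⟩).symm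
  · intro i
    refine (map_tr W _ _ rfl _).trans (W.tr_congr _ _ _ (fun j => ?_) _)
    have : ∀ (i : Fin n) (j : Fin m) (h : fn j = i), flatFib (fun i => (c i).s.k) i
        ((finEnum {j // fn j = i}).symm ⟨j, h⟩) = ⟨fibIdx fn j, h⟩ := by
      rintro i j rfl; rfl
    exact this i j.1 j.2
  · intro j
    have hj : (⟨j, rfl⟩ : {j' // fn j' = fn j}) = finEnum _ ((finEnum {j' // fn j' = fn j}).symm ⟨j, rfl⟩) :=
      (OrderIso.apply_symm_apply (finEnum {j' // fn j' = fn j}) ⟨j, rfl⟩).symm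
    refine (congrArg (fun z => U.map (flatLeaf c (fibIdx fn j)) _ (U.map (fibEquiv fun _ =>
      (OrderIso.symm_apply_eq _).symm) _ (U.map (fibFib φ fn (fn j) _) _ z)))
      (fam ρ (congrArg Subtype.val hj))).trans ?_
    refine (congrArg _ ((congrArg _ (map_tr U _ _ _ _)).trans (map_tr U _ _ _ _))).trans ?_
    refine (map_tr U _ _ _ _).trans ?_
    refine U.tr_congr _ _ _ (fun x => ?_) _
    rfl

/-- Two maps out of `V ∘ (W ∘ U)` agreeing on iterated generators are equal. -/
theorem gmk_ext_gen {M : Type u} [AddCommGroup M] [Module K M]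
    {F G : (comp V (comp W U)).obj X d →ₗ[K] M}
    (h : ∀ (n : ℕ) (f : X → Fin n) (p : ℤ) (q : Fin n → ℤ) (hd : p + ∑ i, q i = d) (μ : V.obj (Fin n) p)
        (c : ∀ i, Gen W U {x // f x = i} (q i)),
        F (gmk (W := comp W U) f p q hd μ fun i => (c i).val) = G (gmk (W := comp W U) f p q hd μ fun i => (c i).val)) :
    F = G := by
  have key : ∀ F' G' : compObj V (comp W U) X d →ₗ[K] M, (∀ (s : Shape X d) μ (c : ∀ i, Gen W U {x // s.f x = i} (s.q i)),
      F' (cmk s μ fun i => (c i).val) = G' (cmk s μ fun i => (c i).val)) → F' = G' := fun F' G' h =>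
    comp_hom_ext fun s μ ν => DFunLike.congr_fun (f := F'.compMultilinearMap (mkM s μ))
      (g := G'.compMultilinearMap (mkM s μ)) (multilinear_ext_span (fun _ => Gen.val) (fun _ => span_gen) (h s μ)) ν
  refine key F G fun s μ c => ?_
  have := h s.k s.f s.p s.q s.hd μ c
  rwa [← cmk_eq_gmk] at this

theorem bijective_assoc (V W U : SMod K) (X : Type) [Finite X] (d : ℤ) :
    Function.Bijective ((assoc V W U).app X d d (add_zero d)) := by
  obtain ⟨R, hR⟩ := exists_assocInv V W U X d
  refine Function.bijective_iff_has_inverse.2 ⟨R, fun x => ?_, fun x => ?_⟩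
  · refine LinearMap.congr_fun (f := R ∘ₗ (assoc V W U).app X d d (add_zero d)) (g := LinearMap.id)
      (gmk_ext₂ fun m φ P s hd n fn p q hP μ w ρ => ?_) x
    rw [LinearMap.comp_apply, assoc_gmk, LinearMap.map_smul_of_tower]
    refine (congrArg (asgn s fn q • R ·) (congrArg (gmk (W := comp W U) (fun x => fn (φ x)) p _
      (fibSum s fn q hd hP) μ) (funext fun i => cmk_eq_gmk _ _ _))).trans ?_
    refine (congrArg (asgn s fn q • ·) ((hR _ _ _ _ _ _ _).trans (flatGen_block φ s hd fn q hP μ w ρ))).trans ?_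
    rw [flat, smul_smul, Int.units_mul_self, one_smul]
    rfl
  · refine LinearMap.congr_fun (f := (assoc V W U).app X d d (add_zero d) ∘ₗ R) (g := LinearMap.id) ?_ x
    refine gmk_ext_gen fun n f p q hd μ c => ?_
    rw [LinearMap.comp_apply, hR, assoc_flatGen]
    rfl

end inverse

end OperadicBar

namespace OperadicBar
open Finset (sum_congr sum_add_distrib sum_comm sum_eq_zero)
variable {K : Type u} [Field K]

/-! ### The pentagon -/

section sign
variable {I J L : Type} [Fintype I] [LinearOrder I] [Fintype J] [LinearOrder J] [Fintype L] [LinearOrder L]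

theorem negOnePow_prod {ι : Type} [Fintype ι] (a : ι → ℤ) :
    ∏ i, (a i).negOnePow = (∑ i, a i).negOnePow := by
  classical
  induction (Finset.univ : Finset ι) using Finset.induction_on with
  | empty => simp
  | insert i s hi ih => rw [Finset.prod_insert hi, Finset.sum_insert hi, ih, Int.negOnePow_add]

theorem sum_fibre_mul (g : L → J) (a : J → ZMod 2) (t : L → ZMod 2) :
    ∑ j, a j * ∑ k : {k // g k = j}, t k = ∑ k, a (g k) * t k := by
  rw [← Fintype.sum_fiberwise g]
  refine sum_congr rfl fun j _ => ?_
  rw [Finset.mul_sum]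
  exact sum_congr rfl fun k _ => by rw [k.2]

theorem sum_bilin (g : L → J) (c : J → J → ZMod 2) (s T : J → ZMod 2) (t : L → ZMod 2)
    (hT : ∀ a : J → ZMod 2, ∑ j, a j * T j = ∑ k, a (g k) * t k) :
    ∑ j, ∑ j', c j j' * ((s j + T j) * (s j' + T j')) = ∑ j, ∑ j', c j j' * (s j * s j') +
      (∑ k, ∑ j, c (g k) j * (t k * s j) + ∑ k, ∑ j, c j (g k) * (t k * s j)) +
      ∑ k, ∑ k', c (g k) (g k') * (t k * t k') := by
  have e : ∀ j j', c j j' * ((s j + T j) * (s j' + T j')) = c j j' * (s j * s j') + (c j j' * s j') * T j +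
    (c j j' * s j) * T j' + (c j j' * T j') * T j := fun j j' => by ring
  simp only [e, sum_add_distrib]
  rw [sum_comm (f := fun j j' => (c j j' * s j') * T j), sum_comm (f := fun j j' => (c j j' * T j') * T j)]
  simp only [hT]
  have e' : ∀ j k, c (g k) j * T j * t k = (c (g k) j * t k) * T j := fun j k => by ring
  rw [sum_comm (f := fun j k => c (g k) j * T j * t k)]
  simp only [e', hT]
  rw [sum_comm (f := fun j k => c (g k) j * s j * t k), sum_comm (f := fun j k => c j (g k) * s j * t k)]
  simp only [add_assoc, mul_assoc, mul_comm (s _) (t _)]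

theorem sum_fibres (f : J → I) (g : L → I) (c : L → J → ZMod 2) :
    ∑ i, ∑ k : {k // g k = i}, ∑ j : {j // f j = i}, c k j = ∑ k, ∑ j, if f j = g k then c k j else 0 := by
  have e : ∀ i, ∑ k : {k // g k = i}, ∑ j : {j // f j = i}, c k j =
      ∑ k : {k // g k = i}, ∑ j, if f j = g k then c k j else 0 := fun i =>
    sum_congr rfl fun k _ => by rw [sum_fibre f i (c k), k.2]
  simp only [e]
  exact Fintype.sum_fiberwise g fun k => ∑ j, if f j = g k then c k j else 0

/-- The Koszul sign identity behind the pentagon. -/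
theorem asgn_pentagon (t : L → ℤ) (g : L → J) (s : J → ℤ) (f : J → I) (q : I → ℤ) :
    asgn t g s * asgn (fun j => s j + ∑ k : {k // g k = j}, t k) f q =
      asgn s f q * asgn t (fun k => f (g k)) (fun i => q i + ∑ j : {j // f j = i}, s j) *
      ∏ i, asgn (I := {j // f j = i}) (fun k : {k // f (g k) = i} => t k) (fun k => ⟨g k, k.2⟩) (fun j => s j) := by
  classical
  simp only [asgn]
  rw [negOnePow_prod]
  simp only [← Int.negOnePow_add]
  apply negOnePow_congr
  rw [sum_add_distrib]
  push_cast
  have hT := fun a => sum_fibre_mul g a (fun k => (t k : ZMod 2))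
  have hS := fun a => sum_fibre_mul f a (fun j => (s j : ZMod 2))
  simp only [← boole_mul _ (_ * _ : ZMod 2)]
  have h1 := sum_fibres f (fun k => f (g k)) (fun k j => (if g k < j then 1 else 0) * ((t k : ZMod 2) * s j))
  have h2 := sum_fibres (fun k => f (g k)) (fun k => f (g k))
    (fun k k' => (if k < k' ∧ g k' < g k then 1 else 0) * ((t k : ZMod 2) * t k'))
  refine Eq.trans ?_ (congrArg₂ (fun x y => _ + (x + y)) h1.symm h2.symm)
  rw [sum_bilin g _ _ _ _ hT]
  have h3 : ∀ (j : J) (i : I), (if f j < i then (1 : ZMod 2) else 0) * (((s j : ZMod 2) + ∑ k : {k // g k = j}, (t k : ZMod 2)) * q i) =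
      (if f j < i then 1 else 0) * ((s j : ZMod 2) * q i) +
       ((if f j < i then 1 else 0) * (q i : ZMod 2)) * ∑ k : {k // g k = j}, (t k : ZMod 2) := fun j i => by ring
  have h4 : ∀ (k : L) (i : I), (if f (g k) < i then (1 : ZMod 2) else 0) * ((t k : ZMod 2) * ((q i : ZMod 2) + ∑ j : {j // f j = i}, (s j : ZMod 2))) =
      ((if f (g k) < i then 1 else 0) * (q i : ZMod 2)) * t k +
       ((if f (g k) < i then 1 else 0) * (t k : ZMod 2)) * ∑ j : {j // f j = i}, (s j : ZMod 2) := fun k i => by ring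
  simp only [h3, h4, sum_add_distrib]
  rw [sum_comm (f := fun j i => ((if f j < i then 1 else 0) * (q i : ZMod 2)) * ∑ k : {k // g k = j}, (t k : ZMod 2))]
  simp only [hT, hS]
  rw [sum_comm (f := fun i k => ((if f (g k) < i then 1 else 0) * (q i : ZMod 2)) * (t k : ZMod 2))]
  have h5 : ∑ k, ∑ j, (if g k < j then (1 : ZMod 2) else 0) * ((t k : ZMod 2) * s j) +
     (∑ k, ∑ j, (if g k < j ∧ f j < f (g k) then (1 : ZMod 2) else 0) * ((t k : ZMod 2) * s j) +
      ∑ k, ∑ j, (if j < g k ∧ f (g k) < f j then (1 : ZMod 2) else 0) * ((t k : ZMod 2) * s j)) =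
     ∑ k, ∑ j, (if f (g k) < f j then (1 : ZMod 2) else 0) * (t k : ZMod 2) * s j +
     ∑ k, ∑ j, if f j = f (g k) then (if g k < j then (1 : ZMod 2) else 0) * ((t k : ZMod 2) * s j) else 0 := by
    simp only [← sum_add_distrib]
    refine sum_congr rfl fun k _ => sum_congr rfl fun j _ => ?_
    have key : ∀ a : J, (if a < j then (1 : ZMod 2) else 0) + ((if a < j ∧ f j < f a then 1 else 0) +
        if j < a ∧ f a < f j then 1 else 0) = (if f a < f j then 1 else 0) + if f j = f a then if a < j then 1 else 0 else 0 := by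
      intro a
      rcases lt_trichotomy a j with h | h | h
      · rcases lt_trichotomy (f a) (f j) with h' | h' | h'
        · simp [h, h.not_gt, h', h'.not_gt, h'.ne']
        · simp [h, h.not_gt, h']
        · simp [h, h', h'.not_gt, h'.ne, two_add]
      · subst h; simp
      · rcases lt_trichotomy (f a) (f j) with h' | h' | h'
        · simp [h, h.not_gt, h', h'.ne']
        · simp [h.not_gt, h']
        · simp [h.not_gt, h'.not_gt, h'.ne]
    have e := key (g k)
    rw [← ite_zero_mul]
    linear_combination (t k : ZMod 2) * s j * e
  have h6 : ∑ k, ∑ k', (if k < k' ∧ g k' < g k then (1 : ZMod 2) else 0) * ((t k : ZMod 2) * t k') +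
      ∑ k, ∑ k', (if g k < g k' ∧ f (g k') < f (g k) then (1 : ZMod 2) else 0) * ((t k : ZMod 2) * t k') =
      ∑ k, ∑ k', (if k < k' ∧ f (g k') < f (g k) then (1 : ZMod 2) else 0) * ((t k : ZMod 2) * t k') +
      ∑ k, ∑ k', (if f (g k') = f (g k) then (if k < k' ∧ g k' < g k then (1 : ZMod 2) else 0) * ((t k : ZMod 2) * t k') else 0) := by
    rw [sum_pairs fun k k' => (if g k < g k' ∧ f (g k') < f (g k) then (1 : ZMod 2) else 0) * ((t k : ZMod 2) * t k')]
    · simp only [← sum_add_distrib]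
      refine sum_congr rfl fun k _ => sum_congr rfl fun k' _ => ?_
      by_cases hk : k < k'
      · simp only [hk, true_and, if_true]
        have key : ∀ a b : J, (if b < a then (1 : ZMod 2) else 0) + ((if a < b ∧ f b < f a then 1 else 0) +
            if b < a ∧ f a < f b then 1 else 0) = (if f b < f a then 1 else 0) + if f b = f a then if b < a then 1 else 0 else 0 := by
          intro a b
          rcases lt_trichotomy a b with h | h | h
          · rcases lt_trichotomy (f a) (f b) with h' | h' | h'
            · simp [h.not_gt, h'.not_gt, h'.ne']
            · simp [h.not_gt, h']
            · simp [h, h.not_gt, h', h'.ne]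
          · subst h; simp
          · rcases lt_trichotomy (f a) (f b) with h' | h' | h'
            · simp [h, h', h'.not_gt, h'.ne', two_add]
            · simp [h, h']
            · simp [h, h.not_gt, h', h'.not_gt, h'.ne]
        rw [← ite_zero_mul]
        linear_combination (t k : ZMod 2) * t k' * key (g k) (g k')
      · simp [hk]
    · intro k
      simp
  linear_combination h5 + h6
end sign

section pentagon
variable {V W U Z : SMod K} {X : Type} [Finite X] {d p : ℤ}

theorem compMap_gmk₀ {V' W' : SMod K} {I : Type} [Fintype I] [LinearOrder I] (F : DegMap V V' 0) (G : DegMap W W' 0) (f : X → I) (p : ℤ)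
    (q : I → ℤ) (hd : p + ∑ i, q i = d) (μ : V.obj I p) (ν : ∀ i, W.obj {x // f x = i} (q i)) :
    (compMap F G).app X d d (add_zero d) (gmk f p q hd μ ν) =
      gmk f p q hd (F.app _ p p (add_zero p) μ) fun i => G.app _ (q i) (q i) (add_zero _) (ν i) := by
  have key : ∀ {A B : SMod K} (F : DegMap A B 0) {Y : Type} [Finite Y] (a b : ℤ) (h : a = b) (h' : a + 0 = b) (x : A.obj Y a),
      F.app Y a b h' x = B.tr (Equiv.refl Y) h (F.app Y a a (add_zero a) x) := by
    rintro A B F Y _ a _ rfl h' x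
    exact (SMod.tr_id _ _ (fun _ => rfl) _ _).symm
  rw [compMap_gmk]
  refine gmk_congr (f := f) (f' := f) (fun _ => rfl) (add_zero p).symm (fun i => (add_zero (q i)).symm) ?_ fun i => ?_
  · exact key F _ _ (add_zero p).symm rfl μ
  · exact key G _ _ (add_zero (q i)).symm rfl (ν i)

theorem gmk_ext₃ {M : Type*} [AddCommGroup M] [Module K M]
    {F G : (comp (comp (comp V W) U) Z).obj X d →ₗ[K] M}
    (h : ∀ (l : ℕ) (φ : X → Fin l) (P' : ℤ) (t : Fin l → ℤ) (hd : P' + ∑ j, t j = d)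
      (m : ℕ) (g : Fin l → Fin m) (P : ℤ) (s : Fin m → ℤ) (hP' : P + ∑ j, s j = P')
      (k : ℕ) (f : Fin m → Fin k) (p : ℤ) (q : Fin k → ℤ) (hP : p + ∑ i, q i = P)
      (μ : V.obj (Fin k) p) (w : ∀ i, W.obj {j // f j = i} (q i))
      (u : ∀ j, U.obj {x // g x = j} (s j)) (r : ∀ j, Z.obj {x // φ x = j} (t j)),
      F (gmk (V := comp (comp V W) U) φ P' t hd (gmk (V := comp V W) g P s hP' (gmk f p q hP μ w) u) r) =
        G (gmk (V := comp (comp V W) U) φ P' t hd (gmk (V := comp V W) g P s hP' (gmk f p q hP μ w) u) r)) : F = G := by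
  refine gmk_ext fun m φ P s hd lam ρ => ?_
  refine LinearMap.congr_fun (f := F ∘ₗ gmkL (V := comp (comp V W) U) (I := Fin m) φ P s hd ρ)
    (g := G ∘ₗ gmkL (V := comp (comp V W) U) (I := Fin m) φ P s hd ρ) (gmk_ext₂ fun _ _ _ _ _ _ _ _ _ _ _ _ _ => ?_) lam
  exact h _ _ _ _ _ _ _ _ _ _ _ _ _ _ _ _ _ _ _

theorem map_comp_gmk {Y I : Type} [Finite Y] [Fintype I] [LinearOrder I] (e : X ≃ Y) (f : X → I) (p : ℤ)
    (q : I → ℤ) (hd : p + ∑ i, q i = d) (μ : V.obj I p) (ν : ∀ i, W.obj {x // f x = i} (q i)) :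
    (comp V W).map e d (gmk f p q hd μ ν) = gmk (fun y => f (e.symm y)) p q hd μ
        (fun i => W.map (fibRelabel f e i) (q i) (ν i)) :=
  comp_tr_gmk e rfl f p q hd μ ν

theorem gmk_smul_left {I : Type} [Fintype I] [LinearOrder I] (f : X → I) (p : ℤ) (q : I → ℤ) (hd : p + ∑ i, q i = d)
    (μ : V.obj I p) (ν : ∀ i, W.obj {x // f x = i} (q i)) (z : ℤˣ) :
    gmk f p q hd (z • μ) ν = z • gmk f p q hd μ ν :=
  LinearMap.map_smul_of_tower (gmkL f p q hd ν) z μ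

theorem gmk_smul_right {I : Type} [Fintype I] [LinearOrder I] (f : X → I) (p : ℤ) (q : I → ℤ) (hd : p + ∑ i, q i = d)
    (μ : V.obj I p) (ν : ∀ i, W.obj {x // f x = i} (q i)) (z : I → ℤˣ) :
    gmk f p q hd μ (fun i => z i • ν i) = (∏ i, z i) • gmk f p q hd μ ν := by
  have e : ∀ (M : Type u) [AddCommGroup M] [Module K M] (z : ℤˣ) (x : M), z • x = ((z : ℤ) : K) • x := by
    intro M _ _ z x
    rw [Units.smul_def, Int.cast_smul_eq_zsmul]
  simp only [e]
  rw [gmk_smul_univ, ← Int.cast_prod, ← Units.coe_prod]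

/-- On iterated generators both sides are the same tree with three levels, and the signs agree by
`asgn_pentagon`. -/
theorem pentagon (V W U Z : SMod K) :
    (assoc V W (comp U Z)).comp (c := 0) (assoc (comp V W) U Z) =
      (compMap (DegMap.id V) (assoc W U Z)).comp ((assoc V (comp W U) Z).comp (c := 0)
        (compMap (assoc V W U) (DegMap.id Z))) := by
  refine degMap_ext_zero fun X _ d x => ?_
  rw [DegMap.comp_app _ _ _ (add_zero d) (add_zero d), DegMap.comp_app _ _ _ (add_zero d) (add_zero d),
    DegMap.comp_app _ _ _ (add_zero d) (add_zero d)]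
  refine LinearMap.congr_fun (f := (assoc V W (comp U Z)).app X d d (add_zero d) ∘ₗ (assoc (comp V W) U Z).app X d d (add_zero d))
    (g := (compMap (DegMap.id V) (assoc W U Z)).app X d d (add_zero d) ∘ₗ ((assoc V (comp W U) Z).app X d d (add_zero d) ∘ₗ
        (compMap (assoc V W U) (DegMap.id Z)).app X d d (add_zero d))) (gmk_ext₃ fun l φ P' t hd m g P s hP' k f p q hP μ w u r => ?_) x
  simp only [LinearMap.comp_apply]
  rw [assoc_gmk, LinearMap.map_smul_of_tower]
  refine (congrArg (asgn t g s • ·) (assoc_gmk (V := V) (W := W) (U := comp U Z) _ _ _ _ _ _ _ _ _)).trans ?_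
  rw [smul_smul, asgn_pentagon]
  refine Eq.symm ?_
  refine (congrArg (fun z => (compMap (DegMap.id V) (assoc W U Z)).app X d d (add_zero d) ((assoc V (comp W U) Z).app X d d (add_zero d) z))
    (compMap_gmk₀ (assoc V W U) (DegMap.id Z) φ P' t hd _ _)).trans ?_
  rw [assoc_gmk]
  refine (congrArg (fun z => (compMap (DegMap.id V) (assoc W U Z)).app X d d (add_zero d) ((assoc V (comp W U) Z).app X d d (add_zero d) z))
    (gmk_smul_left (V := comp V (comp W U)) _ _ _ _ _ _ _)).trans ?_
  rw [LinearMap.map_smul_of_tower, LinearMap.map_smul_of_tower]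
  refine (congrArg (fun z => asgn s f q • (compMap (DegMap.id V) (assoc W U Z)).app X d d (add_zero d) z)
    (assoc_gmk (V := V) (W := comp W U) (U := Z) _ _ _ _ _ _ _ _ _)).trans ?_
  rw [LinearMap.map_smul_of_tower, smul_smul]
  refine Eq.trans (congrArg (_ • ·) ?_) (mul_smul _ _ _).symm
  refine (compMap_gmk₀ (DegMap.id V) (assoc W U Z) _ _ _ _ _ _).trans ?_
  have hj : ∀ (i : Fin k) (j : {j // f j = i}), ∑ k : {k // g k = j}, t k =
      ∑ k : {k : {k // f (g k) = i} // (⟨g k, k.2⟩ : {j // f j = i}) = j}, t k := fun i j =>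
    Fintype.sum_equiv (fibFib g f i j) _ _ fun _ => rfl
  have hD : ∀ i, q i + ∑ j : {j // f j = i}, (s j + ∑ k : {k // g k = j}, t k) =
      q i + ∑ j : {j // f j = i}, s j + ∑ k : {k // f (g k) = i}, t k := fun i => by
    rw [sum_add_distrib, ← add_assoc, sum_congr rfl fun j _ => hj i j]
    exact congrArg (q i + ∑ j : {j // f j = i}, s j + ·)
      (Fintype.sum_fiberwise (fun k : {k // f (g k) = i} => (⟨g k, k.2⟩ : {j // f j = i})) fun k => t k)
  refine Eq.trans ?_ (gmk_smul_right (W := comp W (comp U Z)) _ _ _ _ _ _ _)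
  refine gmk_congr (W := comp W (comp U Z)) (fun _ => rfl) rfl hD
    (SMod.tr_id _ _ (fun _ => rfl) _ _).symm fun i => ?_
  refine (assoc_gmk (X := {x // f (g (φ x)) = i}) _ _ _ _ _ _ _ _ _).trans ?_
  rw [LinearMap.map_smul_of_tower]
  refine congrArg (_ • ·) ?_
  rw [comp_tr_gmk]
  refine gmk_congr (W := comp U Z) (fun _ => rfl) rfl (fun j => ?_)
    (SMod.tr_id _ _ (fun _ => rfl) _ _).symm fun j => ?_
  · exact congrArg (s j + ·) (hj i j)
  · rw [map_comp_gmk, map_comp_gmk]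
    refine Eq.trans ?_ (comp_tr_gmk (V := U) (W := Z) (I := {k // g k = j.1}) _ _ _ _ _ _ _ _).symm
    refine @gmk_eq_mono K _ U Z _ _ {k // g k = j.1} {k : {k // f (g k) = i} // (⟨g k, k.2⟩ : {j // f j = i}) = j} _ _ _ _ _
      (fibFib g f i j) ?_ _ _ _ _ _ _ _ _ ?_ ?_ ?_ _ _ _ _ ?_ ?_
    · exact fun _ _ h => h
    · exact fun _ => rfl
    · exact rfl
    · exact fun _ => rfl
    · exact rfl
    · intro k
      refine (Z.map_trans (fibFib φ (fun x => f (g x)) i _) _ _ _).symm.trans ?_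
      refine Eq.trans ?_ ((tr_map Z _ _ _ _).trans ((tr_map Z _ _ _ _).trans ((tr_map Z _ _ _ _).trans
        (tr_map Z _ _ _ _)))).symm
      refine Z.tr_congr _ _ rfl (fun x => ?_) _
      rfl
end pentagon
end OperadicBar

namespace OperadicBar
variable {K : Type u} [Field K]

/-! ### Coherence of the units -/

section coherence
variable (V W U : SMod K)

/-- The inverse of `assoc`. -/
noncomputable def assocInv : DegMap (comp V (comp W U)) (comp (comp V W) U) 0 where
  app X _ d d' h := (LinearEquiv.ofBijective _ (bijective_assoc V W U X d')).symm.toLinearMap ∘ₗ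
    (comp V (comp W U)).cast X (by omega)
  natural {X Y} _ _ e d d' h x := by
    obtain rfl : d = d' := by omega
    apply (bijective_assoc V W U Y d).1
    rw [(assoc V W U).natural]
    exact ((LinearEquiv.ofBijective _ (bijective_assoc V W U Y d)).apply_symm_apply _).trans
      (congrArg _ ((LinearEquiv.ofBijective _ (bijective_assoc V W U X d)).apply_symm_apply _).symm)

theorem assoc_comp_assocInv :
    (assoc V W U).comp (assocInv V W U) (add_zero 0) = DegMap.id _ := by
  refine degMap_ext_zero fun X _ d x => ?_
  rw [DegMap.comp_app _ _ _ (add_zero d) (add_zero d)]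
  exact (LinearEquiv.ofBijective _ (bijective_assoc V W U X d)).apply_symm_apply _

theorem assocInv_comp_assoc :
    (assocInv V W U).comp (assoc V W U) (add_zero 0) = DegMap.id _ := by
  refine degMap_ext_zero fun X _ d x => ?_
  rw [DegMap.comp_app _ _ _ (add_zero d) (add_zero d)]
  exact (LinearEquiv.ofBijective _ (bijective_assoc V W U X d)).symm_apply_apply _

theorem asgn_eq_one {I J : Type} [Fintype I] [LinearOrder I] [Fintype J] [LinearOrder J] (s : J → ℤ)
    (f : J → I) (q : I → ℤ) (h : (∀ j, s j = 0) ∨ Subsingleton I) : asgn s f q = 1 := by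
  rw [asgn, Int.negOnePow_eq_one_iff]
  rcases h with h | h
  · simp [h]
  · have h' : ∀ a b : I, ¬ a < b := fun a b => (Subsingleton.elim a b).not_lt
    simp [h']

theorem leftUnit_assoc_inv : (leftUnit (comp V W)).comp (c := 0) ((assoc (unit K) V W).comp (c := 0)
      (compMap (leftUnitInv V) (DegMap.id W))) = DegMap.id _ := by
  refine degMap_ext_zero fun X _ d x => ?_
  rw [DegMap.comp_app _ _ _ (add_zero d) (add_zero d), DegMap.comp_app _ _ _ (add_zero d) (add_zero d)]
  refine LinearMap.congr_fun (f := (leftUnit (comp V W)).app X d d (add_zero d) ∘ₗ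
    (assoc (unit K) V W).app X d d (add_zero d) ∘ₗ (compMap (leftUnitInv V) (DegMap.id W)).app X d d (add_zero d))
    (g := LinearMap.id) (gmk_ext fun k φ p q hd μ ν => ?_) x
  simp only [LinearMap.comp_apply]
  rw [compMap_gmk₀]
  refine (congrArg (fun z => (leftUnit (comp V W)).app X d d (add_zero d) ((assoc (unit K) V W).app X d d (add_zero d)
    (gmk (V := comp (unit K) V) φ p q hd z ν))) (lgen_apply μ)).trans ?_
  refine (congrArg _ (assoc_gmk (V := unit K) (I := Unit) _ _ _ _ _ _ _ _ _)).trans ?_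
  rw [asgn_eq_one _ _ _ (Or.inr inferInstance), one_smul]
  refine (leftUnit_gmk (fun _ : X => ()) (Equiv.refl Unit) _ _ rfl (fun _ => ?_) _ () (fun _ => rfl) _).trans ?_
  · exact (congrArg (p + ·) (Fintype.sum_equiv (topFib ()) _ _ fun _ => rfl).symm).trans hd
  refine (one_smul K _).trans ?_
  refine (comp_tr_gmk _ _ _ _ _ _ _ _).trans ?_
  refine @gmk_eq_mono K _ V W _ _ (Fin k) {j : Fin k // (fun _ => ()) j = ()} _ _ _ _ _ (topFib ()) ?_ _ _ _ _ _ _ _ _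
    ?_ ?_ ?_ _ _ _ _ ?_ ?_
  · exact fun _ _ h => h
  · exact fun _ => rfl
  · exact rfl
  · exact fun _ => rfl
  · exact rfl
  · intro i
    refine (W.map_trans _ _ _ _).symm.trans ?_
    refine W.tr_congr _ _ rfl (fun x => ?_) _
    rfl

theorem leftUnit_comp_assoc : (leftUnit (comp V W)).comp (c := 0) (assoc (unit K) V W) =
    compMap (leftUnit V) (DegMap.id W) := by
  have h := congrArg (fun f => DegMap.comp (c := 0) f (compMap (leftUnit V) (DegMap.id W))) (leftUnit_assoc_inv V W)
  rw [DegMap.id_comp] at h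
  rw [← h, DegMap.comp_assoc _ _ _ (add_zero 0) (add_zero 0) (add_zero 0) (add_zero 0),
    DegMap.comp_assoc _ _ _ (add_zero 0) (add_zero 0) (add_zero 0) (add_zero 0), compMap_comp, leftUnitInv_comp, DegMap.id_comp,
    compMap_id, DegMap.comp_id]

theorem rightUnit_assoc_inv : (compMap (DegMap.id V) (rightUnit W)).comp (c := 0) ((assoc V W (unit K)).comp (c := 0)
      (rightUnitInv (comp V W))) = DegMap.id _ := by
  refine degMap_ext_zero fun X _ d x => ?_
  rw [DegMap.comp_app _ _ _ (add_zero d) (add_zero d), DegMap.comp_app _ _ _ (add_zero d) (add_zero d)]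
  refine LinearMap.congr_fun (f := (compMap (DegMap.id V) (rightUnit W)).app X d d (add_zero d) ∘ₗ
    (assoc V W (unit K)).app X d d (add_zero d) ∘ₗ (rightUnitInv (comp V W)).app X d d (add_zero d))
    (g := LinearMap.id) (gmk_ext fun k φ p q hd μ ν => ?_) x
  simp only [LinearMap.comp_apply]
  have h := (rgen_apply (V := comp V W) (gmk φ p q hd μ ν)).trans (congrArg (fun z =>
    gmk (V := comp V W) (W := unit K) (Finite.equivFin X) d (fun _ => 0) (by simp) z (fun _ => unitOne K _ 0))
     (map_comp_gmk (Finite.equivFin X) φ p q hd μ ν))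
  refine (congrArg (fun z => (compMap (DegMap.id V) (rightUnit W)).app X d d (add_zero d)
    ((assoc V W (unit K)).app X d d (add_zero d) z)) h).trans ?_
  rw [assoc_gmk, asgn_eq_one _ _ _ (Or.inl fun _ => rfl), one_smul]
  refine (compMap_gmk₀ (W := comp W (unit K)) _ _ _ _ _ _ _ _).trans ?_
  refine gmk_congr (fun x => ?_) rfl (fun i => ?_) (SMod.tr_id _ _ (fun _ => rfl) _ _).symm fun i => ?_
  · simp
  · simp
  refine (rightUnit_gmk (X := {x // φ ((Finite.equivFin X).symm (Finite.equivFin X x)) = i}) (I := {j // φ ((Finite.equivFin X).symm j) = i})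
    ((Finite.equivFin X).subtypeEquiv fun _ => Iff.rfl) _ _ ?_ (fun _ => rfl) _).trans ?_
  · simp
  refine (tr_map W _ _ _ _).trans ?_
  refine W.tr_congr _ _ _ (fun x => ?_) _
  exact Subtype.ext ((Finite.equivFin X).symm_apply_apply x.1)

theorem rightUnit_comp : (compMap (DegMap.id V) (rightUnit W)).comp (c := 0) (assoc V W (unit K)) =
    rightUnit (comp V W) := by
  have h := congrArg (fun f => DegMap.comp (c := 0) f (rightUnit (comp V W))) (rightUnit_assoc_inv V W)
  rw [DegMap.id_comp] at h
  rw [← h, DegMap.comp_assoc _ _ _ (add_zero 0) (add_zero 0) (add_zero 0) (add_zero 0),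
    DegMap.comp_assoc _ _ _ (add_zero 0) (add_zero 0) (add_zero 0) (add_zero 0), rightUnitInv_comp,
    DegMap.comp_id]

theorem rightUnit_leftUnitInv : (rightUnit (unit K)).comp (c := 0) (leftUnitInv (unit K)) = DegMap.id _ := by
  refine degMap_ext_zero fun X _ d x => ?_
  rw [DegMap.comp_app _ _ _ (add_zero d) (add_zero d)]
  by_cases h : IsEmpty {_e : X ≃ Unit // d = 0}
  · rw [unit_eq_zero h x, map_zero, map_zero, map_zero]
  · obtain ⟨e, rfl⟩ := not_isEmpty_iff.1 h
    rw [unit_eq_smul ⟨e, rfl⟩ x, map_smul, map_smul, map_smul]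
    refine congrArg (unit.ev K ⟨e, rfl⟩ x • ·) ?_
    refine (congrArg _ (lgen_apply _)).trans ?_
    exact (rightUnit_gmk (V := unit K) e (fun _ => 0) (by simp) rfl (fun _ => rfl) _).trans rfl

theorem leftUnit_eq_rightUnit : leftUnit (unit K) = rightUnit (unit K) := by
  have h := congrArg (fun f => DegMap.comp (c := 0) f (leftUnit (unit K))) (rightUnit_leftUnitInv (K := K))
  rw [DegMap.id_comp, DegMap.comp_assoc _ _ _ (add_zero 0) (add_zero 0) (add_zero 0) (add_zero 0), leftUnitInv_comp,
    DegMap.comp_id] at h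
  exact h.symm

end coherence
end OperadicBar

namespace OperadicBar
variable {K : Type u} [Field K]

/-! ### The monoidal category of graded `S`-modules -/

section triangle

/-- The triangle identity, with the right unit inverted so that both sides can be evaluated on generators. -/
theorem triangle_inv (V W : SMod K) : (compMap (DegMap.id V) (leftUnit W)).comp (c := 0) ((assoc V (unit K) W).comp (c := 0)
      (compMap (rightUnitInv V) (DegMap.id W))) = DegMap.id _ := by
  refine degMap_ext_zero fun X _ d x => ?_
  rw [DegMap.comp_app _ _ _ (add_zero d) (add_zero d), DegMap.comp_app _ _ _ (add_zero d) (add_zero d)]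
  refine LinearMap.congr_fun (f := (compMap (DegMap.id V) (leftUnit W)).app X d d (add_zero d) ∘ₗ
    (assoc V (unit K) W).app X d d (add_zero d) ∘ₗ (compMap (rightUnitInv V) (DegMap.id W)).app X d d (add_zero d))
    (g := LinearMap.id) (gmk_ext fun k φ p q hd μ ν => ?_) x
  simp only [LinearMap.comp_apply]
  rw [compMap_gmk₀]
  have hr := (gmk_eq_rgen (Equiv.refl (Fin k)) (fun _ => 0) (by simp) rfl (fun _ => rfl) μ).trans
    (congrArg _ (V.tr_id _ (fun _ => rfl) _ _))
  refine (congrArg (fun z => (compMap (DegMap.id V) (leftUnit W)).app X d d (add_zero d) ((assoc V (unit K) W).app X d d (add_zero d)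
    (gmk (V := comp V (unit K)) φ p q hd z ν))) hr.symm).trans ?_
  rw [assoc_gmk]
  have h1 : asgn q (Equiv.refl (Fin k)) (fun _ => 0) = 1 := by
    rw [asgn, Int.negOnePow_eq_one_iff]
    have : ∀ i j : Fin k, ¬ (i < j ∧ j < i) := fun i j h => h.1.not_gt h.2
    simp [this]
  have hq : ∀ i, ∑ j : {j // Equiv.refl (Fin k) j = i}, q j = q i := fun i =>
    (sum_fibre (Equiv.refl (Fin k)) i q).trans
      ((Finset.sum_eq_single i (fun _ _ h => if_neg h) (fun h => absurd (Finset.mem_univ i) h)).trans (if_pos rfl))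
  rw [h1, one_smul]
  refine (compMap_gmk₀ (W := comp (unit K) W) _ _ _ _ _ _ _ _).trans ?_
  refine gmk_congr (fun _ => rfl) rfl (fun i => ?_) (SMod.tr_id _ _ (fun _ => rfl) _ _).symm fun i => ?_
  · rw [zero_add]
    exact (hq i).symm
  have : Unique {j // Equiv.refl (Fin k) j = i} := ⟨⟨⟨i, rfl⟩⟩, fun j => Subtype.ext j.2⟩
  refine (leftUnit_gmk (X := {x // φ x = i}) (I := {j // Equiv.refl (Fin k) j = i}) _ (Equiv.ofUnique _ _) _ _ rfl
    (fun j => ?_) _ ⟨i, rfl⟩ (fun x => Subtype.ext x.2) _).trans ?_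
  · rw [zero_add]
    exact (congrArg q j.2).trans (hq i).symm
  refine (one_smul K _).trans ?_
  refine (tr_map W _ _ _ _).trans ?_
  exact W.tr_congr _ _ _ (fun x => rfl) _

theorem triangle (V W : SMod K) : (compMap (DegMap.id V) (leftUnit W)).comp (c := 0) (assoc V (unit K) W) =
    compMap (rightUnit V) (DegMap.id W) := by
  have h := congrArg (fun f => DegMap.comp (c := 0) f (compMap (rightUnit V) (DegMap.id W))) (triangle_inv V W)
  rw [DegMap.id_comp] at h
  rw [← h, DegMap.comp_assoc _ _ _ (add_zero 0) (add_zero 0) (add_zero 0) (add_zero 0),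
    DegMap.comp_assoc _ _ _ (add_zero 0) (add_zero 0) (add_zero 0) (add_zero 0), compMap_comp, rightUnitInv_comp, DegMap.id_comp,
    compMap_id, DegMap.comp_id]

end triangle

noncomputable section monoidal
open MonoidalCategory

/-- The category of graded `S`-modules and maps of degree zero. -/
instance : Category (SMod K) where
  Hom V W := DegMap V W 0
  id V := DegMap.id V
  comp f g := g.comp f (add_zero 0)
  id_comp f := DegMap.comp_id f _
  comp_id f := DegMap.id_comp f _
  assoc f g h := (DegMap.comp_assoc h g f _ _ _ _).symm

instance : Preadditive (SMod K) where
  homGroup V W := inferInstanceAs (AddCommGroup (DegMap V W 0))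
  add_comp _ _ _ _ _ _ := DegMap.comp_add ..
  comp_add _ _ _ _ _ _ := DegMap.add_comp ..

/-- The composite product makes graded `S`-modules a monoidal category. -/
instance : MonoidalCategory (SMod K) where
  tensorObj V W := comp V W
  whiskerLeft V _ _ g := compMap (DegMap.id V) g
  whiskerRight f W := compMap f (DegMap.id W)
  tensorHom f g := compMap f g
  tensorUnit := unit K
  associator V W U := ⟨assoc V W U, assocInv V W U, assocInv_comp_assoc V W U, assoc_comp_assocInv V W U⟩
  leftUnitor V := ⟨leftUnit V, leftUnitInv V, leftUnitInv_comp V, leftUnit_comp_inv V⟩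
  rightUnitor V := ⟨rightUnit V, rightUnitInv V, rightUnitInv_comp V, rightUnit_comp_inv V⟩
  tensorHom_def f g := by
    refine Eq.symm ((compMap_comp _ _ _ _).trans ?_)
    rw [DegMap.id_comp, DegMap.comp_id]
  id_tensorHom_id V W := compMap_id V W
  tensorHom_comp_tensorHom f g f' g' := compMap_comp _ _ _ _
  whiskerLeft_id V W := compMap_id V W
  id_whiskerRight V W := compMap_id V W
  associator_naturality f g h := assoc_comp_compMap f g h _ _
  leftUnitor_naturality f := leftUnit_comp_compMap f
  rightUnitor_naturality f := rightUnit_comp_compMap f _ _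
  pentagon V W U Z := (DegMap.comp_assoc _ _ _ _ _ _ _).trans (OperadicBar.pentagon V W U Z).symm
  triangle V W := triangle V W

end monoidal
end OperadicBar

namespace OperadicBar
variable {K : Type u} [Field K]

/-! ### Homogeneous maps as morphisms of a category -/

noncomputable section totalisation
open MonoidalCategory

theorem SMod.comp_app {V W U : SMod K} (f : V ⟶ W) (g : W ⟶ U) {X : Type} [Finite X] {d : ℤ} (x : V.obj X d) :
    DegMap.app (f ≫ g) X d d (add_zero d) x = g.app X d d (add_zero d) (f.app X d d (add_zero d) x) :=
  DegMap.comp_app _ _ _ _ _ _ _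

/-- The graded `S`-modules as objects of a category whose morphisms are all linear maps between products of
homogeneous components. Homogeneous maps of arbitrary degrees embed into it, which makes it possible
to compute with composites of such maps without keeping track of degrees. -/
structure Tot (K : Type u) [Field K] where
  S : SMod K

instance (X : {X : Type // Finite X}) : Finite X.1 := X.2

instance : Category (Tot K) where
  Hom V W := ∀ X : {X : Type // Finite X}, (∀ d, V.S.obj X.1 d) →ₗ[K] (∀ d, W.S.obj X.1 d)
  id _ _ := LinearMap.id
  comp f g X := g X ∘ₗ f X

instance : Preadditive (Tot K) where
  homGroup V W := inferInstanceAs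
    (AddCommGroup (∀ X : {X : Type // Finite X}, (∀ d, V.S.obj X.1 d) →ₗ[K] (∀ d, W.S.obj X.1 d)))
  add_comp _ _ _ _ _ _ := funext fun _ => LinearMap.comp_add _ _ _
  comp_add _ _ _ _ _ _ := funext fun _ => LinearMap.add_comp _ _ _

/-- A homogeneous map as a morphism of `Tot K`. -/
def tot {V W : SMod K} {k : ℤ} (f : DegMap V W k) : (⟨V⟩ : Tot K) ⟶ ⟨W⟩ := fun X =>
  LinearMap.pi fun d' => f.app X.1 (d' - k) d' (by omega) ∘ₗ LinearMap.proj (d' - k)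

variable {U V W : SMod K} {a b c k : ℤ}

theorem tot_apply_eq (f : DegMap V W k) (X : {X : Type // Finite X}) (x : ∀ d, V.obj X.1 d) {d d' : ℤ} (h : d + k = d') :
    tot f X x d' = f.app X.1 d d' h (x d) := by
  obtain rfl : d = d' - k := by omega
  rfl

theorem tot_comp (f : DegMap U V a) (g : DegMap V W b) (h : a + b = c) :
    tot (g.comp f h) = tot f ≫ tot g := by
  funext X
  refine LinearMap.ext fun x => funext fun d' => ?_
  refine (tot_apply_eq _ X x (d := d' - c) (by omega)).trans ?_
  rw [DegMap.comp_app g f h (d' := d' - b) (by omega) (by omega)]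
  refine Eq.symm ((tot_apply_eq g X (tot f X x) (d := d' - b) (by omega)).trans ?_)
  rw [tot_apply_eq f X x (d := d' - c) (by omega)]

theorem tot_comp_zero (f : U ⟶ V) (g : V ⟶ W) : tot (K := K) (k := 0) (f ≫ g) = tot f ≫ tot g := tot_comp f g _

theorem tot_id : tot (DegMap.id V) = 𝟙 (⟨V⟩ : Tot K) := by
  funext X
  exact LinearMap.ext fun x => funext fun d' => tot_apply_eq (DegMap.id V) X x (add_zero d')

theorem tot_add (f g : DegMap V W k) : tot (f + g) = tot f + tot g := rfl
theorem tot_neg (f : DegMap V W k) : tot (-f) = -tot f := rfl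
theorem tot_sub (f g : DegMap V W k) : tot (f - g) = tot f - tot g := by
  rw [sub_eq_add_neg, sub_eq_add_neg, tot_add, tot_neg]
theorem tot_zero : tot (0 : DegMap V W k) = 0 := rfl
theorem tot_recast (f : DegMap V W a) (h : a = b) : tot (f.recast h) = tot f := by
  subst h; rfl

theorem tot_injective {f g : DegMap V W k} (h : tot f = tot g) : f = g := by
  refine DegMap.ext fun X _ d d' hd x => ?_
  classical
  have h1 := congrFun (LinearMap.congr_fun (congrFun h ⟨X, ‹_›⟩) (Pi.single d x)) d'
  rwa [tot_apply_eq f ⟨X, ‹_›⟩ _ hd, tot_apply_eq g ⟨X, ‹_›⟩ _ hd, Pi.single_eq_same] at h1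

end totalisation
end OperadicBar

namespace OperadicBar
open CategoryTheory.Category (id_comp comp_id)
variable {K : Type u} [Field K]

/-! ### Locally eventually constant limits -/

noncomputable section exhaustion
open MonoidalCategory Filter

/-- The value of a map of degree zero at an element. -/
abbrev ev {V W : SMod K} (f : V ⟶ W) {X : Type} [Finite X] {d : ℤ} : V.obj X d →ₗ[K] W.obj X d :=
  DegMap.app f X d d (add_zero d)

theorem ev_comp {V W U : SMod K} (f : V ⟶ W) (g : W ⟶ U) {X : Type} [Finite X] {d : ℤ} (x : V.obj X d) :
    ev (f ≫ g) x = ev g (ev f x) := SMod.comp_app f g x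

theorem ev_id {V : SMod K} {X : Type} [Finite X] {d : ℤ} (x : V.obj X d) : ev (𝟙 V) x = x := rfl

theorem ev_ext {V W : SMod K} {f g : V ⟶ W} (h : ∀ (X : Type) [Finite X] (d : ℤ) (x : V.obj X d), ev f x = ev g x) :
    f = g := degMap_ext_zero h

theorem ev_natural {V W : SMod K} (f : V ⟶ W) {X Y : Type} [Finite X] [Finite Y] (e : X ≃ Y) {d : ℤ} (x : V.obj X d) :
    ev f (V.map e d x) = W.map e d (ev f x) := DegMap.natural f e d d (add_zero d) x

theorem gmk_induction {V W : SMod K} {X : Type} [Finite X] {d : ℤ} {P : (comp V W).obj X d → Prop}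
    (h0 : P 0) (hadd : ∀ x y, P x → P y → P (x + y)) (hsmul : ∀ (c : K) x, P x → P (c • x))
    (hg : ∀ (k : ℕ) (f : X → Fin k) (p : ℤ) (q : Fin k → ℤ) (hd : p + ∑ i, q i = d)
      (μ : V.obj (Fin k) p) (ν : ∀ i, W.obj {x // f x = i} (q i)), P (gmk f p q hd μ ν))
    (z : (comp V W).obj X d) : P z := by
  let S : Submodule K ((comp V W).obj X d) :=
    { carrier := {z | P z}, add_mem' := fun {x y} => hadd x y, zero_mem' := h0, smul_mem' := fun c x => hsmul c x }
  have h : S.mkQ = 0 := gmk_ext fun k f p q hd μ ν => (Submodule.Quotient.mk_eq_zero S).2 (hg k f p q hd μ ν)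
  exact (Submodule.Quotient.mk_eq_zero S).1 (LinearMap.congr_fun h z)

/-- Two sequences of maps agree eventually at each element. -/
def EvEq {A : SMod K} {B : ℕ → SMod K} (f g : ∀ n, A ⟶ B n) : Prop :=
  ∀ (X : Type) [Finite X] (d : ℤ) (x : A.obj X d), ∀ᶠ n in atTop, ev (f n) x = ev (g n) x

theorem EvEq.whiskerLeft {A : SMod K} {B : ℕ → SMod K} {f g : ∀ n, A ⟶ B n} (h : EvEq f g) (V : SMod K) :
    EvEq (fun n => V ◁ f n) (fun n => V ◁ g n) := fun X _ d x => by
  refine gmk_induction (P := fun x => ∀ᶠ n in atTop, ev (V ◁ f n) x = ev (V ◁ g n) x)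
    (Eventually.of_forall fun _ => (map_zero _).trans (map_zero _).symm) (fun x y hx hy => ?_) (fun c x hx => ?_)
    (fun k φ p q hd μ ν => ?_) x
  · filter_upwards [hx, hy] with n h1 h2
    rw [map_add, map_add, h1, h2]
  · filter_upwards [hx] with n h1
    rw [map_smul, map_smul, h1]
  · filter_upwards [eventually_all.2 fun i => h _ _ (ν i)] with n hn
    refine (compMap_gmk₀ _ _ _ _ _ _ _ _).trans (Eq.trans ?_ (compMap_gmk₀ _ _ _ _ _ _ _ _).symm)
    exact congrArg (gmk φ p q hd _) (funext hn)

theorem EvEq.whiskerRight {A : SMod K} {B : ℕ → SMod K} {f g : ∀ n, A ⟶ B n} (h : EvEq f g) (V : SMod K) :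
    EvEq (fun n => f n ▷ V) (fun n => g n ▷ V) := fun X _ d x => by
  refine gmk_induction (P := fun x => ∀ᶠ n in atTop, ev (f n ▷ V) x = ev (g n ▷ V) x)
    (Eventually.of_forall fun _ => (map_zero _).trans (map_zero _).symm) (fun x y hx hy => ?_) (fun c x hx => ?_)
    (fun k φ p q hd μ ν => ?_) x
  · filter_upwards [hx, hy] with n h1 h2
    rw [map_add, map_add, h1, h2]
  · filter_upwards [hx] with n h1
    rw [map_smul, map_smul, h1]
  · filter_upwards [h _ _ μ] with n hn
    refine (compMap_gmk₀ _ _ _ _ _ _ _ _).trans (Eq.trans ?_ (compMap_gmk₀ _ _ _ _ _ _ _ _).symm)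
    exact congrArg (fun z => gmk φ p q hd z _) hn

theorem EvEq.trans {A : SMod K} {B : ℕ → SMod K} {f g h : ∀ n, A ⟶ B n} (h₁ : EvEq f g) (h₂ : EvEq g h) : EvEq f h :=
  fun X _ d x => by
    filter_upwards [h₁ X d x, h₂ X d x] with n h1 h2
    rw [h1, h2]

theorem EvEq.symm {A : SMod K} {B : ℕ → SMod K} {f g : ∀ n, A ⟶ B n} (h : EvEq f g) : EvEq g f :=
  fun X _ d x => (h X d x).mono fun _ => Eq.symm

theorem EvEq.precomp {A A' : SMod K} {B : ℕ → SMod K} {f g : ∀ n, A ⟶ B n} (h : EvEq f g) (t : A' ⟶ A) :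
    EvEq (fun n => t ≫ f n) (fun n => t ≫ g n) :=
  fun X _ d x => by simpa only [ev_comp] using h X d (ev t x)

theorem EvEq.postcomp {A : SMod K} {B B' : ℕ → SMod K} {f g : ∀ n, A ⟶ B n} (h : EvEq f g) (t : ∀ n, B n ⟶ B' n) :
    EvEq (fun n => f n ≫ t n) (fun n => g n ≫ t n) :=
  fun X _ d x => (h X d x).mono fun n hn => by rw [ev_comp, ev_comp, hn]

theorem EvEq.eq {A Z : SMod K} {f g : A ⟶ Z} (h : EvEq (fun _ : ℕ => f) (fun _ => g)) : f = g :=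
  ev_ext fun X _ d x => (h X d x).exists.choose_spec

section lim
variable {A Z : SMod K} {h : ℕ → (A ⟶ Z)}

theorem EvEq.exists_const (hev : EvEq (fun n => h (n + 1)) h) {X : Type} [Finite X] {d : ℤ} (x : A.obj X d) :
    ∃ z : Z.obj X d, ∀ᶠ n in atTop, ev (h n) x = z := by
  obtain ⟨N, hN⟩ := eventually_atTop.1 (hev X d x)
  refine ⟨ev (h N) x, eventually_atTop.2 ⟨N, fun n hn => ?_⟩⟩
  induction n, hn using Nat.le_induction with
  | base => rfl
  | succ n hn ih => rw [hN n hn, ih]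

theorem eventually_unique {α : Type*} {u : ℕ → α} {a b : α} (ha : ∀ᶠ n in atTop, u n = a)
    (hb : ∀ᶠ n in atTop, u n = b) : a = b := by
  obtain ⟨n, h1, h2⟩ := (ha.and hb).exists
  rw [← h1, h2]

/-- The limit of a sequence of maps that is eventually constant at each element. -/
def limMap (h : ℕ → (A ⟶ Z)) (hev : EvEq (fun n => h (n + 1)) h) : A ⟶ Z :=
  have spec : ∀ {X : Type} [Finite X] {d : ℤ} (x : A.obj X d),
    ∀ᶠ n in atTop, ev (h n) x = (hev.exists_const x).choose := fun x => (hev.exists_const x).choose_spec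
  ({ app := fun X _ d d' hd =>
      { toFun := fun x => Z.cast X (by omega) (hev.exists_const x).choose
        map_add' := fun x y => by
          rw [← map_add]
          refine congrArg _ (eventually_unique (spec _) ?_)
          filter_upwards [spec x, spec y] with n h1 h2
          rw [map_add, h1, h2]
        map_smul' := fun c x => by
          rw [← map_smul]
          refine congrArg _ (eventually_unique (spec _) ?_)
          filter_upwards [spec x] with n h1
          rw [map_smul, h1]
          rfl }
     natural := fun {X Y} _ _ e d d' hd x => by
      obtain rfl : d = d' := by omega
      change (hev.exists_const _).choose = Z.map e d (hev.exists_const _).choose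
      refine eventually_unique (spec _) ?_
      filter_upwards [spec x] with n h1
      rw [ev_natural, h1] } : DegMap A Z 0)

theorem limMap_spec (hev : EvEq (fun n => h (n + 1)) h) : EvEq h (fun _ => limMap h hev) :=
  fun X _ d x => (hev.exists_const x).choose_spec

end lim

/-- A presentation of `A` as an increasing union of retracts. -/
structure Exhaustion (A : SMod K) where
  obj : ℕ → SMod K
  J : ∀ n, obj n ⟶ obj (n + 1)
  o : ∀ n, obj n ⟶ A
  E : ∀ n, A ⟶ obj n
  J_o : ∀ n, J n ≫ o (n + 1) = o n
  o_E : ∀ n, o n ≫ E n = 𝟙 _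
  ev : EvEq (fun n => E n ≫ o n) (fun _ => 𝟙 A)

namespace Exhaustion

variable {A : SMod K} (e : Exhaustion A) {Z : SMod K}

/-- The image of an exhaustion under a functor that respects eventual equality. -/
def map (F : SMod K ⥤ SMod K) (hF : ∀ {A : SMod K} {B : ℕ → SMod K} {f g : ∀ n, A ⟶ B n}, EvEq f g →
    EvEq (fun n => F.map (f n)) (fun n => F.map (g n))) : Exhaustion (F.obj A) where
  obj n := F.obj (e.obj n)
  J n := F.map (e.J n)
  o n := F.map (e.o n)
  E n := F.map (e.E n)
  J_o n := by rw [← F.map_comp, e.J_o]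
  o_E n := by rw [← F.map_comp, e.o_E, F.map_id]
  ev := by simpa only [F.map_comp, F.map_id] using hF e.ev

theorem hom_ext {f g : A ⟶ Z} (h : ∀ n, e.o n ≫ f = e.o n ≫ g) : f = g := by
  refine EvEq.eq ?_
  have h1 := fun f : A ⟶ Z => (e.ev.postcomp (B' := fun _ => Z) fun _ => f).symm
  simp only [id_comp, Category.assoc] at h1
  refine (h1 f).trans (EvEq.trans ?_ (h1 g).symm)
  simp only [h]
  exact fun _ _ _ _ => .of_forall fun _ => rfl

theorem exists_trans {g : ∀ n, e.obj n ⟶ Z} (hg : ∀ n, e.J n ≫ g (n + 1) = g n) {n m : ℕ} (h : n ≤ m) :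
    ∃ t : e.obj n ⟶ e.obj m, t ≫ e.o m = e.o n ∧ t ≫ g m = g n := by
  induction m, h using Nat.le_induction with
  | base => exact ⟨𝟙 _, id_comp _, id_comp _⟩
  | succ m _ ih =>
    obtain ⟨t, h1, h2⟩ := ih
    exact ⟨t ≫ e.J m, by rw [Category.assoc, e.J_o, h1], by rw [Category.assoc, hg, h2]⟩

theorem ev_desc {g : ∀ n, e.obj n ⟶ Z} (hg : ∀ n, e.J n ≫ g (n + 1) = g n) :
    EvEq (fun n => e.E (n + 1) ≫ g (n + 1)) (fun n => e.E n ≫ g n) := fun X _ d x => by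
  filter_upwards [e.ev X d x] with n hn
  have h1 : e.o n ≫ e.E (n + 1) ≫ g (n + 1) = g n := by
    rw [← e.J_o, Category.assoc, reassoc_of% e.o_E, hg]
  rw [ev_id, ev_comp] at hn
  rw [← hn, ← ev_comp, ← ev_comp, ← ev_comp, h1, ← ev_comp]
  rw [reassoc_of% e.o_E]

/-- The map out of `A` given by compatible maps on the steps of the exhaustion. -/
def desc (g : ∀ n, e.obj n ⟶ Z) (hg : ∀ n, e.J n ≫ g (n + 1) = g n) : A ⟶ Z :=
  limMap (fun n => e.E n ≫ g n) (e.ev_desc hg)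

theorem o_desc (g : ∀ n, e.obj n ⟶ Z) (hg : ∀ n, e.J n ≫ g (n + 1) = g n) (n : ℕ) :
    e.o n ≫ e.desc g hg = g n := by
  refine EvEq.eq (EvEq.trans ((limMap_spec (e.ev_desc hg)).precomp (e.o n)).symm fun X _ d x => ?_)
  filter_upwards [eventually_ge_atTop n] with m hm
  obtain ⟨t, h1, h2⟩ := e.exists_trans hg hm
  rw [← h1, Category.assoc, reassoc_of% e.o_E, h2]

end Exhaustion

end exhaustion
end OperadicBar

namespace OperadicBar
open Limits Preadditive
open CategoryTheory.Category (id_comp comp_id)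
variable {K : Type u} [Field K]

/-! ### The tree module -/

noncomputable section tree
open MonoidalCategory Filter

section biproduct
variable (V W : SMod K)

/-- The first summand. -/
def inFst : V ⟶ sum V W :=
  ({ app := fun X _ _ _ h => LinearMap.inl K _ _ ∘ₗ V.cast X (by omega)
     natural := fun e d d' h x => by
      obtain rfl : d = d' := by omega
      exact Prod.ext rfl (map_zero (W.map e d)).symm } : DegMap V (sum V W) 0)

/-- The second summand. -/
def inSnd : W ⟶ sum V W :=
  ({ app := fun X _ _ _ h => LinearMap.inr K _ _ ∘ₗ W.cast X (by omega)
     natural := fun e d d' h x => by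
      obtain rfl : d = d' := by omega
      exact Prod.ext (map_zero (V.map e d)).symm rfl } : DegMap W (sum V W) 0)

/-- The first projection. -/
def prFst : sum V W ⟶ V := sumFst V W

/-- The second projection. -/
def prSnd : sum V W ⟶ W := sumSnd V W

theorem inFst_prFst : inFst V W ≫ prFst V W = 𝟙 V := ev_ext fun _ _ _ _ => (ev_comp _ _ _).trans rfl
theorem inFst_prSnd : inFst V W ≫ prSnd V W = 0 := ev_ext fun _ _ _ _ => (ev_comp _ _ _).trans rfl
theorem inSnd_prFst : inSnd V W ≫ prFst V W = 0 := ev_ext fun _ _ _ _ => (ev_comp _ _ _).trans rfl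
theorem inSnd_prSnd : inSnd V W ≫ prSnd V W = 𝟙 W := ev_ext fun _ _ _ _ => (ev_comp _ _ _).trans rfl
theorem sum_total : prFst V W ≫ inFst V W + prSnd V W ≫ inSnd V W = 𝟙 (sum V W) :=
  ev_ext fun X _ d x => by
    have h : ev (prFst V W ≫ inFst V W) x + ev (prSnd V W ≫ inSnd V W) x = x := by
      rw [ev_comp, ev_comp]
      exact Prod.ext (add_zero x.1) (zero_add x.2)
    exact h

end biproduct

@[simp] theorem add_whiskerRight {V W : SMod K} (f g : V ⟶ W) (U : SMod K) : (f + g) ▷ U = f ▷ U + g ▷ U :=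
  compMap_add_left _ _ _

@[simp] theorem zero_whiskerRight {V W : SMod K} (U : SMod K) : (0 : V ⟶ W) ▷ U = 0 :=
  compMap_zero_left _

theorem sub_whiskerRight {V W : SMod K} (f g : V ⟶ W) (U : SMod K) : (f - g) ▷ U = f ▷ U - g ▷ U :=
  compMap_sub_left _ _ _

variable (V : SMod K)

/-- The trees of height at most `n` decorated by `V`. -/
def treeObj : ℕ → SMod K
  | 0 => 𝟙_ (SMod K)
  | n + 1 => sum (𝟙_ (SMod K)) (V ⊗ treeObj n)

/-- The inclusion of the trivial tree. -/
def treeInl (n : ℕ) : 𝟙_ (SMod K) ⟶ treeObj V (n + 1) := inFst _ _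
/-- The inclusion of the trees with a root vertex. -/
def treeInr (n : ℕ) : V ⊗ treeObj V n ⟶ treeObj V (n + 1) := inSnd _ _
/-- The projection onto the trivial tree. -/
def treePrl (n : ℕ) : treeObj V (n + 1) ⟶ 𝟙_ (SMod K) := prFst _ _
/-- The projection onto the trees with a root vertex. -/
def treePrr (n : ℕ) : treeObj V (n + 1) ⟶ V ⊗ treeObj V n := prSnd _ _

@[simp] theorem treeInl_prl (n : ℕ) : treeInl V n ≫ treePrl V n = 𝟙 _ := inFst_prFst _ _
@[simp] theorem treeInl_prr (n : ℕ) : treeInl V n ≫ treePrr V n = 0 := inFst_prSnd _ _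
@[simp] theorem treeInr_prl (n : ℕ) : treeInr V n ≫ treePrl V n = 0 := inSnd_prFst _ _
@[simp] theorem treeInr_prr (n : ℕ) : treeInr V n ≫ treePrr V n = 𝟙 _ := inSnd_prSnd _ _

variable {V} in
theorem treeObj_hom_ext {n : ℕ} {Z : SMod K} {f g : treeObj V (n + 1) ⟶ Z} (h₁ : treeInl V n ≫ f = treeInl V n ≫ g)
    (h₂ : treeInr V n ≫ f = treeInr V n ≫ g) : f = g := by
  have h : treePrl V n ≫ treeInl V n + treePrr V n ≫ treeInr V n = 𝟙 _ := sum_total _ _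
  rw [← id_comp f, ← id_comp g, ← h, add_comp, add_comp]
  simp only [Category.assoc, h₁, h₂]

variable {V} in
/-- The map out of the trees of height at most `n + 1` with given components. -/
def treeDesc {n : ℕ} {Z : SMod K} (f : 𝟙_ (SMod K) ⟶ Z) (g : V ⊗ treeObj V n ⟶ Z) : treeObj V (n + 1) ⟶ Z :=
  treePrl V n ≫ f + treePrr V n ≫ g

@[simp] theorem treeInl_desc {n : ℕ} {Z : SMod K} (f : 𝟙_ (SMod K) ⟶ Z) (g : V ⊗ treeObj V n ⟶ Z) :
    treeInl V n ≫ treeDesc f g = f := by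
  rw [treeDesc, comp_add, ← Category.assoc, ← Category.assoc, treeInl_prl, treeInl_prr, id_comp,
    zero_comp, add_zero]

@[simp] theorem treeInr_desc {n : ℕ} {Z : SMod K} (f : 𝟙_ (SMod K) ⟶ Z) (g : V ⊗ treeObj V n ⟶ Z) :
    treeInr V n ≫ treeDesc f g = g := by
  rw [treeDesc, comp_add, ← Category.assoc, ← Category.assoc, treeInr_prl, treeInr_prr, id_comp,
    zero_comp, zero_add]

/-- The inclusion of the trees of height at most `n` into those of height at most `n + 1`. -/
def treeJ : ∀ n, treeObj V n ⟶ treeObj V (n + 1)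
  | 0 => treeInl V 0
  | n + 1 => treeDesc (treeInl V _) ((V ◁ treeJ n) ≫ treeInr V _)

/-- The projection of the trees of height at most `n + 1` onto those of height at most `n`. -/
def treeR : ∀ n, treeObj V (n + 1) ⟶ treeObj V n
  | 0 => treePrl V 0
  | n + 1 => treeDesc (treeInl V _) ((V ◁ treeR n) ≫ treeInr V _)

@[simp] theorem treeInl_J (n : ℕ) : treeInl V n ≫ treeJ V (n + 1) = treeInl V (n + 1) := treeInl_desc _ _ _
@[simp] theorem treeInr_J (n : ℕ) : treeInr V n ≫ treeJ V (n + 1) = (V ◁ treeJ V n) ≫ treeInr V (n + 1) := treeInr_desc _ _ _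
@[simp] theorem treeInl_R (n : ℕ) : treeInl V (n + 1) ≫ treeR V (n + 1) = treeInl V n := treeInl_desc _ _ _
@[simp] theorem treeInr_R (n : ℕ) : treeInr V (n + 1) ≫ treeR V (n + 1) = (V ◁ treeR V n) ≫ treeInr V n := treeInr_desc _ _ _

/-- The compatible and eventually constant sequences of trees of bounded height. -/
def treeSub (X : Type) [Finite X] (d : ℤ) : Submodule K (∀ n, (treeObj V n).obj X d) where
  carrier := {x | (∀ n, ev (treeR V n) (x (n + 1)) = x n) ∧ ∀ᶠ n in atTop, x (n + 1) = ev (treeJ V n) (x n)}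
  add_mem' {x y} hx hy := ⟨fun n => by rw [Pi.add_apply, Pi.add_apply, map_add, hx.1, hy.1], by
      filter_upwards [hx.2, hy.2] with n h1 h2
      rw [Pi.add_apply, Pi.add_apply, map_add, h1, h2]⟩
  zero_mem' := ⟨fun n => map_zero _, .of_forall fun n => (map_zero _).symm⟩
  smul_mem' c x hx := ⟨fun n => by rw [Pi.smul_apply, Pi.smul_apply, map_smul, hx.1], by
      filter_upwards [hx.2] with n h1
      rw [Pi.smul_apply, Pi.smul_apply, map_smul, h1]⟩

/-- The tree module on `V`: the union of the modules of trees of bounded height. -/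
def Tree : SMod K where
  obj X _ d := treeSub V X d
  map e d := (LinearMap.pi fun n => (treeObj V n).map e d ∘ₗ LinearMap.proj n).restrict fun x hx =>
    ⟨fun n => (ev_natural _ _ _).trans (congrArg _ (hx.1 n)),
      hx.2.mono fun n hn => (congrArg _ hn).trans (ev_natural _ _ _).symm⟩
  map_refl X _ d x := Subtype.ext (funext fun n => (treeObj V n).map_refl X d _)
  map_trans e e' d x := Subtype.ext (funext fun n => (treeObj V n).map_trans e e' d _)

/-- The projection onto the trees of height at most `n`. -/
def treeE (n : ℕ) : Tree V ⟶ treeObj V n :=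
  ({ app := fun X _ d d' h => (treeObj V n).cast X (by omega) ∘ₗ LinearMap.proj n ∘ₗ (treeSub V X d).subtype
     natural := fun e d d' h x => by
      obtain rfl : d = d' := by omega
      rfl } : DegMap (Tree V) (treeObj V n) 0)

theorem treeE_treeR (n : ℕ) : treeE V (n + 1) ≫ treeR V n = treeE V n :=
  ev_ext fun X _ d x => (ev_comp _ _ _).trans (x.2.1 n)

theorem treeE_treeJ : EvEq (fun n => treeE V (n + 1)) (fun n => treeE V n ≫ treeJ V n) := fun X _ d x =>
  x.2.2.mono fun n hn => hn.trans (ev_comp (treeE V n) (treeJ V n) x).symm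

variable {V}

theorem tree_ext {X : Type} [Finite X] {d : ℤ} {x y : (Tree V).obj X d} (h : ∀ᶠ n in atTop, ev (treeE V n) x = ev (treeE V n) y) :
    x = y := by
  obtain ⟨N, hN⟩ := eventually_atTop.1 h
  have key : ∀ n, ev (treeE V n) x = ev (treeE V n) y := fun n => by
    induction k : N - n generalizing n with
    | zero => exact hN n (by omega)
    | succ k ih => rw [← treeE_treeR, ev_comp, ev_comp, ih (n + 1) (by omega)]
  exact Subtype.ext (funext key)

/-- The map into the tree module with given components. -/
def treeLift {A : SMod K} (f : ∀ n, A ⟶ treeObj V n) (hR : ∀ n, f (n + 1) ≫ treeR V n = f n)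
    (hJ : EvEq (fun n => f (n + 1)) (fun n => f n ≫ treeJ V n)) : A ⟶ Tree V :=
  ({ app := fun X _ d d' h => (Tree V).cast X (by omega) ∘ₗ (LinearMap.pi fun n => ev (f n)).codRestrict (treeSub V X d)
      fun x => ⟨fun n => (ev_comp (f (n + 1)) (treeR V n) x).symm.trans (congrArg (fun g => ev g x) (hR n)),
        (hJ X d x).mono fun n hn => hn.trans (ev_comp (f n) (treeJ V n) x)⟩
     natural := fun e d d' h x => by
      obtain rfl : d = d' := by omega
      exact Subtype.ext (funext fun n => ev_natural _ _ _) } : DegMap A (Tree V) 0)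

theorem treeLift_treeE {A : SMod K} (f : ∀ n, A ⟶ treeObj V n) (hR : ∀ n, f (n + 1) ≫ treeR V n = f n)
    (hJ : EvEq (fun n => f (n + 1)) (fun n => f n ≫ treeJ V n)) (n : ℕ) : treeLift f hR hJ ≫ treeE V n = f n :=
  ev_ext fun X _ d x => (ev_comp _ _ _).trans rfl

variable (V)

/-- The components of the trivial tree. -/
def treeUnitAt : ∀ n, 𝟙_ (SMod K) ⟶ treeObj V n
  | 0 => 𝟙 _
  | n + 1 => treeInl V n

/-- The components of the grafting map. -/
def treeNodeAt : ∀ n, V ⊗ Tree V ⟶ treeObj V n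
  | 0 => 0
  | n + 1 => (V ◁ treeE V n) ≫ treeInr V n

theorem treeUnitAt_R : ∀ n, treeUnitAt V (n + 1) ≫ treeR V n = treeUnitAt V n
  | 0 => treeInl_prl V 0
  | n + 1 => treeInl_R V n

theorem treeUnitAt_J : ∀ n, treeUnitAt V (n + 1) = treeUnitAt V n ≫ treeJ V n
  | 0 => (id_comp (treeInl V 0)).symm
  | n + 1 => (treeInl_J V n).symm

theorem treeNodeAt_R : ∀ n, treeNodeAt V (n + 1) ≫ treeR V n = treeNodeAt V n
  | 0 => (Category.assoc _ _ _).trans ((congrArg _ (treeInr_prl V 0)).trans comp_zero)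
  | n + 1 => by
    rw [treeNodeAt, Category.assoc, treeInr_R, ← MonoidalCategory.whiskerLeft_comp_assoc, treeE_treeR, treeNodeAt]

theorem treeNodeAt_J (n : ℕ) : treeNodeAt V (n + 1) ≫ treeJ V (n + 1) = (V ◁ (treeE V n ≫ treeJ V n)) ≫ treeInr V (n + 1) := by
  rw [treeNodeAt, Category.assoc, treeInr_J, MonoidalCategory.whiskerLeft_comp_assoc]

variable {V}

/-- The trivial tree. -/
def treeUnit : 𝟙_ (SMod K) ⟶ Tree V :=
  treeLift (treeUnitAt V) (treeUnitAt_R V) fun _ _ _ _ => .of_forall fun n => congrArg (fun g => ev g _) (treeUnitAt_J V n)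

/-- The grafting map `(v; t₁, …, t_k) ↦ v(t₁, …, t_k)`. -/
def treeNode : V ⊗ Tree V ⟶ Tree V :=
  treeLift (treeNodeAt V) (treeNodeAt_R V) fun X _ d x => by
    obtain ⟨N, hN⟩ := eventually_atTop.1 (((treeE_treeJ V).whiskerLeft V).postcomp (fun n => treeInr V (n + 1)) X d x)
    refine eventually_atTop.2 ⟨N + 1, fun n hn => ?_⟩
    obtain ⟨n, rfl⟩ := Nat.exists_eq_add_of_le' (show 1 ≤ n by omega)
    exact (hN n (by omega)).trans (congrArg (fun g => ev g x) (treeNodeAt_J V n).symm)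

theorem treeUnit_treeE_zero : treeUnit ≫ treeE V 0 = 𝟙 (𝟙_ (SMod K)) :=
  treeLift_treeE (treeUnitAt V) (treeUnitAt_R V) _ 0
theorem treeUnit_treeE_succ (n : ℕ) : treeUnit ≫ treeE V (n + 1) = treeInl V n :=
  treeLift_treeE (treeUnitAt V) (treeUnitAt_R V) _ (n + 1)
theorem treeNode_treeE_succ (n : ℕ) : treeNode ≫ treeE V (n + 1) = (V ◁ treeE V n) ≫ treeInr V n :=
  treeLift_treeE (treeNodeAt V) (treeNodeAt_R V) _ (n + 1)

/-- The inclusion of the trees of height at most `n`. -/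
def treeO : ∀ n, treeObj V n ⟶ Tree V
  | 0 => treeUnit
  | n + 1 => treeDesc treeUnit ((V ◁ treeO n) ≫ treeNode)

@[simp] theorem treeInl_O (n : ℕ) : treeInl V n ≫ treeO (n + 1) = treeUnit := treeInl_desc _ _ _
@[simp] theorem treeInr_O (n : ℕ) : treeInr V n ≫ treeO (n + 1) = (V ◁ treeO n) ≫ treeNode := treeInr_desc _ _ _

theorem treeJ_treeO : ∀ n, treeJ V n ≫ treeO (n + 1) = treeO n
  | 0 => treeInl_O 0
  | n + 1 => treeObj_hom_ext (by rw [← Category.assoc, treeInl_J, treeInl_O, treeInl_O]) (by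
    rw [← Category.assoc, treeInr_J, Category.assoc, treeInr_O, treeInr_O, ← MonoidalCategory.whiskerLeft_comp_assoc,
      treeJ_treeO n])

theorem treeO_treeE : ∀ n, treeO n ≫ treeE V n = 𝟙 _
  | 0 => treeUnit_treeE_zero
  | n + 1 => treeObj_hom_ext (by rw [← Category.assoc, treeInl_O, treeUnit_treeE_succ, comp_id]) (by
    rw [← Category.assoc, treeInr_O, Category.assoc, treeNode_treeE_succ, ← MonoidalCategory.whiskerLeft_comp_assoc,
      treeO_treeE n, MonoidalCategory.whiskerLeft_id, id_comp, comp_id])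

theorem treeE_treeO : EvEq (fun n => treeE V n ≫ treeO n) (fun _ => 𝟙 (Tree V)) := fun X _ d x => by
  obtain ⟨N, hN⟩ := eventually_atTop.1 (treeE_treeJ V X d x)
  have h1 : ∀ n, N ≤ n → ev (treeE V n ≫ treeO n) x = ev (treeE V N ≫ treeO N) x := fun n hn => by
    induction n, hn using Nat.le_induction with
    | base => rfl
    | succ n hn ih =>
      rw [ev_comp, hN n hn, ← ev_comp, Category.assoc, treeJ_treeO, ih]
  have h2 : ev (treeE V N ≫ treeO N) x = x := by
    refine tree_ext (eventually_atTop.2 ⟨N, fun n hn => ?_⟩)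
    rw [← h1 n hn, ← ev_comp, Category.assoc, treeO_treeE, comp_id]
  exact eventually_atTop.2 ⟨N, fun n hn => (h1 n hn).trans h2⟩

variable (V)

/-- The exhaustion of the tree module by height. -/
def treeExh : Exhaustion (Tree V) where
  obj := treeObj V
  J := treeJ V
  o := treeO
  E := treeE V
  J_o := treeJ_treeO
  o_E := treeO_treeE
  ev := treeE_treeO

end tree
end OperadicBar

namespace OperadicBar
open Limits Preadditive
open CategoryTheory.Category (id_comp comp_id)
variable {K : Type u} [Field K]

/-! ### Recursion on trees and the free operad -/

noncomputable section recursion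
open MonoidalCategory

variable {V W Z : SMod K}

theorem exhaustion_tensor_evEq (W : SMod K) {A : SMod K} {B : ℕ → SMod K} {f g : ∀ n, A ⟶ B n} (h : EvEq f g) :
    EvEq (fun n => (tensorRight W).map (f n)) (fun n => (tensorRight W).map (g n)) := h.whiskerRight W

variable (V W) in
/-- The exhaustion of `T(V) ∘ W` by the height of the tree. -/
def treeExhTensor : Exhaustion (Tree V ⊗ W) := (treeExh V).map (tensorRight W) (exhaustion_tensor_evEq W)

theorem treeObj_total (V : SMod K) (n : ℕ) : treePrl V n ≫ treeInl V n + treePrr V n ≫ treeInr V n = 𝟙 _ := sum_total _ _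

theorem treeObj_tensor_hom_ext {n : ℕ} {f g : treeObj V (n + 1) ⊗ W ⟶ Z} (h₁ : treeInl V n ▷ W ≫ f = treeInl V n ▷ W ≫ g)
    (h₂ : treeInr V n ▷ W ≫ f = treeInr V n ▷ W ≫ g) : f = g := by
  have h := treeObj_total V n
  have h' : (treePrl V n ≫ treeInl V n) ▷ W + (treePrr V n ≫ treeInr V n) ▷ W = 𝟙 _ := by
    rw [← add_whiskerRight, h, id_whiskerRight]
  rw [← id_comp f, ← id_comp g, ← h', add_comp, add_comp]
  simp only [comp_whiskerRight, Category.assoc, h₁, h₂]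

/-- Induction on trees with a passive right factor. -/
theorem tree_tensor_induction {f g : Tree V ⊗ W ⟶ Z} (h0 : treeUnit ▷ W ≫ f = treeUnit ▷ W ≫ g)
    (hs : ∀ {A : SMod K} (h : A ⟶ Tree V), h ▷ W ≫ f = h ▷ W ≫ g →
      ((V ◁ h) ≫ treeNode) ▷ W ≫ f = ((V ◁ h) ≫ treeNode) ▷ W ≫ g) : f = g := by
  refine (treeExhTensor V W).hom_ext fun n => ?_
  change treeO n ▷ W ≫ f = treeO n ▷ W ≫ g
  induction n with
  | zero => exact h0
  | succ n ih =>
    refine treeObj_tensor_hom_ext ?_ ?_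
    · rw [← Category.assoc, ← Category.assoc, ← comp_whiskerRight, treeInl_O, h0]
    · rw [← Category.assoc, ← Category.assoc, ← comp_whiskerRight, treeInr_O, hs _ ih]

/-- Induction on trees. -/
theorem tree_induction {f g : Tree V ⟶ Z} (h0 : treeUnit ≫ f = treeUnit ≫ g)
    (hs : ∀ {A : SMod K} (h : A ⟶ Tree V), h ≫ f = h ≫ g →
      V ◁ h ≫ treeNode ≫ f = V ◁ h ≫ treeNode ≫ g) : f = g := by
  rw [← cancel_epi (ρ_ _).hom]
  refine tree_tensor_induction ?_ fun h hh => ?_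
  · rw [rightUnitor_naturality_assoc, rightUnitor_naturality_assoc, h0]
  · rw [rightUnitor_naturality_assoc, rightUnitor_naturality_assoc, cancel_epi] at hh ⊢
    rw [Category.assoc, Category.assoc, hs h hh]

section
variable (a : 𝟙_ (SMod K) ⊗ W ⟶ Z) (c : (V ⊗ Tree V) ⊗ W ⟶ Z) (b : V ⊗ Z ⟶ Z)

/-- The steps of a recursive definition on trees with a passive right factor. -/
def treeRecAt : ∀ n, treeObj V n ⊗ W ⟶ Z
  | 0 => a
  | n + 1 => treePrl V n ▷ W ≫ a + treePrr V n ▷ W ≫ ((V ◁ treeO n) ▷ W ≫ c + (α_ _ _ _).hom ≫ V ◁ treeRecAt n ≫ b)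

theorem treeInl_recAt (n : ℕ) : treeInl V n ▷ W ≫ treeRecAt a c b (n + 1) = a := by
  rw [treeRecAt, comp_add, ← Category.assoc, ← Category.assoc, ← comp_whiskerRight, ← comp_whiskerRight,
    treeInl_prl, treeInl_prr, zero_whiskerRight, zero_comp, add_zero, id_whiskerRight, id_comp]

theorem treeInr_recAt (n : ℕ) : treeInr V n ▷ W ≫ treeRecAt a c b (n + 1) =
    (V ◁ treeO n) ▷ W ≫ c + (α_ _ _ _).hom ≫ V ◁ treeRecAt a c b n ≫ b := by
  rw [treeRecAt, comp_add, ← Category.assoc, ← Category.assoc, ← comp_whiskerRight, ← comp_whiskerRight,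
    treeInr_prl, treeInr_prr, zero_whiskerRight, zero_comp, zero_add, id_whiskerRight, id_comp]

theorem treeJ_recAt : ∀ n, treeJ V n ▷ W ≫ treeRecAt a c b (n + 1) = treeRecAt a c b n
  | 0 => treeInl_recAt a c b 0
  | n + 1 => treeObj_tensor_hom_ext
    (by rw [← Category.assoc, ← comp_whiskerRight, treeInl_J, treeInl_recAt, treeInl_recAt]) (by
      rw [← Category.assoc, ← comp_whiskerRight, treeInr_J, comp_whiskerRight, Category.assoc, treeInr_recAt, treeInr_recAt,
        comp_add, ← Category.assoc, ← comp_whiskerRight, ← MonoidalCategory.whiskerLeft_comp, treeJ_treeO,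
        associator_naturality_middle_assoc, ← whiskerLeft_comp_assoc, treeJ_recAt n])

/-- Recursion on trees with a passive right factor. -/
def treeRec : Tree V ⊗ W ⟶ Z := (treeExhTensor V W).desc (treeRecAt a c b) (treeJ_recAt a c b)

theorem treeO_rec (n : ℕ) : treeO n ▷ W ≫ treeRec a c b = treeRecAt a c b n := (treeExhTensor V W).o_desc _ _ n

theorem treeUnit_rec : treeUnit ▷ W ≫ treeRec a c b = a := treeO_rec a c b 0

theorem treeNode_rec : treeNode ▷ W ≫ treeRec a c b = c + (α_ _ _ _).hom ≫ V ◁ treeRec a c b ≫ b := by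
  refine (((treeExh V).map (tensorLeft V) fun h => h.whiskerLeft V).map (tensorRight W) (exhaustion_tensor_evEq W)).hom_ext
    fun n => ?_
  change (V ◁ treeO n) ▷ W ≫ treeNode ▷ W ≫ treeRec a c b =  (V ◁ treeO n) ▷ W ≫ _
  rw [← comp_whiskerRight_assoc, ← treeInr_O, comp_whiskerRight_assoc, treeO_rec, treeInr_recAt, comp_add,
    associator_naturality_middle_assoc, ← whiskerLeft_comp_assoc, treeO_rec]

end

/-- Recursion on trees. -/
def treeFold (a : 𝟙_ (SMod K) ⟶ Z) (c : V ⊗ Tree V ⟶ Z) (b : V ⊗ Z ⟶ Z) : Tree V ⟶ Z :=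
  (ρ_ _).inv ≫ treeRec ((ρ_ _).hom ≫ a) ((ρ_ _).hom ≫ c) b

theorem treeUnit_fold (a : 𝟙_ (SMod K) ⟶ Z) (c : V ⊗ Tree V ⟶ Z) (b : V ⊗ Z ⟶ Z) : treeUnit ≫ treeFold a c b = a := by
  rw [treeFold, rightUnitor_inv_naturality_assoc, treeUnit_rec, Iso.inv_hom_id_assoc]

theorem treeNode_fold (a : 𝟙_ (SMod K) ⟶ Z) (c : V ⊗ Tree V ⟶ Z) (b : V ⊗ Z ⟶ Z) :
    treeNode ≫ treeFold a c b = c + V ◁ treeFold a c b ≫ b := by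
  rw [treeFold, rightUnitor_inv_naturality_assoc, treeNode_rec, comp_add, Iso.inv_hom_id_assoc,
    rightUnitor_tensor_inv_assoc, Iso.inv_hom_id_assoc, whiskerLeft_comp_assoc]

end recursion

noncomputable section freeOperad
open MonoidalCategory

/-- The composition of an operad as a morphism of the monoidal category of `S`-modules. -/
def GradedOperad.mul (Q : GradedOperad K) : Q.S ⊗ Q.S ⟶ Q.S := Q.γ
/-- The unit of an operad as a morphism of the monoidal category of `S`-modules. -/
def GradedOperad.one (Q : GradedOperad K) : 𝟙_ (SMod K) ⟶ Q.S := Q.η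

theorem GradedOperad.mul_assoc (Q : GradedOperad K) : Q.mul ▷ Q.S ≫ Q.mul = (α_ _ _ _).hom ≫ Q.S ◁ Q.mul ≫ Q.mul :=
  Q.γ_assoc.trans (Category.assoc (obj := SMod K) _ _ _)
theorem GradedOperad.one_mul (Q : GradedOperad K) : Q.one ▷ Q.S ≫ Q.mul = (λ_ _).hom := Q.unit_left
theorem GradedOperad.mul_one (Q : GradedOperad K) : Q.S ◁ Q.one ≫ Q.mul = (ρ_ _).hom := Q.unit_right

variable (V : SMod K)

/-- Grafting of trees. -/
def treeMul : Tree V ⊗ Tree V ⟶ Tree V := treeRec (λ_ _).hom 0 treeNode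

theorem treeUnit_mul : treeUnit ▷ Tree V ≫ treeMul V = (λ_ _).hom := treeUnit_rec _ _ _

theorem treeNode_mul : treeNode ▷ Tree V ≫ treeMul V = (α_ _ _ _).hom ≫ V ◁ treeMul V ≫ treeNode := by
  rw [treeMul, treeNode_rec, zero_add]

variable {V} in
theorem treeNode_mul' {A : SMod K} (h : A ⟶ Tree V) : (V ◁ h ≫ treeNode) ▷ Tree V ≫ treeMul V =
    (α_ _ _ _).hom ≫ V ◁ (h ▷ Tree V ≫ treeMul V) ≫ treeNode := by
  rw [comp_whiskerRight_assoc, treeNode_mul, associator_naturality_middle_assoc, whiskerLeft_comp_assoc]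

theorem treeMul_unit : Tree V ◁ treeUnit ≫ treeMul V = (ρ_ _).hom := by
  refine tree_tensor_induction ?_ fun h hh => ?_
  · rw [← whisker_exchange_assoc, treeUnit_mul, rightUnitor_naturality, leftUnitor_naturality]
    exact congrArg (· ≫ treeUnit) leftUnit_eq_rightUnit
  · rw [← whisker_exchange_assoc] at hh ⊢
    rw [treeNode_mul', tensor_whiskerLeft_assoc, Iso.inv_hom_id_assoc, ← whiskerLeft_comp_assoc, hh,
      rightUnitor_naturality, rightUnitor_naturality, rightUnitor_tensor_hom_assoc, whiskerLeft_comp_assoc]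

theorem treeMul_assoc : treeMul V ▷ Tree V ≫ treeMul V = (α_ _ _ _).hom ≫ Tree V ◁ treeMul V ≫ treeMul V := by
  rw [← cancel_epi (α_ _ _ _).inv]
  refine tree_tensor_induction ?_ fun h hh => ?_
  · simp only [Iso.inv_hom_id_assoc]
    rw [← whisker_exchange_assoc, treeUnit_mul, associator_inv_naturality_left_assoc, ← comp_whiskerRight_assoc, treeUnit_mul,
      leftUnitor_naturality, leftUnitor_tensor_hom_assoc]
  · rw [Iso.inv_hom_id_assoc, associator_inv_naturality_left_assoc, ← comp_whiskerRight_assoc, ← whisker_exchange_assoc] at hh ⊢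
    rw [Iso.inv_comp_eq] at hh ⊢
    rw [treeNode_mul', comp_whiskerRight_assoc, treeNode_mul', hh, whiskerLeft_comp_assoc, pentagon_assoc,
      tensor_whiskerLeft_assoc, Iso.inv_hom_id_assoc, whiskerLeft_comp_assoc]

/-- The free operad. -/
def treeOperad : GradedOperad K where
  S := Tree V
  γ := treeMul V
  η := treeUnit
  γ_assoc := (treeMul_assoc V).trans (Category.assoc _ _ _).symm
  unit_left := treeUnit_mul V
  unit_right := treeMul_unit V

/-- The inclusion of generators. -/
def treeGen : V ⟶ Tree V := (ρ_ V).inv ≫ V ◁ treeUnit ≫ treeNode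

theorem treeGen_mul : treeGen V ▷ Tree V ≫ treeMul V = treeNode := by
  rw [treeGen, comp_whiskerRight_assoc, treeNode_mul', treeUnit_mul, triangle_assoc, ← comp_whiskerRight_assoc,
    Iso.inv_hom_id, id_whiskerRight, id_comp]

variable {V} in
/-- The morphism of operads given by a map on generators. -/
def treeOperadFold (Q : GradedOperad K) (g : V ⟶ Q.S) : Tree V ⟶ Q.S := treeFold Q.one 0 (g ▷ Q.S ≫ Q.mul)

section
variable {V} (Q : GradedOperad K) (g : V ⟶ Q.S)

theorem treeNode_operadFold : treeNode ≫ treeOperadFold Q g = V ◁ treeOperadFold Q g ≫ g ▷ Q.S ≫ Q.mul :=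
  (treeNode_fold _ _ _).trans (zero_add _)

theorem treeOperadFold_mul : treeMul V ≫ treeOperadFold Q g =
    treeOperadFold Q g ▷ Tree V ≫ Q.S ◁ treeOperadFold Q g ≫ Q.mul := by
  refine tree_tensor_induction ?_ fun h hh => ?_
  · rw [← Category.assoc, treeUnit_mul, ← comp_whiskerRight_assoc, treeOperadFold, treeUnit_fold, ← whisker_exchange_assoc,
      Q.one_mul, leftUnitor_naturality]
  · rw [← Category.assoc, treeNode_mul', ← comp_whiskerRight_assoc, Category.assoc, Category.assoc, treeNode_operadFold,
      Category.assoc, treeNode_operadFold, ← whiskerLeft_comp_assoc, Category.assoc, hh]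
    simp only [comp_whiskerRight, whiskerLeft_comp, Category.assoc]
    rw [← whisker_exchange_assoc Q.mul, Q.mul_assoc, tensor_whiskerLeft_assoc, Iso.inv_hom_id_assoc,
      associator_naturality_left_assoc, associator_naturality_middle_assoc, associator_naturality_middle_assoc,
      ← whisker_exchange_assoc, ← whisker_exchange_assoc]

/-- Two maps out of the free operad that respect composition and unit agree if they agree on generators. -/
theorem treeOperad_hom_ext {f f' : Tree V ⟶ Q.S} (h : treeMul V ≫ f = f ▷ Tree V ≫ Q.S ◁ f ≫ Q.mul)
    (h' : treeMul V ≫ f' = f' ▷ Tree V ≫ Q.S ◁ f' ≫ Q.mul) (hu : treeUnit ≫ f = treeUnit ≫ f')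
    (hg : treeGen V ≫ f = treeGen V ≫ f') : f = f' := by
  refine tree_induction hu fun t ht => ?_
  rw [← treeGen_mul, Category.assoc, Category.assoc, h, h', ← comp_whiskerRight_assoc, ← comp_whiskerRight_assoc, hg,
    whisker_exchange_assoc, whisker_exchange_assoc, ← whiskerLeft_comp_assoc, ← whiskerLeft_comp_assoc, ht]

theorem treeGen_fold : treeGen V ≫ treeOperadFold Q g = g := by
  rw [treeGen, Category.assoc, Category.assoc, treeNode_operadFold, ← whiskerLeft_comp_assoc, treeOperadFold, treeUnit_fold,
    whisker_exchange_assoc, Q.mul_one, rightUnitor_naturality, Iso.inv_hom_id_assoc]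

end

/-- A morphism of operads out of the tree module is forced by the recursion on the height, which is
`treeOperadFold`. -/
theorem treeOperad_isFree : IsFreeOperad (treeOperad V) (treeGen V) := fun Q g => by
  have hm : ∀ f : Tree V ⟶ Q.S, f ▷ Tree V ≫ Q.S ◁ f ≫ Q.mul = (f ⊗ₘ f) ≫ Q.mul := fun f => by
    rw [tensorHom_def_assoc]
  refine ⟨{ f := treeOperadFold Q g, map_γ := (treeOperadFold_mul Q g).trans (hm _), map_η := treeUnit_fold _ _ _ },
    treeGen_fold Q g, fun F hF => ?_⟩
  have : F.f = treeOperadFold Q g := treeOperad_hom_ext Q (Eq.trans F.map_γ (hm _).symm) (treeOperadFold_mul Q g)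
    (Eq.trans F.map_η (treeUnit_fold _ _ _).symm) (Eq.trans hF (treeGen_fold Q g).symm)
  cases F
  congr

end freeOperad
end OperadicBar

namespace OperadicBar
open Limits Preadditive
open CategoryTheory.Category (id_comp comp_id)
variable {K : Type u} [Field K]

/-! ### The cooperad of trees -/

noncomputable section treeCooperad
open MonoidalCategory

variable (V : SMod K)

/-- The projection onto the trivial tree. -/
def treeCounit : Tree V ⟶ 𝟙_ (SMod K) := treeE V 0
/-- The root label of a tree with at most one vertex. -/
def treeRoot : treeObj V 1 ⟶ V := (treePrr V 0 : treeObj V 1 ⟶ V ⊗ 𝟙_ (SMod K)) ≫ (ρ_ V).hom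
/-- The projection onto the trees with exactly one vertex. -/
def treeProj : Tree V ⟶ V := treeE V 1 ≫ treeRoot V
/-- The decomposition of a tree that cuts below the root. -/
def treeCut : Tree V ⟶ Tree V ⊗ Tree V := (λ_ _).inv ≫ treeUnit ▷ Tree V
/-- Grafting of the lower part of a decomposed tree. -/
def treeGraft (Z : SMod K) : V ⊗ (Tree V ⊗ Z) ⟶ Tree V ⊗ Z := (α_ _ _ _).inv ≫ treeNode ▷ Z
/-- The sum over all ways to cut a tree into an upper and a lower part. -/
def treeComul : Tree V ⟶ Tree V ⊗ Tree V :=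
  treeFold (treeUnit ≫ treeCut V) (treeNode ≫ treeCut V) (treeGraft V (Tree V))

theorem treeUnit_counit : treeUnit ≫ treeCounit V = 𝟙 _ := treeUnit_treeE_zero
theorem treeNode_counit : treeNode ≫ treeCounit V = 0 := treeLift_treeE (treeNodeAt V) (treeNodeAt_R V) _ 0
theorem treeInl_root : treeInl V 0 ≫ treeRoot V = 0 :=
  (Category.assoc _ _ _).symm.trans ((congrArg (· ≫ (ρ_ V).hom) (treeInl_prr V 0)).trans zero_comp)
theorem treeInr_root : (treeInr V 0 : V ⊗ 𝟙_ (SMod K) ⟶ _) ≫ treeRoot V = (ρ_ V).hom :=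
  (Category.assoc _ _ _).symm.trans ((congrArg (· ≫ (ρ_ V).hom) (treeInr_prr V 0)).trans (id_comp _))
theorem treeUnit_proj : treeUnit ≫ treeProj V = 0 := by
  rw [treeProj, ← Category.assoc, treeUnit_treeE_succ, treeInl_root]
theorem treeNode_proj : treeNode ≫ treeProj V = V ◁ treeCounit V ≫ (ρ_ V).hom :=
  (Category.assoc _ _ _).symm.trans ((congrArg (· ≫ treeRoot V) (treeNode_treeE_succ 0)).trans
    ((Category.assoc _ _ _).trans (congrArg (V ◁ treeCounit V ≫ ·) (treeInr_root V))))
theorem treeUnit_comul : treeUnit ≫ treeComul V = treeUnit ≫ treeCut V := treeUnit_fold _ _ _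
theorem treeNode_comul : treeNode ≫ treeComul V = treeNode ≫ treeCut V + V ◁ treeComul V ≫ treeGraft V _ := treeNode_fold _ _ _

theorem treeCut_whiskerRight {Z : SMod K} (f : Tree V ⟶ Z) : treeCut V ≫ f ▷ Tree V = (λ_ _).inv ≫ (treeUnit ≫ f) ▷ Tree V := by
  rw [treeCut, Category.assoc, comp_whiskerRight]

theorem treeCut_whiskerLeft {Z : SMod K} (f : Tree V ⟶ Z) : treeCut V ≫ Tree V ◁ f = f ≫ (λ_ _).inv ≫ treeUnit ▷ Z := by
  rw [treeCut, Category.assoc, ← whisker_exchange, leftUnitor_inv_naturality_assoc]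

theorem treeGraft_whiskerRight {Z Y : SMod K} (f : Tree V ⟶ Y) : treeGraft V Z ≫ f ▷ Z = (α_ _ _ _).inv ≫ (treeNode ≫ f) ▷ Z := by
  rw [treeGraft, Category.assoc, comp_whiskerRight]

theorem treeGraft_whiskerLeft {Z Z' : SMod K} (f : Z ⟶ Z') : treeGraft V Z ≫ Tree V ◁ f = V ◁ Tree V ◁ f ≫ treeGraft V Z' := by
  rw [treeGraft, treeGraft, Category.assoc, ← whisker_exchange, associator_inv_naturality_right_assoc]

theorem treeUnit_cut : treeUnit ≫ treeCut V = (λ_ _).inv ≫ treeUnit ▷ _ ≫ Tree V ◁ treeUnit := by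
  rw [treeCut, leftUnitor_inv_naturality_assoc, whisker_exchange]

theorem treeComul_counit_left : treeComul V ≫ treeCounit V ▷ Tree V ≫ (λ_ _).hom = 𝟙 _ := by
  refine tree_induction ?_ fun h hh => ?_
  · rw [← Category.assoc, treeUnit_comul, Category.assoc, ← Category.assoc (treeCut V), treeCut_whiskerRight, treeUnit_counit,
      id_whiskerRight, comp_id, Iso.inv_hom_id]
  · rw [← Category.assoc treeNode, treeNode_comul, add_comp, Category.assoc, Category.assoc,
      ← Category.assoc (treeCut V), treeCut_whiskerRight, treeUnit_counit,
      id_whiskerRight, comp_id, Iso.inv_hom_id, ← Category.assoc (treeGraft V _), treeGraft_whiskerRight,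
      treeNode_counit, zero_whiskerRight, comp_zero, zero_comp, comp_zero, add_zero]

theorem treeComul_counit_right : treeComul V ≫ Tree V ◁ treeCounit V ≫ (ρ_ _).hom = 𝟙 _ := by
  have h1 : treeCut V ≫ Tree V ◁ treeCounit V ≫ (ρ_ _).hom = treeCounit V ≫ treeUnit := by
    rw [← Category.assoc, treeCut_whiskerLeft, Category.assoc, Category.assoc, rightUnitor_naturality]
    have : (λ_ (𝟙_ (SMod K))).hom = (ρ_ (𝟙_ (SMod K))).hom := leftUnit_eq_rightUnit
    rw [← this, Iso.inv_hom_id_assoc]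
  have h2 : treeGraft V _ ≫ (ρ_ (Tree V)).hom = V ◁ (ρ_ _).hom ≫ treeNode := by
    rw [treeGraft, Category.assoc, rightUnitor_naturality, rightUnitor_tensor_hom_assoc, Iso.inv_hom_id_assoc]
  refine tree_induction ?_ fun h hh => ?_
  · rw [← Category.assoc, treeUnit_comul, Category.assoc, h1, ← Category.assoc, treeUnit_counit, id_comp,
      comp_id]
  · rw [← Category.assoc treeNode, treeNode_comul, add_comp, Category.assoc, Category.assoc, h1,
      ← Category.assoc treeNode, treeNode_counit, zero_comp, zero_add, ← Category.assoc (treeGraft V _),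
      treeGraft_whiskerLeft, Category.assoc, h2, ← whiskerLeft_comp_assoc, ← whiskerLeft_comp_assoc, ← whiskerLeft_comp_assoc,
      Category.assoc, Category.assoc, hh, comp_id, comp_id]

/-- Induction on trees: cutting is recursive in the branches above the root vertex. -/
theorem treeComul_coassoc : treeComul V ≫ treeComul V ▷ Tree V ≫ (α_ _ _ _).hom = treeComul V ≫ Tree V ◁ treeComul V := by
  have h1 : treeCut V ≫ Tree V ◁ treeComul V = treeComul V ≫ (λ_ _).inv ≫ treeUnit ▷ _ := treeCut_whiskerLeft _ _
  have h2 : treeCut V ▷ Tree V ≫ (α_ _ _ _).hom = (λ_ _).inv ≫ treeUnit ▷ _ := by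
    rw [treeCut, comp_whiskerRight, Category.assoc, associator_naturality_left, leftUnitor_tensor_inv, Category.assoc]
  have h3 : treeCut V ≫ treeComul V ▷ Tree V ≫ (α_ _ _ _).hom = treeCut V ≫ (λ_ _).inv ≫ treeUnit ▷ _ := by
    rw [← Category.assoc, treeCut_whiskerRight, treeUnit_comul, comp_whiskerRight, Category.assoc, Category.assoc, h2, treeCut,
      Category.assoc]
  have h4 : treeGraft V (Tree V) ≫ treeComul V ▷ Tree V ≫ (α_ _ _ _).hom = treeGraft V _ ≫ (λ_ _).inv ≫ treeUnit ▷ _ +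
      V ◁ (treeComul V ▷ Tree V ≫ (α_ _ _ _).hom) ≫ treeGraft V _ := by
    rw [← Category.assoc, treeGraft_whiskerRight, treeNode_comul, add_whiskerRight, comp_add, add_comp]
    congr 1
    · rw [comp_whiskerRight, Category.assoc, Category.assoc, h2, treeGraft, Category.assoc]
    · rw [treeGraft, treeGraft]
      simp only [comp_whiskerRight, Category.assoc, associator_naturality_left, whiskerLeft_comp]
      rw [← associator_inv_naturality_middle_assoc, pentagon_inv_inv_hom_hom_inv_assoc]
  refine tree_induction ?_ fun h hh => ?_
  · rw [← Category.assoc, treeUnit_comul, Category.assoc, h3, ← Category.assoc treeUnit (treeComul V), treeUnit_comul,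
      Category.assoc, h1, ← Category.assoc, ← treeUnit_comul, Category.assoc]
  · rw [← Category.assoc treeNode, ← Category.assoc treeNode, treeNode_comul, add_comp, add_comp,
      Category.assoc, Category.assoc, h3, h4, Category.assoc, Category.assoc, h1, treeGraft_whiskerLeft,
      ← Category.assoc treeNode (treeComul V), treeNode_comul, add_comp]
    have hh' := congrArg (fun z => V ◁ z ≫ treeGraft V _) hh
    simp only [whiskerLeft_comp, Category.assoc] at hh'
    simp only [comp_add, whiskerLeft_comp, Category.assoc, add_assoc]
    rw [hh']

/-- The decomposition of a tree according to its root vertex. -/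
theorem tree_decompose : treeCounit V ≫ treeUnit + treeComul V ≫ treeProj V ▷ Tree V ≫ treeNode = 𝟙 (Tree V) := by
  have h1 : treeCut V ≫ treeProj V ▷ Tree V ≫ treeNode = 0 := by
    rw [← Category.assoc, treeCut_whiskerRight, treeUnit_proj, zero_whiskerRight, comp_zero, zero_comp]
  refine tree_induction ?_ fun h hh => ?_
  · rw [comp_add, ← Category.assoc, treeUnit_counit, ← Category.assoc, treeUnit_comul, Category.assoc, h1,
      comp_zero, add_zero, id_comp, comp_id]
  · rw [comp_add, ← Category.assoc treeNode, treeNode_counit, ← Category.assoc treeNode, treeNode_comul,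
      add_comp, Category.assoc, h1, comp_zero, zero_comp, zero_add, zero_add, Category.assoc,
      ← Category.assoc (treeGraft V _), treeGraft_whiskerRight, treeNode_proj, comp_whiskerRight, Category.assoc, Category.assoc,
      ← associator_inv_naturality_middle_assoc, ← Category.assoc (α_ _ _ _).inv, triangle_assoc_comp_right,
      ← whiskerLeft_comp_assoc, ← whiskerLeft_comp_assoc, ← whiskerLeft_comp_assoc, Category.assoc, Category.assoc,
      treeComul_counit_left, comp_id, comp_id]

/-- The cofree conilpotent cooperad. -/
def treeCooperad : GradedCooperad K where
  S := Tree V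
  Δ := treeComul V
  ε := treeCounit V
  η := treeUnit
  Δ_coassoc := (Category.assoc _ _ _).trans (treeComul_coassoc V)
  counit_left := (Category.assoc _ _ _).trans (treeComul_counit_left V)
  counit_right := (Category.assoc _ _ _).trans (treeComul_counit_right V)
  ε_η := treeUnit_counit V
  Δ_η := by
    have : (λ_ _).hom ≫ treeUnit ≫ treeComul V = treeUnit ⊗ₘ treeUnit := by
      rw [treeUnit_comul, treeUnit_cut, Iso.hom_inv_id_assoc, MonoidalCategory.tensorHom_def]
    exact (Category.assoc _ _ _).trans this

end treeCooperad
end OperadicBar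

namespace OperadicBar
open Limits Preadditive
open CategoryTheory.Category (id_comp comp_id)
variable {K : Type u} [Field K]

/-! ### Cofreeness of the cooperad of trees -/

noncomputable section cofree
open MonoidalCategory Filter

namespace GradedCooperad

variable (C : GradedCooperad K)

/-- The decomposition of a cooperad as a morphism of the monoidal category of `S`-modules. -/
def comul : C.S ⟶ C.S ⊗ C.S := C.Δ
/-- The counit of a cooperad as a morphism of the monoidal category of `S`-modules. -/
def counit : C.S ⟶ 𝟙_ (SMod K) := C.ε
/-- The coaugmentation of a cooperad as a morphism of the monoidal category of `S`-modules. -/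
def coaug : 𝟙_ (SMod K) ⟶ C.S := C.η

theorem comul_assoc : C.comul ≫ C.comul ▷ C.S ≫ (α_ _ _ _).hom = C.comul ≫ C.S ◁ C.comul :=
  (Category.assoc _ _ _).symm.trans C.Δ_coassoc
theorem comul_counit : C.comul ≫ C.counit ▷ C.S ≫ (λ_ _).hom = 𝟙 _ := (Category.assoc _ _ _).symm.trans C.counit_left
theorem comul_counit' : C.comul ≫ C.S ◁ C.counit ≫ (ρ_ _).hom = 𝟙 _ := (Category.assoc _ _ _).symm.trans C.counit_right
theorem coaug_counit : C.coaug ≫ C.counit = 𝟙 _ := C.ε_η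
theorem coaug_comul : C.coaug ≫ C.comul = (λ_ _).inv ≫ C.coaug ▷ _ ≫ C.S ◁ C.coaug := by
  rw [Iso.eq_inv_comp, ← MonoidalCategory.tensorHom_def]
  exact (Category.assoc _ _ _).symm.trans C.Δ_η

theorem comul_counit_left : C.comul ≫ C.counit ▷ C.S = (λ_ _).inv := by
  rw [← cancel_mono (λ_ _).hom, Category.assoc, comul_counit, Iso.inv_hom_id]

theorem proj_comp {V : SMod K} {g : C.S ⟶ V} (h : C.coaug ≫ g = 0) : (C.proj : C.S ⟶ C.S) ≫ g = g := by
  have h1 : (C.proj : C.S ⟶ C.S) = 𝟙 _ - C.counit ≫ C.coaug := rfl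
  rw [h1, sub_comp, Category.assoc, h, comp_zero, sub_zero, id_comp]

theorem coaug_comul_whiskerRight {V Z : SMod K} {g : C.S ⟶ V} (h : C.coaug ≫ g = 0) (f : C.S ⟶ Z) :
    C.coaug ≫ C.comul ≫ g ▷ C.S ≫ V ◁ f = 0 := by
  rw [← Category.assoc, coaug_comul, Category.assoc, Category.assoc, whisker_exchange_assoc, ← comp_whiskerRight_assoc, h,
    zero_whiskerRight, zero_comp, comp_zero]

/-- The span of the two-level trees with upper vertices in a given step of the coradical filtration. -/
def upperSpan (n : ℕ) (X : Type) [Finite X] (d : ℤ) : Submodule K ((comp C.S C.S).obj X d) :=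
  Submodule.span K {z : compObj C.S C.S X d | ∃ (s : Shape X d) (μ : C.S.obj (Fin s.k) s.p)
      (ν : ∀ i, C.S.obj {x // s.f x = i} (s.q i)), (∀ i, ν i ∈ C.level n {x // s.f x = i} (s.q i)) ∧ z = cmk s μ ν}

theorem mem_level_succ {n : ℕ} {X : Type} [Finite X] {d : ℤ} {x : C.S.obj X d} :
    x ∈ C.level (n + 1) X d ↔ ev (C.comul ≫ (C.proj : C.S ⟶ C.S) ▷ C.S) x ∈ C.upperSpan n X d := by
  rw [level]
  exact Iff.rfl

/-- Two maps agree on a step of the coradical filtration. -/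
def Agree {Z : SMod K} (n : ℕ) (f f' : C.S ⟶ Z) : Prop :=
  ∀ (X : Type) [Finite X] (d : ℤ) (x : C.S.obj X d), x ∈ C.level n X d → ev f x = ev f' x

variable {C}

theorem Agree.postcomp {Z Z' : SMod K} {n : ℕ} {f f' : C.S ⟶ Z} (h : C.Agree n f f') (g : Z ⟶ Z') :
    C.Agree n (f ≫ g) (f' ≫ g) := fun X _ d x hx => by rw [ev_comp, ev_comp, h X d x hx]

theorem Agree.add_left {Z : SMod K} {n : ℕ} {f f' : C.S ⟶ Z} (h : C.Agree n f f') (c : C.S ⟶ Z) :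
    C.Agree n (c + f) (c + f') := fun X _ d x hx => congrArg (ev c x + ·) (h X d x hx)

theorem agree_zero {V Z : SMod K} {g : C.S ⟶ V} (h : C.coaug ≫ g = 0) (f f' : C.S ⟶ Z) :
    C.Agree 0 (C.comul ≫ g ▷ C.S ≫ V ◁ f) (C.comul ≫ g ▷ C.S ≫ V ◁ f') := fun X _ d x hx => by
  rw [level] at hx
  obtain ⟨y, rfl⟩ := hx
  change ev _ (ev C.coaug y) = ev _ (ev C.coaug y)
  rw [← ev_comp, ← ev_comp, coaug_comul_whiskerRight C h, coaug_comul_whiskerRight C h]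

theorem Agree.succ {V Z : SMod K} {g : C.S ⟶ V} (h : C.coaug ≫ g = 0) {f f' : C.S ⟶ Z} {n : ℕ} (hf : C.Agree n f f') :
    C.Agree (n + 1) (C.comul ≫ g ▷ C.S ≫ V ◁ f) (C.comul ≫ g ▷ C.S ≫ V ◁ f') := fun X _ d x hx => by
  rw [mem_level_succ] at hx
  have key : ∀ f : C.S ⟶ Z, ev (C.comul ≫ g ▷ C.S ≫ V ◁ f) x =
      ev (g ▷ C.S ≫ V ◁ f) (ev (C.comul ≫ (C.proj : C.S ⟶ C.S) ▷ C.S) x) := fun f => by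
    rw [← ev_comp, Category.assoc, ← comp_whiskerRight_assoc, C.proj_comp h]
  rw [key, key]
  refine Submodule.span_induction (M := (comp C.S C.S).obj X d) (p := fun z _ => ev (g ▷ C.S ≫ V ◁ f) z = ev (g ▷ C.S ≫ V ◁ f') z) ?_
    ((map_zero _).trans (map_zero _).symm) (fun y z _ _ hy hz => ?_) (fun c y _ hy => ?_) hx
  · rintro _ ⟨s, μ, ν, hν, rfl⟩
    have : (cmk s μ ν : (comp C.S C.S).obj X d) = gmk s.f s.p s.q s.hd μ ν := cmk_eq_gmk s μ ν
    rw [this, ← whisker_exchange, ← whisker_exchange, ev_comp, ev_comp]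
    congr 1
    refine (compMap_gmk₀ _ _ _ _ _ _ _ _).trans (Eq.trans ?_ (compMap_gmk₀ _ _ _ _ _ _ _ _).symm)
    exact congrArg (gmk s.f s.p s.q s.hd _) (funext fun i => hf _ _ _ (hν i))
  · rw [map_add, map_add, hy, hz]
  · rw [map_smul, map_smul, hy]

theorem eq_of_agree (hC : C.IsConilpotent) {Z : SMod K} {f f' : C.S ⟶ Z} (h : ∀ n, C.Agree n f f') : f = f' :=
  ev_ext fun X _ d x => by
    obtain ⟨n, hn⟩ := hC X d x
    exact h n X d x hn

/-- Maps out of a conilpotent cooperad are determined by a recursion along the coradical filtration. -/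
theorem conilpotent_unique (hC : C.IsConilpotent) {V Z : SMod K} {g : C.S ⟶ V} (h : C.coaug ≫ g = 0) {c : C.S ⟶ Z}
    {b : V ⊗ Z ⟶ Z} {f f' : C.S ⟶ Z} (hf : f = c + C.comul ≫ g ▷ C.S ≫ V ◁ f ≫ b)
    (hf' : f' = c + C.comul ≫ g ▷ C.S ≫ V ◁ f' ≫ b) : f = f' := by
  have key : ∀ n, C.Agree n (C.comul ≫ g ▷ C.S ≫ V ◁ f) (C.comul ≫ g ▷ C.S ≫ V ◁ f') → C.Agree n f f' := fun n hn => by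
    have := (hn.postcomp b).add_left c
    simp only [Category.assoc] at this
    rwa [← hf, ← hf'] at this
  refine eq_of_agree hC fun n => ?_
  induction n with
  | zero => exact key _ (agree_zero h f f')
  | succ n ih => exact key _ (ih.succ h)

variable (C) in
/-- The approximations to the solution of a recursion along the coradical filtration. -/
def recAt {V Z : SMod K} (g : C.S ⟶ V) (c : C.S ⟶ Z) (b : V ⊗ Z ⟶ Z) : ℕ → (C.S ⟶ Z)
  | 0 => c
  | n + 1 => c + (C.comul ≫ g ▷ C.S ≫ V ◁ recAt g c b n) ≫ b

theorem recAt_agree {V Z : SMod K} {g : C.S ⟶ V} (h : C.coaug ≫ g = 0) (c : C.S ⟶ Z) (b : V ⊗ Z ⟶ Z) (n : ℕ) :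
    ∀ m, n + 1 ≤ m → C.Agree n (C.recAt g c b (m + 1)) (C.recAt g c b m) := by
  induction n with
  | zero =>
    intro m hm
    obtain ⟨m, rfl⟩ := Nat.exists_eq_add_of_le' hm
    exact ((agree_zero h _ _).postcomp b).add_left c
  | succ n ih =>
    intro m hm
    obtain ⟨m, rfl⟩ := Nat.exists_eq_add_of_le' (show 1 ≤ m by omega)
    exact (((ih m (by omega)).succ h).postcomp b).add_left c

/-- Solutions of a recursion along the coradical filtration: the approximations agree with each other on
longer and longer steps, so that conilpotency makes their limit exist. -/
theorem exists_rec (hC : C.IsConilpotent) {V Z : SMod K} {g : C.S ⟶ V} (h : C.coaug ≫ g = 0) (c : C.S ⟶ Z) (b : V ⊗ Z ⟶ Z) :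
    ∃ f : C.S ⟶ Z, f = c + C.comul ≫ g ▷ C.S ≫ V ◁ f ≫ b := by
  have hev : EvEq (fun n => C.recAt g c b (n + 1)) (C.recAt g c b) := fun X _ d x => by
    obtain ⟨n, hn⟩ := hC X d x
    exact eventually_atTop.2 ⟨n + 1, fun m hm => recAt_agree h c b n m hm X d x hn⟩
  refine ⟨limMap _ hev, EvEq.eq ?_⟩
  have h1 := limMap_spec hev
  have h2 := ((h1.whiskerLeft V).precomp (C.comul ≫ g ▷ C.S)).postcomp (B' := fun _ => Z) fun _ => b
  refine (h1.symm.trans hev.symm).trans fun X _ d x => (h2 X d x).mono fun n hn => ?_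
  refine Eq.trans (b := ev c x + ev ((C.comul ≫ g ▷ C.S ≫ V ◁ C.recAt g c b n) ≫ b) x) rfl ?_
  refine Eq.trans (congrArg (ev c x + ·) ?_) (b := ev c x + ev (C.comul ≫ g ▷ C.S ≫ V ◁ limMap _ hev ≫ b) x) rfl
  simpa only [Category.assoc] using hn

end GradedCooperad

variable (V : SMod K)

/-- The projection onto the nontrivial trees. -/
def treeReduced : Tree V ⟶ Tree V := 𝟙 _ - treeCounit V ≫ treeUnit

theorem treeUnit_reduced : treeUnit ≫ treeReduced V = 0 := by
  rw [treeReduced, comp_sub, comp_id, ← Category.assoc, treeUnit_counit, id_comp, sub_self]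

theorem treeO_comul (n : ℕ) : ∃ D : treeObj V n ⟶ Tree V ⊗ treeObj V n, treeO n ≫ treeComul V = D ≫ Tree V ◁ treeO n := by
  induction n with
  | zero => exact ⟨(λ_ _).inv ≫ treeUnit ▷ _, (treeUnit_comul V).trans ((treeUnit_cut V).trans (Category.assoc _ _ _).symm)⟩
  | succ n ih =>
    obtain ⟨D, hD⟩ := ih
    refine ⟨treeDesc (treeInl V n ≫ (λ_ _).inv ≫ treeUnit ▷ _)
      (treeInr V n ≫ (λ_ _).inv ≫ treeUnit ▷ _ + V ◁ D ≫ treeGraft V _ ≫ Tree V ◁ treeJ V n), treeObj_hom_ext ?_ ?_⟩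
    · rw [← Category.assoc, ← Category.assoc, treeInl_desc, treeInl_O, Category.assoc, Category.assoc, treeUnit_comul,
        treeCut, ← whisker_exchange, ← leftUnitor_inv_naturality_assoc, ← Category.assoc (treeInl V n), treeInl_O]
    · rw [← Category.assoc, ← Category.assoc, treeInr_desc, treeInr_O, add_comp, Category.assoc, Category.assoc,
        Category.assoc, Category.assoc, treeNode_comul, comp_add, ← Category.assoc (V ◁ treeO n) treeNode, ← treeInr_O,
        treeCut, Category.assoc, leftUnitor_inv_naturality_assoc, ← whisker_exchange, ← whiskerLeft_comp_assoc, hD, Category.assoc,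
        ← MonoidalCategory.whiskerLeft_comp, treeJ_treeO, treeGraft_whiskerLeft, ← whiskerLeft_comp_assoc]

theorem treeO_comul_proj (n : ℕ) : ∃ D : treeObj V (n + 1) ⟶ Tree V ⊗ treeObj V n,
    treeO (n + 1) ≫ treeComul V ≫ treeReduced V ▷ Tree V = D ≫ Tree V ◁ treeO n := by
  obtain ⟨D, hD⟩ := treeO_comul V n
  have h1 : treeCut V ≫ treeReduced V ▷ Tree V = 0 := by
    rw [treeCut_whiskerRight, treeUnit_reduced, zero_whiskerRight, comp_zero]
  refine ⟨treeDesc 0 (V ◁ D ≫ treeGraft V _ ≫ treeReduced V ▷ _), treeObj_hom_ext ?_ ?_⟩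
  · rw [← Category.assoc, ← Category.assoc, ← Category.assoc, treeInl_desc, treeInl_O, treeUnit_comul, Category.assoc, h1,
      comp_zero, zero_comp]
  · rw [← Category.assoc, ← Category.assoc, ← Category.assoc, treeInr_desc, treeInr_O, Category.assoc, Category.assoc,
      ← Category.assoc treeNode, treeNode_comul,
      add_comp, Category.assoc, h1, comp_zero, zero_add, Category.assoc, Category.assoc, Category.assoc,
      ← whisker_exchange, ← Category.assoc (treeGraft V _), treeGraft_whiskerLeft, ← whiskerLeft_comp_assoc, hD,
      whiskerLeft_comp_assoc, Category.assoc]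

/-- The trees of height at most `n` lie in the step `n` of the coradical filtration. -/
theorem treeO_mem_level (n : ℕ) : ∀ (X : Type) [Finite X] (d : ℤ) (y : (treeObj V n).obj X d),
    ev (treeO n) y ∈ (treeCooperad V).level n X d := by
  induction n with
  | zero =>
    intro X _ d y
    rw [GradedCooperad.level]
    exact ⟨y, rfl⟩
  | succ n ih =>
    intro X _ d y
    obtain ⟨D, hD⟩ := treeO_comul_proj V n
    refine (GradedCooperad.mem_level_succ _).2 ?_
    have h1 : ev (treeComul V ≫ treeReduced V ▷ Tree V) (ev (treeO (n + 1)) y) = ev (Tree V ◁ treeO n) (ev D y) := by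
      rw [← ev_comp, ← ev_comp, hD]
    refine Set.mem_of_eq_of_mem h1 ?_
    refine gmk_induction (P := fun z => ev (Tree V ◁ treeO n) z ∈ (treeCooperad V).upperSpan n X d) ?_ (fun x y hx hy => ?_) (fun c x hx => ?_)
      (fun k φ p q hd μ ν => ?_) (ev D y)
    · rw [map_zero]
      exact zero_mem _
    · rw [map_add]
      exact add_mem hx hy
    · rw [map_smul]
      exact Submodule.smul_mem _ _ hx
    · refine Submodule.subset_span ⟨⟨k, φ, p, q, hd⟩, μ, fun i => ev (treeO n) (ν i), fun i => ih _ _ _, ?_⟩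
      exact (compMap_gmk₀ _ _ _ _ _ _ _ _).trans (cmk_eq_gmk ⟨k, φ, p, q, hd⟩ _ _).symm

theorem treeCooperad_isConilpotent : (treeCooperad V).IsConilpotent := fun X _ d x => by
  obtain ⟨n, hn⟩ := ((treeExh V).ev X d x).exists
  exact ⟨n, Set.mem_of_eq_of_mem ((ev_comp _ _ _).symm.trans hn).symm (treeO_mem_level V n X d (ev (treeE V n) x))⟩

section
variable {V} {C : GradedCooperad K} {g : C.S ⟶ V} {F : C.S ⟶ Tree V}

theorem cofree_counit (hF : F = C.counit ≫ treeUnit + C.comul ≫ g ▷ C.S ≫ V ◁ F ≫ treeNode) : F ≫ treeCounit V = C.counit := by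
  rw [hF, add_comp, Category.assoc, treeUnit_counit]
  simp only [Category.assoc, treeNode_counit, comp_zero, add_zero, comp_id]

/-- Both sides solve the same recursion, hence agree. -/
theorem cofree_comul (hC : C.IsConilpotent) (h : C.coaug ≫ g = 0)
    (hF : F = C.counit ≫ treeUnit + C.comul ≫ g ▷ C.S ≫ V ◁ F ≫ treeNode) :
    F ≫ treeComul V = C.comul ≫ F ▷ C.S ≫ Tree V ◁ F := by
  refine GradedCooperad.conilpotent_unique hC h (c := F ≫ treeCut V) (b := treeGraft V (Tree V)) ?_ ?_
  · have h1 : F ≫ treeComul V = (C.counit ≫ treeUnit + C.comul ≫ g ▷ C.S ≫ V ◁ F ≫ treeNode) ≫ treeComul V :=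
      congrArg (· ≫ treeComul V) hF
    refine h1.trans ?_
    rw [add_comp, Category.assoc, treeUnit_comul]
    simp only [Category.assoc, treeNode_comul, comp_add]
    rw [← add_assoc, whiskerLeft_comp_assoc]
    refine congrArg (· + _) ?_
    have h2 := congrArg (· ≫ treeCut V) hF
    simp only [add_comp, Category.assoc] at h2
    exact h2.symm
  · have h1 : F ▷ C.S = (C.counit ≫ treeUnit) ▷ C.S + (C.comul ≫ g ▷ C.S ≫ V ◁ F ≫ treeNode) ▷ C.S :=
      (congrArg (fun f : C.S ⟶ Tree V => f ▷ C.S) hF).trans (add_whiskerRight _ _ _)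
    refine (congrArg (fun z => C.comul ≫ z ≫ Tree V ◁ F) h1).trans ?_
    rw [add_comp, comp_add]
    refine congrArg₂ (· + ·) ?_ ?_
    · rw [comp_whiskerRight_assoc, ← Category.assoc, C.comul_counit_left, treeCut, leftUnitor_inv_naturality_assoc, whisker_exchange]
    · have h2 := C.comul_assoc
      rw [← Category.assoc, ← Iso.eq_comp_inv] at h2
      simp only [comp_whiskerRight, Category.assoc, treeGraft, whiskerLeft_comp]
      rw [← Category.assoc C.comul (C.comul ▷ C.S), h2, associator_inv_naturality_right_assoc,
        associator_inv_naturality_middle_assoc, whisker_exchange treeNode, ← whisker_exchange_assoc g,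
        Category.assoc, Category.assoc, ← associator_inv_naturality_left_assoc]

theorem cofree_proj (hF : F = C.counit ≫ treeUnit + C.comul ≫ g ▷ C.S ≫ V ◁ F ≫ treeNode) : F ≫ treeProj V = g := by
  have h1 : F ≫ treeProj V = (C.counit ≫ treeUnit + C.comul ≫ g ▷ C.S ≫ V ◁ F ≫ treeNode) ≫ treeProj V :=
    congrArg (· ≫ treeProj V) hF
  rw [h1, add_comp, Category.assoc, treeUnit_proj, comp_zero, zero_add]
  simp only [Category.assoc, treeNode_proj]
  rw [← whiskerLeft_comp_assoc, cofree_counit hF, ← whisker_exchange_assoc, rightUnitor_naturality, ← Category.assoc, ← Category.assoc,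
    Category.assoc C.comul, C.comul_counit', id_comp]

end

/-- A morphism `F` to the tree cooperad over `g` is the solution of the recursion `F = 1 ε + g (F, …, F) Δ`,
which splits off the root vertex. -/
theorem treeCooperad_isCofree : IsCofreeCooperad (treeCooperad V) (treeProj V) := by
  refine ⟨treeCooperad_isConilpotent V, treeUnit_proj V, fun C hC g hg => ?_⟩
  have hT : ∀ f : C.S ⟶ Tree V, C.comul ≫ f ▷ C.S ≫ Tree V ◁ f = C.comul ≫ (f ⊗ₘ f) := fun f => by
    rw [MonoidalCategory.tensorHom_def]
  obtain ⟨F, hF⟩ := GradedCooperad.exists_rec hC (g := g) hg (C.counit ≫ treeUnit) (V ◁ 𝟙 _ ≫ treeNode)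
  rw [MonoidalCategory.whiskerLeft_id, id_comp] at hF
  refine ⟨{ f := F, map_Δ := (cofree_comul hC hg hF).trans (hT F), map_ε := cofree_counit hF, map_η := ?_ }, cofree_proj hF,
    fun G hG => ?_⟩
  · have h1 : C.coaug ≫ F = treeUnit := by
      rw [hF, comp_add, ← Category.assoc, C.coaug_counit, id_comp]
      have := congrArg (· ≫ treeNode) (C.coaug_comul_whiskerRight hg F)
      simp only [Category.assoc, zero_comp] at this
      rw [this, add_zero]
    exact h1
  · obtain ⟨f, hΔ, hε, hη⟩ := G
    change C.S ⟶ Tree V at f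
    have hΔ' : f ≫ treeComul V = C.comul ≫ f ▷ C.S ≫ Tree V ◁ f := Eq.trans hΔ (hT f).symm
    have hε' : f ≫ treeCounit V = C.counit := hε
    have hG' : f ≫ treeProj V = g := hG
    have : f = F := by
      refine GradedCooperad.conilpotent_unique hC (g := g) hg (c := C.counit ≫ treeUnit) (b := treeNode) ?_ hF
      have h1 := congrArg (f ≫ ·) (tree_decompose V)
      simp only [comp_add, comp_id] at h1
      rw [← Category.assoc, hε', ← Category.assoc, hΔ'] at h1
      simp only [Category.assoc] at h1
      rw [whisker_exchange_assoc, ← comp_whiskerRight_assoc, hG', ← whisker_exchange_assoc, whisker_exchange_assoc] at h1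
      exact h1.symm
    subst this
    rfl

end cofree
end OperadicBar

namespace OperadicBar
open Limits Preadditive
variable {K : Type u} [Field K]

/-! ### Products on a direct sum with a suspension -/

noncomputable section totRules

variable {V V' V'' W W' W'' U U' : SMod K} {a a' b c : ℤ}

theorem tot_smul (z : ℤˣ) (f : DegMap V W a) : tot (z • f) = (z : ℤ) • tot f :=
  (map_zsmul ({ toFun := tot, map_zero' := rfl, map_add' := fun _ _ => rfl } : DegMap V W a →+ _) (z : ℤ) f)

/-- Composites of decorated two-level trees. -/
theorem tot_compMap_compMap (f : DegMap V' V'' a') (f' : DegMap V V' a) (g : DegMap W' W'' 0)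
    (g' : DegMap W W' 0) (hc : a + a' = c) :
    tot (compMap f' g') ≫ tot (compMap f g) = tot (compMap (f.comp f' hc) (g.comp g' (add_zero 0))) := by
  rw [← tot_comp _ _ hc, compMap_comp_compMap]

theorem tot_cinf_compMap (f : DegMap V' V'' 0) (f' : DegMap V V' 0) (g : DegMap W' W'' 0)
    (g' : DegMap W W' 0) (h' : DegMap W W' b) :
    tot (cinf f' g' h' (zero_add b)) ≫ tot (compMap f g) =
      tot (cinf (f.comp f' (add_zero 0)) (g.comp g' (add_zero 0)) (g.comp h' (add_zero b)) (zero_add b)) := by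
  rw [← tot_comp _ _ (add_zero b), compMap_comp_cinf (h₃ := add_zero 0) (h₄ := add_zero b) (h₅ := zero_add b)]

theorem tot_compMap_cinf (f : DegMap V' V'' 0) (f' : DegMap V V' 0) (g : DegMap W' W'' 0)
    (g' : DegMap W W' 0) (h : DegMap W' W'' b) :
    tot (compMap f' g') ≫ tot (cinf f g h (zero_add b)) =
      tot (cinf (f.comp f' (add_zero 0)) (g.comp g' (add_zero 0)) (h.comp g' (zero_add b)) (zero_add b)) := by
  rw [← tot_comp _ _ (zero_add b), cinf_comp_compMap (h₃ := add_zero 0) (h₄ := zero_add b) (h₅ := zero_add b), mul_zero,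
    Int.negOnePow_zero, one_smul]

theorem tot_compMap_assoc (f : DegMap V V' a) (g : DegMap W W' 0) (h : DegMap U U' 0) :
    tot (compMap (compMap f g) h) ≫ tot (assoc V' W' U') = tot (assoc V W U) ≫ tot (compMap f (compMap g h)) := by
  rw [← tot_comp _ _ (add_zero a), assoc_comp_compMap _ _ _ _ (zero_add a), tot_comp]

theorem tot_cinf_mid_assoc (f : DegMap V V' 0) (g : DegMap W W' 0) (g' : DegMap W W' b) (h : DegMap U U' 0) :
    tot (compMap (cinf f g g' (zero_add b)) h) ≫ tot (assoc V' W' U') =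
      tot (assoc V W U) ≫ tot (cinf f (compMap g h) (compMap g' h) (zero_add b)) := by
  rw [← tot_comp _ _ (add_zero b), assoc_comp_cinf_mid _ _ _ _ _ _ (zero_add b), tot_comp]

theorem tot_cinf_top_assoc (f : DegMap V V' 0) (g : DegMap W W' 0) (h : DegMap U U' 0) (h' : DegMap U U' b) :
    tot (cinf (compMap f g) h h' (zero_add b)) ≫ tot (assoc V' W' U') =
      tot (assoc V W U) ≫ tot (cinf f (compMap g h) (cinf g h h' (zero_add b)) (zero_add b)) := by
  rw [← tot_comp _ _ (add_zero b), assoc_comp_cinf_top _ _ _ _ _ _ (zero_add b) (zero_add b), tot_comp]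

end totRules

noncomputable section operadExtension

variable {P : GradedOperad K} {E : SMod K} {n : ℤ} (p₀ : DegMap E P.S 0) (p₁ : DegMap E P.S n) (μ : DegMap (comp E E) E 0)

theorem GradedOperad.Hom.tot_γ {P Q : GradedOperad K} (F : GradedOperad.Hom P Q) :
    tot P.γ ≫ tot F.f = tot (compMap F.f F.f) ≫ tot Q.γ := by
  rw [← tot_comp _ _ (add_zero 0), F.map_γ, tot_comp]

theorem GradedOperad.Hom.tot_η {P Q : GradedOperad K} (F : GradedOperad.Hom P Q) : tot P.η ≫ tot F.f = tot Q.η := by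
  rw [← tot_comp _ _ (add_zero 0), F.map_η]

theorem GradedOperad.tot_unit_left (P : GradedOperad K) :
    tot (compMap P.η (DegMap.id P.S)) ≫ tot P.γ = tot (leftUnit P.S) := by
  rw [← tot_comp _ _ (add_zero 0), P.unit_left]

theorem GradedOperad.tot_unit_right (P : GradedOperad K) :
    tot (compMap (DegMap.id P.S) P.η) ≫ tot P.γ = tot (rightUnit P.S) := by
  rw [← tot_comp _ _ (add_zero 0), P.unit_right]

theorem tot_γ_assoc (P : GradedOperad K) : tot (compMap P.γ (DegMap.id P.S)) ≫ tot P.γ =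
    tot (assoc P.S P.S P.S) ≫ tot (compMap (DegMap.id P.S) P.γ) ≫ tot P.γ := by
  rw [← tot_comp _ _ (add_zero 0), P.γ_assoc, tot_comp, tot_comp, Category.assoc]

theorem extension_assoc₀ (h₀ : p₀.comp μ (add_zero 0) = P.γ.comp (compMap p₀ p₀) (add_zero 0)) :
    tot (compMap μ (DegMap.id E)) ≫ tot μ ≫ tot p₀ =
      tot (assoc E E E) ≫ tot (compMap (DegMap.id E) μ) ≫ tot μ ≫ tot p₀ := by
  have h : tot μ ≫ tot p₀ = tot (compMap p₀ p₀) ≫ tot P.γ := by rw [← tot_comp _ _ (add_zero 0), h₀, tot_comp]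
  have e₁ : tot (compMap μ (DegMap.id E)) ≫ tot (compMap p₀ p₀) =
      tot (compMap (compMap p₀ p₀) p₀) ≫ tot (compMap P.γ (DegMap.id P.S)) := by
    rw [tot_compMap_compMap _ _ _ _ (add_zero 0), tot_compMap_compMap _ _ _ _ (add_zero 0), h₀, DegMap.comp_id, DegMap.id_comp]
  have e₂ : tot (compMap (DegMap.id E) μ) ≫ tot (compMap p₀ p₀) =
      tot (compMap p₀ (compMap p₀ p₀)) ≫ tot (compMap (DegMap.id P.S) P.γ) := by
    rw [tot_compMap_compMap _ _ _ _ (add_zero 0), tot_compMap_compMap _ _ _ _ (add_zero 0), h₀, DegMap.comp_id, DegMap.id_comp]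
  rw [h, reassoc_of% e₁, reassoc_of% e₂, tot_γ_assoc, reassoc_of% tot_compMap_assoc p₀ p₀ p₀]

/-- Associativity in the suspended summand: there the composition is a derivation along the projection, and both
sides mark the same vertex of a tree with three levels. -/
theorem extension_assoc₁ (h₀ : p₀.comp μ (add_zero 0) = P.γ.comp (compMap p₀ p₀) (add_zero 0))
    (h₁ : p₁.comp μ (zero_add n) = P.γ.comp (compMap p₁ p₀ + cinf p₀ p₀ p₁ (zero_add n)) (add_zero n)) :
    tot (compMap μ (DegMap.id E)) ≫ tot μ ≫ tot p₁ =
      tot (assoc E E E) ≫ tot (compMap (DegMap.id E) μ) ≫ tot μ ≫ tot p₁ := by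
  have h : tot μ ≫ tot p₁ = (tot (compMap p₁ p₀) + tot (cinf p₀ p₀ p₁ (zero_add n))) ≫ tot P.γ := by
    rw [← tot_comp _ _ (zero_add n), h₁, tot_comp, tot_add]
  have e₁ : tot (compMap μ (DegMap.id E)) ≫ tot (compMap p₁ p₀) =
      (tot (compMap (compMap p₁ p₀) p₀) + tot (compMap (cinf p₀ p₀ p₁ (zero_add n)) p₀)) ≫ tot (compMap P.γ (DegMap.id P.S)) := by
    rw [tot_compMap_compMap _ _ _ _ (zero_add n), ← tot_add, ← compMap_add_left, tot_compMap_compMap _ _ _ _ (add_zero n), h₁,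
      DegMap.comp_id, DegMap.id_comp]
  have e₂ : tot (compMap μ (DegMap.id E)) ≫ tot (cinf p₀ p₀ p₁ (zero_add n)) =
      tot (cinf (compMap p₀ p₀) p₀ p₁ (zero_add n)) ≫ tot (compMap P.γ (DegMap.id P.S)) := by
    rw [tot_compMap_cinf, tot_cinf_compMap, h₀, DegMap.comp_id, DegMap.id_comp, DegMap.comp_id, DegMap.id_comp]
  have e₃ : tot (compMap (DegMap.id E) μ) ≫ tot (compMap p₁ p₀) =
      tot (compMap p₁ (compMap p₀ p₀)) ≫ tot (compMap (DegMap.id P.S) P.γ) := by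
    rw [tot_compMap_compMap _ _ _ _ (zero_add n), tot_compMap_compMap _ _ _ _ (add_zero n), h₀, DegMap.comp_id, DegMap.id_comp]
  have e₄ : tot (compMap (DegMap.id E) μ) ≫ tot (cinf p₀ p₀ p₁ (zero_add n)) =
      (tot (cinf p₀ (compMap p₀ p₀) (compMap p₁ p₀) (zero_add n)) +
        tot (cinf p₀ (compMap p₀ p₀) (cinf p₀ p₀ p₁ (zero_add n)) (zero_add n))) ≫ tot (compMap (DegMap.id P.S) P.γ) := by
    rw [tot_compMap_cinf, ← tot_add, ← cinf_add_right, tot_cinf_compMap, h₀, h₁, DegMap.comp_id, DegMap.id_comp]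
  rw [h]
  simp only [comp_add, add_comp, reassoc_of% e₁, reassoc_of% e₂, reassoc_of% e₃, reassoc_of% e₄,
    tot_γ_assoc, reassoc_of% tot_compMap_assoc p₁ p₀ p₀, reassoc_of% tot_cinf_mid_assoc p₀ p₀ p₁ p₀,
    reassoc_of% tot_cinf_top_assoc p₀ p₀ p₀ p₁, Category.assoc, add_assoc]

/-- Decomposition of a unit along the components of a square-zero extension. -/
theorem extension_unit_left (η : DegMap (unit K) E 0)
    (h₁ : p₁.comp μ (zero_add n) = P.γ.comp (compMap p₁ p₀ + cinf p₀ p₀ p₁ (zero_add n)) (add_zero n))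
    (e₀ : p₀.comp η (add_zero 0) = P.η) (e₁ : p₁.comp η (zero_add n) = 0) :
    tot (compMap η (DegMap.id E)) ≫ tot μ ≫ tot p₁ = tot (leftUnit E) ≫ tot p₁ := by
  have h : tot μ ≫ tot p₁ = (tot (compMap p₁ p₀) + tot (cinf p₀ p₀ p₁ (zero_add n))) ≫ tot P.γ := by
    rw [← tot_comp _ _ (zero_add n), h₁, tot_comp, tot_add]
  have h3 : tot (compMap η (DegMap.id E)) ≫ tot (cinf p₀ p₀ p₁ (zero_add n)) =
      tot (cinf (DegMap.id _) p₀ p₁ (zero_add n)) ≫ tot (compMap P.η (DegMap.id P.S)) := by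
    rw [tot_compMap_cinf, tot_cinf_compMap, e₀, DegMap.comp_id, DegMap.comp_id, DegMap.comp_id, DegMap.id_comp, DegMap.id_comp]
  have h4 : tot (compMap P.η (DegMap.id P.S)) ≫ tot P.γ = tot (leftUnit P.S) := by
    rw [← tot_comp _ _ (add_zero 0), P.unit_left]
  rw [h, add_comp, comp_add, ← Category.assoc, tot_compMap_compMap _ _ _ _ (zero_add n), e₁,
    compMap_zero_left, tot_zero, zero_comp, zero_add, reassoc_of% h3, h4, ← tot_comp _ _ (add_zero n),
    leftUnit_comp_cinf _ _ _ _ (zero_add n), tot_comp]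

theorem extension_unit_left₀ (η : DegMap (unit K) E 0)
    (h₀ : p₀.comp μ (add_zero 0) = P.γ.comp (compMap p₀ p₀) (add_zero 0))
    (e₀ : p₀.comp η (add_zero 0) = P.η) :
    tot (compMap η (DegMap.id E)) ≫ tot μ ≫ tot p₀ = tot (leftUnit E) ≫ tot p₀ := by
  have h : tot μ ≫ tot p₀ = tot (compMap p₀ p₀) ≫ tot P.γ := by rw [← tot_comp _ _ (add_zero 0), h₀, tot_comp]
  have h3 : tot (compMap η (DegMap.id E)) ≫ tot (compMap p₀ p₀) =
      tot (compMap (DegMap.id _) p₀) ≫ tot (compMap P.η (DegMap.id P.S)) := by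
    rw [tot_compMap_compMap _ _ _ _ (zero_add 0), tot_compMap_compMap _ _ _ _ (add_zero 0), e₀, DegMap.comp_id, DegMap.comp_id,
      DegMap.id_comp]
  have h4 : tot (compMap P.η (DegMap.id P.S)) ≫ tot P.γ = tot (leftUnit P.S) := by
    rw [← tot_comp _ _ (add_zero 0), P.unit_left]
  rw [h, reassoc_of% h3, h4, ← tot_comp _ _ (add_zero 0), leftUnit_comp_compMap, tot_comp]

theorem extension_unit_right₀ (η : DegMap (unit K) E 0)
    (h₀ : p₀.comp μ (add_zero 0) = P.γ.comp (compMap p₀ p₀) (add_zero 0))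
    (e₀ : p₀.comp η (add_zero 0) = P.η) :
    tot (compMap (DegMap.id E) η) ≫ tot μ ≫ tot p₀ = tot (rightUnit E) ≫ tot p₀ := by
  have h : tot μ ≫ tot p₀ = tot (compMap p₀ p₀) ≫ tot P.γ := by rw [← tot_comp _ _ (add_zero 0), h₀, tot_comp]
  have h3 : tot (compMap (DegMap.id E) η) ≫ tot (compMap p₀ p₀) =
      tot (compMap p₀ (DegMap.id _)) ≫ tot (compMap (DegMap.id P.S) P.η) := by
    rw [tot_compMap_compMap _ _ _ _ (zero_add 0), tot_compMap_compMap _ _ _ _ (add_zero 0), e₀, DegMap.comp_id, DegMap.comp_id,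
      DegMap.id_comp]
  have h4 : tot (compMap (DegMap.id P.S) P.η) ≫ tot P.γ = tot (rightUnit P.S) := by
    rw [← tot_comp _ _ (add_zero 0), P.unit_right]
  rw [h, reassoc_of% h3, h4, ← tot_comp _ _ (add_zero 0), rightUnit_comp_compMap _ _ (add_zero 0), tot_comp]

theorem extension_unit_right₁ (η : DegMap (unit K) E 0)
    (h₁ : p₁.comp μ (zero_add n) = P.γ.comp (compMap p₁ p₀ + cinf p₀ p₀ p₁ (zero_add n)) (add_zero n))
    (e₀ : p₀.comp η (add_zero 0) = P.η) (e₁ : p₁.comp η (zero_add n) = 0) :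
    tot (compMap (DegMap.id E) η) ≫ tot μ ≫ tot p₁ = tot (rightUnit E) ≫ tot p₁ := by
  have h : tot μ ≫ tot p₁ = (tot (compMap p₁ p₀) + tot (cinf p₀ p₀ p₁ (zero_add n))) ≫ tot P.γ := by
    rw [← tot_comp _ _ (zero_add n), h₁, tot_comp, tot_add]
  have h3 : tot (compMap (DegMap.id E) η) ≫ tot (compMap p₁ p₀) =
      tot (compMap p₁ (DegMap.id _)) ≫ tot (compMap (DegMap.id P.S) P.η) := by
    rw [tot_compMap_compMap _ _ _ _ (zero_add n), tot_compMap_compMap _ _ _ _ (add_zero n), e₀, DegMap.comp_id, DegMap.comp_id,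
      DegMap.id_comp]
  have h4 : tot (compMap (DegMap.id P.S) P.η) ≫ tot P.γ = tot (rightUnit P.S) := by
    rw [← tot_comp _ _ (add_zero 0), P.unit_right]
  have h5 : tot (compMap (DegMap.id E) η) ≫ tot (cinf p₀ p₀ p₁ (zero_add n)) = 0 := by
    rw [tot_compMap_cinf, e₁, cinf_zero_right, tot_zero]
  rw [h, add_comp, comp_add, reassoc_of% h5, zero_comp, add_zero, reassoc_of% h3, h4,
    ← tot_comp _ _ (add_zero n), rightUnit_comp_compMap _ _ (zero_add n), tot_comp]

end operadExtension
end OperadicBar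

namespace OperadicBar
open Limits Preadditive
open CategoryTheory.Category (id_comp comp_id)
variable {K : Type u} [Field K]

/-! ### Derivations as morphisms to square-zero extensions -/

noncomputable section extension
open MonoidalCategory

section object
variable (V : SMod K) (m n : ℤ) (h : m + n = 0)

/-- The direct sum of `V` and of its `m`-fold suspension. -/
abbrev ext (V : SMod K) (m : ℤ) : SMod K := sum V (shift V m)
/-- The inclusion of the first summand. -/
def extI₀ : DegMap V (ext V m) 0 := inFst V (shift V m)
/-- The inclusion of the suspended summand, of degree `m`. -/
def extI₁ : DegMap V (ext V m) m := DegMap.comp (inSnd V (shift V m) : DegMap _ _ 0) (susp V m) (add_zero m)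
/-- The projection onto the first summand. -/
def extP₀ : DegMap (ext V m) V 0 := sumFst V (shift V m)
/-- The projection onto the suspended summand, of degree `-m`. -/
def extP₁ : DegMap (ext V m) V n := (desusp V m n h).comp (sumSnd V (shift V m)) (zero_add n)

theorem cast_cast {X : Type} [Finite X] {d d' : ℤ} (h₁ : d = d') (h₂ : d' = d) (x : V.obj X d) :
    V.cast X h₂ (V.cast X h₁ x) = x := by
  subst h₁
  rfl

theorem susp_desusp : tot (susp V m) ≫ tot (desusp V m n h) = 𝟙 _ := by
  rw [← tot_comp _ _ h, ← tot_id]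
  refine congrArg tot (DegMap.ext fun X _ d d' hd x => ?_)
  obtain rfl : d = d' := by omega
  rw [DegMap.comp_app _ _ _ rfl (by omega)]
  exact cast_cast V _ _ x

theorem desusp_susp : tot (desusp V m n h) ≫ tot (susp V m) = 𝟙 _ := by
  rw [← tot_comp _ _ ((add_comm n m).trans h), ← tot_id]
  refine congrArg tot (DegMap.ext fun X _ d d' hd x => ?_)
  obtain rfl : d = d' := by omega
  rw [DegMap.comp_app _ _ _ rfl (by omega)]
  exact cast_cast V _ _ x

theorem extI₀_P₀ : tot (extI₀ V m) ≫ tot (extP₀ V m) = 𝟙 _ := by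
  rw [← tot_id, ← tot_comp _ _ (add_zero 0)]
  exact congrArg tot (inFst_prFst V (shift V m))

theorem extI₀_P₁ : tot (extI₀ V m) ≫ tot (extP₁ V m n h) = 0 := by
  have h1 : tot (extI₀ V m) ≫ tot (sumSnd V (shift V m)) = 0 := by
    rw [← tot_comp _ _ (add_zero 0)]
    exact congrArg tot (inFst_prSnd V (shift V m))
  rw [extP₁, tot_comp, reassoc_of% h1, zero_comp]

theorem extI₁_P₀ : tot (extI₁ V m) ≫ tot (extP₀ V m) = 0 := by
  have h1 : tot (k := 0) (inSnd V (shift V m)) ≫ tot (extP₀ V m) = 0 := by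
    rw [← tot_comp _ _ (add_zero 0)]
    exact congrArg tot (inSnd_prFst V (shift V m))
  rw [extI₁, tot_comp, Category.assoc, h1, comp_zero]

theorem extI₁_P₁ : tot (extI₁ V m) ≫ tot (extP₁ V m n h) = 𝟙 _ := by
  have h1 : tot (k := 0) (inSnd V (shift V m)) ≫ tot (sumSnd V (shift V m)) = 𝟙 _ := by
    rw [← tot_comp _ _ (add_zero 0), ← tot_id]
    exact congrArg tot (inSnd_prSnd V (shift V m))
  rw [extI₁, extP₁, tot_comp, tot_comp, Category.assoc, reassoc_of% h1, susp_desusp]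

theorem ext_total : tot (extP₀ V m) ≫ tot (extI₀ V m) + tot (extP₁ V m n h) ≫ tot (extI₁ V m) = 𝟙 _ := by
  have h1 : tot (k := 0) (prFst V (shift V m) ≫ inFst V (shift V m) + prSnd V (shift V m) ≫ inSnd V (shift V m)) = 𝟙 _ := by
    rw [sum_total]
    exact tot_id
  have h2 := tot_add (k := 0) (prFst V (shift V m) ≫ inFst V (shift V m)) (prSnd V (shift V m) ≫ inSnd V (shift V m))
  rw [tot_comp_zero, tot_comp_zero] at h2
  rw [extI₁, extP₁, tot_comp, tot_comp, Category.assoc, reassoc_of% desusp_susp]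
  exact h2.symm.trans h1

end object

/-- A presentation of `E` as the direct sum of `V` and of its `m`-fold suspension, where `n = -m`. -/
structure ExtData (V E : SMod K) (m n : ℤ) where
  i₀ : DegMap V E 0
  i₁ : DegMap V E m
  p₀ : DegMap E V 0
  p₁ : DegMap E V n
  sum_zero : m + n = 0
  i₀_p₀ : tot i₀ ≫ tot p₀ = 𝟙 _
  i₀_p₁ : tot i₀ ≫ tot p₁ = 0
  i₁_p₀ : tot i₁ ≫ tot p₀ = 0
  i₁_p₁ : tot i₁ ≫ tot p₁ = 𝟙 _
  total : tot p₀ ≫ tot i₀ + tot p₁ ≫ tot i₁ = 𝟙 _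

/-- The standard presentation. -/
def extData (V : SMod K) (m n : ℤ) (h : m + n = 0) : ExtData V (ext V m) m n where
  i₀ := extI₀ V m
  i₁ := extI₁ V m
  p₀ := extP₀ V m
  p₁ := extP₁ V m n h
  sum_zero := h
  i₀_p₀ := extI₀_P₀ V m
  i₀_p₁ := extI₀_P₁ V m n h
  i₁_p₀ := extI₁_P₀ V m
  i₁_p₁ := extI₁_P₁ V m n h
  total := ext_total V m n h

namespace ExtData
variable {V E : SMod K} {m n : ℤ} (x : ExtData V E m n)

theorem hom_ext {Z : Tot K} {f g : Z ⟶ ⟨E⟩} (h₀ : f ≫ tot x.p₀ = g ≫ tot x.p₀) (h₁ : f ≫ tot x.p₁ = g ≫ tot x.p₁) : f = g := by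
  rw [← comp_id f, ← comp_id g, ← x.total, comp_add, comp_add,
    reassoc_of% h₀, reassoc_of% h₁]

theorem hom_ext' {Z : Tot K} {f g : (⟨E⟩ : Tot K) ⟶ Z} (h₀ : tot x.i₀ ≫ f = tot x.i₀ ≫ g) (h₁ : tot x.i₁ ≫ f = tot x.i₁ ≫ g) :
    f = g := by
  rw [← id_comp f, ← id_comp g, ← x.total, add_comp, add_comp,
    Category.assoc, Category.assoc, Category.assoc, Category.assoc, h₀, h₁]

/-- The map of degree zero with given components. -/
def pair {W : SMod K} (f : DegMap W V 0) (g : DegMap W V n) : DegMap W E 0 :=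
  x.i₀.comp f (add_zero 0) + x.i₁.comp g ((add_comm n m).trans x.sum_zero)

theorem tot_pair {W : SMod K} (f : DegMap W V 0) (g : DegMap W V n) : tot (x.pair f g) = tot f ≫ tot x.i₀ + tot g ≫ tot x.i₁ := by
  rw [pair, tot_add, tot_comp, tot_comp]

theorem tot_pair_p₀ {W : SMod K} (f : DegMap W V 0) (g : DegMap W V n) : tot (x.pair f g) ≫ tot x.p₀ = tot f := by
  rw [tot_pair, add_comp, Category.assoc, Category.assoc, i₀_p₀, i₁_p₀, comp_zero, add_zero, comp_id]

theorem tot_pair_p₁ {W : SMod K} (f : DegMap W V 0) (g : DegMap W V n) : tot (x.pair f g) ≫ tot x.p₁ = tot g := by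
  rw [tot_pair, add_comp, Category.assoc, Category.assoc, i₀_p₁, i₁_p₁, comp_zero, zero_add, comp_id]

theorem p₀_pair {W : SMod K} (f : DegMap W V 0) (g : DegMap W V n) : x.p₀.comp (x.pair f g) (add_zero 0) = f :=
  tot_injective (by rw [tot_comp, tot_pair_p₀])

theorem p₁_pair {W : SMod K} (f : DegMap W V 0) (g : DegMap W V n) : x.p₁.comp (x.pair f g) (zero_add n) = g :=
  tot_injective (by rw [tot_comp, tot_pair_p₁])

end ExtData

/-- A square-zero extension of an operad by its own `m`-fold suspension. Morphisms into it are the same as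
morphisms into the operad together with a derivation of degree `n = -m` along them. -/
structure OperadExt (P : GradedOperad K) (m n : ℤ) where
  Q : GradedOperad K
  x : ExtData P.S Q.S m n
  mul₀ : x.p₀.comp Q.γ (add_zero 0) = P.γ.comp (compMap x.p₀ x.p₀) (add_zero 0)
  mul₁ : x.p₁.comp Q.γ (zero_add n) = P.γ.comp (compMap x.p₁ x.p₀ + cinf x.p₀ x.p₀ x.p₁ (zero_add n)) (add_zero n)
  unit₀ : x.p₀.comp Q.η (add_zero 0) = P.η
  unit₁ : x.p₁.comp Q.η (zero_add n) = 0

/-- The square-zero extension of an operad. -/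
def operadExt (P : GradedOperad K) (m n : ℤ) (h : m + n = 0) : OperadExt P m n :=
  let x := extData P.S m n h
  let μ := x.pair (P.γ.comp (compMap x.p₀ x.p₀) (add_zero 0))
    (P.γ.comp (compMap x.p₁ x.p₀ + cinf x.p₀ x.p₀ x.p₁ (zero_add n)) (add_zero n))
  let η := x.pair P.η 0
  have h₀ : x.p₀.comp μ (add_zero 0) = P.γ.comp (compMap x.p₀ x.p₀) (add_zero 0) := x.p₀_pair _ _
  have h₁ : x.p₁.comp μ (zero_add n) = P.γ.comp (compMap x.p₁ x.p₀ + cinf x.p₀ x.p₀ x.p₁ (zero_add n)) (add_zero n) :=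
    x.p₁_pair _ _
  have e₀ : x.p₀.comp η (add_zero 0) = P.η := x.p₀_pair _ _
  have e₁ : x.p₁.comp η (zero_add n) = 0 := x.p₁_pair _ _
  { Q :=
    { S := ext P.S m
      γ := μ
      η := η
      γ_assoc := by
        refine tot_injective (x.hom_ext ?_ ?_)
        · simp only [tot_comp, Category.assoc]
          exact extension_assoc₀ _ _ h₀
        · simp only [tot_comp, Category.assoc]
          exact extension_assoc₁ _ _ _ h₀ h₁
      unit_left := by
        refine tot_injective (x.hom_ext ?_ ?_)
        · rw [tot_comp, Category.assoc]
          exact extension_unit_left₀ _ _ _ h₀ e₀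
        · rw [tot_comp, Category.assoc]
          exact extension_unit_left _ _ _ _ h₁ e₀ e₁
      unit_right := by
        refine tot_injective (x.hom_ext ?_ ?_)
        · rw [tot_comp, Category.assoc]
          exact extension_unit_right₀ _ _ _ h₀ e₀
        · rw [tot_comp, Category.assoc]
          exact extension_unit_right₁ _ _ _ _ h₁ e₀ e₁ }
    x := x
    mul₀ := h₀
    mul₁ := h₁
    unit₀ := e₀
    unit₁ := e₁ }

/-- Derivations of degree `n` along a morphism of operads. -/
structure IsDerivation {O P : GradedOperad K} (F : DegMap O.S P.S 0) {n : ℤ} (E : DegMap O.S P.S n) : Prop where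
  unit : E.comp O.η (zero_add n) = 0
  mul : E.comp O.γ (zero_add n) = P.γ.comp (compMap E F + cinf F F E (zero_add n)) (add_zero n)

section derivation
variable {O P : GradedOperad K} {m n : ℤ}

theorem IsDerivation.tot_unit {F : DegMap O.S P.S 0} {E : DegMap O.S P.S n} (hE : IsDerivation F E) : tot O.η ≫ tot E = 0 := by
  rw [← tot_comp _ _ (zero_add n), hE.unit, tot_zero]

theorem IsDerivation.tot_mul {F : DegMap O.S P.S 0} {E : DegMap O.S P.S n} (hE : IsDerivation F E) :
    tot O.γ ≫ tot E = (tot (compMap E F) + tot (cinf F F E (zero_add n))) ≫ tot P.γ := by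
  rw [← tot_comp _ _ (zero_add n), hE.mul, tot_comp, tot_add]

theorem OperadExt.tot_unit₀ (X : OperadExt P m n) : tot X.Q.η ≫ tot X.x.p₀ = tot P.η := by
  rw [← tot_comp _ _ (add_zero 0), X.unit₀]

theorem OperadExt.tot_unit₁ (X : OperadExt P m n) : tot X.Q.η ≫ tot X.x.p₁ = 0 := by
  rw [← tot_comp _ _ (zero_add n), X.unit₁, tot_zero]

theorem OperadExt.tot_mul₀ (X : OperadExt P m n) : tot X.Q.γ ≫ tot X.x.p₀ = tot (compMap X.x.p₀ X.x.p₀) ≫ tot P.γ := by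
  rw [← tot_comp _ _ (add_zero 0), X.mul₀, tot_comp]

theorem OperadExt.tot_mul₁ (X : OperadExt P m n) : tot X.Q.γ ≫ tot X.x.p₁ =
    (tot (compMap X.x.p₁ X.x.p₀) + tot (cinf X.x.p₀ X.x.p₀ X.x.p₁ (zero_add n))) ≫ tot P.γ := by
  rw [← tot_comp _ _ (zero_add n), X.mul₁, tot_comp, tot_add]

/-- The morphism to the square-zero extension given by a derivation. -/
def IsDerivation.toHom (X : OperadExt P m n) (F : GradedOperad.Hom O P) {E : DegMap O.S P.S n} (hE : IsDerivation F.f E) :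
    GradedOperad.Hom O X.Q where
  f := X.x.pair F.f E
  map_γ := by
    refine tot_injective (X.x.hom_ext ?_ ?_)
    · rw [tot_comp, tot_comp, Category.assoc, Category.assoc, X.tot_mul₀, X.x.tot_pair_p₀, F.tot_γ, ← Category.assoc,
        tot_compMap_compMap _ _ _ _ (add_zero 0), X.x.p₀_pair]
    · rw [tot_comp, tot_comp, Category.assoc, Category.assoc, X.tot_mul₁, X.x.tot_pair_p₁, hE.tot_mul, ← Category.assoc,
        comp_add, tot_compMap_compMap _ _ _ _ (zero_add n), tot_compMap_cinf, X.x.p₀_pair, X.x.p₁_pair]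
  map_η := by
    refine tot_injective (X.x.hom_ext ?_ ?_)
    · rw [tot_comp, Category.assoc, X.x.tot_pair_p₀, F.tot_η, X.tot_unit₀]
    · rw [tot_comp, Category.assoc, X.x.tot_pair_p₁, hE.tot_unit, X.tot_unit₁]

/-- A morphism to the square-zero extension is a derivation along its projection to the operad. -/
theorem OperadExt.isDerivation (X : OperadExt P m n) (G : GradedOperad.Hom O X.Q) :
    IsDerivation (X.x.p₀.comp G.f (add_zero 0)) (X.x.p₁.comp G.f (zero_add n)) where
  unit := tot_injective (by
    rw [tot_comp, tot_comp, reassoc_of% G.tot_η, X.tot_unit₁, tot_zero])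
  mul := tot_injective (by
    rw [tot_comp, tot_comp, tot_comp, reassoc_of% G.tot_γ, X.tot_mul₁, tot_add, ← tot_compMap_compMap _ _ _ _ (zero_add n),
      ← tot_compMap_cinf, ← comp_add, Category.assoc])

/-- The projection of a morphism to the square-zero extension. -/
def OperadExt.projHom (X : OperadExt P m n) (G : GradedOperad.Hom O X.Q) : GradedOperad.Hom O P where
  f := X.x.p₀.comp G.f (add_zero 0)
  map_γ := tot_injective (by
    rw [tot_comp, tot_comp, tot_comp, reassoc_of% G.tot_γ, X.tot_mul₀, ← tot_compMap_compMap _ _ _ _ (add_zero 0), Category.assoc])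
  map_η := tot_injective (by
    rw [tot_comp, tot_comp, reassoc_of% G.tot_η, X.tot_unit₀])

variable {V : SMod K} {ι : DegMap V O.S 0}

/-- A derivation on a free operad is determined by its values on generators. -/
theorem IsFreeOperad.derivation_ext (hO : IsFreeOperad O ι) (F : GradedOperad.Hom O P) {E E' : DegMap O.S P.S n}
    (hE : IsDerivation F.f E) (hE' : IsDerivation F.f E') (h : E.comp ι (zero_add n) = E'.comp ι (zero_add n)) : E = E' := by
  let X := operadExt P (-n) n (neg_add_cancel n)
  have h1 : hE.toHom X F = hE'.toHom X F := by
    refine (hO _ ((X.x.pair F.f E').comp ι (add_zero 0))).unique (tot_injective (X.x.hom_ext ?_ ?_)) rfl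
    · rw [tot_comp, tot_comp, Category.assoc, Category.assoc, IsDerivation.toHom, X.x.tot_pair_p₀, X.x.tot_pair_p₀]
    · rw [tot_comp, tot_comp, Category.assoc, Category.assoc, IsDerivation.toHom, X.x.tot_pair_p₁, X.x.tot_pair_p₁,
        ← tot_comp _ _ (zero_add n), h, tot_comp]
  have h2 := congrArg (fun G : GradedOperad.Hom O X.Q => tot G.f ≫ tot X.x.p₁) h1
  exact tot_injective ((X.x.tot_pair_p₁ F.f E).symm.trans (h2.trans (X.x.tot_pair_p₁ F.f E')))

/-- A derivation on a free operad can be prescribed on generators. -/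
theorem IsFreeOperad.exists_derivation (hO : IsFreeOperad O ι) (F : GradedOperad.Hom O P) (g : DegMap V P.S n) :
    ∃ E : DegMap O.S P.S n, IsDerivation F.f E ∧ E.comp ι (zero_add n) = g := by
  let X := operadExt P (-n) n (neg_add_cancel n)
  obtain ⟨G, hG, -⟩ := hO X.Q (X.x.pair (F.f.comp ι (add_zero 0)) g)
  have tG := congrArg tot hG
  rw [tot_comp] at tG
  have hGF : X.projHom G = F := by
    refine (hO P (F.f.comp ι (add_zero 0))).unique (tot_injective ?_) rfl
    rw [tot_comp, OperadExt.projHom, tot_comp, reassoc_of% tG, X.x.tot_pair_p₀]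
  refine ⟨X.x.p₁.comp G.f (zero_add n), ?_, tot_injective ?_⟩
  · have := X.isDerivation G
    rwa [← hGF]
  · rw [tot_comp, tot_comp, reassoc_of% tG, X.x.tot_pair_p₁]

end derivation

end extension
end OperadicBar

namespace OperadicBar
open Limits Preadditive
open CategoryTheory.Category (id_comp comp_id)
variable {K : Type u} [Field K]

/-! ### Coderivations as morphisms out of square-zero extensions -/

noncomputable section level
open MonoidalCategory
namespace GradedCooperad

variable (C : GradedCooperad K)

theorem upperSpan_mono {n n' : ℕ} (h : ∀ (X : Type) [Finite X] (d : ℤ), C.level n X d ≤ C.level n' X d) (X : Type) [Finite X]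
    (d : ℤ) : C.upperSpan n X d ≤ C.upperSpan n' X d := by
  refine Submodule.span_mono ?_
  rintro _ ⟨s, μ, ν, hν, rfl⟩
  exact ⟨s, μ, ν, fun i => h _ _ (hν i), rfl⟩

theorem coaug_comul_proj {X : Type} [Finite X] {d : ℤ} (y : (unit K).obj X d) :
    ev (C.comul ≫ (C.proj : C.S ⟶ C.S) ▷ C.S) (ev C.coaug y) = 0 := by
  have h2 : C.coaug ≫ (C.proj : C.S ⟶ C.S) = 0 := by
    have h3 : (C.proj : C.S ⟶ C.S) = 𝟙 _ - C.counit ≫ C.coaug := rfl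
    rw [h3, comp_sub, ← Category.assoc, C.coaug_counit, id_comp, comp_id, sub_self]
  have h1 := C.coaug_comul_whiskerRight h2 (𝟙 _)
  rw [MonoidalCategory.whiskerLeft_id, comp_id] at h1
  rw [← ev_comp, h1]
  rfl

theorem level_zero_le (X : Type) [Finite X] (d : ℤ) : C.level 0 X d ≤ C.level 1 X d := by
  intro x hx
  rw [level] at hx
  obtain ⟨y, rfl⟩ := hx
  exact C.mem_level_succ.2 (Set.mem_of_eq_of_mem (C.coaug_comul_proj y) (zero_mem _))

theorem level_le_succ (n : ℕ) : ∀ (X : Type) [Finite X] (d : ℤ), C.level n X d ≤ C.level (n + 1) X d := by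
  induction n with
  | zero => exact C.level_zero_le
  | succ n ih =>
    intro X _ d x hx
    exact C.mem_level_succ.2 (C.upperSpan_mono ih X d (C.mem_level_succ.1 hx))

theorem level_mono {n n' : ℕ} (h : n ≤ n') (X : Type) [Finite X] (d : ℤ) : C.level n X d ≤ C.level n' X d := by
  induction n', h using Nat.le_induction with
  | base => exact le_rfl
  | succ n' _ ih => exact ih.trans (C.level_le_succ n' X d)

theorem gmk_mem_upperSpan {n : ℕ} {X : Type} [Finite X] {d : ℤ} {k : ℕ} (φ : X → Fin k) (p : ℤ) (q : Fin k → ℤ)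
    (hd : p + ∑ i, q i = d) (μ : C.S.obj (Fin k) p) (ν : ∀ i, C.S.obj {x // φ x = i} (q i))
    (hν : ∀ i, ν i ∈ C.level n {x // φ x = i} (q i)) : gmk φ p q hd μ ν ∈ C.upperSpan n X d :=
  Submodule.subset_span ⟨⟨k, φ, p, q, hd⟩, μ, ν, hν, (cmk_eq_gmk ⟨k, φ, p, q, hd⟩ _ _).symm⟩

theorem upperSpan_induction {n : ℕ} {X : Type} [Finite X] {d : ℤ} {M : Type u} [AddCommGroup M] [Module K M]
    (f : (comp C.S C.S).obj X d →ₗ[K] M) (S : Submodule K M)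
    (h : ∀ (k : ℕ) (φ : X → Fin k) (p : ℤ) (q : Fin k → ℤ) (hd : p + ∑ i, q i = d) (μ : C.S.obj (Fin k) p)
      (ν : ∀ i, C.S.obj {x // φ x = i} (q i)), (∀ i, ν i ∈ C.level n {x // φ x = i} (q i)) → f (gmk φ p q hd μ ν) ∈ S)
    {z : (comp C.S C.S).obj X d} (hz : z ∈ C.upperSpan n X d) : f z ∈ S := by
  have h1 : C.upperSpan n X d ≤ S.comap f := by
    refine Submodule.span_le.2 ?_
    rintro _ ⟨s, μ, ν, hν, rfl⟩
    have h2 : (cmk s μ ν : (comp C.S C.S).obj X d) = gmk s.f s.p s.q s.hd μ ν := cmk_eq_gmk s μ ν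
    refine Set.mem_of_eq_of_mem h2 ?_
    exact h _ _ _ _ _ _ _ hν
  exact h1 hz

theorem level_map (n : ℕ) : ∀ {X Y : Type} [Finite X] [Finite Y] (e : X ≃ Y) {d : ℤ} {x : C.S.obj X d}, x ∈ C.level n X d →
    C.S.map e d x ∈ C.level n Y d := by
  induction n with
  | zero =>
    intro X Y _ _ e d x hx
    rw [level] at hx ⊢
    obtain ⟨y, rfl⟩ := hx
    exact ⟨(unit K).map e d y, ev_natural C.coaug e y⟩
  | succ n ih =>
    intro X Y _ _ e d x hx
    rw [mem_level_succ] at hx ⊢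
    refine Set.mem_of_eq_of_mem (ev_natural _ e x) ?_
    refine C.upperSpan_induction ((comp C.S C.S).map e d) (C.upperSpan n Y d) (fun k φ p q hd μ ν hν => ?_) hx
    refine Set.mem_of_eq_of_mem (comp_tr_gmk e rfl φ p q hd μ ν) ?_
    refine C.gmk_mem_upperSpan _ _ _ _ _ _ fun i => ?_
    exact ih _ (hν i)

theorem gmk_mem_upperSpan' {n : ℕ} {X I : Type} [Finite X] [Fintype I] [LinearOrder I] {d : ℤ} (φ : X → I) (p : ℤ) (q : I → ℤ)
    (hd : p + ∑ i, q i = d) (μ : C.S.obj I p) (ν : ∀ i, C.S.obj {x // φ x = i} (q i))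
    (hν : ∀ i, ν i ∈ C.level n {x // φ x = i} (q i)) : gmk φ p q hd μ ν ∈ C.upperSpan n X d :=
  Submodule.subset_span ⟨_, _, _, fun _ => C.level_map n _ (hν _), rfl⟩

/-- The coradical filtration is compatible with the decomposition, in the weak sense that the upper vertices of
the decomposition of an element stay in the same step. -/
theorem comul_mem {n : ℕ} {X : Type} [Finite X] {d : ℤ} {x : C.S.obj X d} (hx : x ∈ C.level n X d) :
    ev C.comul x ∈ C.upperSpan n X d := by
  have h1 : C.comul = C.comul ≫ (C.proj : C.S ⟶ C.S) ▷ C.S + (λ_ _).inv ≫ C.coaug ▷ C.S := by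
    have h3 : (C.proj : C.S ⟶ C.S) = 𝟙 _ - C.counit ≫ C.coaug := rfl
    rw [← C.comul_counit_left, h3, sub_whiskerRight, comp_sub, id_whiskerRight, comp_id, comp_whiskerRight,
      Category.assoc, sub_add_cancel]
  have h2 : ev (C.comul ≫ (C.proj : C.S ⟶ C.S) ▷ C.S) x ∈ C.upperSpan n X d := by
    cases n with
    | zero =>
      rw [level] at hx
      obtain ⟨y, rfl⟩ := hx
      exact Set.mem_of_eq_of_mem (C.coaug_comul_proj y) (zero_mem _)
    | succ n => exact C.upperSpan_mono (C.level_le_succ n) X d (C.mem_level_succ.1 hx)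
  have h3 : ev ((λ_ _).inv ≫ C.coaug ▷ C.S) x ∈ C.upperSpan n X d := by
    rw [ev_comp]
    refine Set.mem_of_eq_of_mem (congrArg (ev (C.coaug ▷ C.S)) (lgen_apply x)) ?_
    refine Set.mem_of_eq_of_mem (compMap_gmk₀ _ _ _ _ _ _ _ _) ?_
    exact C.gmk_mem_upperSpan' _ _ _ _ _ _ fun i => C.level_map n _ hx
  have h4 : ev C.comul x = ev (C.comul ≫ (C.proj : C.S ⟶ C.S) ▷ C.S) x + ev ((λ_ _).inv ≫ C.coaug ▷ C.S) x :=
    congrArg (fun f => ev f x) h1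
  rw [h4]
  exact add_mem h2 h3

end GradedCooperad
end level

noncomputable section cooperadExtension

theorem GradedCooperad.tot_Δ_coassoc (C : GradedCooperad K) :
    tot C.Δ ≫ tot (compMap C.Δ (DegMap.id C.S)) ≫ tot (assoc C.S C.S C.S) = tot C.Δ ≫ tot (compMap (DegMap.id C.S) C.Δ) := by
  rw [← tot_comp _ _ (add_zero 0), ← tot_comp _ _ (add_zero 0), ← tot_comp _ _ (add_zero 0), ← C.Δ_coassoc, tot_comp, tot_comp,
    tot_comp, tot_comp, Category.assoc]

theorem GradedCooperad.tot_counit_left (C : GradedCooperad K) :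
    tot C.Δ ≫ tot (compMap C.ε (DegMap.id C.S)) ≫ tot (leftUnit C.S) = 𝟙 _ := by
  have h := congrArg tot C.counit_left
  rwa [tot_comp, tot_comp, tot_id, Category.assoc] at h

theorem GradedCooperad.tot_counit_right (C : GradedCooperad K) :
    tot C.Δ ≫ tot (compMap (DegMap.id C.S) C.ε) ≫ tot (rightUnit C.S) = 𝟙 _ := by
  have h := congrArg tot C.counit_right
  rwa [tot_comp, tot_comp, tot_id, Category.assoc] at h

/-- A square-zero extension of a cooperad by its own `m`-fold suspension. Morphisms out of it are the same as
morphisms out of the cooperad together with a coderivation of degree `m` along them. -/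
structure CooperadExt (C : GradedCooperad K) (m n : ℤ) where
  Q : GradedCooperad K
  x : ExtData C.S Q.S m n
  comul₀ : Q.Δ.comp x.i₀ (add_zero 0) = (compMap x.i₀ x.i₀).comp C.Δ (add_zero 0)
  comul₁ : Q.Δ.comp x.i₁ (add_zero m) = (compMap x.i₁ x.i₀ + cinf x.i₀ x.i₀ x.i₁ (zero_add m)).comp C.Δ (zero_add m)
  counit₀ : Q.ε.comp x.i₀ (add_zero 0) = C.ε
  counit₁ : Q.ε.comp x.i₁ (add_zero m) = 0
  coaug : Q.η = x.i₀.comp C.η (add_zero 0)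

section construction
variable {C : GradedCooperad K} {E : SMod K} {m n : ℤ} (x : ExtData C.S E m n) (δ : DegMap E (comp E E) 0) (ε : DegMap E (unit K) 0)

theorem coextension_coassoc (h₀ : δ.comp x.i₀ (add_zero 0) = (compMap x.i₀ x.i₀).comp C.Δ (add_zero 0))
    (h₁ : δ.comp x.i₁ (add_zero m) = (compMap x.i₁ x.i₀ + cinf x.i₀ x.i₀ x.i₁ (zero_add m)).comp C.Δ (zero_add m)) :
    tot δ ≫ tot (compMap δ (DegMap.id E)) ≫ tot (assoc E E E) = tot δ ≫ tot (compMap (DegMap.id E) δ) := by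
  have t₀ : tot x.i₀ ≫ tot δ = tot C.Δ ≫ tot (compMap x.i₀ x.i₀) := by rw [← tot_comp _ _ (add_zero 0), h₀, tot_comp]
  have t₁ : tot x.i₁ ≫ tot δ = tot C.Δ ≫ (tot (compMap x.i₁ x.i₀) + tot (cinf x.i₀ x.i₀ x.i₁ (zero_add m))) := by
    rw [← tot_comp _ _ (add_zero m), h₁, tot_comp, tot_add]
  have hc := C.tot_Δ_coassoc
  refine x.hom_ext' ?_ ?_
  · rw [reassoc_of% t₀, reassoc_of% t₀, ← Category.assoc (tot (compMap x.i₀ x.i₀)), tot_compMap_compMap _ _ _ _ (add_zero 0),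
      tot_compMap_compMap _ _ _ _ (add_zero 0), DegMap.id_comp, h₀]
    have e₁ : tot (compMap ((compMap x.i₀ x.i₀).comp C.Δ (add_zero 0)) x.i₀) =
        tot (compMap C.Δ (DegMap.id _)) ≫ tot (compMap (compMap x.i₀ x.i₀) x.i₀) := by
      rw [tot_compMap_compMap _ _ _ _ (add_zero 0), DegMap.comp_id]
    have e₂ : tot (compMap x.i₀ ((compMap x.i₀ x.i₀).comp C.Δ (add_zero 0))) =
        tot (compMap (DegMap.id _) C.Δ) ≫ tot (compMap x.i₀ (compMap x.i₀ x.i₀)) := by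
      rw [tot_compMap_compMap _ _ _ _ (add_zero 0), DegMap.comp_id]
    rw [e₁, e₂, Category.assoc, tot_compMap_assoc, reassoc_of% hc]
  · have e₁ : tot (compMap x.i₁ x.i₀) ≫ tot (compMap δ (DegMap.id E)) = tot (compMap C.Δ (DegMap.id _)) ≫
        (tot (compMap (compMap x.i₁ x.i₀) x.i₀) + tot (compMap (cinf x.i₀ x.i₀ x.i₁ (zero_add m)) x.i₀)) := by
      rw [tot_compMap_compMap _ _ _ _ (add_zero m), ← tot_add, ← compMap_add_left, tot_compMap_compMap _ _ _ _ (zero_add m), h₁,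
        DegMap.comp_id, DegMap.id_comp]
    have e₂ : tot (cinf x.i₀ x.i₀ x.i₁ (zero_add m)) ≫ tot (compMap δ (DegMap.id E)) = tot (compMap C.Δ (DegMap.id _)) ≫
        tot (cinf (compMap x.i₀ x.i₀) x.i₀ x.i₁ (zero_add m)) := by
      rw [tot_compMap_cinf, tot_cinf_compMap, h₀, DegMap.comp_id, DegMap.id_comp, DegMap.comp_id, DegMap.id_comp]
    have e₃ : tot (compMap x.i₁ x.i₀) ≫ tot (compMap (DegMap.id E) δ) = tot (compMap (DegMap.id _) C.Δ) ≫
        tot (compMap x.i₁ (compMap x.i₀ x.i₀)) := by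
      rw [tot_compMap_compMap _ _ _ _ (add_zero m), tot_compMap_compMap _ _ _ _ (zero_add m), h₀, DegMap.comp_id, DegMap.id_comp]
    have e₄ : tot (cinf x.i₀ x.i₀ x.i₁ (zero_add m)) ≫ tot (compMap (DegMap.id E) δ) = tot (compMap (DegMap.id _) C.Δ) ≫
        (tot (cinf x.i₀ (compMap x.i₀ x.i₀) (compMap x.i₁ x.i₀) (zero_add m)) +
          tot (cinf x.i₀ (compMap x.i₀ x.i₀) (cinf x.i₀ x.i₀ x.i₁ (zero_add m)) (zero_add m))) := by
      rw [tot_cinf_compMap, ← tot_add, ← cinf_add_right, tot_compMap_cinf, h₀, h₁, DegMap.comp_id, DegMap.id_comp]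
    rw [reassoc_of% t₁, reassoc_of% t₁]
    simp only [comp_add, add_comp, reassoc_of% e₁, reassoc_of% e₂, e₃, e₄,
      tot_compMap_assoc, tot_cinf_mid_assoc, tot_cinf_top_assoc, reassoc_of% hc, add_assoc]

theorem coextension_counit_left (h₀ : δ.comp x.i₀ (add_zero 0) = (compMap x.i₀ x.i₀).comp C.Δ (add_zero 0))
    (h₁ : δ.comp x.i₁ (add_zero m) = (compMap x.i₁ x.i₀ + cinf x.i₀ x.i₀ x.i₁ (zero_add m)).comp C.Δ (zero_add m))
    (e₀ : ε.comp x.i₀ (add_zero 0) = C.ε) (e₁ : ε.comp x.i₁ (add_zero m) = 0) :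
    tot δ ≫ tot (compMap ε (DegMap.id E)) ≫ tot (leftUnit E) = 𝟙 _ := by
  have t₀ : tot x.i₀ ≫ tot δ = tot C.Δ ≫ tot (compMap x.i₀ x.i₀) := by rw [← tot_comp _ _ (add_zero 0), h₀, tot_comp]
  have t₁ : tot x.i₁ ≫ tot δ = tot C.Δ ≫ (tot (compMap x.i₁ x.i₀) + tot (cinf x.i₀ x.i₀ x.i₁ (zero_add m))) := by
    rw [← tot_comp _ _ (add_zero m), h₁, tot_comp, tot_add]
  have hc := C.tot_counit_left
  refine x.hom_ext' ?_ ?_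
  · have h2 : tot (compMap x.i₀ x.i₀) ≫ tot (compMap ε (DegMap.id E)) =
        tot (compMap C.ε (DegMap.id _)) ≫ tot (compMap (DegMap.id _) x.i₀) := by
      rw [tot_compMap_compMap _ _ _ _ (add_zero 0), tot_compMap_compMap _ _ _ _ (add_zero 0), e₀, DegMap.comp_id,
        DegMap.id_comp, DegMap.id_comp]
    rw [reassoc_of% t₀, reassoc_of% h2, ← tot_comp _ _ (add_zero 0), leftUnit_comp_compMap, tot_comp, reassoc_of% hc,
      comp_id]
  · have h2 : tot (cinf x.i₀ x.i₀ x.i₁ (zero_add m)) ≫ tot (compMap ε (DegMap.id E)) =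
        tot (compMap C.ε (DegMap.id _)) ≫ tot (cinf (DegMap.id _) x.i₀ x.i₁ (zero_add m)) := by
      rw [tot_cinf_compMap, tot_compMap_cinf, e₀, DegMap.comp_id, DegMap.comp_id, DegMap.id_comp, DegMap.id_comp, DegMap.id_comp]
    have h3 : tot (compMap x.i₁ x.i₀) ≫ tot (compMap ε (DegMap.id E)) = 0 := by
      rw [tot_compMap_compMap _ _ _ _ (add_zero m), e₁, compMap_zero_left, tot_zero]
    rw [reassoc_of% t₁, add_comp, reassoc_of% h3, zero_comp, zero_add, reassoc_of% h2,
      ← tot_comp _ _ (add_zero m), leftUnit_comp_cinf _ _ _ _ (zero_add m), tot_comp, reassoc_of% hc, comp_id]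

theorem coextension_counit_right (h₀ : δ.comp x.i₀ (add_zero 0) = (compMap x.i₀ x.i₀).comp C.Δ (add_zero 0))
    (h₁ : δ.comp x.i₁ (add_zero m) = (compMap x.i₁ x.i₀ + cinf x.i₀ x.i₀ x.i₁ (zero_add m)).comp C.Δ (zero_add m))
    (e₀ : ε.comp x.i₀ (add_zero 0) = C.ε) (e₁ : ε.comp x.i₁ (add_zero m) = 0) :
    tot δ ≫ tot (compMap (DegMap.id E) ε) ≫ tot (rightUnit E) = 𝟙 _ := by
  have t₀ : tot x.i₀ ≫ tot δ = tot C.Δ ≫ tot (compMap x.i₀ x.i₀) := by rw [← tot_comp _ _ (add_zero 0), h₀, tot_comp]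
  have t₁ : tot x.i₁ ≫ tot δ = tot C.Δ ≫ (tot (compMap x.i₁ x.i₀) + tot (cinf x.i₀ x.i₀ x.i₁ (zero_add m))) := by
    rw [← tot_comp _ _ (add_zero m), h₁, tot_comp, tot_add]
  have hc := C.tot_counit_right
  refine x.hom_ext' ?_ ?_
  · have h2 : tot (compMap x.i₀ x.i₀) ≫ tot (compMap (DegMap.id E) ε) =
        tot (compMap (DegMap.id _) C.ε) ≫ tot (compMap x.i₀ (DegMap.id _)) := by
      rw [tot_compMap_compMap _ _ _ _ (add_zero 0), tot_compMap_compMap _ _ _ _ (add_zero 0), e₀, DegMap.comp_id,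
        DegMap.id_comp, DegMap.id_comp]
    rw [reassoc_of% t₀, reassoc_of% h2, ← tot_comp _ _ (add_zero 0), rightUnit_comp_compMap _ _ (add_zero 0), tot_comp,
      reassoc_of% hc, comp_id]
  · have h2 : tot (compMap x.i₁ x.i₀) ≫ tot (compMap (DegMap.id E) ε) =
        tot (compMap (DegMap.id _) C.ε) ≫ tot (compMap x.i₁ (DegMap.id _)) := by
      rw [tot_compMap_compMap _ _ _ _ (add_zero m), tot_compMap_compMap _ _ _ _ (zero_add m), e₀, DegMap.comp_id,
        DegMap.id_comp, DegMap.id_comp]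
    have h3 : tot (cinf x.i₀ x.i₀ x.i₁ (zero_add m)) ≫ tot (compMap (DegMap.id E) ε) = 0 := by
      rw [tot_cinf_compMap, e₁, cinf_zero_right, tot_zero]
    rw [reassoc_of% t₁, add_comp, reassoc_of% h3, zero_comp, add_zero, reassoc_of% h2,
      ← tot_comp _ _ (add_zero m), rightUnit_comp_compMap _ _ (zero_add m), tot_comp, reassoc_of% hc, comp_id]

end construction

/-- The map out of a square-zero extension with given components. -/
def ExtData.copair {V E W : SMod K} {m n : ℤ} (x : ExtData V E m n) (f : DegMap V W 0) (g : DegMap V W m) : DegMap E W 0 :=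
  f.comp x.p₀ (add_zero 0) + g.comp x.p₁ ((add_comm n m).trans x.sum_zero)

theorem ExtData.tot_copair {V E W : SMod K} {m n : ℤ} (x : ExtData V E m n) (f : DegMap V W 0) (g : DegMap V W m) :
    tot (x.copair f g) = tot x.p₀ ≫ tot f + tot x.p₁ ≫ tot g := by
  rw [copair, tot_add, tot_comp, tot_comp]

theorem ExtData.tot_i₀_copair {V E W : SMod K} {m n : ℤ} (x : ExtData V E m n) (f : DegMap V W 0) (g : DegMap V W m) :
    tot x.i₀ ≫ tot (x.copair f g) = tot f := by
  rw [tot_copair, comp_add, reassoc_of% x.i₀_p₀, reassoc_of% x.i₀_p₁, zero_comp, add_zero]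

theorem ExtData.tot_i₁_copair {V E W : SMod K} {m n : ℤ} (x : ExtData V E m n) (f : DegMap V W 0) (g : DegMap V W m) :
    tot x.i₁ ≫ tot (x.copair f g) = tot g := by
  rw [tot_copair, comp_add, reassoc_of% x.i₁_p₀, reassoc_of% x.i₁_p₁, zero_comp, zero_add]

theorem ExtData.copair_i₀ {V E W : SMod K} {m n : ℤ} (x : ExtData V E m n) (f : DegMap V W 0) (g : DegMap V W m) :
    (x.copair f g).comp x.i₀ (add_zero 0) = f := tot_injective (by rw [tot_comp, tot_i₀_copair])

theorem ExtData.copair_i₁ {V E W : SMod K} {m n : ℤ} (x : ExtData V E m n) (f : DegMap V W 0) (g : DegMap V W m) :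
    (x.copair f g).comp x.i₁ (add_zero m) = g := tot_injective (by rw [tot_comp, tot_i₁_copair])

/-- The square-zero extension of a cooperad. -/
def cooperadExt (C : GradedCooperad K) (m n : ℤ) (h : m + n = 0) : CooperadExt C m n :=
  let x := extData C.S m n h
  let δ := x.copair ((compMap x.i₀ x.i₀).comp C.Δ (add_zero 0))
    ((compMap x.i₁ x.i₀ + cinf x.i₀ x.i₀ x.i₁ (zero_add m)).comp C.Δ (zero_add m))
  let ε := x.copair C.ε 0
  have h₀ : δ.comp x.i₀ (add_zero 0) = (compMap x.i₀ x.i₀).comp C.Δ (add_zero 0) := x.copair_i₀ _ _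
  have h₁ : δ.comp x.i₁ (add_zero m) = (compMap x.i₁ x.i₀ + cinf x.i₀ x.i₀ x.i₁ (zero_add m)).comp C.Δ (zero_add m) :=
    x.copair_i₁ _ _
  have e₀ : ε.comp x.i₀ (add_zero 0) = C.ε := x.copair_i₀ _ _
  have e₁ : ε.comp x.i₁ (add_zero m) = 0 := x.copair_i₁ _ _
  { Q :=
    { S := ext C.S m
      Δ := δ
      ε := ε
      η := x.i₀.comp C.η (add_zero 0)
      Δ_coassoc := tot_injective (by
        simp only [tot_comp, Category.assoc]
        exact coextension_coassoc x δ h₀ h₁)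
      counit_left := tot_injective (by
        simp only [tot_comp, Category.assoc, tot_id]
        exact coextension_counit_left x δ ε h₀ h₁ e₀ e₁)
      counit_right := tot_injective (by
        simp only [tot_comp, Category.assoc, tot_id]
        exact coextension_counit_right x δ ε h₀ h₁ e₀ e₁)
      ε_η := tot_injective (by
        have t₀ := congrArg tot e₀
        have t₁ := congrArg tot C.ε_η
        rw [tot_comp] at t₀ t₁
        rw [tot_comp, tot_comp, Category.assoc, t₀, t₁])
      Δ_η := tot_injective (by
        have t₀ := congrArg tot h₀
        have t₁ := congrArg tot C.Δ_η
        rw [tot_comp, tot_comp] at t₀ t₁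
        refine (tot_comp _ _ _).trans ((congrArg (· ≫ tot δ) (tot_comp _ _ _)).trans ?_)
        rw [tot_comp, Category.assoc, Category.assoc, t₀, ← Category.assoc (tot C.η), ← Category.assoc,
          ← Category.assoc (tot (leftUnit _)), t₁, tot_compMap_compMap _ _ _ _ (add_zero 0)]) }
    x := x
    comul₀ := h₀
    comul₁ := h₁
    counit₀ := e₀
    counit₁ := e₁
    coaug := rfl }

section conilpotent
variable {C : GradedCooperad K} {m n : ℤ} (X : CooperadExt C m n)

theorem compMap_mem_upperSpan {C D : GradedCooperad K} {a : ℤ} (f : DegMap C.S D.S a) (g : DegMap C.S D.S 0) {n n' : ℕ}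
    (hg : ∀ {X : Type} [Finite X] {d d' : ℤ} (h : d + 0 = d') {x : C.S.obj X d}, x ∈ C.level n X d → g.app X d d' h x ∈ D.level n' X d')
    {X : Type} [Finite X] {d d' : ℤ} (h : d + a = d') {z : (comp C.S C.S).obj X d} (hz : z ∈ C.upperSpan n X d) :
    (compMap f g).app X d d' h z ∈ D.upperSpan n' X d' := by
  refine C.upperSpan_induction _ _ (fun k φ p q hd μ ν hν => ?_) hz
  refine Set.mem_of_eq_of_mem (compMap_gmk f g h φ p q hd μ ν) ?_
  exact D.gmk_mem_upperSpan _ _ _ _ _ _ fun i => hg rfl (hν i)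

theorem cinf_mem_upperSpan {C D : GradedCooperad K} {a b c : ℤ} (f : DegMap C.S D.S a) (g : DegMap C.S D.S 0) (g' : DegMap C.S D.S b)
    (hc : a + b = c) {n n' : ℕ}
    (hg : ∀ {X : Type} [Finite X] {d d' : ℤ} (h : d + 0 = d') {x : C.S.obj X d}, x ∈ C.level n X d → g.app X d d' h x ∈ D.level n' X d')
    (hg' : ∀ {X : Type} [Finite X] {d d' : ℤ} (h : d + b = d') {x : C.S.obj X d}, x ∈ C.level n X d → g'.app X d d' h x ∈ D.level n' X d')
    {X : Type} [Finite X] {d d' : ℤ} (h : d + c = d') {z : (comp C.S C.S).obj X d} (hz : z ∈ C.upperSpan n X d) :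
    (cinf f g g' hc).app X d d' h z ∈ D.upperSpan n' X d' := by
  refine C.upperSpan_induction _ _ (fun k φ p q hd μ ν hν => ?_) hz
  refine Set.mem_of_eq_of_mem (cinf_gmk f g g' hc h φ p q hd μ ν) (Submodule.sum_mem _ fun i _ => ?_)
  rw [units_smul_eq, ← Int.cast_smul_eq_zsmul K]
  refine Submodule.smul_mem _ _ (D.gmk_mem_upperSpan _ _ _ _ _ _ fun j => ?_)
  by_cases hj : j = i
  · rw [(infD_pos g g' hj).app_eq rfl (by rw [if_pos hj])]
    exact hg' _ (hν j)
  · rw [(infD_neg g g' hj).app_eq rfl (by rw [if_neg hj])]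
    exact hg _ (hν j)

theorem GradedCooperad.Hom.tot_Δ {C D : GradedCooperad K} (F : GradedCooperad.Hom C D) :
    tot F.f ≫ tot D.Δ = tot C.Δ ≫ tot (compMap F.f F.f) := by
  rw [← tot_comp _ _ (add_zero 0), F.map_Δ, tot_comp]

theorem GradedCooperad.Hom.tot_ε {C D : GradedCooperad K} (F : GradedCooperad.Hom C D) : tot F.f ≫ tot D.ε = tot C.ε := by
  rw [← tot_comp _ _ (add_zero 0), F.map_ε]

theorem GradedCooperad.Hom.tot_η {C D : GradedCooperad K} (F : GradedCooperad.Hom C D) : tot C.η ≫ tot F.f = tot D.η := by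
  rw [← tot_comp _ _ (add_zero 0), F.map_η]

theorem CooperadExt.tot_counit₀ : tot X.x.i₀ ≫ tot X.Q.ε = tot C.ε := by
  rw [← tot_comp _ _ (add_zero 0), X.counit₀]

theorem CooperadExt.tot_counit₁ : tot X.x.i₁ ≫ tot X.Q.ε = 0 := by
  rw [← tot_comp _ _ (add_zero m), X.counit₁, tot_zero]

theorem CooperadExt.tot_comul₀ : tot X.x.i₀ ≫ tot X.Q.Δ = tot C.Δ ≫ tot (compMap X.x.i₀ X.x.i₀) := by
  rw [← tot_comp _ _ (add_zero 0), X.comul₀, tot_comp]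

theorem CooperadExt.tot_comul₁ : tot X.x.i₁ ≫ tot X.Q.Δ =
    tot C.Δ ≫ (tot (compMap X.x.i₁ X.x.i₀) + tot (cinf X.x.i₀ X.x.i₀ X.x.i₁ (zero_add m))) := by
  rw [← tot_comp _ _ (add_zero m), X.comul₁, tot_comp, tot_add]

theorem GradedCooperad.tot_proj (C : GradedCooperad K) : tot C.proj = 𝟙 _ - tot C.ε ≫ tot C.η := by
  rw [proj, tot_sub, tot_id, tot_comp]

theorem CooperadExt.proj_i₀ : X.Q.proj.comp X.x.i₀ (add_zero 0) = X.x.i₀.comp C.proj (add_zero 0) := by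
  refine tot_injective ?_
  rw [tot_comp, tot_comp, GradedCooperad.tot_proj, GradedCooperad.tot_proj, comp_sub, sub_comp,
    comp_id, id_comp, ← Category.assoc, ← tot_comp _ _ (add_zero 0), X.counit₀, X.coaug, tot_comp, Category.assoc]

theorem CooperadExt.proj_i₁ : X.Q.proj.comp X.x.i₁ (add_zero m) = X.x.i₁ := by
  refine tot_injective ?_
  rw [tot_comp, GradedCooperad.tot_proj, comp_sub,
    comp_id, ← Category.assoc, ← tot_comp _ _ (add_zero m), X.counit₁, tot_zero, zero_comp, sub_zero]

theorem CooperadExt.comul_proj₀ : ((compMap X.Q.proj (DegMap.id X.Q.S)).comp X.Q.Δ (add_zero 0)).comp X.x.i₀ (add_zero 0) =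
    (compMap X.x.i₀ X.x.i₀).comp ((compMap C.proj (DegMap.id C.S)).comp C.Δ (add_zero 0)) (add_zero 0) := by
  refine tot_injective ?_
  rw [tot_comp, tot_comp, tot_comp, tot_comp, reassoc_of% X.tot_comul₀, Category.assoc, tot_compMap_compMap _ _ _ _ (add_zero 0),
    tot_compMap_compMap _ _ _ _ (add_zero 0), X.proj_i₀, DegMap.comp_id, DegMap.id_comp]

theorem CooperadExt.comul_proj₁ : ((compMap X.Q.proj (DegMap.id X.Q.S)).comp X.Q.Δ (add_zero 0)).comp X.x.i₁ (add_zero m) =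
    (compMap X.x.i₁ X.x.i₀).comp C.Δ (zero_add m) +
    (cinf X.x.i₀ X.x.i₀ X.x.i₁ (zero_add m)).comp ((compMap C.proj (DegMap.id C.S)).comp C.Δ (add_zero 0)) (zero_add m) := by
  refine tot_injective ?_
  rw [tot_add, tot_comp, tot_comp, tot_comp, tot_comp, tot_comp, reassoc_of% X.tot_comul₁, Category.assoc, add_comp,
    comp_add, tot_compMap_compMap _ _ _ _ (add_zero m), tot_cinf_compMap, tot_compMap_cinf, X.proj_i₀, X.proj_i₁,
    DegMap.id_comp, DegMap.id_comp, DegMap.comp_id, DegMap.comp_id]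

theorem CooperadExt.i₀_mem_level (k : ℕ) : ∀ {Y : Type} [Finite Y] {d d' : ℤ} (h : d + 0 = d') {y : C.S.obj Y d},
    y ∈ C.level k Y d → X.x.i₀.app Y d d' h y ∈ X.Q.level k Y d' := by
  induction k with
  | zero =>
    intro Y _ d d' h y hy
    obtain rfl : d = d' := by omega
    rw [GradedCooperad.level] at hy ⊢
    obtain ⟨w, rfl⟩ := hy
    refine ⟨w, ?_⟩
    rw [X.coaug, DegMap.comp_app _ _ _ (add_zero d) (add_zero d)]
  | succ k ih =>
    intro Y _ d d' h y hy
    obtain rfl : d = d' := by omega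
    rw [GradedCooperad.level] at hy
    refine (GradedCooperad.mem_level_succ _).2 ?_
    have h1 := congrArg (fun f => f.app Y d d (add_zero d) y) X.comul_proj₀
    beta_reduce at h1
    rw [DegMap.comp_app _ _ _ (add_zero d) (add_zero d), DegMap.comp_app (compMap X.x.i₀ X.x.i₀) _ _ (add_zero d) (add_zero d)] at h1
    refine Set.mem_of_eq_of_mem h1 ?_
    exact compMap_mem_upperSpan (C := C) (D := X.Q) X.x.i₀ X.x.i₀ ih (add_zero d) hy

/-- The suspended copy of `1` is primitive, so the filtration is shifted by one step on the suspended summand. -/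
theorem CooperadExt.i₁_mem_level (k : ℕ) : ∀ {Y : Type} [Finite Y] {d d' : ℤ} (h : d + m = d') {y : C.S.obj Y d},
    y ∈ C.level k Y d → X.x.i₁.app Y d d' h y ∈ X.Q.level (k + 1) Y d' := by
  induction k with
  | zero =>
    intro Y _ d d' h y hy
    have hy' := hy
    rw [GradedCooperad.level] at hy'
    refine (GradedCooperad.mem_level_succ _).2 ?_
    have h0 : ((compMap C.proj (DegMap.id C.S)).comp C.Δ (add_zero 0)).app Y d d (add_zero d) y = 0 := by
      obtain ⟨w, rfl⟩ := hy'
      exact C.coaug_comul_proj w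
    have h1 := congrArg (fun f => f.app Y d d' h y) X.comul_proj₁
    simp only [DegMap.add_app] at h1
    rw [DegMap.comp_app _ _ _ h (add_zero d'), DegMap.comp_app (compMap X.x.i₁ X.x.i₀) _ _ (add_zero d) h,
      DegMap.comp_app (cinf X.x.i₀ X.x.i₀ X.x.i₁ (zero_add m)) _ _ (add_zero d) h, h0, map_zero, add_zero] at h1
    refine Set.mem_of_eq_of_mem h1 ?_
    exact compMap_mem_upperSpan (C := C) (D := X.Q) X.x.i₁ X.x.i₀ (X.i₀_mem_level 0) h (C.comul_mem hy)
  | succ k ih =>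
    intro Y _ d d' h y hy
    have hy' := hy
    rw [GradedCooperad.level] at hy'
    refine (GradedCooperad.mem_level_succ _).2 ?_
    have h1 := congrArg (fun f => f.app Y d d' h y) X.comul_proj₁
    simp only [DegMap.add_app] at h1
    rw [DegMap.comp_app _ _ _ h (add_zero d'), DegMap.comp_app (compMap X.x.i₁ X.x.i₀) _ _ (add_zero d) h,
      DegMap.comp_app (cinf X.x.i₀ X.x.i₀ X.x.i₁ (zero_add m)) _ _ (add_zero d) h] at h1
    refine Set.mem_of_eq_of_mem h1 (add_mem ?_ ?_)
    · exact compMap_mem_upperSpan (C := C) (D := X.Q) X.x.i₁ X.x.i₀ (X.i₀_mem_level (k + 1)) h (C.comul_mem hy)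
    · refine cinf_mem_upperSpan (C := C) (D := X.Q) X.x.i₀ X.x.i₀ X.x.i₁ (zero_add m) (n := k)
        (fun h x hx => X.Q.level_le_succ k _ _ (X.i₀_mem_level k h hx)) ih h hy'

theorem CooperadExt.isConilpotent (hC : C.IsConilpotent) : X.Q.IsConilpotent := fun Y _ d y => by
  obtain ⟨k₀, h₀⟩ := hC Y d (X.x.p₀.app Y d d (add_zero d) y)
  obtain ⟨k₁, h₁⟩ := hC Y (d + n) (X.x.p₁.app Y d (d + n) rfl y)
  refine ⟨max k₀ (k₁ + 1), ?_⟩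
  have hs := X.x.sum_zero
  have h2 : X.x.i₀.comp X.x.p₀ (add_zero 0) + X.x.i₁.comp X.x.p₁ ((add_comm n m).trans hs) = DegMap.id X.Q.S :=
    tot_injective (by rw [tot_add, tot_comp, tot_comp, X.x.total, tot_id])
  have h3 := congrArg (fun f => f.app Y d d (add_zero d) y) h2
  simp only [DegMap.add_app] at h3
  rw [DegMap.comp_app _ _ _ (add_zero d) (add_zero d), DegMap.comp_app X.x.i₁ _ _ rfl (by omega)] at h3
  refine Set.mem_of_eq_of_mem h3.symm (add_mem ?_ ?_)
  · exact X.Q.level_mono (le_max_left _ _) _ _ (X.i₀_mem_level k₀ _ h₀)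
  · exact X.Q.level_mono (le_max_right _ _) _ _ (X.i₁_mem_level k₁ _ h₁)

end conilpotent

/-- Coderivations of degree `m` along a morphism of cooperads. -/
structure IsCoderivation {C B : GradedCooperad K} (F : DegMap C.S B.S 0) {m : ℤ} (E : DegMap C.S B.S m) : Prop where
  counit : B.ε.comp E (add_zero m) = 0
  comul : B.Δ.comp E (add_zero m) = (compMap E F + cinf F F E (zero_add m)).comp C.Δ (zero_add m)

section coderivation
variable {C B : GradedCooperad K} {m n : ℤ}

theorem IsCoderivation.tot_counit {F : DegMap C.S B.S 0} {E : DegMap C.S B.S m} (hE : IsCoderivation F E) : tot E ≫ tot B.ε = 0 := by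
  rw [← tot_comp _ _ (add_zero m), hE.counit, tot_zero]

theorem IsCoderivation.tot_comul {F : DegMap C.S B.S 0} {E : DegMap C.S B.S m} (hE : IsCoderivation F E) :
    tot E ≫ tot B.Δ = tot C.Δ ≫ (tot (compMap E F) + tot (cinf F F E (zero_add m))) := by
  rw [← tot_comp _ _ (add_zero m), hE.comul, tot_comp, tot_add]

/-- The morphism out of the square-zero extension given by a coderivation. -/
def IsCoderivation.toHom (X : CooperadExt C m n) (F : GradedCooperad.Hom C B) {E : DegMap C.S B.S m}
    (hE : IsCoderivation F.f E) : GradedCooperad.Hom X.Q B where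
  f := X.x.copair F.f E
  map_Δ := by
    refine tot_injective (X.x.hom_ext' ?_ ?_)
    · rw [tot_comp, tot_comp, ← Category.assoc, X.x.tot_i₀_copair, F.tot_Δ, reassoc_of% X.tot_comul₀,
        tot_compMap_compMap _ _ _ _ (add_zero 0), X.x.copair_i₀]
    · rw [tot_comp, tot_comp, ← Category.assoc, X.x.tot_i₁_copair, hE.tot_comul, reassoc_of% X.tot_comul₁, add_comp,
        tot_compMap_compMap _ _ _ _ (add_zero m), tot_cinf_compMap, X.x.copair_i₀, X.x.copair_i₁]
  map_ε := by
    refine tot_injective (X.x.hom_ext' ?_ ?_)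
    · rw [tot_comp, ← Category.assoc, X.x.tot_i₀_copair, F.tot_ε, X.tot_counit₀]
    · rw [tot_comp, ← Category.assoc, X.x.tot_i₁_copair, hE.tot_counit, X.tot_counit₁]
  map_η := by
    refine tot_injective ?_
    rw [tot_comp, X.coaug, tot_comp, Category.assoc, X.x.tot_i₀_copair, F.tot_η]

/-- The restriction to the cooperad of a morphism out of the square-zero extension. -/
def CooperadExt.restrict (X : CooperadExt C m n) (G : GradedCooperad.Hom X.Q B) : GradedCooperad.Hom C B where
  f := G.f.comp X.x.i₀ (add_zero 0)
  map_Δ := tot_injective (by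
    rw [tot_comp, tot_comp, tot_comp, Category.assoc, G.tot_Δ, reassoc_of% X.tot_comul₀, ← tot_compMap_compMap _ _ _ _ (add_zero 0)])
  map_ε := tot_injective (by
    rw [tot_comp, tot_comp, Category.assoc, G.tot_ε, X.tot_counit₀])
  map_η := tot_injective (by
    have h₀ := congrArg tot X.coaug
    rw [tot_comp] at h₀
    rw [tot_comp, tot_comp, ← Category.assoc, ← h₀, G.tot_η])

/-- A morphism out of the square-zero extension is a coderivation along its restriction to the cooperad. -/
theorem CooperadExt.isCoderivation (X : CooperadExt C m n) (G : GradedCooperad.Hom X.Q B) :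
    IsCoderivation (G.f.comp X.x.i₀ (add_zero 0)) (G.f.comp X.x.i₁ (add_zero m)) where
  counit := tot_injective (by
    rw [tot_comp, tot_comp, Category.assoc, G.tot_ε, X.tot_counit₁, tot_zero])
  comul := tot_injective (by
    rw [tot_comp, tot_comp, tot_comp, Category.assoc, G.tot_Δ, reassoc_of% X.tot_comul₁, tot_add,
      ← tot_compMap_compMap _ _ _ _ (add_zero m), ← tot_cinf_compMap, add_comp])


variable {V : SMod K} {π : DegMap B.S V 0}

/-- A coderivation to a cofree cooperad is determined by its projection to the cogenerators. -/
theorem IsCofreeCooperad.coderivation_ext (hB : IsCofreeCooperad B π) (hC : C.IsConilpotent) (F : GradedCooperad.Hom C B)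
    {E E' : DegMap C.S B.S m} (hE : IsCoderivation F.f E) (hE' : IsCoderivation F.f E')
    (h : π.comp E (add_zero m) = π.comp E' (add_zero m)) : E = E' := by
  let X := cooperadExt C m (-m) (add_neg_cancel m)
  have h1 : hE.toHom X F = hE'.toHom X F := by
    refine (hB.2.2 _ (X.isConilpotent hC) (π.comp (X.x.copair F.f E') (add_zero 0)) ?_).unique
      (tot_injective (X.x.hom_ext' ?_ ?_)) rfl
    · have hη := congrArg tot (hE'.toHom X F).map_η
      have hπ := congrArg tot hB.2.1
      rw [tot_comp] at hη hπ
      refine tot_injective ?_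
      change tot X.Q.η ≫ tot (X.x.copair F.f E') = _ at hη
      rw [tot_comp, tot_comp, reassoc_of% hη, hπ]
    · rw [tot_comp, tot_comp, ← Category.assoc, ← Category.assoc, IsCoderivation.toHom, X.x.tot_i₀_copair, X.x.tot_i₀_copair]
    · rw [tot_comp, tot_comp, ← Category.assoc, ← Category.assoc, IsCoderivation.toHom, X.x.tot_i₁_copair, X.x.tot_i₁_copair,
        ← tot_comp _ _ (add_zero m), h, tot_comp]
  have h2 := congrArg (fun G : GradedCooperad.Hom X.Q B => tot X.x.i₁ ≫ tot G.f) h1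
  exact tot_injective ((X.x.tot_i₁_copair F.f E).symm.trans (h2.trans (X.x.tot_i₁_copair F.f E')))

/-- A coderivation to a cofree cooperad can be prescribed on the cogenerators. -/
theorem IsCofreeCooperad.exists_coderivation (hB : IsCofreeCooperad B π) (hC : C.IsConilpotent) (F : GradedCooperad.Hom C B)
    (g : DegMap C.S V m) : ∃ E : DegMap C.S B.S m, IsCoderivation F.f E ∧ π.comp E (add_zero m) = g := by
  let X := cooperadExt C m (-m) (add_neg_cancel m)
  have hFη : tot C.η ≫ tot F.f ≫ tot π = 0 := by
    rw [← Category.assoc, ← tot_comp _ _ (add_zero 0), F.map_η, ← tot_comp _ _ (add_zero 0), hB.2.1, tot_zero]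
  obtain ⟨G, hG, -⟩ := hB.2.2 X.Q (X.isConilpotent hC) (X.x.copair (π.comp F.f (add_zero 0)) g) (tot_injective (by
    rw [tot_comp, X.coaug, tot_comp, Category.assoc, X.x.tot_i₀_copair, tot_comp, hFη, tot_zero]))
  have tG := congrArg tot hG
  rw [tot_comp] at tG
  have hGF : X.restrict G = F := by
    refine (hB.2.2 C hC (π.comp F.f (add_zero 0)) (tot_injective (by rw [tot_comp, tot_comp, hFη, tot_zero]))).unique
      (tot_injective ?_) rfl
    rw [tot_comp, CooperadExt.restrict, tot_comp, Category.assoc, tG, X.x.tot_i₀_copair]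
  refine ⟨G.f.comp X.x.i₁ (add_zero m), ?_, tot_injective ?_⟩
  · have := X.isCoderivation G
    rwa [← hGF]
  · rw [tot_comp, tot_comp, Category.assoc, tG, X.x.tot_i₁_copair]

open MonoidalCategory in
/-- The endomorphism `x ↦ ε(x) 1`. -/
def GradedCooperad.trivialHom (C : GradedCooperad K) : GradedCooperad.Hom C C where
  f := C.η.comp C.ε (add_zero 0)
  map_Δ := by
    have h1 : (C.counit ≫ C.coaug) ≫ C.comul = C.comul ≫ ((C.counit ≫ C.coaug) ▷ C.S) ≫ (C.S ◁ (C.counit ≫ C.coaug)) := by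
      rw [Category.assoc, C.coaug_comul, comp_whiskerRight, Category.assoc, reassoc_of% C.comul_counit_left,
        ← whisker_exchange, leftUnitor_inv_naturality_assoc, MonoidalCategory.whiskerLeft_comp, whisker_exchange,
        whisker_exchange_assoc]
    rw [← MonoidalCategory.tensorHom_def] at h1
    exact h1
  map_ε := by
    have h1 : (C.counit ≫ C.coaug) ≫ C.counit = C.counit := by
      rw [Category.assoc, C.coaug_counit, comp_id]
    exact h1
  map_η := by
    have h1 : C.coaug ≫ C.counit ≫ C.coaug = C.coaug := by
      rw [← Category.assoc, C.coaug_counit, id_comp]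
    exact h1

/-- Coderivations compose with morphisms on the right. -/
theorem IsCoderivation.comp_hom {A : GradedCooperad K} {F : DegMap C.S B.S 0} {E : DegMap C.S B.S m} (hE : IsCoderivation F E)
    (G : GradedCooperad.Hom A C) : IsCoderivation (F.comp G.f (add_zero 0)) (E.comp G.f (zero_add m)) where
  counit := tot_injective (by
    rw [tot_comp, tot_comp, Category.assoc, hE.tot_counit, tot_zero, comp_zero])
  comul := tot_injective (by
    rw [tot_comp, tot_comp, Category.assoc, hE.tot_comul, reassoc_of% G.tot_Δ, tot_comp, tot_add, comp_add,
      tot_compMap_compMap _ _ _ _ (zero_add m), tot_compMap_cinf])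

/-- Coderivations compose with morphisms on the left. -/
theorem IsCoderivation.hom_comp {A : GradedCooperad K} {F : DegMap C.S B.S 0} {E : DegMap C.S B.S m} (hE : IsCoderivation F E)
    (G : GradedCooperad.Hom B A) : IsCoderivation (G.f.comp F (add_zero 0)) (G.f.comp E (add_zero m)) where
  counit := tot_injective (by
    rw [tot_comp, tot_comp, Category.assoc, G.tot_ε, hE.tot_counit, tot_zero])
  comul := tot_injective (by
    rw [tot_comp, tot_comp, Category.assoc, G.tot_Δ, reassoc_of% hE.tot_comul, tot_comp, tot_add, add_comp,
      tot_compMap_compMap _ _ _ _ (add_zero m), tot_cinf_compMap])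

theorem isCoderivation_zero (F : DegMap C.S B.S 0) : IsCoderivation F (0 : DegMap C.S B.S m) where
  counit := tot_injective (by rw [tot_comp, tot_zero, tot_zero, zero_comp])
  comul := tot_injective (by
    rw [tot_comp, tot_comp, compMap_zero_left, cinf_zero_right, add_zero, tot_zero, tot_zero, zero_comp, comp_zero])

/-- The composite of two morphisms of cooperads. -/
def GradedCooperad.Hom.comp {A : GradedCooperad K} (F : GradedCooperad.Hom C B) (G : GradedCooperad.Hom A C) :
    GradedCooperad.Hom A B where
  f := F.f.comp G.f (add_zero 0)
  map_Δ := tot_injective (by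
    rw [tot_comp, tot_comp, tot_comp, Category.assoc, F.tot_Δ, reassoc_of% G.tot_Δ, tot_compMap_compMap _ _ _ _ (add_zero 0)])
  map_ε := tot_injective (by
    rw [tot_comp, tot_comp, Category.assoc, F.tot_ε, G.tot_ε])
  map_η := tot_injective (by
    rw [tot_comp, tot_comp, reassoc_of% G.tot_η, F.tot_η])

/-- A coderivation to a cofree cooperad kills `1` if its projection to the cogenerators does. -/
theorem IsCofreeCooperad.coderivation_coaug (hB : IsCofreeCooperad B π) (hC : C.IsConilpotent) (F : GradedCooperad.Hom C B)
    {E : DegMap C.S B.S m} (hE : IsCoderivation F.f E) (h : (π.comp E (add_zero m)).comp C.η (zero_add m) = 0) :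
    E.comp C.η (zero_add m) = 0 := by
  -- `x ↦ ε(x) 1` is a morphism of cooperads, so precomposing with it gives a coderivation.
  have h1 : E.comp C.trivialHom.f (zero_add m) = 0 := by
    refine hB.coderivation_ext hC (F.comp C.trivialHom) (hE.comp_hom C.trivialHom) (isCoderivation_zero _) (tot_injective ?_)
    have h2 := congrArg tot h
    rw [tot_comp, tot_comp, tot_zero] at h2
    rw [tot_comp, tot_comp, GradedCooperad.trivialHom, tot_comp, tot_comp, Category.assoc, Category.assoc, h2, tot_zero,
      comp_zero, zero_comp]
  have h3 := congrArg tot h1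
  have h4 := congrArg tot C.ε_η
  refine tot_injective ?_
  rw [tot_comp, GradedCooperad.trivialHom, tot_comp, Category.assoc] at h3
  rw [tot_comp, tot_id] at h4
  rw [tot_comp, ← id_comp (tot C.η), ← h4, Category.assoc, Category.assoc, h3, tot_zero, tot_zero, comp_zero]

end coderivation

end cooperadExtension
end OperadicBar

namespace OperadicBar
open Limits Preadditive
open CategoryTheory.Category (id_comp comp_id)
variable {K : Type u} [Field K]

/-! ### The infinitesimal convolution product and the curvature operator -/

noncomputable section totRules

variable {V V' V'' W W' W'' U U' : SMod K} {a a' a'' b b' b'' c c' e : ℤ}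

theorem tot_comp_of {f : DegMap U V a} {g : DegMap V W b} {h : a + b = c} {F : DegMap U W c} (H : g.comp f h = F) :
    tot f ≫ tot g = tot F := by rw [← H, tot_comp]

/-- Composites of decorated two-level trees, one of which has a marked upper vertex. -/
theorem tot_cinf_compMap_of {f : DegMap V' V'' a'} {f' : DegMap V V' a} {g : DegMap W' W'' 0}
    {g' : DegMap W W' 0} {h' : DegMap W W' b} {F : DegMap V V'' a''} {G : DegMap W W'' 0} {H : DegMap W W'' b}
    (hF : tot f' ≫ tot f = tot F) (hG : tot g' ≫ tot g = tot G) (hH : tot h' ≫ tot g = tot H)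
    (ha : a + a' = a'') (h₁ : a + b = c) (h₅ : a'' + b = c') :
    tot (cinf f' g' h' h₁) ≫ tot (compMap f g) = tot (cinf F G H h₅) := by
  obtain rfl : f.comp f' ha = F := tot_injective (by rw [tot_comp, hF])
  obtain rfl : g.comp g' (add_zero 0) = G := tot_injective (by rw [tot_comp, hG])
  obtain rfl : g.comp h' (add_zero b) = H := tot_injective (by rw [tot_comp, hH])
  rw [← tot_comp _ _ (by omega : c + a' = c'), compMap_comp_cinf (h₃ := ha) (h₄ := add_zero b) (h₅ := h₅)]

theorem tot_compMap_cinf_of {f : DegMap V' V'' a'} {f' : DegMap V V' a} {g : DegMap W' W'' 0}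
    {g' : DegMap W W' 0} {h : DegMap W' W'' b} {F : DegMap V V'' a''} {G : DegMap W W'' 0} {H : DegMap W W'' b}
    (hF : tot f' ≫ tot f = tot F) (hG : tot g' ≫ tot g = tot G) (hH : tot g' ≫ tot h = tot H)
    (ha : a + a' = a'') (h₁ : a' + b = c) (h₅ : a'' + b = c') :
    tot (compMap f' g') ≫ tot (cinf f g h h₁) = ((b * a).negOnePow : ℤ) • tot (cinf F G H h₅) := by
  obtain rfl : f.comp f' ha = F := tot_injective (by rw [tot_comp, hF])
  obtain rfl : g.comp g' (add_zero 0) = G := tot_injective (by rw [tot_comp, hG])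
  obtain rfl : h.comp g' (zero_add b) = H := tot_injective (by rw [tot_comp, hH])
  rw [← tot_comp _ _ (by omega : a + c = c'), cinf_comp_compMap (h₃ := ha) (h₄ := zero_add b) (h₅ := h₅), tot_smul]

theorem tot_cinf_cinf_of {f : DegMap V' V'' a'} {f' : DegMap V V' a} {g : DegMap W' W'' 0}
    {g' : DegMap W W' 0} {h : DegMap W' W'' b} {h' : DegMap W W' b'} {F : DegMap V V'' a''} {G : DegMap W W'' 0}
    {H : DegMap W W'' b''}
    (hF : tot f' ≫ tot f = tot F) (hG : tot g' ≫ tot g = tot G) (hH : tot h' ≫ tot h = tot H)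
    (ha : a + a' = a'') (hb : b' + b = b'') (h₁ : a' + b = c) (h₁' : a + b' = c') (h₅ : a'' + b'' = e)
    (hz : tot g' ≫ tot h = 0 ∨ tot h' ≫ tot g = 0 ∨ Odd b ∧ b = b' ∧ tot g' ≫ tot h = tot h' ≫ tot g) :
    tot (cinf f' g' h' h₁') ≫ tot (cinf f g h h₁) = ((b * a).negOnePow : ℤ) • tot (cinf F G H h₅) := by
  obtain rfl : f.comp f' ha = F := tot_injective (by rw [tot_comp, hF])
  obtain rfl : g.comp g' (add_zero 0) = G := tot_injective (by rw [tot_comp, hG])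
  obtain rfl : h.comp h' hb = H := tot_injective (by rw [tot_comp, hH])
  rw [← tot_comp _ _ (by omega : c' + c = e), cinf_comp_cinf (h₃ := ha) (h₄ := hb) (h₅ := h₅), tot_smul]
  rcases hz with hz | hz | ⟨ho, rfl, hz⟩
  · exact Or.inl (tot_injective (by rw [tot_comp, hz, tot_zero]))
  · exact Or.inr (Or.inl (tot_injective (by rw [tot_comp, hz, tot_zero])))
  · refine Or.inr (Or.inr ⟨ho, rfl, tot_injective ?_⟩)
    rw [tot_recast, tot_comp, tot_comp, hz]

/-- The square of the derivation induced by an endomorphism of odd degree. -/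
theorem tot_der_sq {d : DegMap V V a} (ha : Odd a) {d' : DegMap V V b} (hd : tot d ≫ tot d = tot d') (hb : a + a = b) :
    (tot (compMap d (DegMap.id V)) + tot (cinf (DegMap.id V) (DegMap.id V) d (zero_add a))) ≫
      (tot (compMap d (DegMap.id V)) + tot (cinf (DegMap.id V) (DegMap.id V) d (zero_add a))) =
    tot (compMap d' (DegMap.id V)) + tot (cinf (DegMap.id V) (DegMap.id V) d' (zero_add b)) := by
  have hi : tot (DegMap.id V) ≫ tot (DegMap.id V) = tot (DegMap.id V) := by rw [tot_id, comp_id]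
  have hl : tot (DegMap.id V) ≫ tot d = tot d := by rw [tot_id, id_comp]
  have hr : tot d ≫ tot (DegMap.id V) = tot d := by rw [tot_id, comp_id]
  have e₁ : tot (compMap d (DegMap.id V)) ≫ tot (compMap d (DegMap.id V)) = tot (compMap d' (DegMap.id V)) := by
    rw [tot_compMap_compMap _ _ _ _ hb, DegMap.comp_id]
    congr 2
    exact tot_injective (by rw [tot_comp, hd])
  have e₂ := tot_compMap_cinf_of hr hi hl (add_zero a) (zero_add a) hb
  have e₃ := tot_cinf_compMap_of hl hi hr (zero_add a) (zero_add a) hb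
  have e₄ := tot_cinf_cinf_of hi hi hd (add_zero 0) hb (zero_add a) (zero_add a) (zero_add b)
    (Or.inr (Or.inr ⟨ha, rfl, hl.trans hr.symm⟩))
  rw [Int.negOnePow_odd _ (ha.mul ha)] at e₂
  rw [mul_zero, Int.negOnePow_zero, Units.val_one, one_smul] at e₄
  rw [comp_add, add_comp, add_comp, e₁, e₂, e₃, e₄, Units.val_neg, Units.val_one, neg_smul,
    one_smul]
  abel

end totRules

noncomputable section convolution
variable {C : GradedCooperad K} {P : GradedOperad K} {a b c m a' b' c' : ℤ}

/-- The map `x ↦ ε(x) 1` from a cooperad to an operad. -/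
def trivialMap (C : GradedCooperad K) (P : GradedOperad K) : DegMap C.S P.S 0 := P.η.comp C.ε (add_zero 0)

theorem tot_trivialMap : tot (trivialMap C P) = tot C.ε ≫ tot P.η := by rw [trivialMap, tot_comp]

/-- The infinitesimal convolution product `γ (α ⊗ β) Δ`, with `α` on the lower vertex, `β` on one of the upper
vertices and the trivial map on the others. -/
def conv (α : DegMap C.S P.S a) (β : DegMap C.S P.S b) (h : a + b = c) : DegMap C.S P.S c :=
  P.γ.comp ((cinf α (trivialMap C P) β h).comp C.Δ (zero_add c)) (add_zero c)

theorem tot_conv (α : DegMap C.S P.S a) (β : DegMap C.S P.S b) (h : a + b = c) :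
    tot (conv α β h) = tot C.Δ ≫ tot (cinf α (trivialMap C P) β h) ≫ tot P.γ := by
  rw [conv, tot_comp, tot_comp, Category.assoc]

theorem GradedCooperad.tot_ε_η (C : GradedCooperad K) : tot C.η ≫ tot C.ε = 𝟙 _ := by
  rw [← tot_comp _ _ (add_zero 0), C.ε_η, tot_id]

theorem GradedCooperad.tot_proj_comp {V : SMod K} {β : DegMap C.S V b} (h : tot C.η ≫ tot β = 0) : tot C.proj ≫ tot β = tot β := by
  rw [C.tot_proj, sub_comp, Category.assoc, h, comp_zero, sub_zero, id_comp]

/-- The part on trees with two vertices in the coaugmentation coideal, applied with maps that kill `1`. -/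
theorem tot_Δ₂_cinf {V W : SMod K} {α : DegMap C.S V a} {β : DegMap C.S W b} {g g' : DegMap C.S W 0} (h : a + b = c)
    {α' : DegMap C.S V a} (hα : tot C.proj ≫ tot α = tot α') {β' : DegMap C.S W b} (hβ' : tot C.proj ≫ tot β = tot β')
    (hβ : tot C.η ≫ tot β = 0 ∨ tot C.proj ≫ tot g = 0) (hg : tot C.ε ≫ tot C.η ≫ tot g = tot g') :
    tot C.Δ₂ ≫ tot (cinf α g β h) = tot C.Δ ≫ tot (cinf α' g' β' h) := by
  have h1 : tot C.Δ₂ = tot C.Δ ≫ tot (cinf C.proj (C.η.comp C.ε (add_zero 0)) C.proj (zero_add 0)) := tot_comp _ _ _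
  rw [h1, Category.assoc, tot_cinf_cinf_of (f := α) (g := g) (h := β) (g' := C.η.comp C.ε (add_zero 0)) hα ?_ hβ'
    (zero_add a) (zero_add b) h (zero_add 0) h ?_, mul_zero, Int.negOnePow_zero, Units.val_one, one_smul]
  · rw [tot_comp, Category.assoc, hg]
  · rw [tot_comp, Category.assoc]
    exact hβ.imp (fun h => by rw [h, comp_zero]) Or.inl

/-- The convolution square of the definition of twisting morphisms is a value of the infinitesimal convolution product. -/
theorem star_eq_conv {α : DegMap C.S P.S (-1)} (hα : tot C.η ≫ tot α = 0) : star C P α = conv α α (by norm_num) := by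
  refine tot_injective ?_
  rw [star, tot_comp, tot_comp, tot_conv, ← Category.assoc (tot C.Δ)]
  refine congrArg (· ≫ tot P.γ) (tot_Δ₂_cinf (h := by norm_num) (C.tot_proj_comp hα) (C.tot_proj_comp hα) (Or.inl hα) ?_)
  change _ ≫ _ ≫ tot (trivialMap C P) = tot (trivialMap C P)
  rw [tot_trivialMap, reassoc_of% C.tot_ε_η]

/-- The product is compatible with morphisms of operads. -/
theorem hom_conv {Q : GradedOperad K} (F : GradedOperad.Hom P Q) {α : DegMap C.S P.S a} {β : DegMap C.S P.S b} {h : a + b = c}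
    {α' : DegMap C.S Q.S a} {β' : DegMap C.S Q.S b} (hα : tot α ≫ tot F.f = tot α') (hβ : tot β ≫ tot F.f = tot β') :
    tot (conv α β h) ≫ tot F.f = tot (conv α' β' h) := by
  rw [tot_conv, tot_conv, Category.assoc, Category.assoc, F.tot_γ, ← Category.assoc (tot (cinf _ _ _ _)),
    tot_cinf_compMap_of hα (G := trivialMap C Q) ?_ hβ (add_zero a) h h]
  rw [tot_trivialMap, tot_trivialMap, Category.assoc, F.tot_η]

/-- The product is compatible with morphisms of cooperads. -/
theorem conv_hom {D : GradedCooperad K} (F : GradedCooperad.Hom D C) {α : DegMap C.S P.S a} {β : DegMap C.S P.S b} {h : a + b = c}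
    {α' : DegMap D.S P.S a} {β' : DegMap D.S P.S b} (hα : tot F.f ≫ tot α = tot α') (hβ : tot F.f ≫ tot β = tot β') :
    tot F.f ≫ tot (conv α β h) = tot (conv α' β' h) := by
  rw [tot_conv, tot_conv, reassoc_of% F.tot_Δ, ← Category.assoc (tot (compMap _ _)),
    tot_compMap_cinf_of hα (G := trivialMap D P) ?_ hβ (zero_add a) h h, mul_zero, Int.negOnePow_zero, Units.val_one, one_smul]
  rw [tot_trivialMap, tot_trivialMap, reassoc_of% F.tot_ε]

/-- Derivations of the operad act on the product. -/
theorem derivation_conv {E : DegMap P.S P.S m} (hE : IsDerivation (DegMap.id P.S) E) {α : DegMap C.S P.S a} {β : DegMap C.S P.S b}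
    {h : a + b = c} {α' : DegMap C.S P.S a'} {β' : DegMap C.S P.S b'} (hα : tot α ≫ tot E = tot α') (hβ : tot β ≫ tot E = tot β')
    (ha : a + m = a') (hb : b + m = b') (h₁ : a' + b = c') (h₂ : a + b' = c') :
    tot (conv α β h) ≫ tot E = tot (conv α' β h₁) + ((m * a).negOnePow : ℤ) • tot (conv α β' h₂) := by
  have hr {b : ℤ} (β : DegMap C.S P.S b) : tot β ≫ tot (DegMap.id P.S) = tot β := by rw [tot_id, comp_id]
  rw [tot_conv, tot_conv, tot_conv, Category.assoc, Category.assoc, hE.tot_mul, ← Category.assoc (tot (cinf _ _ _ _)),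
    comp_add, tot_cinf_compMap_of hα (hr _) (hr _) ha h h₁,
    tot_cinf_cinf_of (hr _) (hr _) hβ (add_zero a) hb (zero_add m) h h₂ (Or.inl ?_), add_comp, comp_add,
    zsmul_comp, comp_zsmul]
  rw [tot_trivialMap, Category.assoc, hE.tot_unit, comp_zero]

/-- Coderivations of the cooperad act on the product. -/
theorem conv_coderivation {E : DegMap C.S C.S m} (hE : IsCoderivation (DegMap.id C.S) E) {α : DegMap C.S P.S a} {β : DegMap C.S P.S b}
    {h : a + b = c} {α' : DegMap C.S P.S a'} {β' : DegMap C.S P.S b'} (hα : tot E ≫ tot α = tot α') (hβ : tot E ≫ tot β = tot β')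
    (ha : m + a = a') (hb : m + b = b') (h₁ : a' + b = c') (h₂ : a + b' = c') :
    tot E ≫ tot (conv α β h) = ((b * m).negOnePow : ℤ) • tot (conv α' β h₁) + tot (conv α β' h₂) := by
  have hr {b : ℤ} (β : DegMap C.S P.S b) : tot (DegMap.id C.S) ≫ tot β = tot β := by rw [tot_id, id_comp]
  rw [tot_conv, tot_conv, tot_conv, reassoc_of% hE.tot_comul, ← Category.assoc (_ + _), add_comp,
    tot_compMap_cinf_of hα (hr _) (hr _) ha h h₁,
    tot_cinf_cinf_of (hr _) (hr _) hβ (zero_add a) hb h (zero_add m) h₂ (Or.inr (Or.inl ?_)), mul_zero, Int.negOnePow_zero,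
    Units.val_one, one_smul, add_comp, comp_add, zsmul_comp, comp_zsmul]
  rw [tot_trivialMap, reassoc_of% hE.tot_counit, zero_comp]

theorem conv_coaug {α : DegMap C.S P.S a} {β : DegMap C.S P.S b} {h : a + b = c} (hα : tot C.η ≫ tot α = 0) :
    tot C.η ≫ tot (conv α β h) = 0 := by
  have h1 : tot C.trivialHom.f ≫ tot (conv α β h) = 0 := by
    rw [conv_hom C.trivialHom (α' := 0) (β' := β.comp C.trivialHom.f (zero_add b)) ?_ (by rw [tot_comp])]
    · rw [tot_conv, cinf_zero_left, tot_zero, zero_comp, comp_zero]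
    · rw [GradedCooperad.trivialHom, tot_comp, Category.assoc, hα, comp_zero, tot_zero]
  rw [GradedCooperad.trivialHom, tot_comp, Category.assoc] at h1
  rw [← id_comp (tot C.η), ← C.tot_ε_η, Category.assoc, Category.assoc, h1, comp_zero]

end convolution

noncomputable section action
variable {C : GradedCooperad K} {P : GradedOperad K} {V V' V'' W W' : SMod K} {a b c : ℤ}

theorem tot_leftUnit_comp (β : DegMap V V' b) : tot (leftUnit V) ≫ tot β =
    tot (cinf (DegMap.id (unit K)) 0 β (zero_add b)) ≫ tot (leftUnit V') := by
  rw [← tot_comp _ _ (zero_add b), ← leftUnit_comp_cinf 0 β (zero_add b) (add_zero b), tot_comp]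

theorem tot_rightUnit_comp (β : DegMap V V' b) : tot (rightUnit V) ≫ tot β =
    tot (compMap β (DegMap.id (unit K))) ≫ tot (rightUnit V') := by
  rw [← tot_comp _ _ (zero_add b), ← rightUnit_comp_compMap β (add_zero b), tot_comp]

/-- A tree with lower vertex decorated by the unit has only one upper vertex. -/
theorem tot_cinf_leftUnit {θ : DegMap W (unit K) a} {g g' : DegMap W' V 0} {β : DegMap W' V b} (h : a + b = c) :
    tot (cinf θ g β h) ≫ tot (leftUnit V) = tot (cinf θ g' β h) ≫ tot (leftUnit V) := by
  have h1 (g : DegMap W' V 0) : tot (cinf θ g β h) ≫ tot (leftUnit V) = tot (cinf θ 0 β h) ≫ tot (leftUnit V) := by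
    have h2 := tot_leftUnit_comp (DegMap.id V)
    rw [tot_id, comp_id] at h2
    rw [h2, ← Category.assoc, tot_cinf_cinf_of (F := θ) (G := 0) (H := β) ?_ ?_ ?_ (add_zero a) (add_zero b) (zero_add 0) h h
      (Or.inr (Or.inl ?_)), zero_mul, Int.negOnePow_zero, Units.val_one, one_smul]
    · rw [← h2]
    all_goals simp only [tot_id, tot_zero, comp_id, comp_zero]
  rw [h1 g, h1 g']

theorem tot_compMap_leftUnit {θ : DegMap W (unit K) a} {g : DegMap W' V 0} {β : DegMap W' V 0} :
    tot (compMap θ β) ≫ tot (leftUnit V) = tot (cinf θ g β (add_zero a)) ≫ tot (leftUnit V) := by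
  have h2 := tot_leftUnit_comp (DegMap.id V)
  rw [tot_id, comp_id] at h2
  rw [tot_cinf_leftUnit (g' := 0), h2, ← Category.assoc, tot_compMap_cinf_of (F := θ) (G := 0) (H := β) ?_ ?_ ?_ (add_zero a)
    (zero_add 0) (add_zero a), zero_mul, Int.negOnePow_zero, Units.val_one, one_smul, ← h2]
  all_goals simp only [tot_id, tot_zero, comp_id, comp_zero]

theorem tot_cinf_leftUnit_comp {θ : DegMap W (unit K) a} {g : DegMap W' V 0} {β : DegMap W' V b} {b' c' : ℤ} {δ : DegMap V V' b'}
    {β' : DegMap W' V' c} (hβ : tot β ≫ tot δ = tot β') (hc : b + b' = c) (h : a + b = c') {e : ℤ} (he : a + c = e)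
    (hs : Even (b' * a)) :
    tot (cinf θ g β h) ≫ tot (leftUnit V) ≫ tot δ = tot (cinf θ 0 β' he) ≫ tot (leftUnit V') := by
  rw [tot_leftUnit_comp, ← Category.assoc, tot_cinf_cinf_of (F := θ) (G := 0) (H := β') ?_ ?_ hβ (add_zero a) hc (zero_add b') h he
      (Or.inr (Or.inl ?_)), Int.negOnePow_even _ hs, Units.val_one, one_smul]
  all_goals simp only [tot_id, tot_zero, comp_id, comp_zero]

/-- The action of a functional on the lower vertex of a two-vertex decomposition, `(φ ⊗ id) Δ`. -/
def leftAct (C : GradedCooperad K) (φ : DegMap C.S (unit K) a) : DegMap C.S C.S a :=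
  (leftUnit C.S).comp ((compMap φ (DegMap.id C.S)).comp C.Δ (zero_add a)) (add_zero a)

/-- The action of a functional on the upper vertex of a two-vertex decomposition, `(id ⊗ φ) Δ`. -/
def rightAct (C : GradedCooperad K) (φ : DegMap C.S (unit K) a) : DegMap C.S C.S a :=
  (rightUnit C.S).comp ((cinf (DegMap.id C.S) C.ε φ (zero_add a)).comp C.Δ (zero_add a)) (add_zero a)

theorem tot_leftAct (φ : DegMap C.S (unit K) a) : tot (leftAct C φ) = tot C.Δ ≫ tot (compMap φ (DegMap.id C.S)) ≫ tot (leftUnit C.S) := by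
  rw [leftAct, tot_comp, tot_comp, Category.assoc]

theorem tot_rightAct (φ : DegMap C.S (unit K) a) :
    tot (rightAct C φ) = tot C.Δ ≫ tot (cinf (DegMap.id C.S) C.ε φ (zero_add a)) ≫ tot (rightUnit C.S) := by
  rw [rightAct, tot_comp, tot_comp, Category.assoc]

theorem tot_leftAct_comp {φ : DegMap C.S (unit K) a} {β : DegMap C.S V b} (g : DegMap C.S V 0) (h : a + b = c) (hs : Even (b * a)) :
    tot (leftAct C φ) ≫ tot β = tot C.Δ ≫ tot (cinf φ g β h) ≫ tot (leftUnit V) := by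
  rw [tot_leftAct, tot_compMap_leftUnit (g := 0), Category.assoc, Category.assoc,
    tot_cinf_leftUnit_comp (β' := β) (by rw [tot_id, id_comp]) (zero_add b) (add_zero a) h hs, tot_cinf_leftUnit]

theorem tot_rightAct_comp {φ : DegMap C.S (unit K) a} {β : DegMap C.S V b} (h : b + a = c) :
    tot (rightAct C φ) ≫ tot β = tot C.Δ ≫ tot (cinf β C.ε φ h) ≫ tot (rightUnit V) := by
  rw [tot_rightAct, Category.assoc, Category.assoc, tot_rightUnit_comp, ← Category.assoc (tot (cinf _ _ _ _)),
    tot_cinf_compMap_of (F := β) ?_ ?_ ?_ (zero_add b) (zero_add a) h]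
  all_goals simp only [tot_id, id_comp, comp_id]

theorem tot_leftAct_counit (φ : DegMap C.S (unit K) a) : tot (leftAct C φ) ≫ tot C.ε = tot φ := by
  have h1 : tot (compMap φ C.ε) = tot (compMap (DegMap.id C.S) C.ε) ≫ tot (compMap φ (DegMap.id (unit K))) := by
    rw [tot_compMap_compMap _ _ _ _ (zero_add a), DegMap.comp_id, DegMap.id_comp]
  rw [tot_leftAct_comp 0 (add_zero a) (by simp), ← tot_compMap_leftUnit, leftUnit_eq_rightUnit, h1, Category.assoc, ← tot_rightUnit_comp,
    reassoc_of% C.tot_counit_right]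

theorem tot_rightAct_counit (φ : DegMap C.S (unit K) a) : tot (rightAct C φ) ≫ tot C.ε = tot φ := by
  have h1 : tot (cinf C.ε C.ε φ (zero_add a)) ≫ tot (leftUnit (unit K)) =
      tot (compMap C.ε (DegMap.id C.S)) ≫ tot (cinf (DegMap.id _) 0 φ (zero_add a)) ≫ tot (leftUnit (unit K)) := by
    rw [tot_cinf_leftUnit (g' := 0), ← Category.assoc, tot_compMap_cinf_of (F := C.ε) (G := 0) (H := φ) ?_ ?_ ?_ (add_zero 0)
      (zero_add a) (zero_add a), mul_zero, Int.negOnePow_zero, Units.val_one, one_smul]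
    all_goals simp only [tot_id, tot_zero, id_comp, comp_id, comp_zero]
  rw [tot_rightAct_comp (zero_add a), ← leftUnit_eq_rightUnit, h1, ← tot_leftUnit_comp, reassoc_of% C.tot_counit_left]

/-- The product with a functional on the left. -/
theorem conv_functional_left {θ : DegMap C.S (unit K) a} {θ' : DegMap C.S P.S a} (hθ : tot θ ≫ tot P.η = tot θ')
    {β : DegMap C.S P.S b} (h : a + b = c) (hs : Even (b * a)) : tot (conv θ' β h) = tot (leftAct C θ) ≫ tot β := by
  have h1 : tot (cinf θ (trivialMap C P) β h) ≫ tot (compMap P.η (DegMap.id P.S)) = tot (cinf θ' (trivialMap C P) β h) :=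
    tot_cinf_compMap_of hθ (by rw [tot_id, comp_id]) (by rw [tot_id, comp_id]) (add_zero _) h h
  rw [tot_leftAct_comp (trivialMap C P) h hs, tot_conv, ← h1, Category.assoc, P.tot_unit_left]

/-- The product with a functional on the right. -/
theorem conv_functional_right {θ : DegMap C.S (unit K) a} {θ' : DegMap C.S P.S a} (hθ : tot θ ≫ tot P.η = tot θ')
    {β : DegMap C.S P.S b} (h : b + a = c) : tot (conv β θ' h) = tot (rightAct C θ) ≫ tot β := by
  have h1 : tot (cinf β C.ε θ h) ≫ tot (compMap (DegMap.id P.S) P.η) = tot (cinf β (trivialMap C P) θ' h) :=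
    tot_cinf_compMap_of (by rw [tot_id, comp_id]) (by rw [tot_trivialMap]) hθ (add_zero _) h h
  rw [tot_rightAct_comp h, tot_conv, ← h1, Category.assoc, P.tot_unit_right]

/-- The operator `(θ ⊗ id - id ⊗ θ) Δ₂` attached to a curvature. -/
def curvatureOp (C : GradedCooperad K) (θ : DegMap C.S (unit K) (-2)) : DegMap C.S C.S (-2) :=
  (leftUnit C.S).comp ((compMap θ (DegMap.id C.S)).comp C.Δ₂ (zero_add _)) (add_zero _) -
    (rightUnit C.S).comp ((cinf (DegMap.id C.S) C.ε θ (zero_add _)).comp C.Δ₂ (zero_add _)) (add_zero _)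

theorem tot_curvatureOp {θ : DegMap C.S (unit K) (-2)} (hθ : tot C.η ≫ tot θ = 0) :
    tot (curvatureOp C θ) = tot (leftAct C θ - rightAct C θ) := by
  have h1 : tot C.Δ₂ ≫ tot (compMap θ (DegMap.id C.S)) ≫ tot (leftUnit C.S) = tot (leftAct C θ) ≫ tot C.proj := by
    rw [tot_leftAct_comp 0 (add_zero _) (by simp), tot_compMap_leftUnit (g := 0), ← Category.assoc,
      tot_Δ₂_cinf (add_zero _) (C.tot_proj_comp hθ) (β' := C.proj) (g' := 0) ?_ (Or.inr ?_) ?_, Category.assoc]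
    all_goals simp only [tot_id, tot_zero, comp_id, comp_zero]
  have h2 : tot C.Δ₂ ≫ tot (cinf (DegMap.id C.S) C.ε θ (zero_add _)) ≫ tot (rightUnit C.S) = tot (rightAct C θ) ≫ tot C.proj := by
    rw [tot_rightAct_comp (zero_add _), ← Category.assoc,
      tot_Δ₂_cinf (zero_add _) (α' := C.proj) ?_ (C.tot_proj_comp hθ) (Or.inl hθ) (g' := C.ε) ?_, Category.assoc]
    · rw [tot_id, comp_id]
    · rw [C.tot_ε_η, comp_id]
  rw [curvatureOp, tot_sub, tot_comp, tot_comp, tot_comp, tot_comp, Category.assoc, Category.assoc, h1, h2, C.tot_proj, tot_sub,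
    comp_sub, comp_sub, ← Category.assoc, ← Category.assoc (tot (rightAct C θ)), tot_leftAct_counit, tot_rightAct_counit,
    comp_id, comp_id]
  abel

theorem degMap_unit_eq_zero {V : SMod K} {a : ℤ} (f : DegMap V (unit K) a) (g : DegMap (unit K) V 0) (ha : a ≠ 0) :
    tot g ≫ tot f = 0 := by
  rw [tot_comp_of (F := f.comp g (zero_add a)) rfl, ← tot_zero]
  refine congrArg tot (DegMap.ext fun X _ d d' h x => ?_)
  by_cases hd : d = 0
  · exact unit_eq_zero ⟨fun e => by have := e.2; omega⟩ _
  · rw [unit_eq_zero ⟨fun e => by have := e.2; omega⟩ x, map_zero, map_zero]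

end action

noncomputable section associativity
variable {C : GradedCooperad K} {P : GradedOperad K} {a b c : ℤ}

/-- The convolution product `γ (f ∘ g) Δ`. -/
def fullConv (f : DegMap C.S P.S a) (g : DegMap C.S P.S 0) : DegMap C.S P.S a :=
  P.γ.comp ((compMap f g).comp C.Δ (zero_add a)) (add_zero a)

/-- The infinitesimal convolution product at `g`: the lower vertex is mapped by `f`, one upper vertex by `h` and the
others by `g`. -/
def baseConv (f : DegMap C.S P.S a) (g : DegMap C.S P.S 0) (h : DegMap C.S P.S b) (hc : a + b = c) : DegMap C.S P.S c :=
  P.γ.comp ((cinf f g h hc).comp C.Δ (zero_add c)) (add_zero c)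

theorem tot_fullConv (f : DegMap C.S P.S a) (g : DegMap C.S P.S 0) :
    tot (fullConv f g) = tot C.Δ ≫ tot (compMap f g) ≫ tot P.γ := by
  rw [fullConv, tot_comp, tot_comp, Category.assoc]

theorem tot_baseConv (f : DegMap C.S P.S a) (g : DegMap C.S P.S 0) (h : DegMap C.S P.S b) (hc : a + b = c) :
    tot (baseConv f g h hc) = tot C.Δ ≫ tot (cinf f g h hc) ≫ tot P.γ := by
  rw [baseConv, tot_comp, tot_comp, Category.assoc]

/-- The infinitesimal form of the associativity of the convolution product. -/
theorem baseConv_assoc (f : DegMap C.S P.S a) (g h : DegMap C.S P.S 0) (h' : DegMap C.S P.S b) (hc : a + b = c) :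
    baseConv (fullConv f g) h h' hc = baseConv f (fullConv g h) (baseConv g h h' (zero_add b)) hc := by
  have hr {b : ℤ} (β : DegMap C.S P.S b) : tot β ≫ tot (DegMap.id P.S) = tot β := by rw [tot_id, comp_id]
  have hl {b : ℤ} (β : DegMap C.S P.S b) : tot (DegMap.id C.S) ≫ tot β = tot β := by rw [tot_id, id_comp]
  have e₁ : tot (cinf (fullConv f g) h h' hc) =
      tot (compMap C.Δ (DegMap.id C.S)) ≫ tot (cinf (compMap f g) h h' hc) ≫ tot (compMap P.γ (DegMap.id P.S)) := by
    rw [tot_cinf_compMap_of (F := P.γ.comp (compMap f g) (add_zero a)) (tot_comp _ _ _).symm (hr _) (hr _) (add_zero a) hc hc,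
      tot_compMap_cinf_of (F := fullConv f g) ?_ (hl _) (hl _) (zero_add a) hc hc, mul_zero, Int.negOnePow_zero,
      Units.val_one, one_smul]
    rw [tot_fullConv, tot_comp]
  have e₂ : tot (cinf f (fullConv g h) (baseConv g h h' (zero_add b)) hc) =
      tot (compMap (DegMap.id C.S) C.Δ) ≫ tot (cinf f (compMap g h) (cinf g h h' (zero_add b)) hc) ≫
        tot (compMap (DegMap.id P.S) P.γ) := by
    rw [tot_cinf_compMap_of (hr f) (tot_comp _ _ (add_zero 0)).symm (tot_comp _ _ (add_zero b)).symm (add_zero a) hc hc,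
      tot_compMap_cinf_of (hl _) (G := fullConv g h) (H := baseConv g h h' (zero_add b)) ?_ ?_ (zero_add a) hc hc, mul_zero,
      Int.negOnePow_zero, Units.val_one, one_smul]
    · rw [tot_fullConv, tot_comp]
    · rw [tot_baseConv, tot_comp]
  have e₃ : tot (cinf (compMap f g) h h' hc) ≫ tot (assoc _ _ _) =
      tot (assoc _ _ _) ≫ tot (cinf f (compMap g h) (cinf g h h' (zero_add b)) hc) := by
    rw [← tot_comp _ _ (add_zero c), assoc_comp_cinf_top _ _ _ _ _ _ (zero_add c) (zero_add b), tot_comp]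
  have hc' := C.tot_Δ_coassoc
  refine tot_injective ?_
  rw [tot_baseConv, tot_baseConv, e₁, e₂, Category.assoc, Category.assoc, tot_γ_assoc, reassoc_of% e₃, reassoc_of% hc',
    Category.assoc, Category.assoc]

theorem fullConv_trivialMap (f : DegMap C.S P.S a) : fullConv f (trivialMap C P) = f := by
  have h1 : tot (compMap f (trivialMap C P)) =
      tot (compMap (DegMap.id _) C.ε) ≫ tot (compMap f (DegMap.id _)) ≫ tot (compMap (DegMap.id _) P.η) := by
    rw [tot_compMap_compMap _ _ _ _ (add_zero a), tot_compMap_compMap _ _ _ _ (zero_add a), DegMap.id_comp, DegMap.comp_id,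
      DegMap.comp_id, trivialMap]
  refine tot_injective ?_
  rw [tot_fullConv, h1, Category.assoc, Category.assoc, P.tot_unit_right, ← tot_rightUnit_comp, reassoc_of% C.tot_counit_right]

theorem conv_trivialMap_left (β : DegMap C.S P.S b) : conv (trivialMap C P) β (zero_add b) = β := by
  refine tot_injective ?_
  have h1 := tot_leftAct C.ε
  rw [C.tot_counit_left] at h1
  rw [conv_functional_left (tot_trivialMap (C := C) (P := P)).symm (zero_add b) (by simp), h1, id_comp]

section ext
variable {m n : ℤ} (X : OperadExt P m n)

theorem OperadExt.tot_unit : tot X.Q.η = tot P.η ≫ tot X.x.i₀ := by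
  refine X.x.hom_ext ?_ ?_
  · rw [X.tot_unit₀, Category.assoc, X.x.i₀_p₀, comp_id]
  · rw [X.tot_unit₁, Category.assoc, X.x.i₀_p₁, comp_zero]

/-- The second component of an infinitesimal convolution product in a square-zero extension. -/
theorem OperadExt.baseConv_p₁ {f : DegMap C.S X.Q.S a} {g : DegMap C.S X.Q.S 0} {h : DegMap C.S X.Q.S b} (hc : a + b = c)
    {f₀ : DegMap C.S P.S a} {g₀ : DegMap C.S P.S 0} {h₀ : DegMap C.S P.S b} {a' b' c' : ℤ} {f₁ : DegMap C.S P.S a'}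
    {h₁ : DegMap C.S P.S b'} (ha' : a + n = a') (hb' : b + n = b') (h₃ : a' + b = c') (h₄ : a + b' = c')
    (hf₀ : tot f ≫ tot X.x.p₀ = tot f₀) (hg₀ : tot g ≫ tot X.x.p₀ = tot g₀) (hh₀ : tot h ≫ tot X.x.p₀ = tot h₀)
    (hf₁ : tot f ≫ tot X.x.p₁ = tot f₁) (hh₁ : tot h ≫ tot X.x.p₁ = tot h₁)
    (H : tot g ≫ tot X.x.p₁ = 0 ∨ Odd n ∧ n = b ∧ tot g ≫ tot X.x.p₁ = tot h₀) :
    tot (baseConv f g h hc) ≫ tot X.x.p₁ =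
      tot (baseConv f₁ g₀ h₀ h₃) + ((n * a).negOnePow : ℤ) • tot (baseConv f₀ g₀ h₁ h₄) := by
  rw [tot_baseConv, tot_baseConv, tot_baseConv, Category.assoc, Category.assoc, X.tot_mul₁, ← Category.assoc (tot (cinf _ _ _ _)),
    comp_add, tot_cinf_compMap_of hf₁ hg₀ hh₀ ha' hc h₃, tot_cinf_cinf_of hf₀ hg₀ hh₁ (add_zero a) hb' (zero_add n) hc h₄
    (H.imp_right fun H => Or.inr (by rwa [← hh₀] at H)), add_comp, comp_add, zsmul_comp,
    comp_zsmul]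

theorem OperadExt.baseConv_p₀ {f : DegMap C.S X.Q.S a} {g : DegMap C.S X.Q.S 0} {h : DegMap C.S X.Q.S b} (hc : a + b = c)
    {f₀ : DegMap C.S P.S a} {g₀ : DegMap C.S P.S 0} {h₀ : DegMap C.S P.S b}
    (hf₀ : tot f ≫ tot X.x.p₀ = tot f₀) (hg₀ : tot g ≫ tot X.x.p₀ = tot g₀) (hh₀ : tot h ≫ tot X.x.p₀ = tot h₀) :
    tot (baseConv f g h hc) ≫ tot X.x.p₀ = tot (baseConv f₀ g₀ h₀ hc) := by
  rw [tot_baseConv, tot_baseConv, Category.assoc, Category.assoc, X.tot_mul₀, ← Category.assoc (tot (cinf _ _ _ _)),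
    tot_cinf_compMap_of hf₀ hg₀ hh₀ (add_zero a) hc hc]

end ext

/-- The infinitesimal product is in general only a pre-Lie product. For maps of odd degree its associator on the diagonal
vanishes, because the two ways of inserting `α` into two different vertices above `α` cancel. The proof reads this off
from the associativity of the full convolution product with values in the square-zero extension by a class of degree one:
there the sum of the trivial map and of `α` times this class is a map of degree zero. -/
theorem conv_assoc (α : DegMap C.S P.S (-1)) : conv (conv α α (c := -2) (by norm_num)) α (c := -3) (by norm_num) =
    conv α (conv α α (c := -2) (by norm_num)) (c := -3) (by norm_num) := by
  let X := operadExt P 1 (-1) (by norm_num)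
  let e := trivialMap C P
  -- The map `1 + α ε`, where `ε` is a class of degree one and square zero.
  let ψ := X.x.pair e α
  let A : DegMap C.S X.Q.S (-1) := X.x.i₀.comp α (add_zero _)
  let e' := trivialMap C X.Q
  have he : tot e' = tot e ≫ tot X.x.i₀ := by
    rw [tot_trivialMap, tot_trivialMap, X.tot_unit, Category.assoc]
  have e₀ : tot e' ≫ tot X.x.p₀ = tot e := by rw [he, Category.assoc, X.x.i₀_p₀, comp_id]
  have e₁ : tot e' ≫ tot X.x.p₁ = 0 := by rw [he, Category.assoc, X.x.i₀_p₁, comp_zero]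
  have A₀ : tot A ≫ tot X.x.p₀ = tot α := by rw [tot_comp, Category.assoc, X.x.i₀_p₀, comp_id]
  have A₁ : tot A ≫ tot X.x.p₁ = tot (0 : DegMap C.S P.S (-2)) := by
    rw [tot_comp, Category.assoc, X.x.i₀_p₁, comp_zero, tot_zero]
  have ψ₀ : tot ψ ≫ tot X.x.p₀ = tot e := X.x.tot_pair_p₀ _ _
  have ψ₁ : tot ψ ≫ tot X.x.p₁ = tot α := X.x.tot_pair_p₁ _ _
  have Φ₀ : tot (fullConv A ψ) ≫ tot X.x.p₀ = tot α := by
    rw [tot_fullConv, Category.assoc, Category.assoc, X.tot_mul₀, ← Category.assoc (tot (compMap _ _)),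
      tot_compMap_compMap _ _ _ _ (add_zero _)]
    conv_rhs => rw [← fullConv_trivialMap α, tot_fullConv]
    rw [tot_injective ((tot_comp A X.x.p₀ (add_zero (-1))).trans A₀), tot_injective ((tot_comp ψ X.x.p₀ (add_zero 0)).trans ψ₀)]
  -- The sign comes from moving `α` of odd degree past the projection of odd degree.
  have Φ₁ : tot (fullConv A ψ) ≫ tot X.x.p₁ = tot (-conv α α (c := -2) (by norm_num)) := by
    rw [tot_fullConv, Category.assoc, Category.assoc, X.tot_mul₁, ← Category.assoc (tot (compMap _ _)), comp_add,
      tot_compMap_compMap _ _ _ _ (by norm_num : -1 + -1 = (-2 : ℤ)),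
      tot_injective ((tot_comp A X.x.p₁ (by norm_num : -1 + -1 = (-2 : ℤ))).trans A₁), compMap_zero_left, tot_zero, zero_add,
      tot_compMap_cinf_of A₀ ψ₀ ψ₁ (add_zero _) (zero_add _) (by norm_num : -1 + -1 = (-2 : ℤ)), Int.negOnePow_odd _ (by decide),
      zsmul_comp, comp_zsmul, tot_neg, tot_conv, Units.val_neg, Units.val_one, neg_smul, one_smul]
  have Ψ₀ : tot (baseConv ψ e' A (zero_add _)) ≫ tot X.x.p₀ = tot α := by
    rw [X.baseConv_p₀ (zero_add _) ψ₀ e₀ A₀]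
    exact congrArg tot (conv_trivialMap_left α)
  have Ψ₁ : tot (baseConv ψ e' A (zero_add _)) ≫ tot X.x.p₁ = tot (conv α α (c := -2) (by norm_num)) := by
    rw [X.baseConv_p₁ (zero_add _) (zero_add _) (by norm_num) (by norm_num) (zero_add _) ψ₀ e₀ A₀ ψ₁ A₁ (Or.inl e₁), mul_zero, Int.negOnePow_zero,
      Units.val_one, one_smul]
    have h0 : tot (baseConv e e (0 : DegMap C.S P.S (-2)) (zero_add _)) = 0 := by
      rw [tot_baseConv, cinf_zero_right, tot_zero, zero_comp, comp_zero]
    rw [h0, add_zero]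
    rfl
  -- The left side of this component of associativity is `-(α ⋆ α) ⋆ α` and the right side is
  -- `-α ⋆ (α ⋆ α)`, where the terms with two marked upper vertices cancel in pairs.
  have key := congrArg (fun f => tot f ≫ tot X.x.p₁) (baseConv_assoc A ψ e' A (c := -2) (by norm_num))
  beta_reduce at key
  have hl : tot (baseConv α e (0 : DegMap C.S P.S (-2)) (c := -3) (by norm_num)) = 0 := by
    rw [tot_baseConv, cinf_zero_right, tot_zero, zero_comp, comp_zero]
  have hr : tot (baseConv (0 : DegMap C.S P.S (-2)) e α (c := -3) (by norm_num)) = 0 := by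
    rw [tot_baseConv, cinf_zero_left, tot_zero, zero_comp, comp_zero]
  have hn : baseConv (-conv α α (c := -2) (by norm_num)) e α (c := -3) (by norm_num) =
      -conv (conv α α (c := -2) (by norm_num)) α (c := -3) (by norm_num) := by
    refine tot_injective ?_
    rw [tot_neg, tot_baseConv, tot_conv, cinf_neg_left, tot_neg, neg_comp, comp_neg]
  rw [fullConv_trivialMap, X.baseConv_p₁ _ (by norm_num) (by norm_num) (c' := -3) (by norm_num) (by norm_num) Φ₀ e₀ A₀ Φ₁ A₁ (Or.inl e₁),
    X.baseConv_p₁ _ (by norm_num) (by norm_num) (c' := -3) (by norm_num) (by norm_num) A₀ ψ₀ Ψ₀ A₁ Ψ₁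
      (Or.inr ⟨by decide, rfl, ψ₁⟩), hl, hr, smul_zero, add_zero, zero_add, hn, Int.negOnePow_odd _ (by decide),
    Units.val_neg, Units.val_one, neg_smul, one_smul, tot_neg, neg_inj] at key
  exact tot_injective key

end associativity

noncomputable section curvature
variable {C : GradedCooperad K} {a b c : ℤ}

/-- A coderivation is compatible with the counit. -/
theorem isCoderivation_of_comul {d : DegMap C.S C.S a} (h : C.Δ.comp d (add_zero a) =
    (compMap d (DegMap.id C.S) + cinf (DegMap.id C.S) (DegMap.id C.S) d (zero_add a)).comp C.Δ (zero_add a)) :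
    IsCoderivation (DegMap.id C.S) d where
  counit := by
    have h1 := congrArg tot h
    rw [tot_comp, tot_comp, tot_add, comp_add] at h1
    have h2 : tot d = tot (leftAct C (C.ε.comp d (add_zero a))) + tot d := by
      have e₁ : tot (compMap d (DegMap.id C.S)) ≫ tot (compMap C.ε (DegMap.id C.S)) =
          tot (compMap (C.ε.comp d (add_zero a)) (DegMap.id C.S)) := by
        rw [tot_compMap_compMap _ _ _ _ (add_zero a), DegMap.comp_id]
      have e₂ : tot (cinf (DegMap.id C.S) (DegMap.id C.S) d (zero_add a)) ≫ tot (compMap C.ε (DegMap.id C.S)) ≫ tot (leftUnit C.S) =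
          tot (compMap C.ε (DegMap.id C.S)) ≫ tot (leftUnit C.S) ≫ tot d := by
        rw [tot_leftUnit_comp, ← Category.assoc, tot_cinf_compMap, ← Category.assoc, tot_compMap_cinf_of (F := C.ε) (G := 0) (H := d)
          ?_ ?_ ?_ (add_zero 0) (zero_add a) (zero_add a), mul_zero, Int.negOnePow_zero, Units.val_one, one_smul,
          tot_cinf_leftUnit (g' := 0), DegMap.comp_id, DegMap.id_comp]
        all_goals simp only [tot_id, tot_zero, id_comp, comp_id, comp_zero]
      have hc := C.tot_counit_left
      calc tot d = tot d ≫ tot C.Δ ≫ tot (compMap C.ε (DegMap.id C.S)) ≫ tot (leftUnit C.S) := by rw [hc, comp_id]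
        _ = _ := by
          rw [reassoc_of% h1, add_comp, Category.assoc, Category.assoc, reassoc_of% e₁, e₂, reassoc_of% hc, tot_leftAct]
    have h3 : tot (leftAct C (C.ε.comp d (add_zero a))) = 0 := by
      rwa [right_eq_add] at h2
    refine tot_injective ?_
    rw [← tot_leftAct_counit, h3, zero_comp, tot_zero]
  comul := h

theorem IsCoderivation.sq {d : DegMap C.S C.S a} (hd : IsCoderivation (DegMap.id C.S) d) (ha : Odd a) (hb : a + a = b) :
    IsCoderivation (DegMap.id C.S) (d.comp d hb) where
  counit := tot_injective (by
    rw [tot_comp, tot_comp, Category.assoc, hd.tot_counit, tot_zero, comp_zero])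
  comul := tot_injective (by
    rw [tot_comp, tot_comp, tot_comp, tot_add, ← tot_der_sq ha (tot_comp _ _ _).symm hb, Category.assoc, hd.tot_comul, reassoc_of% hd.tot_comul])

theorem comul_leftAct (θ : DegMap C.S (unit K) a) :
    tot (leftAct C θ) ≫ tot C.Δ = tot C.Δ ≫ tot (compMap (leftAct C θ) (DegMap.id C.S)) := by
  have hc := C.tot_Δ_coassoc
  have e₁ : tot (compMap θ C.Δ) =
      tot (compMap (DegMap.id C.S) C.Δ) ≫ tot (compMap θ (compMap (DegMap.id C.S) (DegMap.id C.S))) := by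
    rw [tot_compMap_compMap _ _ _ _ (zero_add a), DegMap.comp_id, compMap_id, DegMap.id_comp]
  have e₂ := congrArg tot (leftUnit_comp_assoc C.S C.S)
  rw [tot_comp] at e₂
  have e₃ : tot (compMap (leftAct C θ) (DegMap.id C.S)) = tot (compMap C.Δ (DegMap.id C.S)) ≫
      tot (compMap (compMap θ (DegMap.id C.S)) (DegMap.id C.S)) ≫ tot (compMap (leftUnit C.S) (DegMap.id C.S)) := by
    rw [tot_compMap_compMap _ _ _ _ (add_zero a), tot_compMap_compMap _ _ _ _ (zero_add a), DegMap.comp_id, DegMap.comp_id]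
    refine congrArg (fun f => tot (compMap f (DegMap.id C.S))) (tot_injective ?_)
    rw [tot_leftAct, tot_comp, tot_comp]
  rw [tot_leftAct_comp 0 (add_zero a) (by simp), ← tot_compMap_leftUnit, e₁, Category.assoc, ← reassoc_of% hc,
    ← reassoc_of% (tot_compMap_assoc θ (DegMap.id C.S) (DegMap.id C.S)), e₂, e₃]

theorem comul_rightAct (θ : DegMap C.S (unit K) a) :
    tot (rightAct C θ) ≫ tot C.Δ = tot C.Δ ≫ tot (cinf (DegMap.id C.S) (DegMap.id C.S) (rightAct C θ) (zero_add a)) := by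
  have hc := C.tot_Δ_coassoc
  have e₁ : tot (cinf C.Δ C.ε θ (zero_add a)) = tot (compMap C.Δ (DegMap.id C.S)) ≫
      tot (cinf (compMap (DegMap.id C.S) (DegMap.id C.S)) C.ε θ (zero_add a)) := by
    rw [tot_compMap_cinf, compMap_id, DegMap.id_comp, DegMap.comp_id, DegMap.comp_id]
  have e₂ := congrArg tot (rightUnit_comp C.S C.S)
  rw [tot_comp] at e₂
  have e₃ : tot (cinf (DegMap.id C.S) (DegMap.id C.S) (rightAct C θ) (zero_add a)) = tot (compMap (DegMap.id C.S) C.Δ) ≫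
      tot (cinf (DegMap.id C.S) (compMap (DegMap.id C.S) C.ε) (cinf (DegMap.id C.S) C.ε θ (zero_add a)) (zero_add a)) ≫
      tot (compMap (DegMap.id C.S) (rightUnit C.S)) := by
    rw [tot_cinf_compMap, tot_compMap_cinf, DegMap.id_comp, DegMap.id_comp]
    refine congrArg₂ (fun f g => tot (cinf (DegMap.id C.S) f g (zero_add a))) (tot_injective ?_) (tot_injective ?_)
    · rw [tot_comp, tot_comp, C.tot_counit_right, tot_id]
    · rw [tot_rightAct, tot_comp, tot_comp]
  rw [tot_rightAct_comp (zero_add a), ← e₂, e₁, Category.assoc,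
    reassoc_of% (tot_cinf_top_assoc (DegMap.id C.S) (DegMap.id C.S) C.ε θ), reassoc_of% hc, e₃]

/-- Acting on the upper vertex of the lower part is the same as acting on the lower vertices of the upper parts;
this is coassociativity. -/
theorem comul_rightAct_leftAct (θ : DegMap C.S (unit K) a) :
    tot C.Δ ≫ tot (compMap (rightAct C θ) (DegMap.id C.S)) =
      tot C.Δ ≫ tot (cinf (DegMap.id C.S) (DegMap.id C.S) (leftAct C θ) (zero_add a)) := by
  have hc := C.tot_Δ_coassoc
  have e₁ : tot (compMap (rightAct C θ) (DegMap.id C.S)) = tot (compMap C.Δ (DegMap.id C.S)) ≫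
      tot (compMap (cinf (DegMap.id C.S) C.ε θ (zero_add a)) (DegMap.id C.S)) ≫ tot (compMap (rightUnit C.S) (DegMap.id C.S)) := by
    rw [tot_compMap_compMap _ _ _ _ (add_zero a), tot_compMap_compMap _ _ _ _ (zero_add a), DegMap.comp_id, DegMap.comp_id]
    refine congrArg (fun f => tot (compMap f (DegMap.id C.S))) (tot_injective ?_)
    rw [tot_rightAct, tot_comp, tot_comp]
  have e₂ := congrArg tot (triangle C.S C.S)
  rw [tot_comp] at e₂
  have e₃ : tot (cinf (DegMap.id C.S) (DegMap.id C.S) (leftAct C θ) (zero_add a)) = tot (compMap (DegMap.id C.S) C.Δ) ≫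
      tot (cinf (DegMap.id C.S) (compMap C.ε (DegMap.id C.S)) (compMap θ (DegMap.id C.S)) (zero_add a)) ≫
      tot (compMap (DegMap.id C.S) (leftUnit C.S)) := by
    rw [tot_cinf_compMap, tot_compMap_cinf, DegMap.id_comp, DegMap.id_comp]
    refine congrArg₂ (fun f g => tot (cinf (DegMap.id C.S) f g (zero_add a))) (tot_injective ?_) (tot_injective ?_)
    · rw [tot_comp, tot_comp, C.tot_counit_left, tot_id]
    · rw [tot_leftAct, tot_comp, tot_comp]
  rw [e₁, ← e₂, reassoc_of% (tot_cinf_mid_assoc (DegMap.id C.S) C.ε θ (DegMap.id C.S)), reassoc_of% hc, e₃]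

/-- The difference of the two actions of a functional is a coderivation: in the coproduct of an element, the action on the
upper vertex of the lower part cancels against the action on the lower vertices of the upper part. -/
theorem isCoderivation_act (θ : DegMap C.S (unit K) a) : IsCoderivation (DegMap.id C.S) (leftAct C θ - rightAct C θ) where
  counit := tot_injective (by
    rw [tot_comp, tot_sub, sub_comp, tot_leftAct_counit, tot_rightAct_counit, sub_self, tot_zero])
  comul := tot_injective (by
    rw [tot_comp, tot_comp, tot_sub, cinf_sub_right, compMap_sub_left, tot_add, tot_sub, tot_sub, sub_comp,
      comp_add, comp_sub, comp_sub, comul_leftAct, comul_rightAct, comul_rightAct_leftAct]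
    abel)

end curvature
end OperadicBar

namespace OperadicBar
open Limits Preadditive
open CategoryTheory.Category (id_comp comp_id)
variable {K : Type u} [Field K]

/-! ### Twisting morphisms and the cobar construction -/

noncomputable section twisting
variable {C : GradedCooperad K} {P : GradedOperad K} {a b c : ℤ}

theorem conv_sub_left (α α' : DegMap C.S P.S a) (β : DegMap C.S P.S b) (h : a + b = c) :
    conv (α - α') β h = conv α β h - conv α' β h := tot_injective (by
  rw [tot_sub, tot_conv, tot_conv, tot_conv, cinf_sub_left, tot_sub, sub_comp, comp_sub])

theorem conv_sub_right (α : DegMap C.S P.S a) (β β' : DegMap C.S P.S b) (h : a + b = c) :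
    conv α (β - β') h = conv α β h - conv α β' h := tot_injective (by
  rw [tot_sub, tot_conv, tot_conv, tot_conv, cinf_sub_right, tot_sub, sub_comp, comp_sub])

theorem CurvedCooperad.isCoderivation (C : CurvedCooperad K) : IsCoderivation (DegMap.id C.S) C.d :=
  isCoderivation_of_comul C.d_Δ

theorem CurvedCooperad.tot_η_θ (C : CurvedCooperad K) : tot C.η ≫ tot C.θ = 0 := degMap_unit_eq_zero _ _ (by norm_num)

theorem CurvedCooperad.tot_d_sq (C : CurvedCooperad K) : tot C.d ≫ tot C.d = tot (leftAct C.toGradedCooperad C.θ) - tot (rightAct C.toGradedCooperad C.θ) := by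
  have h1 : tot C.d ≫ tot C.d = tot (curvatureOp C.toGradedCooperad C.θ) := (tot_comp _ _ _).symm.trans (congrArg tot C.d_sq)
  rw [h1, tot_curvatureOp C.tot_η_θ, tot_sub]

theorem DGOperad.isDerivation (P : DGOperad K) : IsDerivation (DegMap.id P.S) P.d where
  unit := P.d_η
  mul := P.d_γ

/-- The value `θ 1 - α d - α ⋆ α` that a differential takes on a twisting morphism `α`. -/
def twistTerm (C : CurvedCooperad K) (P : GradedOperad K) (α : DegMap C.S P.S (-1)) : DegMap C.S P.S (-2) :=
  P.η.comp C.θ (add_zero _) - α.comp C.d (by norm_num) - conv (C := C.toGradedCooperad) α α (by norm_num)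

theorem tot_twistTerm (C : CurvedCooperad K) (P : GradedOperad K) (α : DegMap C.S P.S (-1)) :
    tot (twistTerm C P α) = tot C.θ ≫ tot P.η - tot C.d ≫ tot α - tot (conv (C := C.toGradedCooperad) α α (c := -2) (by norm_num)) := by
  rw [twistTerm, tot_sub, tot_sub, tot_comp, tot_comp]

theorem twistTerm_coaug (C : CurvedCooperad K) {α : DegMap C.S P.S (-1)} (hα : tot C.η ≫ tot α = 0) :
    tot C.η ≫ tot (twistTerm C P α) = 0 := by
  have h1 := congrArg tot C.d_η
  rw [tot_comp] at h1
  rw [tot_twistTerm, comp_sub, comp_sub, reassoc_of% C.tot_η_θ, reassoc_of% h1,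
    conv_coaug hα, tot_zero, zero_comp, zero_comp, sub_zero, sub_zero]

/-- The twisting morphism equation is preserved by its differential: this is why the differential of the cobar
construction squares to zero. -/
theorem derivation_sq_eq_zero (C : CurvedCooperad K) {E : DegMap P.S P.S (-1)} (hE : IsDerivation (DegMap.id P.S) E)
    {α : DegMap C.S P.S (-1)} (h : tot α ≫ tot E = tot (twistTerm C P α)) :
    tot α ≫ tot E ≫ tot E = 0 := by
  have h2 := congrArg tot C.θ_d
  rw [tot_comp, tot_zero] at h2
  let αd : DegMap C.S P.S (-2) := α.comp C.d (by norm_num)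
  let ηθ : DegMap C.S P.S (-2) := P.η.comp C.θ (add_zero _)
  let αα : DegMap C.S P.S (-2) := conv (C := C.toGradedCooperad) α α (by norm_num)
  have e₁ := derivation_conv (C := C.toGradedCooperad) hE (h := by norm_num) h h (by norm_num) (by norm_num) (c := -2) (c' := -3) (by norm_num) (by norm_num)
  have e₂ := conv_coderivation C.isCoderivation (h := by norm_num) (tot_comp C.d α (c := -2) (by norm_num)).symm (tot_comp C.d α (c := -2) (by norm_num)).symm
    (by norm_num) (by norm_num) (c := -2) (c' := -3) (by norm_num) (by norm_num)
  have e₃ := conv_functional_left (tot_comp C.θ P.η (add_zero _)).symm (β := α) (c := -3) (by norm_num) (by decide)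
  have e₄ := conv_functional_right (tot_comp C.θ P.η (add_zero _)).symm (β := α) (c := -3) (by norm_num)
  rw [Int.negOnePow_odd _ (by decide), Units.val_neg, Units.val_one, neg_smul, one_smul] at e₁ e₂
  rw [← Category.assoc, h, tot_twistTerm, sub_comp, sub_comp, Category.assoc, hE.tot_unit, comp_zero,
    Category.assoc, h, e₁, tot_twistTerm, comp_sub, comp_sub, reassoc_of% h2, zero_comp, e₂,
    ← Category.assoc (tot C.d) (tot C.d), C.tot_d_sq, sub_comp, ← e₃, ← e₄, twistTerm]
  simp only [conv_sub_left, conv_sub_right, tot_sub, conv_assoc]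
  abel

end twisting

noncomputable section derivations
variable {O P Q : GradedOperad K} {a b : ℤ}

theorem IsDerivation.sq {d : DegMap P.S P.S a} (hd : IsDerivation (DegMap.id P.S) d) (ha : Odd a) (hb : a + a = b) :
    IsDerivation (DegMap.id P.S) (d.comp d hb) where
  unit := tot_injective (by
    rw [tot_comp, tot_comp, reassoc_of% hd.tot_unit, tot_zero, zero_comp])
  mul := tot_injective (by
    rw [tot_comp, tot_comp, tot_comp, tot_add, ← tot_der_sq ha (tot_comp _ _ _).symm hb, Category.assoc, reassoc_of% hd.tot_mul, hd.tot_mul])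

theorem isDerivation_zero (F : DegMap O.S P.S 0) : IsDerivation F (0 : DegMap O.S P.S a) where
  unit := tot_injective (by rw [tot_comp, tot_zero, tot_zero, comp_zero])
  mul := tot_injective (by
    rw [tot_comp, tot_comp, compMap_zero_left, cinf_zero_right, add_zero, tot_zero, tot_zero, zero_comp, comp_zero])

/-- Derivations compose with morphisms on the left. -/
theorem IsDerivation.hom_comp {E : DegMap P.S P.S a} (hE : IsDerivation (DegMap.id P.S) E) (F : GradedOperad.Hom P Q) :
    IsDerivation F.f (F.f.comp E (add_zero a)) where
  unit := tot_injective (by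
    rw [tot_comp, tot_comp, reassoc_of% hE.tot_unit, tot_zero, zero_comp])
  mul := tot_injective (by
    rw [tot_comp, tot_comp, tot_comp, tot_add, reassoc_of% hE.tot_mul, F.tot_γ, ← Category.assoc, add_comp,
      tot_compMap_compMap _ _ _ _ (add_zero a), tot_cinf_compMap, DegMap.comp_id])

/-- Derivations compose with morphisms on the right. -/
theorem IsDerivation.comp_hom {E : DegMap Q.S Q.S a} (hE : IsDerivation (DegMap.id Q.S) E) (F : GradedOperad.Hom P Q) :
    IsDerivation F.f (E.comp F.f (zero_add a)) where
  unit := tot_injective (by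
    rw [tot_comp, tot_comp, reassoc_of% F.tot_η, hE.tot_unit, tot_zero])
  mul := tot_injective (by
    rw [tot_comp, tot_comp, tot_comp, tot_add, reassoc_of% F.tot_γ, hE.tot_mul, ← Category.assoc, comp_add,
      tot_compMap_compMap _ _ _ _ (zero_add a), tot_compMap_cinf, DegMap.id_comp])

/-- The identity morphism of an operad. -/
def GradedOperad.idHom (P : GradedOperad K) : GradedOperad.Hom P P where
  f := DegMap.id P.S
  map_γ := by rw [compMap_id, DegMap.comp_id, DegMap.id_comp]
  map_η := DegMap.id_comp _ _

/-- The identity morphism of a cooperad. -/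
def GradedCooperad.idHom (C : GradedCooperad K) : GradedCooperad.Hom C C where
  f := DegMap.id C.S
  map_Δ := by rw [compMap_id, DegMap.comp_id, DegMap.id_comp]
  map_ε := DegMap.comp_id _ _
  map_η := DegMap.id_comp _ _

end derivations

noncomputable section cobar
variable {W : SMod K} {a b : ℤ}

/-- The inclusion of the coaugmentation coideal. -/
def coidealIncl (C : GradedCooperad K) : DegMap C.coideal C.S 0 where
  app X _ d d' h := C.S.cast X (by omega) ∘ₗ (LinearMap.ker (C.ε.app X d d (add_zero d))).subtype
  natural e d d' h x := by
    obtain rfl : d = d' := by omega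
    rfl

/-- The map `x ↦ s⁻¹ x` of degree `-1`, vanishing on `1`. -/
def coidealSusp (C : GradedCooperad K) : DegMap C.S (shift C.coideal (-1)) (-1) :=
  (susp C.coideal (-1)).comp C.projCoideal (zero_add _)

theorem tot_projCoideal_incl (C : GradedCooperad K) : tot C.projCoideal ≫ tot (coidealIncl C) = tot C.proj := by
  rw [← tot_comp _ _ (add_zero 0)]
  refine congrArg tot (degMap_ext_zero fun X _ d x => ?_)
  rw [DegMap.comp_app _ _ _ (add_zero d) (add_zero d)]
  rfl

theorem tot_incl_projCoideal (C : GradedCooperad K) : tot (coidealIncl C) ≫ tot C.projCoideal = 𝟙 _ := by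
  rw [← tot_comp _ _ (add_zero 0), ← tot_id]
  refine congrArg tot (degMap_ext_zero fun X _ d x => Subtype.ext ?_)
  rw [DegMap.comp_app _ _ _ (add_zero d) (add_zero d)]
  change x.1 + -(C.η.comp C.ε (add_zero 0)).app X d d (add_zero d) x.1 = x.1
  rw [DegMap.comp_app _ _ _ (add_zero d) (add_zero d), LinearMap.mem_ker.1 x.2, map_zero, neg_zero, add_zero]

/-- The map on `s⁻¹` of the coaugmentation coideal induced by a map on the cooperad. -/
def coidealLift (C : GradedCooperad K) (g : DegMap C.S W a) (h : a + 1 = b) : DegMap (shift C.coideal (-1)) W b :=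
  g.comp ((coidealIncl C).comp (desusp C.coideal (-1) 1) (add_zero 1)) ((add_comm _ _).trans h)

theorem coidealSusp_lift (C : GradedCooperad K) {g : DegMap C.S W a} (h : a + 1 = b) (hg : tot C.η ≫ tot g = 0) :
    tot (coidealSusp C) ≫ tot (coidealLift C g h) = tot g := by
  rw [coidealSusp, coidealLift, tot_comp, tot_comp, tot_comp, Category.assoc, Category.assoc, reassoc_of% susp_desusp, reassoc_of% tot_projCoideal_incl,
    C.tot_proj_comp hg]

theorem coidealSusp_epi (C : GradedCooperad K) {f g : DegMap (shift C.coideal (-1)) W a} (h : tot (coidealSusp C) ≫ tot f = tot (coidealSusp C) ≫ tot g) :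
    f = g := by
  have h1 := congrArg (fun t => tot (desusp C.coideal (-1) 1) ≫ tot (coidealIncl C) ≫ t) h
  simp only [coidealSusp, tot_comp, Category.assoc, reassoc_of% tot_incl_projCoideal, reassoc_of% desusp_susp] at h1
  exact tot_injective h1

theorem coaug_coidealSusp (C : GradedCooperad K) : tot C.η ≫ tot (coidealSusp C) = 0 := by
  have h1 : tot C.η ≫ tot C.proj = 0 := by
    rw [C.tot_proj, comp_sub, reassoc_of% C.tot_ε_η, comp_id, sub_self]
  have h2 : tot C.η ≫ tot C.projCoideal = 0 := by
    rw [← comp_id (tot C.projCoideal), ← tot_incl_projCoideal, reassoc_of% tot_projCoideal_incl, reassoc_of% h1,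
      zero_comp]
  rw [coidealSusp, tot_comp, reassoc_of% h2, zero_comp]

variable {C : CurvedCooperad K}

theorem tot_cobarGen {O : DGOperad K} (ι : DegMap (shift C.coideal (-1)) O.S 0) :
    tot (cobarGen ι) = tot (coidealSusp C.toGradedCooperad) ≫ tot ι := tot_comp _ _ _

theorem cobarGen_coaug {O : DGOperad K} (ι : DegMap (shift C.coideal (-1)) O.S 0) : tot C.η ≫ tot (cobarGen ι) = 0 := by
  rw [tot_cobarGen, ← Category.assoc, coaug_coidealSusp, zero_comp]

/-- The twisting morphism equation in terms of the differential of the operad. -/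
theorem twisting_iff {P : DGOperad K} {α : DegMap C.S P.S (-1)} (hα : tot C.η ≫ tot α = 0) :
    P.d.comp α (by norm_num) + α.comp C.d (by norm_num) + star C.toGradedCooperad P.toGradedOperad α = P.η.comp (c := -2) C.θ (by norm_num) ↔
      tot α ≫ tot P.d = tot (twistTerm C P.toGradedOperad α) := by
  rw [star_eq_conv hα, tot_twistTerm]
  constructor
  · intro h
    have h1 := congrArg tot h
    rw [tot_add, tot_add, tot_comp, tot_comp, tot_comp] at h1
    rw [← h1]
    abel
  · intro h
    refine tot_injective ?_
    rw [tot_add, tot_add, tot_comp, tot_comp, tot_comp, h]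
    abel

theorem Tw.coaug {P : DGOperad K} (α : Tw C P) : tot C.η ≫ tot α.α = 0 := by
  rw [← tot_comp _ _ (zero_add _), α.α_η, tot_zero]

theorem Tw.tot_d {P : DGOperad K} (α : Tw C P) : tot α.α ≫ tot P.d = tot (twistTerm C P.toGradedOperad α.α) :=
  (twisting_iff α.coaug).1 α.eqn

/-- A twisting morphism from its defining equations. -/
def Tw.mk' {P : DGOperad K} (α : DegMap C.S P.S (-1)) (h : tot C.η ≫ tot α = 0) (h' : tot α ≫ tot P.d = tot (twistTerm C P.toGradedOperad α)) :
    Tw C P where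
  α := α
  α_η := tot_injective (by rw [tot_comp, h, tot_zero])
  eqn := (twisting_iff h).2 h'

/-- Twisting morphisms are contravariant in the cooperad and covariant in the operad. -/
def Tw.map {C' : CurvedCooperad K} {P P' : DGOperad K} (α : Tw C P) (g : C' ⟶ C) (h : P ⟶ P') : Tw C' P' :=
  Tw.mk' (h.f.comp (α.α.comp g.f (zero_add _)) (add_zero _))
    (by
      rw [tot_comp, tot_comp, Category.assoc, reassoc_of% g.tot_η, reassoc_of% α.coaug, zero_comp])
    (by
      have h1 := congrArg tot g.map_d
      have h2 := congrArg tot h.map_d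
      have h3 := congrArg tot g.map_θ
      rw [tot_comp, tot_comp] at h1 h2
      rw [tot_comp] at h3
      rw [tot_comp, tot_comp, Category.assoc, Category.assoc, ← h2, reassoc_of% α.tot_d, tot_twistTerm, tot_twistTerm, sub_comp,
        sub_comp, comp_sub, comp_sub, tot_comp, tot_comp, Category.assoc, Category.assoc, Category.assoc,
        reassoc_of% h3, h.tot_η, reassoc_of% h1, hom_conv h.toHom (α' := h.f.comp α.α (add_zero _)) (β' := h.f.comp α.α (add_zero _)) ?_ ?_,
        conv_hom g.toHom (α' := h.f.comp (α.α.comp g.f (zero_add _)) (add_zero _))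
          (β' := h.f.comp (α.α.comp g.f (zero_add _)) (add_zero _)) ?_ ?_]
      all_goals simp only [tot_comp, Category.assoc])

/-- The cobar construction exists. -/
theorem exists_cobar (C : CurvedCooperad K) : ∃ (O : DGOperad K) (ι : DegMap (shift C.coideal (-1)) O.S 0), IsCobar C O ι := by
  obtain ⟨O, ι, hO⟩ : ∃ (O : GradedOperad K) (ι : DegMap (shift C.coideal (-1)) O.S 0), IsFreeOperad O ι :=
    ⟨_, _, treeOperad_isFree _⟩
  let β : DegMap C.S O.S (-1) := ι.comp (coidealSusp C.toGradedCooperad) (add_zero _)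
  have hβ : tot C.η ≫ tot β = 0 := by rw [tot_comp, ← Category.assoc, coaug_coidealSusp, zero_comp]
  obtain ⟨D, hD, hDι⟩ := hO.exists_derivation O.idHom
    (coidealLift C.toGradedCooperad (twistTerm C O β) (b := -1) (by norm_num))
  have h1 : tot β ≫ tot D = tot (twistTerm C O β) := by
    rw [tot_comp, Category.assoc, ← tot_comp _ _ (zero_add _), hDι, coidealSusp_lift _ _ (twistTerm_coaug C hβ)]
  have hsq : D.comp D (by norm_num) = (0 : DegMap O.S O.S (-2)) := by
    refine hO.derivation_ext O.idHom (hD.sq (by decide) (by norm_num)) (isDerivation_zero _) (coidealSusp_epi _ ?_)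
    have h2 := derivation_sq_eq_zero C hD h1
    rw [tot_comp, Category.assoc] at h2
    rw [tot_comp, tot_comp, tot_comp, h2, tot_zero, comp_zero, comp_zero]
  let O' : DGOperad K :=
    { O with
      d := D
      d_sq := hsq
      d_γ := hD.mul
      d_η := hD.unit }
  refine ⟨O', ι, hO, tot_injective ?_⟩
  have h3 := star_eq_conv (C := C.toGradedCooperad) (P := O) hβ
  have h4 : tot (star C.toGradedCooperad O'.toGradedOperad (cobarGen (O := O') ι)) =
    tot (conv (C := C.toGradedCooperad) (P := O) β β (c := -2) (by norm_num)) := congrArg tot h3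
  rw [tot_sub, tot_sub, h4, tot_comp, tot_comp, tot_comp]
  exact h1.trans (tot_twistTerm _ _ _)

section bijection
variable {O : DGOperad K} {ι : DegMap (shift C.coideal (-1)) O.S 0}

/-- The universal twisting morphism to a cobar construction. -/
def IsCobar.tw (h : IsCobar C O ι) : Tw C O := Tw.mk' (cobarGen ι) (cobarGen_coaug ι) (by
  have h1 := congrArg tot h.d_gen
  rw [star_eq_conv (cobarGen_coaug ι), tot_sub, tot_sub, tot_comp, tot_comp, tot_comp] at h1
  rw [h1, tot_twistTerm])

/-- A morphism out of a cobar construction is determined by its values on generators. -/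
theorem IsCobar.hom_ext (h : IsCobar C O ι) {P : DGOperad K} {F G : O ⟶ P} (hFG : tot (cobarGen ι) ≫ tot F.f = tot (cobarGen ι) ≫ tot G.f) :
    F = G := by
  rw [tot_cobarGen, Category.assoc, Category.assoc, ← tot_comp _ _ (add_zero 0), ← tot_comp _ _ (add_zero 0)] at hFG
  have h1 := (h.free P.toGradedOperad (G.f.comp ι (add_zero 0))).unique (y₁ := F.toHom) (y₂ := G.toHom) (coidealSusp_epi _ hFG) rfl
  exact DGOperad.Hom.ext (congrArg GradedOperad.Hom.f h1)

/-- Every twisting morphism is the restriction of a morphism out of the cobar construction. -/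
theorem IsCobar.exists_hom (h : IsCobar C O ι) {P : DGOperad K} (α : Tw C P) :
    ∃ F : O ⟶ P, tot (cobarGen ι) ≫ tot F.f = tot α.α := by
  obtain ⟨F, hF, -⟩ := h.free P.toGradedOperad (coidealLift C.toGradedCooperad α.α (b := 0) (by norm_num))
  have h1 : tot (cobarGen ι) ≫ tot F.f = tot α.α := by
    rw [tot_cobarGen, Category.assoc, ← tot_comp _ _ (add_zero 0), hF, coidealSusp_lift _ _ α.coaug]
  refine ⟨{ F with map_d := ?_ }, h1⟩
  refine h.free.derivation_ext F (O.isDerivation.hom_comp F) (P.isDerivation.comp_hom F) (coidealSusp_epi _ ?_)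
  have h3 := h.tw.tot_d
  change tot (cobarGen ι) ≫ _ = tot (twistTerm C O.toGradedOperad (cobarGen ι)) at h3
  rw [tot_comp, tot_comp, tot_comp, tot_comp, ← Category.assoc, ← Category.assoc (tot (coidealSusp _)), ← tot_cobarGen,
    reassoc_of% h1, α.tot_d, reassoc_of% h3, tot_twistTerm, tot_twistTerm, sub_comp, sub_comp,
    Category.assoc, Category.assoc, h1, F.tot_η, hom_conv F h1 h1]

end bijection

end cobar
end OperadicBar

namespace OperadicBar
open Limits Preadditive
open CategoryTheory.Category (id_comp comp_id)
variable {K : Type u} [Field K]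

/-! ### The curved bar construction -/

noncomputable section barTwisting
variable {C : GradedCooperad K} {P : DGOperad K}

/-- The value on `α` of the coderivation of the bar construction. -/
def barTerm (P : DGOperad K) (α : DegMap C.S P.S (-1)) (θ : DegMap C.S (unit K) (-2)) : DegMap C.S P.S (-2) :=
  P.η.comp θ (add_zero _) - P.d.comp α (by norm_num) - conv (P := P.toGradedOperad) α α (by norm_num)

theorem tot_barTerm (α : DegMap C.S P.S (-1)) (θ : DegMap C.S (unit K) (-2)) :
    tot (barTerm P α θ) = tot θ ≫ tot P.η - tot α ≫ tot P.d - tot (conv (P := P.toGradedOperad) α α (c := -2) (by norm_num)) := by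
  rw [barTerm, tot_sub, tot_sub, tot_comp, tot_comp]

theorem barTerm_coaug {α : DegMap C.S P.S (-1)} {θ : DegMap C.S (unit K) (-2)} (hα : tot C.η ≫ tot α = 0) :
    tot C.η ≫ tot (barTerm P α θ) = 0 := by
  rw [tot_barTerm, comp_sub, comp_sub, ← Category.assoc, degMap_unit_eq_zero θ C.η (by norm_num), reassoc_of% hα,
    conv_coaug hα, zero_comp, zero_comp, sub_zero, sub_zero]

/-- The square of the coderivation of the bar construction is given by the curvature, after projection to the operad. -/
theorem coderivation_sq {E : DegMap C.S C.S (-1)} (hE : IsCoderivation (DegMap.id C.S) E) {α : DegMap C.S P.S (-1)}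
    {θ : DegMap C.S (unit K) (-2)} (h : tot E ≫ tot α = tot (barTerm P α θ)) (hθ : tot E ≫ tot θ = 0) :
    tot E ≫ tot E ≫ tot α = tot (leftAct C θ - rightAct C θ) ≫ tot α := by
  have h1 := congrArg tot P.d_η
  have h2 := congrArg tot P.d_sq
  rw [tot_comp, tot_zero] at h1 h2
  have e₁ := derivation_conv (C := C) P.isDerivation (h := by norm_num) (tot_comp α P.d (c := -2) (by norm_num)).symm
    (tot_comp α P.d (c := -2) (by norm_num)).symm (by norm_num) (by norm_num) (c := -2) (c' := -3) (by norm_num) (by norm_num)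
  have e₂ := conv_coderivation hE (h := by norm_num) h h (by norm_num) (by norm_num) (c := -2) (c' := -3) (by norm_num) (by norm_num)
  have e₃ := conv_functional_left (tot_comp θ P.η (add_zero _)).symm (β := α) (c := -3) (by norm_num) (by decide)
  have e₄ := conv_functional_right (tot_comp θ P.η (add_zero _)).symm (β := α) (c := -3) (by norm_num)
  rw [Int.negOnePow_odd _ (by decide), Units.val_neg, Units.val_one, neg_smul, one_smul] at e₁ e₂
  rw [tot_sub, sub_comp, ← e₃, ← e₄, h, tot_barTerm, comp_sub, comp_sub, reassoc_of% hθ, e₂, ← Category.assoc, h,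
    tot_barTerm, sub_comp, sub_comp, Category.assoc, h1, Category.assoc, h2, e₁, zero_comp,
    comp_zero, comp_zero, barTerm]
  simp only [conv_sub_left, conv_sub_right, tot_sub, conv_assoc]
  abel

theorem act_curvature (θ : DegMap C.S (unit K) (-2)) : tot (leftAct C θ - rightAct C θ) ≫ tot θ = 0 := by
  rw [tot_sub, sub_comp, tot_leftAct_comp C.ε (c := -4) (by norm_num) (by decide), tot_rightAct_comp (c := -4) (by norm_num),
    leftUnit_eq_rightUnit, sub_self]

end barTwisting

noncomputable section cogenerators
variable {P : DGOperad K} {W : SMod K} {a b c : ℤ}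

/-- The projection of the cogenerators to the operad, of degree `-1`. -/
def cogenPr (P : DGOperad K) : DegMap (barCogen P) P.S (-1) := (desusp P.S 1 (-1)).comp (sumFst _ _) (zero_add _)

/-- The coefficient of the curvature cogenerator. -/
def cogenV (P : DGOperad K) : DegMap (barCogen P) (unit K) (-2) := (desusp (unit K) 2 (-2)).comp (sumSnd _ _) (zero_add _)

/-- The map to the cogenerators with given components. -/
def cogenPair (f : DegMap W P.S a) (g : DegMap W (unit K) b) (ha : a + 1 = c) (hb : b + 2 = c) : DegMap W (barCogen P) c :=
  DegMap.comp (inFst (shift P.S 1) (shift (unit K) 2) : DegMap _ _ 0) ((susp P.S 1).comp f ha) (add_zero c) +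
    DegMap.comp (inSnd (shift P.S 1) (shift (unit K) 2) : DegMap _ _ 0) ((susp (unit K) 2).comp g hb) (add_zero c)

theorem tot_inFst_fst (V W : SMod K) : tot (k := 0) (inFst V W) ≫ tot (sumFst V W) = 𝟙 _ := by
  rw [← tot_comp _ _ (add_zero 0), ← tot_id]
  exact congrArg tot (inFst_prFst V W)

theorem tot_inFst_snd (V W : SMod K) : tot (k := 0) (inFst V W) ≫ tot (sumSnd V W) = 0 := by
  rw [← tot_comp _ _ (add_zero 0)]
  exact congrArg tot (inFst_prSnd V W)

theorem tot_inSnd_fst (V W : SMod K) : tot (k := 0) (inSnd V W) ≫ tot (sumFst V W) = 0 := by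
  rw [← tot_comp _ _ (add_zero 0)]
  exact congrArg tot (inSnd_prFst V W)

theorem tot_inSnd_snd (V W : SMod K) : tot (k := 0) (inSnd V W) ≫ tot (sumSnd V W) = 𝟙 _ := by
  rw [← tot_comp _ _ (add_zero 0), ← tot_id]
  exact congrArg tot (inSnd_prSnd V W)

theorem tot_sum_total (V W : SMod K) : tot (sumFst V W) ≫ tot (k := 0) (inFst V W) + tot (sumSnd V W) ≫ tot (k := 0) (inSnd V W) = 𝟙 _ := by
  rw [← tot_comp _ _ (add_zero 0), ← tot_comp _ _ (add_zero 0), ← tot_add, ← tot_id]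
  exact congrArg tot (sum_total V W)

theorem cogenPair_fst (f : DegMap W P.S a) (g : DegMap W (unit K) b) (ha : a + 1 = c) (hb : b + 2 = c) :
    tot (cogenPair f g ha hb) ≫ tot (sumFst _ _) = tot f ≫ tot (susp P.S 1) := by
  rw [cogenPair, tot_add, tot_comp, tot_comp, tot_comp, tot_comp, add_comp, Category.assoc, Category.assoc, Category.assoc,
    Category.assoc, tot_inFst_fst, tot_inSnd_fst, comp_id, comp_zero, comp_zero, add_zero]

theorem cogenPair_snd (f : DegMap W P.S a) (g : DegMap W (unit K) b) (ha : a + 1 = c) (hb : b + 2 = c) :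
    tot (cogenPair f g ha hb) ≫ tot (sumSnd _ _) = tot g ≫ tot (susp (unit K) 2) := by
  rw [cogenPair, tot_add, tot_comp, tot_comp, tot_comp, tot_comp, add_comp, Category.assoc, Category.assoc, Category.assoc,
    Category.assoc, tot_inFst_snd, tot_inSnd_snd, comp_id, comp_zero, comp_zero, zero_add]

theorem cogenPair_pr (f : DegMap W P.S a) (g : DegMap W (unit K) b) (ha : a + 1 = c) (hb : b + 2 = c) :
    tot (cogenPair f g ha hb) ≫ tot (cogenPr P) = tot f := by
  rw [cogenPr, tot_comp, ← Category.assoc, cogenPair_fst, Category.assoc, susp_desusp, comp_id]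

theorem cogenPair_V (f : DegMap W P.S a) (g : DegMap W (unit K) b) (ha : a + 1 = c) (hb : b + 2 = c) :
    tot (cogenPair f g ha hb) ≫ tot (cogenV P) = tot g := by
  rw [cogenV, tot_comp, ← Category.assoc, cogenPair_snd, Category.assoc, susp_desusp, comp_id]

theorem cogen_ext {Z : Tot K} {f g : Z ⟶ ⟨barCogen P⟩} (h₁ : f ≫ tot (cogenPr P) = g ≫ tot (cogenPr P))
    (h₂ : f ≫ tot (cogenV P) = g ≫ tot (cogenV P)) : f = g := by
  have e₁ : f ≫ tot (sumFst _ _) = g ≫ tot (sumFst _ _) := by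
    have := congrArg (· ≫ tot (susp P.S 1)) h₁
    simpa only [cogenPr, tot_comp, Category.assoc, desusp_susp, comp_id] using this
  have e₂ : f ≫ tot (sumSnd _ _) = g ≫ tot (sumSnd _ _) := by
    have := congrArg (· ≫ tot (susp (unit K) 2)) h₂
    simpa only [cogenV, tot_comp, Category.assoc, desusp_susp, comp_id] using this
  rw [← comp_id f, ← comp_id g, ← tot_sum_total, comp_add, comp_add, reassoc_of% e₁, reassoc_of% e₂]

end cogenerators

noncomputable section bar
variable {P : DGOperad K}

theorem tot_barPr {B : CurvedCooperad K} (π : DegMap B.S (barCogen P) 0) : tot (barPr π) = tot π ≫ tot (cogenPr P) := by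
  rw [barPr, cogenPr, tot_comp, tot_comp, tot_comp, Category.assoc]

theorem tot_barV {B : CurvedCooperad K} (π : DegMap B.S (barCogen P) 0) : tot (barV π) = tot π ≫ tot (cogenV P) := by
  rw [barV, cogenV, tot_comp, tot_comp, tot_comp, Category.assoc]

/-- The curved bar construction exists. -/
theorem exists_bar (P : DGOperad K) : ∃ (B : CurvedCooperad K) (π : DegMap B.S (barCogen P) 0), IsBar P B π := by
  obtain ⟨B, π, hB⟩ : ∃ (B : GradedCooperad K) (π : DegMap B.S (barCogen P) 0), IsCofreeCooperad B π := ⟨_, _, treeCooperad_isCofree _⟩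
  have hη : tot B.η ≫ tot π = 0 := by rw [← tot_comp _ _ (add_zero 0), hB.2.1, tot_zero]
  let α : DegMap B.S P.S (-1) := (cogenPr P).comp π (zero_add _)
  let θ : DegMap B.S (unit K) (-2) := (cogenV P).comp π (zero_add _)
  have hα : tot B.η ≫ tot α = 0 := by rw [tot_comp, reassoc_of% hη, zero_comp]
  obtain ⟨D, hD, hDπ⟩ := hB.exists_coderivation hB.1 B.idHom (cogenPair (barTerm P α θ) (0 : DegMap B.S (unit K) (-3)) (c := -1)
    (by norm_num) (by norm_num))
  have tD := congrArg tot hDπ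
  rw [tot_comp] at tD
  have h1 : tot D ≫ tot α = tot (barTerm P α θ) := by rw [tot_comp, reassoc_of% tD, cogenPair_pr]
  have h2 : tot D ≫ tot θ = 0 := by rw [tot_comp, reassoc_of% tD, cogenPair_V, tot_zero]
  have hDη : D.comp B.η (zero_add _) = 0 := by
    refine hB.coderivation_coaug hB.1 B.idHom hD (tot_injective (cogen_ext ?_ ?_))
    · rw [tot_comp, hDπ, Category.assoc, cogenPair_pr, barTerm_coaug hα, tot_zero, zero_comp]
    · rw [tot_comp, hDπ, Category.assoc, cogenPair_V, tot_zero, tot_zero, zero_comp, comp_zero]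
  -- `D²` and the curvature operator are coderivations, so it suffices to compare their projections.
  have hsq : D.comp D (by norm_num) = leftAct B θ - rightAct B θ := by
    refine hB.coderivation_ext hB.1 B.idHom (hD.sq (by decide) (by norm_num)) (isCoderivation_act θ) (tot_injective (cogen_ext ?_ ?_))
    · have h3 := coderivation_sq hD h1 h2
      rw [tot_comp π] at h3
      rwa [tot_comp, tot_comp, tot_comp, Category.assoc, Category.assoc, Category.assoc]
    · have h3 := act_curvature θ
      rw [tot_comp π] at h2 h3
      rw [tot_comp, tot_comp, tot_comp, Category.assoc, Category.assoc, Category.assoc, h2, h3, comp_zero]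
  let B' : CurvedCooperad K :=
    { B with
      conilpotent := hB.1
      d := D
      θ := θ
      d_Δ := hD.comul
      d_η := hDη
      d_sq := by
        -- `θ` kills `1` because its values have degree `-2` while `1` has degree zero.
        have h3 := tot_curvatureOp (C := B) (θ := θ) (degMap_unit_eq_zero _ _ (by norm_num))
        exact hsq.trans (tot_injective h3).symm
      θ_d := tot_injective (by rw [tot_comp, h2, tot_zero]) }
  have hα' : barPr (B := B') π = α := tot_injective (by rw [tot_barPr, tot_comp])
  have hθ' : barV (B := B') π = θ := tot_injective (by rw [tot_barV, tot_comp])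
  refine ⟨B', π, hB, tot_injective ?_, tot_injective ?_, hθ'.symm⟩
  · have h3 : tot (star B'.toGradedCooperad P.toGradedOperad (barPr (B := B') π)) =
        tot (conv (C := B) (P := P.toGradedOperad) α α (c := -2) (by norm_num)) := by
      rw [hα']
      exact congrArg tot (star_eq_conv (C := B) hα)
    rw [tot_comp, tot_comp, tot_comp, tot_sub, tot_sub, tot_comp, tot_comp, h3, hα', hθ', ← tot_barTerm (C := B)]
    exact (congrArg (· ≫ tot (sumFst _ _)) tD).trans (cogenPair_fst _ _ _ _)
  · rw [tot_comp, tot_comp]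
    refine (congrArg (· ≫ tot (sumSnd _ _)) tD).trans ((cogenPair_snd _ _ _ _).trans ?_)
    rw [tot_zero, zero_comp, tot_zero]

section bijection
variable {B : CurvedCooperad K} {π : DegMap B.S (barCogen P) 0}

theorem IsBar.coaug_proj (h : IsBar P B π) : tot B.η ≫ tot π = 0 := by rw [← tot_comp _ _ (add_zero 0), h.cofree.2.1, tot_zero]

theorem IsBar.coaug_barPr (h : IsBar P B π) : tot B.η ≫ tot (barPr π) = 0 := by
  rw [tot_barPr, reassoc_of% h.coaug_proj, zero_comp]

theorem IsBar.tot_d (h : IsBar P B π) : tot B.d ≫ tot (barPr π) = tot (barTerm (C := B.toGradedCooperad) P (barPr π) B.θ) := by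
  have h1 := congrArg tot h.fst_d
  rw [star_eq_conv h.coaug_barPr, tot_comp, tot_comp, tot_comp, tot_sub, tot_sub, tot_comp, tot_comp, ← h.θ_eq,
    ← tot_barTerm (C := B.toGradedCooperad)] at h1
  rw [tot_barPr, cogenPr, tot_comp, ← Category.assoc, ← Category.assoc, h1, Category.assoc, susp_desusp, comp_id]

theorem IsBar.tot_d_barV (h : IsBar P B π) : tot B.d ≫ tot (barV π) = 0 := by
  rw [← h.θ_eq, ← tot_comp _ _ (c := -3) (by norm_num), B.θ_d, tot_zero]

/-- The universal twisting morphism from a bar construction. -/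
def IsBar.tw (h : IsBar P B π) : Tw B P := Tw.mk' (barPr π) h.coaug_barPr (by
  rw [tot_twistTerm, h.tot_d, tot_barTerm]
  abel)

/-- A morphism to a bar construction is determined by its projection to the operad. -/
theorem IsBar.hom_ext (h : IsBar P B π) {C : CurvedCooperad K} {F G : C ⟶ B}
    (hFG : tot F.f ≫ tot (barPr π) = tot G.f ≫ tot (barPr π)) : F = G := by
  have hF := congrArg tot F.map_θ
  have hG := congrArg tot G.map_θ
  rw [tot_comp, h.θ_eq, tot_barV] at hF hG
  have h1 := (h.cofree.2.2 C.toGradedCooperad C.conilpotent (π.comp G.f (add_zero 0)) (tot_injective (by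
    rw [tot_comp, tot_comp, reassoc_of% G.tot_η, h.coaug_proj, tot_zero]))).unique (y₁ := F.toHom) (y₂ := G.toHom) (tot_injective (by
      rw [tot_barPr] at hFG
      rw [tot_comp, tot_comp]
      refine cogen_ext ?_ ?_
      · rw [Category.assoc, Category.assoc, hFG]
      · rw [Category.assoc, Category.assoc, hF, hG])) rfl
  exact CurvedCooperad.Hom.ext (congrArg GradedCooperad.Hom.f h1)

/-- Every twisting morphism is the projection of a morphism to the bar construction. -/
theorem IsBar.exists_hom (h : IsBar P B π) {C : CurvedCooperad K} (α : Tw C P) :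
    ∃ F : C ⟶ B, tot F.f ≫ tot (barPr π) = tot α.α := by
  obtain ⟨F, hF, -⟩ := h.cofree.2.2 C.toGradedCooperad C.conilpotent (cogenPair α.α C.θ (c := 0) (by norm_num) (by norm_num))
    (tot_injective (cogen_ext
      (by rw [tot_comp, Category.assoc, cogenPair_pr, α.coaug, tot_zero, zero_comp])
      (by rw [tot_comp, Category.assoc, cogenPair_V, C.tot_η_θ, tot_zero, zero_comp])))
  have tF := congrArg tot hF
  rw [tot_comp] at tF
  have h1 : tot F.f ≫ tot (barPr π) = tot α.α := by rw [tot_barPr, reassoc_of% tF, cogenPair_pr]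
  have h2 : tot F.f ≫ tot (barV π) = tot C.θ := by rw [tot_barV, reassoc_of% tF, cogenPair_V]
  refine ⟨{ F with map_d := ?_, map_θ := tot_injective (by rw [tot_comp, h.θ_eq, h2]) }, h1⟩
  have hd₁ := B.isCoderivation.comp_hom F
  have hd₂ := C.isCoderivation.hom_comp F
  rw [DegMap.id_comp] at hd₁
  rw [DegMap.comp_id] at hd₂
  refine h.cofree.coderivation_ext C.conilpotent F hd₁ hd₂ (tot_injective (cogen_ext ?_ ?_))
  · rw [tot_comp, tot_comp, tot_comp, tot_comp, Category.assoc, Category.assoc, Category.assoc, Category.assoc, ← tot_barPr, h1, h.tot_d,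
      tot_barTerm, comp_sub, comp_sub, h.θ_eq, reassoc_of% h2, reassoc_of% h1, conv_hom F h1 h1, α.tot_d, tot_twistTerm]
    abel
  · rw [tot_comp, tot_comp, tot_comp, tot_comp, Category.assoc, Category.assoc, Category.assoc, Category.assoc, ← tot_barV, h2,
      h.tot_d_barV, comp_zero, ← tot_comp _ _ (c := -3) (by norm_num), C.θ_d, tot_zero]

end bijection

end bar
end OperadicBar

namespace OperadicBar
open CategoryTheory.Category (id_comp comp_id)
variable {K : Type u} [Field K]

/-! ### Functoriality and the adjunction -/

noncomputable section functors

theorem DGOperad.tot_comp_f {P Q R : DGOperad K} (f : P ⟶ Q) (g : Q ⟶ R) : tot (f ≫ g).f = tot f.f ≫ tot g.f := tot_comp _ _ (add_zero 0)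
theorem DGOperad.tot_id_f (P : DGOperad K) : tot (𝟙 P : P ⟶ P).f = 𝟙 _ := tot_id
theorem CurvedCooperad.tot_comp_f {P Q R : CurvedCooperad K} (f : P ⟶ Q) (g : Q ⟶ R) : tot (f ≫ g).f = tot f.f ≫ tot g.f :=
  tot_comp _ _ (add_zero 0)
theorem CurvedCooperad.tot_id_f (P : CurvedCooperad K) : tot (𝟙 P : P ⟶ P).f = 𝟙 _ := tot_id

theorem Tw.tot_map {C C' : CurvedCooperad K} {P P' : DGOperad K} (α : Tw C P) (g : C' ⟶ C) (h : P ⟶ P') :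
    tot (α.map g h).α = tot g.f ≫ tot α.α ≫ tot h.f := by
  change tot (h.f.comp (α.α.comp g.f (zero_add _)) (add_zero _)) = _
  rw [tot_comp, tot_comp, Category.assoc]

/-- The cobar constructions of all curved cooperads, with the induced morphisms, form a functor. -/
theorem nonempty_cobarConstruction : Nonempty (CobarConstruction K) := by
  choose O ι hO using exists_cobar (K := K)
  have hm {C C' : CurvedCooperad K} (g : C ⟶ C') : ∃ F : O C ⟶ O C', tot (cobarGen (ι C)) ≫ tot F.f = tot g.f ≫ tot (cobarGen (ι C')) := by
    obtain ⟨F, hF⟩ := (hO C).exists_hom ((hO C').tw.map g (𝟙 _))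
    refine ⟨F, ?_⟩
    rw [hF, Tw.tot_map, DGOperad.tot_id_f, comp_id]
    rfl
  choose M hM using @hm
  exact ⟨{
    F :=
      { obj := O
        map := M
        map_id C := (hO C).hom_ext (by rw [hM, DGOperad.tot_id_f, CurvedCooperad.tot_id_f, id_comp, comp_id])
        map_comp f g := (hO _).hom_ext (by
          rw [hM, DGOperad.tot_comp_f, CurvedCooperad.tot_comp_f, reassoc_of% (hM f), hM, Category.assoc]) }
    ι := ι
    isCobar := hO
    map_gen := fun g => tot_injective (by rw [tot_comp, tot_comp]; exact hM g) }⟩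

/-- The bar constructions of all dg operads, with the induced morphisms, form a functor. -/
theorem nonempty_barConstruction : Nonempty (BarConstruction K) := by
  choose B π hB using exists_bar (K := K)
  have hm {P P' : DGOperad K} (g : P ⟶ P') : ∃ F : B P ⟶ B P', tot F.f ≫ tot (barPr (π P')) = tot (barPr (π P)) ≫ tot g.f := by
    obtain ⟨F, hF⟩ := (hB P').exists_hom ((hB P).tw.map (𝟙 _) g)
    refine ⟨F, ?_⟩
    rw [hF, Tw.tot_map, CurvedCooperad.tot_id_f, id_comp]
    rfl
  choose M hM using @hm
  exact ⟨{
    F :=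
      { obj := B
        map := M
        map_id P := (hB P).hom_ext (by rw [hM, DGOperad.tot_id_f, CurvedCooperad.tot_id_f, id_comp, comp_id])
        map_comp f g := (hB _).hom_ext (by
          rw [hM, DGOperad.tot_comp_f, CurvedCooperad.tot_comp_f, Category.assoc, hM, reassoc_of% (hM f)]) }
    π := π
    isBar := hB
    map_pr := fun g => tot_injective (by rw [tot_comp, tot_comp]; exact hM g) }⟩

/-- Morphisms out of a cobar construction are twisting morphisms. -/
def IsCobar.homEquiv {C : CurvedCooperad K} {O : DGOperad K} {ι : DegMap (shift C.coideal (-1)) O.S 0} (h : IsCobar C O ι)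
    (P : DGOperad K) : (O ⟶ P) ≃ Tw C P :=
  Equiv.ofBijective (fun F => h.tw.map (𝟙 C) F) ⟨fun F G hFG => h.hom_ext (by
      have h1 := congrArg (fun α : Tw C P => tot α.α) hFG
      simp only [Tw.tot_map, CurvedCooperad.tot_id_f, id_comp] at h1
      exact h1),
    fun α => (h.exists_hom α).imp fun F hF => Tw.ext (tot_injective (by
      rw [Tw.tot_map, CurvedCooperad.tot_id_f, id_comp, ← hF]
      rfl))⟩

theorem IsCobar.tot_homEquiv {C : CurvedCooperad K} {O : DGOperad K} {ι : DegMap (shift C.coideal (-1)) O.S 0} (h : IsCobar C O ι)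
    {P : DGOperad K} (F : O ⟶ P) : tot (h.homEquiv P F).α = tot (cobarGen ι) ≫ tot F.f :=
  (h.tw.tot_map (𝟙 C) F).trans (by
    rw [CurvedCooperad.tot_id_f, id_comp]
    rfl)

/-- Morphisms to a bar construction are twisting morphisms. -/
def IsBar.homEquiv {P : DGOperad K} {B : CurvedCooperad K} {π : DegMap B.S (barCogen P) 0} (h : IsBar P B π)
    (C : CurvedCooperad K) : (C ⟶ B) ≃ Tw C P :=
  Equiv.ofBijective (fun F => h.tw.map F (𝟙 P)) ⟨fun F G hFG => h.hom_ext (by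
      have h1 := congrArg (fun α : Tw C P => tot α.α) hFG
      simp only [Tw.tot_map, DGOperad.tot_id_f, comp_id] at h1
      exact h1),
    fun α => (h.exists_hom α).imp fun F hF => Tw.ext (tot_injective (by
      rw [Tw.tot_map, DGOperad.tot_id_f, comp_id, ← hF]
      rfl))⟩

theorem IsBar.tot_homEquiv {P : DGOperad K} {B : CurvedCooperad K} {π : DegMap B.S (barCogen P) 0} (h : IsBar P B π)
    {C : CurvedCooperad K} (F : C ⟶ B) : tot (h.homEquiv C F).α = tot F.f ≫ tot (barPr π) :=
  (h.tw.tot_map F (𝟙 P)).trans (by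
    rw [DGOperad.tot_id_f, comp_id]
    rfl)

variable (Ω : CobarConstruction K) (B : BarConstruction K)

theorem CobarConstruction.tot_homEquiv_map {C C' : CurvedCooperad K} {P P' : DGOperad K} (g : C' ⟶ C) (h : P ⟶ P') (f : Ω.F.obj C ⟶ P) :
    tot ((Ω.isCobar C').homEquiv P' (Ω.F.map g ≫ f ≫ h)).α = tot g.f ≫ tot ((Ω.isCobar C).homEquiv P f).α ≫ tot h.f := by
  have h1 := congrArg tot (Ω.map_gen g)
  rw [tot_comp, tot_comp] at h1
  rw [IsCobar.tot_homEquiv, IsCobar.tot_homEquiv, DGOperad.tot_comp_f, DGOperad.tot_comp_f, reassoc_of% h1, Category.assoc]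

theorem BarConstruction.tot_homEquiv_map {C C' : CurvedCooperad K} {P P' : DGOperad K} (g : C' ⟶ C) (h : P ⟶ P') (f : C ⟶ B.F.obj P) :
    tot ((B.isBar P').homEquiv C' (g ≫ f ≫ B.F.map h)).α = tot g.f ≫ tot ((B.isBar P).homEquiv C f).α ≫ tot h.f := by
  have h1 := congrArg tot (B.map_pr h)
  rw [tot_comp, tot_comp] at h1
  rw [IsBar.tot_homEquiv, IsBar.tot_homEquiv, CurvedCooperad.tot_comp_f, CurvedCooperad.tot_comp_f, Category.assoc, Category.assoc, h1,
    Category.assoc]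

/-- The adjunction whose bijection on morphisms passes through twisting morphisms. -/
def cobarBarAdjunction : Ω.F ⊣ B.F :=
  Adjunction.mkOfHomEquiv
    { homEquiv := fun C P => ((Ω.isCobar C).homEquiv P).trans ((B.isBar P).homEquiv C).symm
      homEquiv_naturality_left_symm := fun {C' C P} g f => by
        refine ((Ω.isCobar C').homEquiv P).injective (Tw.ext (tot_injective ?_))
        have h1 := Ω.tot_homEquiv_map g (𝟙 P) (((Ω.isCobar C).homEquiv P).symm ((B.isBar P).homEquiv C f))
        have h2 := B.tot_homEquiv_map g (𝟙 P) f
        rw [comp_id] at h1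
        rw [B.F.map_id, comp_id] at h2
        simp only [Equiv.symm_trans_apply, Equiv.symm_symm, Equiv.apply_symm_apply] at h1 ⊢
        rw [h1, h2]
      homEquiv_naturality_right := fun {C P P'} f h => by
        refine ((B.isBar P').homEquiv C).injective (Tw.ext (tot_injective ?_))
        have h1 := Ω.tot_homEquiv_map (𝟙 C) h f
        have h2 := B.tot_homEquiv_map (𝟙 C) h (((B.isBar P).homEquiv C).symm ((Ω.isCobar C).homEquiv P f))
        rw [Ω.F.map_id, id_comp] at h1
        rw [id_comp] at h2
        simp only [Equiv.trans_apply, Equiv.apply_symm_apply] at h2 ⊢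
        rw [h1, h2] }

end functors
end OperadicBar


open OperadicBar
theorem mainTheorem10 (K : Type u) [Field K] :
    Nonempty (CobarConstruction K) ∧ Nonempty (BarConstruction K) ∧
    ∀ (Ω : CobarConstruction K) (B : BarConstruction K),
      ∃ (e₁ : ∀ (C : CurvedCooperad K) (P : DGOperad K), (Ω.F.obj C ⟶ P) ≃ Tw C P)
        (e₂ : ∀ (C : CurvedCooperad K) (P : DGOperad K), Tw C P ≃ (C ⟶ B.F.obj P)),
        (∀ C P (f : Ω.F.obj C ⟶ P), (e₁ C P f).α = f.f.comp (cobarGen (Ω.ι C))) ∧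
        (∀ C P (α : Tw C P), α.α = (barPr (B.π P)).comp (e₂ C P α).f) ∧
        (∀ {C C' : CurvedCooperad K} {P P' : DGOperad K} (g : C' ⟶ C) (h : P ⟶ P')
          (f : Ω.F.obj C ⟶ P),
          (e₁ C' P' (Ω.F.map g ≫ f ≫ h)).α =
            h.f.comp ((e₁ C P f).α.comp (c := -1) g.f)) ∧
        (∀ {C C' : CurvedCooperad K} {P P' : DGOperad K} (g : C' ⟶ C) (h : P ⟶ P')
          (f : C ⟶ B.F.obj P),
          ((e₂ C' P').symm (g ≫ f ≫ B.F.map h)).α =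
            h.f.comp (((e₂ C P).symm f).α.comp (c := -1) g.f)) ∧
        ∃ adj : Ω.F ⊣ B.F, ∀ C P, adj.homEquiv C P = (e₁ C P).trans (e₂ C P) := by
  refine ⟨nonempty_cobarConstruction, nonempty_barConstruction, fun Ω B =>
    ⟨fun C P => (Ω.isCobar C).homEquiv P, fun C P => ((B.isBar P).homEquiv C).symm, fun C P f => ?_, fun C P α => ?_,
      fun g h f => ?_, fun g h f => ?_, cobarBarAdjunction Ω B, fun C P => ?_⟩⟩
  · exact tot_injective (by rw [IsCobar.tot_homEquiv, tot_comp])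
  · refine tot_injective ?_
    rw [tot_comp, ← (B.isBar P).tot_homEquiv, Equiv.apply_symm_apply]
  · exact tot_injective (by rw [Ω.tot_homEquiv_map, tot_comp, tot_comp, Category.assoc])
  · exact tot_injective (by
      rw [Equiv.symm_symm, Equiv.symm_symm, B.tot_homEquiv_map, tot_comp, tot_comp, Category.assoc])
  · exact congrFun (congrFun (Adjunction.mkOfHomEquiv_homEquiv _) C) P
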